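/- Let $\Bbbk$ be a field of characteristic $0$ and let $\mathscr O$ be an operad in $\Bbbk$-vector spaces without unit, given by partial compositions that satisfy the sequential and the parallel associativity axioms. **Bimodules.** A $\Bbbk(\mathsf{FB}\times\mathsf{FB})$-module is a functor from pairs $(X,Y)$ of finite sets and bijections to $\Bbbk$-vector spaces; $\circledcirc$ is the Day convolution product for disjoint union, and $\Lambda^*_\circledcirc$, $S^*_\circledcirc$ are the corresponding exterior and symmetric algebras. View $\mathscr O$ as supported on pairs $(X,Y)$ with $|Y|=1$ ($X$ the inputs, $Y$ the root). The vector spaces $\delta_{1,1}\mathscr O(X,\emptyset)=\mathscr O(X\sqcup\{*\},\{\text{root}\})$ form a monoid for $\circledcirc$ (graft one root on the other marked input $*$); $|\delta_{1,1}\mathscr O|$, supported on pairs $(X,\emptyset)$, is its commutator quotient, $\pi$ is the quotient map, and $\alpha(w,b)$ denotes the element obtained from $w\in|\delta_{1,1}\mathscr O|(X\sqcup\{*\},\emptyset)$ by grafting the root of $b\in\mathscr O$ on the input $*$. **Brauer categories.** $\Bbbk\mathsf{dwb}$ (resp. $(\Bbbk\mathsf{dwb})_-$) is the $\Bbbk$-linear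 category with objects the pairs $(X,Y)$ of finite sets, whose morphisms $(U,W)\to(X,Y)$ are spanned by the data of injections $X\hookrightarrow U$, $Y\hookrightarrow W$ and an ordering of the pairs of a perfect matching between the complements of the images, where a reordering by a permutation $\sigma$ acts by $1$ (resp. by $\operatorname{sgn}\sigma$); composition concatenates the matchings. $\Bbbk\mathsf{uwb}$ is the opposite category of $\Bbbk\mathsf{dwb}$. The Koszul complex $\mathscr K$ of $\Bbbk\mathsf{uwb}\otimes(\Bbbk\mathsf{dwb})_-^{\mathrm{op}}$-modules is $$\mathscr K_n=\bigoplus_m \Bbbk\mathsf{uwb}((\mathbf m,\mathbf n),-)\otimes_{\mathfrak S_m\times\mathfrak S_n}(\Bbbk\mathsf{dwb})_-(-,(\mathbf m,\mathbf n)),$$ with differential the sum, over all pairs $(x,y)\in\mathbf m\times\mathbf n$, of the composition in both tensor factors with the morphism that matches $x$ with $y$. **Split monomorphisms.** $\mathcal S(\Bbbk)$ is the category of finite-dimensional vector spaces $V$ with morphisms $V\to W$ the pairs $(i,p)$, $i:V\to W$, $p:W\to V$, $pi=\mathrm{id}_V$. Put $T^{m,n}(V)=V^{\otimes m}\otimes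 (V^\sharp)^{\otimes n}$, functorial by $i^{\otimes m}\otimes(p^\sharp)^{\otimes n}$; contractions make $T^{\bullet,\bullet}$ a right $\Bbbk\mathsf{uwb}$-module in functors on $\mathcal S(\Bbbk)$. A functor from $\mathcal S(\Bbbk)$ to $\Bbbk$-vector spaces is *algebraic* if it is a subquotient of a direct sum of functors $T^{m,n}$. **Lie algebras.** Let $\mathscr O(V)=\bigoplus_n\mathscr O(n)\otimes_{\mathfrak S_n}V^{\otimes n}$, and let $|\partial\mathscr O(V)|$ be the value on $V$ of the Schur functor of $|\delta_{1,1}\mathscr O|$. Let $\mathrm{Der}(\mathscr O(V))=\hom_\Bbbk(V,\mathscr O(V))$, with bracket $[f,g]=\widetilde f\circ g-\widetilde g\circ f$, where $\widetilde f$ is the derivation of $\mathscr O(V)$ that inserts $f(v_i)$ for each $v_i$ in turn. It acts by the same insertions (through $\alpha$) on $|\partial\mathscr O(V)|$. Let $\mathrm{div}:\mathrm{Der}(\mathscr O(V))\to|\partial\mathscr O(V)|$ be the divergence: it sends the derivation $v\mapsto\xi(v)s$ ($\xi\in V^\sharp$, $s\in\mathscr O(V)$) to the image under $\pi$ of $\partial_\xi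 s$, the sum over all inputs of $s$ of the elements obtained by evaluating $\xi$ on the vector at this input and marking this input. Then $\mathrm{Der}(\mathscr O(V))\oplus s^{-1}|\partial\mathscr O(V)|$, the semi-direct product with differential $\mathrm{div}$, is a DG Lie algebra in homological degrees $0$ and $-1$, and sending $s^{-1}|\partial\mathscr O(V)|$ to $0$ is a morphism of DG Lie algebras to $\mathrm{Der}(\mathscr O(V))$. **Theorem.** 1. There is a $(\Bbbk\mathsf{dwb})_-$-module structure on $\Lambda^*_\circledcirc\mathscr O\circledcirc S^*_\circledcirc|\delta_{1,1}\mathscr O|$, extending the $\Bbbk(\mathsf{FB}\times\mathsf{FB})$-module structure, such that the morphism that contracts a pair $(x,y)$ acts as follows, for $t\in\Lambda^*_\circledcirc\mathscr O$, $s\in S^*_\circledcirc|\delta_{1,1}\mathscr O|$, $a,b\in\mathscr O$, $w\in|\delta_{1,1}\mathscr O|$: - $a\wedge t\otimes s\mapsto t\otimes\pi(a)s$, if $x$ is an input of $a$ and $y$ is the root of $a$; - $b\wedge a\wedge t\otimes s\mapsto(a\circ_x b)\wedge t\otimes s$, if $x$ is an input of $a$ and $y$ is the root of $b$; - $b\wedge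 t\otimes ws\mapsto t\otimes\alpha(w,b)s$, if $x$ is an input of $w$ and $y$ is the root of $b$ (with $*=x$). There is also a $(\Bbbk\mathsf{dwb})_-$-module structure on $\Lambda^*_\circledcirc\mathscr O$ for which the projection $\Lambda^*_\circledcirc\mathscr O\circledcirc S^*_\circledcirc|\delta_{1,1}\mathscr O|\twoheadrightarrow\Lambda^*_\circledcirc\mathscr O$ onto the part of degree $0$ in $S^*_\circledcirc$ is a morphism of $(\Bbbk\mathsf{dwb})_-$-modules. 2. For these structures, the morphism of complexes of algebraic functors on $\mathcal S(\Bbbk)$ $$T^{\bullet,\bullet}\otimes_{\Bbbk\mathsf{uwb}}\mathscr K\otimes_{(\Bbbk\mathsf{dwb})_-}\big(\Lambda^*_\circledcirc\mathscr O\circledcirc S^*_\circledcirc|\delta_{1,1}\mathscr O|\big)\twoheadrightarrow T^{\bullet,\bullet}\otimes_{\Bbbk\mathsf{uwb}}\mathscr K\otimes_{(\Bbbk\mathsf{dwb})_-}\Lambda^*_\circledcirc\mathscr O$$ induced by this projection is isomorphic, naturally in $V\in\mathcal S(\Bbbk)$, to the morphism of Chevalley–Eilenberg complexes $$\Lambda^*(\mathrm{Der}(\mathscr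 O(V)))\otimes S^*(|\partial\mathscr O(V)|)\twoheadrightarrow\Lambda^*(\mathrm{Der}(\mathscr O(V)))$$ given by the morphism of DG Lie algebras $\mathrm{Der}(\mathscr O(V))\oplus s^{-1}|\partial\mathscr O(V)|\to\mathrm{Der}(\mathscr O(V))$; the homological degree is the degree in $\Lambda^*$. That is, there are isomorphisms $\Phi$, $\Psi$ of complexes of functors on $\mathcal S(\Bbbk)$ between the sources and between the targets that form a commutative square with these two morphisms. 3. Hence, on homology, in each degree, $\Phi$ and $\Psi$ induce isomorphisms that form a commutative square of algebraic functors on $\mathcal S(\Bbbk)$ with the maps $$H_*\Big(T^{\bullet,\bullet}\otimes_{\Bbbk\mathsf{uwb}}\mathscr K\otimes_{(\Bbbk\mathsf{dwb})_-}\big(\Lambda^*_\circledcirc\mathscr O\circledcirc S^*_\circledcirc|\delta_{1,1}\mathscr O|\big)\Big)\to H_*\Big(T^{\bullet,\bullet}\otimes_{\Bbbk\mathsf{uwb}}\mathscr K\otimes_{(\Bbbk\mathsf{dwb})_-}\Lambda^*_\circledcirc\mathscr O\Big)$$ and $$H^{\mathsf{CE}}_*\big(\mathrm{Der}(\mathscr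 O(-))\oplus s^{-1}|\partial\mathscr O(-)|\big)\to H^{\mathsf{CE}}_*\big(\mathrm{Der}(\mathscr O(-))\big).$$ -/

import Mathlib

open CategoryTheory TensorProduct DirectSum

universe u

noncomputable section

namespace KWB

/-- Finite sets and bijections. -/
structure FB where
  carrier : Type
  [finite : Finite carrier]

namespace FB

instance : CoeSort FB Type := ⟨FB.carrier⟩

instance (X : FB) : Finite X.carrier := X.finite

instance : Category FB where
  Hom X Y := X.carrier ≃ Y.carrier
  id X := Equiv.refl X.carrier
  comp f g := f.trans g

end FB

/-- The category of `k(FB × FB)`-modules. -/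
abbrev FBMod (k : Type u) [Field k] := (FB × FB) ⥤ ModuleCat.{u} k

namespace FBMod

variable {k : Type u} [Field k]

/-- The value of a bimodule on a pair of finite sets. -/
abbrev at' (F : FBMod k) (X Y : Type) [Finite X] [Finite Y] : Type u :=
  F.obj (⟨X⟩, ⟨Y⟩)

/-- The relabelling isomorphism of a bimodule along a pair of bijections. -/
def relabel (F : FBMod k) {X Y X' Y' : Type} [Finite X] [Finite Y] [Finite X'] [Finite Y']
    (e : X ≃ X') (e' : Y ≃ Y') : F.at' X Y →ₗ[k] F.at' X' Y' :=
  (F.map (X := (⟨X⟩, ⟨Y⟩)) (Y := (⟨X'⟩, ⟨Y'⟩)) (e, e')).hom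

theorem relabel_refl (F : FBMod k) {X Y : Type} [Finite X] [Finite Y] :
    F.relabel (Equiv.refl X) (Equiv.refl Y) = LinearMap.id := by
  unfold relabel
  have := F.map_id (⟨X⟩, ⟨Y⟩)
  exact congrArg ModuleCat.Hom.hom this

theorem relabel_comp (F : FBMod k) {X Y X' Y' X'' Y'' : Type} [Finite X] [Finite Y] [Finite X']
    [Finite Y'] [Finite X''] [Finite Y''] (e : X ≃ X') (e' : Y ≃ Y') (f : X' ≃ X'')
    (f' : Y' ≃ Y'') :
    F.relabel f f' ∘ₗ F.relabel e e' = F.relabel (e.trans f) (e'.trans f') := by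
  unfold relabel
  have := F.map_comp (X := (⟨X⟩, ⟨Y⟩)) (Y := (⟨X'⟩, ⟨Y'⟩)) (Z := (⟨X''⟩, ⟨Y''⟩)) (e, e') (f, f')
  exact (congrArg ModuleCat.Hom.hom this).symm

theorem relabel_relabel (F : FBMod k) {X Y X' Y' X'' Y'' : Type} [Finite X] [Finite Y] [Finite X']
    [Finite Y'] [Finite X''] [Finite Y''] (e : X ≃ X') (e' : Y ≃ Y') (f : X' ≃ X'')
    (f' : Y' ≃ Y'') (a : F.at' X Y) :
    F.relabel f f' (F.relabel e e' a) = F.relabel (e.trans f) (e'.trans f') a := by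
  rw [← relabel_comp]; rfl

/-- A bimodule from its values and relabelling maps. -/
def ofData (obj : ∀ (X Y : Type) [Finite X] [Finite Y], Type u)
    [∀ (X Y : Type) [Finite X] [Finite Y], AddCommGroup (obj X Y)]
    [∀ (X Y : Type) [Finite X] [Finite Y], Module k (obj X Y)]
    (map : ∀ {X Y X' Y' : Type} [Finite X] [Finite Y] [Finite X'] [Finite Y'],
      (X ≃ X') → (Y ≃ Y') → obj X Y →ₗ[k] obj X' Y')
    (map_refl : ∀ (X Y : Type) [Finite X] [Finite Y],
      map (Equiv.refl X) (Equiv.refl Y) = LinearMap.id)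
    (map_trans : ∀ {X Y X' Y' X'' Y'' : Type} [Finite X] [Finite Y] [Finite X'] [Finite Y']
      [Finite X''] [Finite Y''] (e : X ≃ X') (e' : Y ≃ Y') (f : X' ≃ X'') (f' : Y' ≃ Y''),
      map (e.trans f) (e'.trans f') = map f f' ∘ₗ map e e') : FBMod k where
  obj P := ModuleCat.of k (obj P.1.carrier P.2.carrier)
  map {P Q} f := ModuleCat.ofHom (map (X := P.1.carrier) (Y := P.2.carrier)
    (X' := Q.1.carrier) (Y' := Q.2.carrier) f.1 f.2)
  map_id P := by
    ext1
    exact map_refl _ _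
  map_comp f g := by
    ext1
    exact map_trans _ _ _ _

end FBMod

/-- Fibres of a two-colouring. -/
abbrev Fib {X : Type} (p : X → Bool) (b : Bool) : Type := {x : X // p x = b}

/-- Restriction of a bijection to fibres of a two-colouring. -/
def fibEquiv {X X' : Type} (e : X ≃ X') (p : X → Bool) (b : Bool) :
    Fib p b ≃ Fib (p ∘ e.symm) b where
  toFun x := ⟨e x.1, by simpa using x.2⟩
  invFun y := ⟨e.symm y.1, y.2⟩
  left_inv x := by simp
  right_inv y := by simp

/-- The bijection from a summand of a decomposition to the corresponding fibre. -/
def fibInl {X₁ X₂ X : Type} (e : X₁ ⊕ X₂ ≃ X) :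
    X₁ ≃ Fib (fun x => (e.symm x).isLeft) true where
  toFun x := ⟨e (Sum.inl x), by simp⟩
  invFun y := (e.symm y.1).getLeft y.2
  left_inv x := by simp
  right_inv y := by simp

def fibInr {X₁ X₂ X : Type} (e : X₁ ⊕ X₂ ≃ X) :
    X₂ ≃ Fib (fun x => (e.symm x).isLeft) false where
  toFun x := ⟨e (Sum.inr x), by simp⟩
  invFun y := (e.symm y.1).getRight (by simpa using y.2)
  left_inv x := by simp
  right_inv y := by simp


/-- The bijection `X₁ ⊔ (X₂ ⊔ X₃) ≃ X₂ ⊔ (X₁ ⊔ X₃)`. -/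
def leftComm (X₁ X₂ X₃ : Type) : X₁ ⊕ (X₂ ⊕ X₃) ≃ X₂ ⊕ (X₁ ⊕ X₃) :=
  (Equiv.sumAssoc X₁ X₂ X₃).symm.trans
    (((Equiv.sumComm X₁ X₂).sumCongr (Equiv.refl X₃)).trans (Equiv.sumAssoc X₂ X₁ X₃))

section Conv

variable {k : Type u} [Field k] (F G : FBMod k)

/-- The values of the Day convolution product: the sum over all
decompositions `X = X₁ ⊔ X₂`, `Y = Y₁ ⊔ Y₂` of `F(X₁,Y₁) ⊗ G(X₂,Y₂)`. -/
abbrev ConvObj (X Y : Type) [Finite X] [Finite Y] : Type u :=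
  ⨁ c : (X → Bool) × (Y → Bool),
    F.at' (Fib c.1 true) (Fib c.2 true) ⊗[k] G.at' (Fib c.1 false) (Fib c.2 false)

open Classical in
/-- The inclusion of the summand of a decomposition. -/
def convOf {X Y : Type} [Finite X] [Finite Y] (p : X → Bool) (q : Y → Bool) :
    F.at' (Fib p true) (Fib q true) →ₗ[k] G.at' (Fib p false) (Fib q false) →ₗ[k]
      ConvObj F G X Y :=
  (TensorProduct.mk k _ _).compr₂ (DirectSum.lof k _ (fun c : (X → Bool) × (Y → Bool) =>
    F.at' (Fib c.1 true) (Fib c.2 true) ⊗[k] G.at' (Fib c.1 false) (Fib c.2 false)) (p, q))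

open Classical in
theorem convObj_ext {X Y : Type} [Finite X] [Finite Y] {N : Type*} [AddCommMonoid N] [Module k N]
    {f g : ConvObj F G X Y →ₗ[k] N}
    (h : ∀ p q a b, f (convOf F G p q a b) = g (convOf F G p q a b)) : f = g := by
  apply DirectSum.linearMap_ext
  rintro ⟨p, q⟩
  apply TensorProduct.ext'
  intro a b
  exact h p q a b

open Classical in
/-- The relabelling maps of the Day convolution product. -/
def convMap {X Y X' Y' : Type} [Finite X] [Finite Y]
    [Finite X'] [Finite Y'] (e : X ≃ X') (e' : Y ≃ Y') :
    ConvObj F G X Y →ₗ[k] ConvObj F G X' Y' :=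
  DirectSum.toModule k _ _ fun c =>
    TensorProduct.lift ((convOf F G (c.1 ∘ e.symm) (c.2 ∘ e'.symm)).compl₁₂
      (F.relabel (fibEquiv e c.1 true) (fibEquiv e' c.2 true))
      (G.relabel (fibEquiv e c.1 false) (fibEquiv e' c.2 false)))

theorem convMap_of {X Y X' Y' : Type} [Finite X] [Finite Y]
    [Finite X'] [Finite Y'] (e : X ≃ X') (e' : Y ≃ Y') (p : X → Bool) (q : Y → Bool) (a b) :
    convMap F G e e' (convOf F G p q a b) = convOf F G (p ∘ e.symm) (q ∘ e'.symm)
      (F.relabel (fibEquiv e p true) (fibEquiv e' q true) a)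
      (G.relabel (fibEquiv e p false) (fibEquiv e' q false) b) := by
  simp [convMap, convOf, DirectSum.toModule_lof]

/-- The Day convolution product of bimodules. -/
def Conv : FBMod k :=
  FBMod.ofData (fun X Y _ _ => ConvObj F G X Y) (fun e e' => convMap F G e e')
    (by
      intro X Y _ _
      apply convObj_ext
      intro p q a b
      rw [convMap_of]
      have h1 : ∀ (Z : Type) (p : Z → Bool) (b : Bool),
        fibEquiv (Equiv.refl Z) p b = Equiv.refl _ := fun Z p b => rfl
      rw [h1, h1, h1, h1]
      erw [FBMod.relabel_refl, FBMod.relabel_refl]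
      rfl)
    (by
      intro X Y X' Y' X'' Y'' _ _ _ _ _ _ e e' f f'
      apply convObj_ext
      intro p q a b
      rw [LinearMap.comp_apply, convMap_of, convMap_of, convMap_of, FBMod.relabel_relabel,
        FBMod.relabel_relabel]
      rfl)

/-- The element of the Day convolution product given by a decomposition (up to bijection)
and an element of each factor. -/
def convMk {X₁ X₂ Y₁ Y₂ X Y : Type} [Finite X₁] [Finite X₂] [Finite Y₁] [Finite Y₂]
    [Finite X] [Finite Y] (e : X₁ ⊕ X₂ ≃ X) (e' : Y₁ ⊕ Y₂ ≃ Y) :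
    F.at' X₁ Y₁ →ₗ[k] G.at' X₂ Y₂ →ₗ[k] (Conv F G).at' X Y :=
  (convOf F G (fun x => (e.symm x).isLeft) (fun y => (e'.symm y).isLeft)).compl₁₂
    (F.relabel (fibInl e) (fibInl e')) (G.relabel (fibInr e) (fibInr e'))

theorem relabel_convMk {X₁ X₂ Y₁ Y₂ X Y X' Y' : Type} [Finite X₁] [Finite X₂] [Finite Y₁]
    [Finite Y₂] [Finite X] [Finite Y] [Finite X'] [Finite Y'] (e : X₁ ⊕ X₂ ≃ X)
    (e' : Y₁ ⊕ Y₂ ≃ Y) (f : X ≃ X') (f' : Y ≃ Y') (a b) :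
    (Conv F G).relabel f f' (convMk F G e e' a b)
      = convMk F G (e.trans f) (e'.trans f') a b := by
  change convMap F G f f' (convOf F G _ _ _ _) = convOf F G _ _ _ _
  rw [convMap_of, FBMod.relabel_relabel, FBMod.relabel_relabel]
  rfl

/-- The unit of the Day convolution product. -/
def convUnit (k : Type u) [Field k] : FBMod k :=
  FBMod.ofData (fun X Y _ _ => PLift (IsEmpty X ∧ IsEmpty Y) → k)
    (fun e e' => LinearMap.funLeft k k
      (fun h => ⟨e.isEmpty_congr.mpr h.down.1, e'.isEmpty_congr.mpr h.down.2⟩))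
    (fun _ _ _ _ => rfl) (fun _ _ _ _ => rfl)

/-- The iterated Day convolution power. -/
def convPow (F : FBMod k) : ℕ → FBMod k
  | 0 => convUnit k
  | d + 1 => Conv F (convPow F d)

/-- The product of an element of `F` with an element of the power `F^{⊚ d}`. -/
def powCons (F : FBMod k) (d : ℕ) {X₁ X₂ Y₁ Y₂ X Y : Type} [Finite X₁] [Finite X₂] [Finite Y₁]
    [Finite Y₂] [Finite X] [Finite Y] (e : X₁ ⊕ X₂ ≃ X) (e' : Y₁ ⊕ Y₂ ≃ Y) :
    F.at' X₁ Y₁ →ₗ[k] (convPow F d).at' X₂ Y₂ →ₗ[k] (convPow F (d + 1)).at' X Y :=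
  convMk F (convPow F d) e e'

theorem relabel_powCons (F : FBMod k) (d : ℕ) {X₁ X₂ Y₁ Y₂ X Y X' Y' : Type} [Finite X₁]
    [Finite X₂] [Finite Y₁] [Finite Y₂] [Finite X] [Finite Y] [Finite X'] [Finite Y']
    (e : X₁ ⊕ X₂ ≃ X) (e' : Y₁ ⊕ Y₂ ≃ Y) (f : X ≃ X') (f' : Y ≃ Y') (a b) :
    (convPow F (d + 1)).relabel f f' (powCons F d e e' a b)
      = powCons F d (e.trans f) (e'.trans f') a b :=
  relabel_convMk F (convPow F d) e e' f f' a b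

/-- The relations defining the coinvariants of `F^{⊚ d}` for the symmetric group `𝔖_d` acting by
permutation of the factors, twisted by the character sending each adjacent transposition
to `ε`. -/
inductive PowRel (F : FBMod k) (ε : k) : ∀ (d : ℕ) (X Y : Type) [Finite X] [Finite Y],
    (convPow F d).at' X Y → Prop
  | swap {d : ℕ} {X₁ X₂ X₃ Y₁ Y₂ Y₃ X Y : Type} [Finite X₁] [Finite X₂] [Finite X₃] [Finite Y₁]
      [Finite Y₂] [Finite Y₃] [Finite X] [Finite Y] (e : X₁ ⊕ (X₂ ⊕ X₃) ≃ X)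
      (e' : Y₁ ⊕ (Y₂ ⊕ Y₃) ≃ Y) (a : F.at' X₁ Y₁) (b : F.at' X₂ Y₂)
      (t : (convPow F d).at' X₃ Y₃) :
      PowRel F ε (d + 2) X Y
        (powCons F (d + 1) e e' a
            (powCons F d (Equiv.refl _) (Equiv.refl _) b t)
          - ε • powCons F (d + 1)
              ((leftComm X₂ X₁ X₃).trans e) ((leftComm Y₂ Y₁ Y₃).trans e') b
            (powCons F d (Equiv.refl _) (Equiv.refl _) a t))
  | cons {d : ℕ} {X₁ X₂ Y₁ Y₂ X Y : Type} [Finite X₁] [Finite X₂] [Finite Y₁]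
      [Finite Y₂] [Finite X] [Finite Y] (e : X₁ ⊕ X₂ ≃ X) (e' : Y₁ ⊕ Y₂ ≃ Y)
      (a : F.at' X₁ Y₁) (r : (convPow F d).at' X₂ Y₂) :
      PowRel F ε d X₂ Y₂ r → PowRel F ε (d + 1) X Y (powCons F d e e' a r)

/-- The submodule spanned by the relations. -/
def powRel (F : FBMod k) (ε : k) (d : ℕ) (X Y : Type) [Finite X] [Finite Y] :
    Submodule k ((convPow F d).at' X Y) :=
  Submodule.span k {r | PowRel F ε d X Y r}

theorem PowRel.relabel (F : FBMod k) (ε : k) {d : ℕ} {X Y X' Y' : Type} [Finite X] [Finite Y]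
    [Finite X'] [Finite Y'] (f : X ≃ X') (f' : Y ≃ Y') {r : (convPow F d).at' X Y}
    (h : PowRel F ε d X Y r) : PowRel F ε d X' Y' ((convPow F d).relabel f f' r) := by
  cases h with
  | swap e e' a b t =>
    have := PowRel.swap (ε := ε) (e.trans f) (e'.trans f') a b t
    rw [map_sub, map_smul, relabel_powCons, relabel_powCons]
    exact this
  | cons e e' a r h =>
    have := PowRel.cons (e.trans f) (e'.trans f') a r h
    rw [relabel_powCons]
    exact this

/-- The quotient of `F^{⊚ d}` by the twisted symmetric group action: `S^d(F)` for `ε = 1`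
and `Λ^d(F)` for `ε = -1`. -/
def powQuot (F : FBMod k) (ε : k) (d : ℕ) : FBMod k :=
  FBMod.ofData (fun X Y _ _ => (convPow F d).at' X Y ⧸ powRel F ε d X Y)
    (fun e e' => Submodule.mapQ _ _ ((convPow F d).relabel e e') (by
      rw [powRel, Submodule.span_le]
      intro r hr
      exact Submodule.subset_span (PowRel.relabel F ε e e' hr)))
    (by
      intro X Y _ _
      apply Submodule.linearMap_qext
      ext x
      simp [FBMod.relabel_refl])
    (by
      intro X Y X' Y' X'' Y'' _ _ _ _ _ _ e e' f f'
      apply Submodule.linearMap_qext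
      ext x
      simp [FBMod.relabel_relabel])

open Classical in
/-- The direct sum of a family of bimodules. -/
def bigSum {ι : Type} (F : ι → FBMod k) : FBMod k :=
  FBMod.ofData (fun X Y _ _ => ⨁ i, (F i).at' X Y)
    (fun e e' => DirectSum.lmap (fun i => (F i).relabel e e'))
    (by
      intro X Y _ _
      apply DirectSum.linearMap_ext
      intro i
      ext x
      simp [FBMod.relabel_refl])
    (by
      intro X Y X' Y' X'' Y'' _ _ _ _ _ _ e e' f f'
      apply DirectSum.linearMap_ext
      intro i
      ext x
      simp [FBMod.relabel_relabel])

/-- `S^*(F)` for `ε = 1` and `Λ^*(F)` for `ε = -1`. -/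
def powAlg (F : FBMod k) (ε : k) : FBMod k := bigSum (powQuot F ε)

open Classical in
/-- The class in `S^*(F)` or `Λ^*(F)` of an element of `F^{⊚ d}`. -/
def powMk (F : FBMod k) (ε : k) {d : ℕ} {X Y : Type} [Finite X] [Finite Y] :
    (convPow F d).at' X Y →ₗ[k] (powAlg F ε).at' X Y :=
  DirectSum.lof k ℕ (fun d => (powQuot F ε d).at' X Y) d ∘ₗ (powRel F ε d X Y).mkQ

end Conv

/-- The objects of the downward walled Brauer categories: pairs of finite sets. -/
structure Wall where
  left : FB
  right : FB

/-- The object given by a pair of finite sets. -/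
abbrev wall (X Y : Type) [Finite X] [Finite Y] : Wall := ⟨⟨X⟩, ⟨Y⟩⟩

/-- A morphism `(U,V) → (X,Y)` of the ordered downward walled Brauer category: injections
`X → U` and `Y → V` together with an ordered list of pairs in `U × V` that matches the
complements of the images. This is the same as a pair of bijections `X ⊔ {1,…,n} ≃ U`,
`Y ⊔ {1,…,n} ≃ V`, where `n` is the length of the list. -/
@[ext]
structure OrdHom (P Q : Wall) where
  i : Q.left.carrier → P.left.carrier
  j : Q.right.carrier → P.right.carrier
  pairs : List (P.left.carrier × P.right.carrier)
  i_inj : Function.Injective i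
  j_inj : Function.Injective j
  nodup_left : (pairs.map Prod.fst).Nodup
  nodup_right : (pairs.map Prod.snd).Nodup
  mem_left : ∀ u, u ∈ pairs.map Prod.fst ↔ u ∉ Set.range i
  mem_right : ∀ v, v ∈ pairs.map Prod.snd ↔ v ∉ Set.range j

namespace OrdHom

/-- The identity. -/
def id (P : Wall) : OrdHom P P where
  i := _root_.id
  j := _root_.id
  pairs := []
  i_inj := Function.injective_id
  j_inj := Function.injective_id
  nodup_left := by simp
  nodup_right := by simp
  mem_left := by simp
  mem_right := by simp

theorem aux_nodup {A B : Type} {i : B → A} (hi : Function.Injective i)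
    {l : List A} {m : List B} (hl : l.Nodup) (hm : m.Nodup) (h : ∀ u, u ∈ l ↔ u ∉ Set.range i) :
    (l ++ m.map i).Nodup := by
  rw [List.nodup_append]
  refine ⟨hl, hm.map hi, ?_⟩
  intro a ha b hb hab
  subst hab
  obtain ⟨c, -, rfl⟩ := List.mem_map.1 hb
  exact (h _).1 ha ⟨c, rfl⟩

theorem aux_mem {A B C : Type} {i : B → A} {i' : C → B} (hi : Function.Injective i)
    {l : List A} {m : List B} (h : ∀ u, u ∈ l ↔ u ∉ Set.range i)
    (h' : ∀ u, u ∈ m ↔ u ∉ Set.range i') (u : A) :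
    u ∈ l ++ m.map i ↔ u ∉ Set.range (i ∘ i') := by
  rw [List.mem_append, h, List.mem_map]
  constructor
  · rintro (h1 | ⟨b, hb, rfl⟩) ⟨c, hc⟩
    · exact h1 ⟨i' c, hc⟩
    · exact (h' b).1 hb ⟨c, hi hc⟩
  · intro hu
    by_cases h1 : u ∈ Set.range i
    · obtain ⟨b, rfl⟩ := h1
      refine Or.inr ⟨b, (h' b).2 ?_, rfl⟩
      rintro ⟨c, rfl⟩
      exact hu ⟨c, rfl⟩
    · exact Or.inl h1

/-- Composition: the matched pairs of `f` are followed by those of `g`. -/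
def comp {P Q R : Wall} (f : OrdHom P Q) (g : OrdHom Q R) : OrdHom P R where
  i := f.i ∘ g.i
  j := f.j ∘ g.j
  pairs := f.pairs ++ g.pairs.map (Prod.map f.i f.j)
  i_inj := f.i_inj.comp g.i_inj
  j_inj := f.j_inj.comp g.j_inj
  nodup_left := by
    have := aux_nodup f.i_inj f.nodup_left g.nodup_left f.mem_left
    simpa [List.map_append, List.map_map, Function.comp_def] using this
  nodup_right := by
    have := aux_nodup f.j_inj f.nodup_right g.nodup_right f.mem_right
    simpa [List.map_append, List.map_map, Function.comp_def] using this
  mem_left u := by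
    have := aux_mem f.i_inj f.mem_left g.mem_left u
    rw [← this]
    simp
  mem_right u := by
    have := aux_mem f.j_inj f.mem_right g.mem_right u
    rw [← this]
    simp

end OrdHom

/-- The ordered downward walled Brauer category. -/
instance : Category Wall where
  Hom := OrdHom
  id := OrdHom.id
  comp := OrdHom.comp
  id_comp f := by
    apply OrdHom.ext <;> simp [OrdHom.comp, OrdHom.id]
  comp_id f := by
    apply OrdHom.ext <;> simp [OrdHom.comp, OrdHom.id]
  assoc f g h := by
    apply OrdHom.ext <;>
      simp [OrdHom.comp, Function.comp_assoc, List.map_append, List.append_assoc]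

/-- Two morphisms of the ordered category that differ by an exchange of two adjacent pairs in
the ordering. -/
def SwapRel {P Q : Wall} (f g : P ⟶ Q) : Prop :=
  OrdHom.i f = OrdHom.i g ∧ OrdHom.j f = OrdHom.j g ∧ ∃ l a b m,
    OrdHom.pairs f = l ++ a :: b :: m ∧ OrdHom.pairs g = l ++ b :: a :: m

theorem SwapRel.precomp {P Q R : Wall} (h : P ⟶ Q) {f g : Q ⟶ R} (hfg : SwapRel f g) :
    SwapRel (h ≫ f) (h ≫ g) := by
  obtain ⟨h1, h2, l, a, b, m, h3, h4⟩ := hfg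
  refine ⟨congrArg (_ ∘ ·) h1, congrArg (_ ∘ ·) h2, OrdHom.pairs h ++ l.map (Prod.map h.i h.j),
    Prod.map h.i h.j a, Prod.map h.i h.j b, m.map (Prod.map h.i h.j), ?_, ?_⟩
  · change OrdHom.pairs h ++ List.map _ (OrdHom.pairs f) = _
    rw [h3]; simp
  · change OrdHom.pairs h ++ List.map _ (OrdHom.pairs g) = _
    rw [h4]; simp

theorem SwapRel.postcomp {P Q R : Wall} {f g : P ⟶ Q} (hfg : SwapRel f g) (h : Q ⟶ R) :
    SwapRel (f ≫ h) (g ≫ h) := by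
  obtain ⟨h1, h2, l, a, b, m, h3, h4⟩ := hfg
  refine ⟨congrArg (· ∘ _) h1, congrArg (· ∘ _) h2, l, a, b,
    m ++ h.pairs.map (Prod.map f.i f.j), ?_, ?_⟩
  · change OrdHom.pairs f ++ _ = _
    rw [h3]; simp
  · change OrdHom.pairs g ++ _ = _
    rw [h4, h1, h2]; simp

/-- The relations identifying, up to the factor `ε`, two morphisms that differ by an exchange of
two adjacent pairs in the ordering. -/
def swapSpan {k : Type u} [Field k] (ε : k) (P Q : Wall) : Submodule k ((P ⟶ Q) →₀ k) :=
  Submodule.span k {z | ∃ f g : P ⟶ Q, SwapRel f g ∧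
    z = Finsupp.single f 1 - Finsupp.single g ε}

/-- The objects of the `k`-linear downward walled Brauer category twisted by the
character of the symmetric groups with value `ε` on transpositions: `kdwb` for `ε = 1` and
`(kdwb)_-` for `ε = -1`. -/
structure Dwb {k : Type u} [Field k] (ε : k) where
  toWall : Wall

namespace Dwb

variable {k : Type u} [Field k] {ε : k}

/-- The morphisms: (twisted) coinvariants of the linear span of the morphisms of the
ordered category for the action of the symmetric groups on the orderings. -/
abbrev Hom (ε : k) (P Q : Wall) : Type u := ((P ⟶ Q) →₀ k) ⧸ swapSpan ε P Q

/-- The class of a morphism of the ordered category. -/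
def cls (ε : k) {P Q : Wall} (f : P ⟶ Q) : Hom ε P Q :=
  (swapSpan ε P Q).mkQ (Finsupp.single f 1)

theorem hom_ext {P Q : Wall} {N : Type*} [AddCommGroup N] [Module k N] {φ ψ : Hom ε P Q →ₗ[k] N}
    (h : ∀ f, φ (cls ε f) = ψ (cls ε f)) : φ = ψ := by
  apply Submodule.linearMap_qext
  apply Finsupp.lhom_ext'
  intro f
  ext
  exact h f

/-- A linear map out of a morphism space. -/
def liftHom {P Q : Wall} {N : Type*} [AddCommGroup N] [Module k N] (F : (P ⟶ Q) → N)
    (h : ∀ f g, SwapRel f g → F f = ε • F g) : Hom ε P Q →ₗ[k] N :=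
  (swapSpan ε P Q).liftQ (Finsupp.linearCombination k F) (by
    rw [swapSpan, Submodule.span_le]
    rintro z ⟨f, g, hfg, rfl⟩
    simp [h f g hfg])

@[simp]
theorem liftHom_cls {P Q : Wall} {N : Type*} [AddCommGroup N] [Module k N] (F : (P ⟶ Q) → N)
    (h : ∀ f g, SwapRel f g → F f = ε • F g) (f : P ⟶ Q) :
    liftHom F h (cls ε f) = F f := by
  simp [liftHom, cls]

theorem cls_swap {P Q : Wall} {f g : P ⟶ Q} (h : SwapRel f g) : cls ε f = ε • cls ε g := by
  have : Finsupp.single f 1 - Finsupp.single g ε ∈ swapSpan ε P Q :=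
    Submodule.subset_span ⟨f, g, h, rfl⟩
  have h2 := (Submodule.Quotient.mk_eq_zero _).2 this
  rw [Submodule.Quotient.mk_sub, sub_eq_zero] at h2
  rw [cls, Submodule.mkQ_apply, h2, cls, Submodule.mkQ_apply, ← Submodule.Quotient.mk_smul]
  simp

/-- Composition, as a bilinear map. -/
def compHom (P Q R : Wall) : Hom ε P Q →ₗ[k] Hom ε Q R →ₗ[k] Hom ε P R :=
  liftHom (fun f => liftHom (fun g => cls ε (f ≫ g)) (fun _ _ h => cls_swap (h.precomp f)))
    (fun f f' h => by
      apply hom_ext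
      intro g
      simp [cls_swap (h.postcomp g)])

@[simp]
theorem compHom_cls {P Q R : Wall} (f : P ⟶ Q) (g : Q ⟶ R) :
    compHom P Q R (cls ε f) (cls ε g) = cls ε (f ≫ g) := by
  simp [compHom]

instance : Category (Dwb ε) where
  Hom P Q := Hom ε P.toWall Q.toWall
  id P := cls ε (𝟙 P.toWall)
  comp f g := compHom _ _ _ f g
  id_comp {P Q} f := by
    have : compHom _ _ _ (cls ε (𝟙 P.toWall)) = (LinearMap.id : Hom ε P.toWall Q.toWall →ₗ[k] _) :=
      hom_ext (fun f => by simp)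
    exact LinearMap.congr_fun this f
  comp_id {P Q} f := by
    have : (compHom _ _ _).flip (cls ε (𝟙 Q.toWall)) =
        (LinearMap.id : Hom ε P.toWall Q.toWall →ₗ[k] _) :=
      hom_ext (fun f => by simp)
    exact LinearMap.congr_fun this f
  assoc {P Q R S} f g h := by
    have key : ∀ (f₀ : P.toWall ⟶ Q.toWall) (g₀ : Q.toWall ⟶ R.toWall) (h : Hom ε R.toWall S.toWall),
        compHom _ _ _ (cls ε (f₀ ≫ g₀)) h
          = compHom _ _ _ (cls ε f₀) (compHom _ _ _ (cls ε g₀) h) := by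
      intro f₀ g₀ h
      have : compHom P.toWall R.toWall S.toWall (cls ε (f₀ ≫ g₀))
          = compHom _ _ _ (cls ε f₀) ∘ₗ compHom _ _ _ (cls ε g₀) :=
        hom_ext (fun h₀ => by simp)
      exact LinearMap.congr_fun this h
    have key2 : ∀ (f₀ : P.toWall ⟶ Q.toWall) (g : Hom ε Q.toWall R.toWall) (h : Hom ε R.toWall S.toWall),
        compHom _ _ _ (compHom _ _ _ (cls ε f₀) g) h
          = compHom _ _ _ (cls ε f₀) (compHom _ _ _ g h) := by
      intro f₀ g h
      have : (compHom P.toWall R.toWall S.toWall).flip h ∘ₗ compHom _ _ _ (cls ε f₀)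
          = compHom _ _ _ (cls ε f₀) ∘ₗ (compHom _ _ _).flip h :=
        hom_ext (fun g₀ => by simp [key])
      exact LinearMap.congr_fun this g
    have : (compHom P.toWall R.toWall S.toWall).flip h ∘ₗ (compHom _ _ _).flip g
          = (compHom _ _ _).flip (compHom _ _ _ g h) :=
        hom_ext (fun f₀ => by simp [key2])
    exact LinearMap.congr_fun this f

instance (P Q : Dwb ε) : AddCommGroup (P ⟶ Q) :=
  inferInstanceAs (AddCommGroup (Hom ε P.toWall Q.toWall))

instance (P Q : Dwb ε) : Module k (P ⟶ Q) :=
  inferInstanceAs (Module k (Hom ε P.toWall Q.toWall))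

instance : Preadditive (Dwb ε) where
  homGroup P Q := inferInstance
  add_comp P Q R f f' g := by
    change compHom _ _ _ (f + f') g = _
    rw [map_add]; rfl
  comp_add P Q R f g g' := by
    change compHom _ _ _ f (g + g') = _
    rw [map_add]; rfl

instance : Linear k (Dwb ε) where
  homModule P Q := inferInstance
  smul_comp P Q R c f g := by
    change compHom _ _ _ (c • f) g = _
    rw [map_smul]; rfl
  comp_smul P Q R f c g := by
    change compHom _ _ _ f (c • g) = _
    rw [map_smul]; rfl

/-- The morphism given by a morphism of the ordered category. -/
def of {P Q : Dwb ε} (f : P.toWall ⟶ Q.toWall) : P ⟶ Q := cls ε f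

theorem of_comp {P Q R : Dwb ε} (f : P.toWall ⟶ Q.toWall) (g : Q.toWall ⟶ R.toWall) :
    (of f : P ⟶ Q) ≫ (of g : Q ⟶ R) = of (f ≫ g) := compHom_cls f g

theorem of_swap {P Q : Dwb ε} {f g : P.toWall ⟶ Q.toWall} (h : SwapRel f g) :
    (of f : P ⟶ Q) = ε • (of g : P ⟶ Q) := cls_swap h

theorem of_id (P : Dwb ε) : of (𝟙 P.toWall) = 𝟙 P := rfl

/-- The linear extension of a functor on the ordered category. -/
def lift (F : Wall ⥤ ModuleCat.{u} k)
    (h : ∀ {P Q : Wall} (f g : P ⟶ Q), SwapRel f g → F.map f = ε • F.map g) :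
    Dwb ε ⥤ ModuleCat.{u} k where
  obj P := F.obj P.toWall
  map f := liftHom (fun f => F.map f) h f
  map_id P := by
    change liftHom _ _ (cls ε _) = _
    simp
  map_comp {P Q R} f g := by
    let L : ∀ P Q : Wall, Hom ε P Q →ₗ[k] (F.obj P ⟶ F.obj Q) :=
      fun P Q => liftHom (fun f => F.map f) h
    have hL : ∀ {P Q : Wall} (f : P ⟶ Q), L P Q (cls ε f) = F.map f := fun f => liftHom_cls _ _ f
    have key : ∀ (f₀ : P.toWall ⟶ Q.toWall) (g : Q ⟶ R),
        L P.toWall R.toWall (compHom _ _ _ (cls ε f₀) g) = F.map f₀ ≫ L Q.toWall R.toWall g := by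
      intro f₀ g
      have : L P.toWall R.toWall ∘ₗ compHom P.toWall Q.toWall R.toWall (cls ε f₀)
          = (Linear.leftComp k (F.obj R.toWall) (F.map f₀)) ∘ₗ L Q.toWall R.toWall :=
        hom_ext (fun g₀ => by simp [hL])
      exact LinearMap.congr_fun this g
    have : L P.toWall R.toWall ∘ₗ (compHom P.toWall Q.toWall R.toWall).flip g
        = (Linear.rightComp k (F.obj P.toWall) (L Q.toWall R.toWall g)) ∘ₗ L P.toWall Q.toWall :=
      hom_ext (fun f₀ => by simp [hL, key])
    exact LinearMap.congr_fun this f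

end Dwb

/-- The morphism of the ordered category given by a pair of bijections. -/
def bijHom {X Y X' Y' : Type} [Finite X] [Finite Y] [Finite X'] [Finite Y']
    (e : X ≃ X') (e' : Y ≃ Y') : wall X Y ⟶ wall X' Y' where
  i := e.symm
  j := e'.symm
  pairs := []
  i_inj := e.symm.injective
  j_inj := e'.symm.injective
  nodup_left := by simp
  nodup_right := by simp
  mem_left := by simp
  mem_right := by simp

/-- The contraction `(X ⊔ {*}, Y ⊔ {*}) → (X, Y)` matching the two added points. -/
def contrHom (X Y : Type) [Finite X] [Finite Y] :
    wall (X ⊕ Fin 1) (Y ⊕ Fin 1) ⟶ wall X Y where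
  i := Sum.inl
  j := Sum.inl
  pairs := [(Sum.inr 0, Sum.inr 0)]
  i_inj := Sum.inl_injective
  j_inj := Sum.inl_injective
  nodup_left := by simp
  nodup_right := by simp
  mem_left u := by rcases u with u | u <;> simp [Subsingleton.elim _ (0 : Fin 1)]
  mem_right u := by rcases u with u | u <;> simp [Subsingleton.elim _ (0 : Fin 1)]

/-- The contraction `(m+1, n+1) → (m, n)` matching `x` with `y`, via the order-preserving
bijections from `{0,…,m-1}` and `{0,…,n-1}` to the complements of `x` and `y`. -/
def faceHom {m n : ℕ} (x : Fin (m + 1)) (y : Fin (n + 1)) :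
    wall (Fin (m + 1)) (Fin (n + 1)) ⟶ wall (Fin m) (Fin n) where
  i := x.succAbove
  j := y.succAbove
  pairs := [(x, y)]
  i_inj := Fin.succAbove_right_injective
  j_inj := Fin.succAbove_right_injective
  nodup_left := by simp
  nodup_right := by simp
  mem_left u := by simp [Fin.range_succAbove]
  mem_right u := by simp [Fin.range_succAbove]

section Tens

variable {k : Type u} [Field k] {ι : Type} {A : Type*} [Category A] (sk : ι → A)

open Classical in
/-- The direct sum of the tensor products of the values of a right and a left module. -/
abbrev TensSum (M : Aᵒᵖ ⥤ ModuleCat.{u} k) (N : A ⥤ ModuleCat.{u} k) : Type u :=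
  ⨁ i, M.obj (Opposite.op (sk i)) ⊗[k] N.obj (sk i)

open Classical in
/-- Elementary tensors. -/
def tensSumMk (M : Aᵒᵖ ⥤ ModuleCat.{u} k) (N : A ⥤ ModuleCat.{u} k) (i : ι) :
    M.obj (Opposite.op (sk i)) →ₗ[k] N.obj (sk i) →ₗ[k] TensSum sk M N :=
  (TensorProduct.mk k _ _).compr₂ (DirectSum.lof k ι
    (fun i => M.obj (Opposite.op (sk i)) ⊗[k] N.obj (sk i)) i)

/-- The relations of the tensor product over a category. -/
def tensRel (M : Aᵒᵖ ⥤ ModuleCat.{u} k) (N : A ⥤ ModuleCat.{u} k) :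
    Submodule k (TensSum sk M N) :=
  Submodule.span k {z | ∃ (i j : ι) (f : sk i ⟶ sk j) (y : M.obj (Opposite.op (sk j)))
    (x : N.obj (sk i)),
    z = tensSumMk sk M N i (M.map f.op y) x - tensSumMk sk M N j y (N.map f x)}

/-- The tensor product `M ⊗_A N` of a right `A`-module and a left `A`-module, where the objects
`sk i` represent all isomorphism classes of objects of `A`. -/
abbrev Tens (M : Aᵒᵖ ⥤ ModuleCat.{u} k) (N : A ⥤ ModuleCat.{u} k) : Type u :=
  TensSum sk M N ⧸ tensRel sk M N

/-- The class of an elementary tensor. -/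
def tensMk (M : Aᵒᵖ ⥤ ModuleCat.{u} k) (N : A ⥤ ModuleCat.{u} k) (i : ι) :
    M.obj (Opposite.op (sk i)) →ₗ[k] N.obj (sk i) →ₗ[k] Tens sk M N :=
  (tensSumMk sk M N i).compr₂ (tensRel sk M N).mkQ

open Classical in
theorem tens_ext {M : Aᵒᵖ ⥤ ModuleCat.{u} k} {N : A ⥤ ModuleCat.{u} k} {P : Type*}
    [AddCommGroup P] [Module k P] {f g : Tens sk M N →ₗ[k] P}
    (h : ∀ i y x, f (tensMk sk M N i y x) = g (tensMk sk M N i y x)) : f = g := by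
  apply Submodule.linearMap_qext
  apply DirectSum.linearMap_ext
  intro i
  apply TensorProduct.ext'
  exact h i

theorem tensMk_rel (M : Aᵒᵖ ⥤ ModuleCat.{u} k) (N : A ⥤ ModuleCat.{u} k) {i j : ι}
    (f : sk i ⟶ sk j) (y : M.obj (Opposite.op (sk j))) (x : N.obj (sk i)) :
    tensMk sk M N i (M.map f.op y) x = tensMk sk M N j y (N.map f x) := by
  have : tensSumMk sk M N i (M.map f.op y) x - tensSumMk sk M N j y (N.map f x)
      ∈ tensRel sk M N := Submodule.subset_span ⟨i, j, f, y, x, rfl⟩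
  exact (Submodule.Quotient.eq _).2 this

open Classical in
/-- A linear map out of a tensor product. -/
def tensLift {M : Aᵒᵖ ⥤ ModuleCat.{u} k} {N : A ⥤ ModuleCat.{u} k} {P : Type*}
    [AddCommGroup P] [Module k P]
    (φ : ∀ i, M.obj (Opposite.op (sk i)) →ₗ[k] N.obj (sk i) →ₗ[k] P)
    (h : ∀ i j (f : sk i ⟶ sk j) y x, φ i (M.map f.op y) x = φ j y (N.map f x)) :
    Tens sk M N →ₗ[k] P :=
  (tensRel sk M N).liftQ (DirectSum.toModule k ι P (fun i => TensorProduct.lift (φ i))) (by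
    rw [tensRel, Submodule.span_le]
    rintro z ⟨i, j, f, y, x, rfl⟩
    simp [tensSumMk, DirectSum.toModule_lof, h])

@[simp]
theorem tensLift_mk {M : Aᵒᵖ ⥤ ModuleCat.{u} k} {N : A ⥤ ModuleCat.{u} k} {P : Type*}
    [AddCommGroup P] [Module k P]
    (φ : ∀ i, M.obj (Opposite.op (sk i)) →ₗ[k] N.obj (sk i) →ₗ[k] P)
    (h : ∀ i j (f : sk i ⟶ sk j) y x, φ i (M.map f.op y) x = φ j y (N.map f x)) (i y x) :
    tensLift sk φ h (tensMk sk M N i y x) = φ i y x := by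
  simp [tensLift, tensMk, tensSumMk, DirectSum.toModule_lof]

/-- Functoriality of the tensor product over a category. -/
def tensMap {M M' : Aᵒᵖ ⥤ ModuleCat.{u} k} {N N' : A ⥤ ModuleCat.{u} k} (α : M ⟶ M')
    (β : N ⟶ N') : Tens sk M N →ₗ[k] Tens sk M' N' :=
  tensLift sk (fun i => (tensMk sk M' N' i).compl₁₂ (α.app _).hom (β.app _).hom) (by
    intro i j f y x
    have h1 : α.app _ (M.map f.op y) = M'.map f.op (α.app _ y) :=
      NatTrans.naturality_apply α f.op y
    have h2 : β.app _ (N.map f x) = N'.map f (β.app _ x) := NatTrans.naturality_apply β f x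
    change tensMk sk M' N' i (α.app _ (M.map f.op y)) (β.app _ x) =
      tensMk sk M' N' j (α.app _ y) (β.app _ (N.map f x))
    rw [h1, h2, tensMk_rel])

@[simp]
theorem tensMap_mk {M M' : Aᵒᵖ ⥤ ModuleCat.{u} k} {N N' : A ⥤ ModuleCat.{u} k} (α : M ⟶ M')
    (β : N ⟶ N') (i y x) : tensMap sk α β (tensMk sk M N i y x)
      = tensMk sk M' N' i (α.app _ y) (β.app _ x) := tensLift_mk _ _ _ _ _ _

/-- The tensor product over a category as a functor of both variables. -/
def tens : (Aᵒᵖ ⥤ ModuleCat.{u} k) ⥤ (A ⥤ ModuleCat.{u} k) ⥤ ModuleCat.{u} k where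
  obj M :=
    { obj N := ModuleCat.of k (Tens sk M N)
      map β := ModuleCat.ofHom (tensMap sk (𝟙 M) β)
      map_id N := by
        ext1
        exact tens_ext sk fun i y x => by simp
      map_comp β γ := by
        ext1
        exact tens_ext sk fun i y x => by simp }
  map α :=
    { app N := ModuleCat.ofHom (tensMap sk α (𝟙 N))
      naturality N N' β := by
        ext1
        exact tens_ext sk fun i y x => by simp }
  map_id M := by
    ext N : 2
    ext1
    exact tens_ext sk fun i y x => by simp
  map_comp α β := by
    ext N : 2
    ext1
    exact tens_ext sk fun i y x => by simp

theorem tensMap_add {M M' : Aᵒᵖ ⥤ ModuleCat.{u} k} {N N' : A ⥤ ModuleCat.{u} k} (α α' : M ⟶ M')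
    (β : N ⟶ N') : tensMap sk (α + α') β = tensMap sk α β + tensMap sk α' β :=
  tens_ext sk fun i y x => by simp

instance : (tens (k := k) (A := A) sk).Additive where
  map_add {M M' α β} := by
    ext N : 2
    ext1
    exact tensMap_add sk α β (𝟙 N)

instance (N : A ⥤ ModuleCat.{u} k) : ((tens (k := k) sk).flip.obj N).Additive where
  map_add {M M' α β} := by
    ext1
    exact tensMap_add sk α β (𝟙 N)

end Tens

section Koszul

variable (k : Type u) [Field k]

/-- The pairs `({1,…,m}, {1,…,n})`. -/
abbrev skW (m n : ℕ) : Wall := wall (Fin m) (Fin n)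

/-- The representatives of the isomorphism classes of objects. -/
abbrev sk {k : Type u} [Field k] (ε : k) (p : ℕ × ℕ) : Dwb ε := ⟨skW p.1 p.2⟩

variable {k}

/-- The relations for the diagonal action of the automorphisms of a pair of finite sets. -/
def diagRel (m n : ℕ) (a : Dwb (1 : k)) (b : Dwb (-1 : k)) :
    Submodule k ((a ⟶ sk 1 (m, n)) ⊗[k] (b ⟶ sk (-1) (m, n))) :=
  Submodule.span k {z | ∃ (s : Equiv.Perm (Fin m)) (t : Equiv.Perm (Fin n))
    (φ : a ⟶ sk 1 (m, n)) (ψ : b ⟶ sk (-1) (m, n)),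
    z = (φ ≫ Dwb.of (bijHom s t)) ⊗ₜ[k] (ψ ≫ Dwb.of (bijHom s t)) - φ ⊗ₜ[k] ψ}

/-- The tensor product `kuwb((m,n),a) ⊗_{𝔖_m × 𝔖_n} (kdwb)_-(b,(m,n))`. -/
abbrev Diag (m n : ℕ) (a : Dwb (1 : k)) (b : Dwb (-1 : k)) : Type u :=
  ((a ⟶ sk 1 (m, n)) ⊗[k] (b ⟶ sk (-1) (m, n))) ⧸ diagRel m n a b

def diagMk (m n : ℕ) (a : Dwb (1 : k)) (b : Dwb (-1 : k)) :
    (a ⟶ sk 1 (m, n)) →ₗ[k] (b ⟶ sk (-1) (m, n)) →ₗ[k] Diag m n a b :=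
  (TensorProduct.mk k _ _).compr₂ (diagRel m n a b).mkQ

theorem diag_ext {m n : ℕ} {a : Dwb (1 : k)} {b : Dwb (-1 : k)} {P : Type*}
    [AddCommGroup P] [Module k P] {f g : Diag m n a b →ₗ[k] P}
    (h : ∀ φ ψ, f (diagMk m n a b φ ψ) = g (diagMk m n a b φ ψ)) : f = g := by
  apply Submodule.linearMap_qext
  apply TensorProduct.ext'
  exact h

theorem diagMk_rel {m n : ℕ} {a : Dwb (1 : k)} {b : Dwb (-1 : k)} (s : Equiv.Perm (Fin m))
    (t : Equiv.Perm (Fin n)) (φ : a ⟶ sk 1 (m, n)) (ψ : b ⟶ sk (-1) (m, n)) :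
    diagMk m n a b (φ ≫ Dwb.of (bijHom s t)) (ψ ≫ Dwb.of (bijHom s t)) = diagMk m n a b φ ψ :=
  (Submodule.Quotient.eq _).2 (Submodule.subset_span ⟨s, t, φ, ψ, rfl⟩)

def diagLift {m n : ℕ} {a : Dwb (1 : k)} {b : Dwb (-1 : k)} {P : Type*}
    [AddCommGroup P] [Module k P]
    (F : (a ⟶ sk 1 (m, n)) →ₗ[k] (b ⟶ sk (-1) (m, n)) →ₗ[k] P)
    (h : ∀ s t φ ψ, F (φ ≫ Dwb.of (bijHom s t)) (ψ ≫ Dwb.of (bijHom s t)) = F φ ψ) :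
    Diag m n a b →ₗ[k] P :=
  (diagRel m n a b).liftQ (TensorProduct.lift F) (by
    rw [diagRel, Submodule.span_le]
    rintro z ⟨s, t, φ, ψ, rfl⟩
    simp [h])

@[simp]
theorem diagLift_mk {m n : ℕ} {a : Dwb (1 : k)} {b : Dwb (-1 : k)} {P : Type*}
    [AddCommGroup P] [Module k P]
    (F : (a ⟶ sk 1 (m, n)) →ₗ[k] (b ⟶ sk (-1) (m, n)) →ₗ[k] P)
    (h : ∀ s t φ ψ, F (φ ≫ Dwb.of (bijHom s t)) (ψ ≫ Dwb.of (bijHom s t)) = F φ ψ) (φ ψ) :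
    diagLift F h (diagMk m n a b φ ψ) = F φ ψ := by
  simp [diagLift, diagMk]

/-- Functoriality of `Diag`. -/
def diagMap (m n : ℕ) {a a' : Dwb (1 : k)} {b b' : Dwb (-1 : k)} (f : a' ⟶ a) (g : b' ⟶ b) :
    Diag m n a b →ₗ[k] Diag m n a' b' :=
  diagLift ((diagMk m n a' b').compl₁₂ (Linear.leftComp k _ f) (Linear.leftComp k _ g)) (by
    intro s t φ ψ
    simp only [LinearMap.compl₁₂_apply, Linear.leftComp_apply]
    rw [← Category.assoc, ← Category.assoc, diagMk_rel])

@[simp]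
theorem diagMap_mk (m n : ℕ) {a a' : Dwb (1 : k)} {b b' : Dwb (-1 : k)} (f : a' ⟶ a)
    (g : b' ⟶ b) (φ ψ) :
    diagMap m n f g (diagMk m n a b φ ψ) = diagMk m n a' b' (f ≫ φ) (g ≫ ψ) :=
  diagLift_mk _ _ _ _

/-- The bimodule `kuwb((m,n),-) ⊗_{𝔖_m × 𝔖_n} (kdwb)_-(-,(m,n))`; left `kuwb`-modules are right
modules over `kdwb`, which is the opposite category. -/
def diagFun (m n : ℕ) : (Dwb (1 : k))ᵒᵖ ⥤ (Dwb (-1 : k))ᵒᵖ ⥤ ModuleCat.{u} k where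
  obj a :=
    { obj b := ModuleCat.of k (Diag m n a.unop b.unop)
      map g := ModuleCat.ofHom (diagMap m n (𝟙 _) g.unop)
      map_id b := by
        ext1
        exact diag_ext fun φ ψ => by simp
      map_comp g g' := by
        ext1
        exact diag_ext fun φ ψ => by simp }
  map f :=
    { app b := ModuleCat.ofHom (diagMap m n f.unop (𝟙 _))
      naturality b b' g := by
        ext1
        exact diag_ext fun φ ψ => by simp }
  map_id a := by
    ext b : 2
    ext1
    exact diag_ext fun φ ψ => by simp
  map_comp f f' := by
    ext b : 2
    ext1
    exact diag_ext fun φ ψ => by simp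

theorem bijHom_faceHom {m n : ℕ} (s : Equiv.Perm (Fin (m + 1))) (t : Equiv.Perm (Fin (n + 1)))
    (x : Fin (m + 1)) (y : Fin (n + 1)) :
    ∃ s' t', bijHom s t ≫ faceHom (s x) (t y) = faceHom x y ≫ bijHom s' t' := by
  have key : ∀ {m : ℕ} (s : Equiv.Perm (Fin (m + 1))) (x : Fin (m + 1)),
      ∃ s' : Equiv.Perm (Fin m), ∀ i, s.symm ((s x).succAbove i) = x.succAbove (s'.symm i) := by
    intro m s x
    let s' : Equiv.Perm (Fin m) := (finSuccAboveEquiv x).trans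
      ((s.subtypeEquiv (q := fun y => y ≠ s x) (by intro a; simp)).trans
        (finSuccAboveEquiv (s x)).symm)
    refine ⟨s', fun i => ?_⟩
    rw [Equiv.symm_apply_eq]
    obtain ⟨j, rfl⟩ := s'.surjective i
    rw [Equiv.symm_apply_apply]
    have : (finSuccAboveEquiv (s x)) (s' j) = ⟨s (x.succAbove j), by
      simp⟩ := by
      simp [s']
      rfl
    exact congrArg Subtype.val this
  obtain ⟨s', hs⟩ := key s x
  obtain ⟨t', ht⟩ := key t y
  refine ⟨s', t', ?_⟩
  apply OrdHom.ext
  · funext i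
    exact hs i
  · funext i
    exact ht i
  · change [] ++ [Prod.map s.symm t.symm (s x, t y)] = [(x, y)] ++ []
    simp

/-- The differential `φ ⊗ ψ ↦ ∑_{x,y} ι_{x,y} φ ⊗ ι_{x,y} ψ`. -/
def diagD (m n : ℕ) (a : Dwb (1 : k)) (b : Dwb (-1 : k)) :
    Diag (m + 1) (n + 1) a b →ₗ[k] Diag m n a b :=
  diagLift (∑ x : Fin (m + 1), ∑ y : Fin (n + 1), (diagMk m n a b).compl₁₂
      (Linear.rightComp k _ (Dwb.of (faceHom x y))) (Linear.rightComp k _ (Dwb.of (faceHom x y))))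
    (by
      intro s t φ ψ
      simp only [LinearMap.sum_apply, LinearMap.compl₁₂_apply, Linear.rightComp_apply,
        Category.assoc]
      rw [← Equiv.sum_comp s]
      refine Finset.sum_congr rfl fun x _ => ?_
      rw [← Equiv.sum_comp t]
      refine Finset.sum_congr rfl fun y _ => ?_
      obtain ⟨s', t', h⟩ := bijHom_faceHom s t x y
      rw [Dwb.of_comp, Dwb.of_comp, h, ← Dwb.of_comp, ← Dwb.of_comp, ← Category.assoc,
        ← Category.assoc, diagMk_rel])

@[simp]
theorem diagD_mk (m n : ℕ) (a : Dwb (1 : k)) (b : Dwb (-1 : k)) (φ ψ) :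
    diagD m n a b (diagMk (m + 1) (n + 1) a b φ ψ) = ∑ x : Fin (m + 1), ∑ y : Fin (n + 1),
      diagMk m n a b (φ ≫ Dwb.of (faceHom x y)) (ψ ≫ Dwb.of (faceHom x y)) := by
  rw [diagD, diagLift_mk]
  simp

/-- The differential as a morphism of bimodules. -/
def diagDHom (m n : ℕ) : diagFun (k := k) (m + 1) (n + 1) ⟶ diagFun (k := k) m n where
  app a :=
    { app b := ModuleCat.ofHom (diagD m n a.unop b.unop)
      naturality b b' g := by
        ext1
        exact diag_ext fun φ ψ => by
          change diagD m n a.unop b'.unop (diagMap (m + 1) (n + 1) (𝟙 a.unop) g.unop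
              (diagMk (m + 1) (n + 1) a.unop b.unop φ ψ))
            = diagMap m n (𝟙 a.unop) g.unop (diagD m n a.unop b.unop
              (diagMk (m + 1) (n + 1) a.unop b.unop φ ψ))
          simp }
  naturality a a' f := by
    ext b : 2
    ext1
    exact diag_ext fun φ ψ => by
      change diagD m n a'.unop b.unop (diagMap (m + 1) (n + 1) f.unop (𝟙 b.unop)
          (diagMk (m + 1) (n + 1) a.unop b.unop φ ψ))
        = diagMap m n f.unop (𝟙 b.unop) (diagD m n a.unop b.unop
          (diagMk (m + 1) (n + 1) a.unop b.unop φ ψ))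
      simp

/-- The exchange of the two elements removed from a finite set. -/
def exch {m : ℕ} (p : Fin (m + 2) × Fin (m + 1)) : Fin (m + 2) × Fin (m + 1) :=
  (p.1.succAbove p.2, p.2.predAbove p.1)

theorem exch_exch {m : ℕ} (p : Fin (m + 2) × Fin (m + 1)) : exch (exch p) = p :=
  Prod.ext (Fin.succAbove_succAbove_predAbove p.1 p.2) (Fin.predAbove_predAbove_succAbove p.1 p.2)

theorem faceHom_swap {m n : ℕ} (x : Fin (m + 2)) (y : Fin (n + 2)) (x' : Fin (m + 1))
    (y' : Fin (n + 1)) :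
    SwapRel (faceHom x y ≫ faceHom x' y')
      (faceHom (x.succAbove x') (y.succAbove y') ≫ faceHom (x'.predAbove x) (y'.predAbove y)) := by
  refine ⟨?_, ?_, [], (x, y), (x.succAbove x', y.succAbove y'), [], rfl, ?_⟩
  · funext i
    exact (Fin.succAbove_succAbove_succAbove_predAbove x x' i).symm
  · funext i
    exact (Fin.succAbove_succAbove_succAbove_predAbove y y' i).symm
  · change [_] ++ [Prod.map _ _ (_, _)] = _
    simp [faceHom, Fin.succAbove_succAbove_predAbove]

theorem diagD_diagD (m n : ℕ) (a : Dwb (1 : k)) (b : Dwb (-1 : k)) :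
    diagD m n a b ∘ₗ diagD (m + 1) (n + 1) a b = 0 := by
  apply diag_ext
  intro φ ψ
  simp only [LinearMap.comp_apply, diagD_mk, map_sum, Category.assoc, Dwb.of_comp,
    LinearMap.zero_apply]
  let T : (Fin (m + 2) × Fin (m + 1)) × (Fin (n + 2) × Fin (n + 1)) → Diag m n a b := fun q =>
    diagMk m n a b (φ ≫ Dwb.of (faceHom q.1.1 q.2.1 ≫ faceHom q.1.2 q.2.2))
      (ψ ≫ Dwb.of (faceHom q.1.1 q.2.1 ≫ faceHom q.1.2 q.2.2))
  have h1 : ∀ q, T q + T (exch q.1, exch q.2) = 0 := by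
    rintro ⟨⟨x, x'⟩, ⟨y, y'⟩⟩
    have hs := faceHom_swap x y x' y'
    have e1 := Dwb.of_swap (P := sk (1 : k) (m + 2, n + 2)) (Q := sk (1 : k) (m, n)) hs
    have e2 := Dwb.of_swap (P := sk (-1 : k) (m + 2, n + 2)) (Q := sk (-1 : k) (m, n)) hs
    simp only [T, exch]
    rw [e1, e2]
    simp
  have h2 : ∑ q, T q = 0 := by
    refine Finset.sum_involution (fun q _ => (exch q.1, exch q.2)) (fun q _ => h1 q) ?_
      (fun _ _ => Finset.mem_univ _) (fun q _ => by simp [exch_exch])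
    intro q _ _ hq
    have := congrArg (fun q => q.1.1) hq
    exact Fin.succAbove_ne _ _ this
  rw [← h2]
  simp only [Fintype.sum_prod_type, T]
  refine Finset.sum_congr rfl fun x _ => ?_
  rw [Finset.sum_comm]

theorem diagDHom_comp (m n : ℕ) :
    diagDHom (k := k) (m + 1) (n + 1) ≫ diagDHom m n = 0 := by
  ext a b : 4
  ext1
  exact diagD_diagD m n a.unop b.unop

/-- The terms of the Koszul complex,
`K_n = ⨁_m kuwb((m,n),-) ⊗_{𝔖_m × 𝔖_n} (kdwb)_-(-,(m,n))`. -/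
def koszulX (k : Type u) [Field k] (n : ℕ) :
    (Dwb (1 : k))ᵒᵖ ⥤ (Dwb (-1 : k))ᵒᵖ ⥤ ModuleCat.{u} k :=
  ∐ fun m : ℕ => diagFun (k := k) m n

/-- The inclusion of a summand of a term of the Koszul complex. -/
def koszulι (k : Type u) [Field k] (m n : ℕ) : diagFun (k := k) m n ⟶ koszulX k n :=
  Limits.Sigma.ι (fun m : ℕ => diagFun (k := k) m n) m

theorem koszulX_ext {n : ℕ} {F : (Dwb (1 : k))ᵒᵖ ⥤ (Dwb (-1 : k))ᵒᵖ ⥤ ModuleCat.{u} k}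
    {f g : koszulX k n ⟶ F} (h : ∀ m, koszulι k m n ≫ f = koszulι k m n ≫ g) : f = g :=
  Limits.Sigma.hom_ext _ _ h

/-- The differential of the Koszul complex on a summand. -/
def koszulDComp (n : ℕ) : ∀ m : ℕ, diagFun (k := k) m (n + 1) ⟶ koszulX k n
  | 0 => 0
  | m + 1 => diagDHom m n ≫ koszulι k m n

/-- The differential of the Koszul complex. -/
def koszulD (k : Type u) [Field k] (n : ℕ) : koszulX k (n + 1) ⟶ koszulX k n :=
  Limits.Sigma.desc (koszulDComp n)

theorem koszulι_koszulD (m n : ℕ) :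
    koszulι k m (n + 1) ≫ koszulD k n = koszulDComp n m := Limits.Sigma.ι_desc _ _

theorem koszulD_comp (n : ℕ) : koszulD k (n + 1) ≫ koszulD k n = 0 := by
  apply koszulX_ext
  intro m
  rw [Limits.comp_zero, ← Category.assoc, koszulι_koszulD]
  cases m with
  | zero => exact Limits.zero_comp
  | succ m =>
    simp only [koszulDComp, Category.assoc]
    rw [koszulι_koszulD]
    cases m with
    | zero => exact Limits.comp_zero
    | succ m =>
      simp only [koszulDComp]
      rw [← Category.assoc, diagDHom_comp, Limits.zero_comp]

/-- The Koszul complex, a complex of left modules over `kuwb` and right modules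
over `(kdwb)_-`. -/
def koszul (k : Type u) [Field k] :
    ChainComplex ((Dwb (1 : k))ᵒᵖ ⥤ (Dwb (-1 : k))ᵒᵖ ⥤ ModuleCat.{u} k) ℕ :=
  ChainComplex.of (koszulX k) (koszulD k) koszulD_comp

end Koszul

/-- The category of finite-dimensional vector spaces and split monomorphisms. -/
structure Spmon (k : Type u) [Field k] where
  carrier : Type u
  [group : AddCommGroup carrier]
  [module : Module k carrier]
  [finite : FiniteDimensional k carrier]

namespace Spmon

variable {k : Type u} [Field k]

instance : CoeSort (Spmon k) (Type u) := ⟨Spmon.carrier⟩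

instance (V : Spmon k) : AddCommGroup V.carrier := V.group
instance (V : Spmon k) : Module k V.carrier := V.module
instance (V : Spmon k) : FiniteDimensional k V.carrier := V.finite

/-- A split monomorphism together with a chosen retraction. -/
@[ext]
structure Hom (V W : Spmon k) where
  i : V.carrier →ₗ[k] W.carrier
  p : W.carrier →ₗ[k] V.carrier
  retract : p ∘ₗ i = LinearMap.id

theorem Hom.p_i {V W : Spmon k} (f : Hom V W) (x : V.carrier) : f.p (f.i x) = x :=
  LinearMap.congr_fun f.retract x

instance : Category (Spmon k) where
  Hom := Hom
  id V := ⟨LinearMap.id, LinearMap.id, rfl⟩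
  comp f g := ⟨g.i ∘ₗ f.i, f.p ∘ₗ g.p, by ext x; simp [Hom.p_i]⟩

/-- The inclusion of a morphism. -/
def inj {V W : Spmon k} (f : V ⟶ W) : V.carrier →ₗ[k] W.carrier := Hom.i f

/-- The retraction of a morphism. -/
def ret {V W : Spmon k} (f : V ⟶ W) : W.carrier →ₗ[k] V.carrier := Hom.p f

@[simp] theorem ret_inj {V W : Spmon k} (f : V ⟶ W) (x : V.carrier) : ret f (inj f x) = x :=
  Hom.p_i f x

@[simp] theorem inj_id (V : Spmon k) : inj (𝟙 V) = LinearMap.id := rfl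
@[simp] theorem ret_id (V : Spmon k) : ret (𝟙 V) = LinearMap.id := rfl
@[simp] theorem inj_comp {V W X : Spmon k} (f : V ⟶ W) (g : W ⟶ X) :
    inj (f ≫ g) = inj g ∘ₗ inj f := rfl
@[simp] theorem ret_comp {V W X : Spmon k} (f : V ⟶ W) (g : W ⟶ X) :
    ret (f ≫ g) = ret f ∘ₗ ret g := rfl

end Spmon

section Mixed

variable {k : Type u} [Field k] {V W : Type u} [AddCommGroup V] [Module k V]
  [AddCommGroup W] [Module k W]

/-- The product of the pairings of the entries matched by a list of pairs. -/
def pairProd {A B : Type} (β : V →ₗ[k] W →ₗ[k] k) (l : List (A × B)) (v : A → V) (w : B → W) : k :=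
  (l.map fun p => β (v p.1) (w p.2)).prod

theorem pairProd_swap {A B : Type} (β : V →ₗ[k] W →ₗ[k] k) (l : List (A × B)) (v : A → V)
    (w : B → W) : pairProd β l v w = pairProd β.flip (l.map Prod.swap) w v := by
  simp [pairProd, Function.comp_def]

theorem pairProd_update_of_notMem {A B : Type} [DecidableEq A] (β : V →ₗ[k] W →ₗ[k] k)
    (l : List (A × B)) (v : A → V) (w : B → W) (a : A) (x : V) (h : a ∉ l.map Prod.fst) :
    pairProd β l (Function.update v a x) w = pairProd β l v w := by
  unfold pairProd
  congr 1
  apply List.map_congr_left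
  intro p hp
  rw [Function.update_of_ne]
  rintro rfl
  exact h (List.mem_map_of_mem hp)

theorem pairProd_update_add {A B : Type} [DecidableEq A] (β : V →ₗ[k] W →ₗ[k] k)
    (l : List (A × B)) (hl : (l.map Prod.fst).Nodup) (v : A → V) (w : B → W) (a : A) (x y : V)
    (h : a ∈ l.map Prod.fst) :
    pairProd β l (Function.update v a (x + y)) w
      = pairProd β l (Function.update v a x) w + pairProd β l (Function.update v a y) w := by
  induction l with
  | nil => simp at h
  | cons p l ih =>
    have hc : ∀ z, pairProd β (p :: l) (Function.update v a z) w
        = β (Function.update v a z p.1) (w p.2) * pairProd β l (Function.update v a z) w := by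
      intro z; simp [pairProd]
    rw [hc, hc, hc]
    rw [List.map_cons, List.nodup_cons] at hl
    by_cases hp : p.1 = a
    · subst hp
      simp only [Function.update_self, map_add, LinearMap.add_apply]
      rw [pairProd_update_of_notMem _ _ _ _ _ _ hl.1, pairProd_update_of_notMem _ _ _ _ _ _ hl.1,
        pairProd_update_of_notMem _ _ _ _ _ _ hl.1]
      ring
    · rw [ih hl.2 (by
        rw [List.map_cons, List.mem_cons] at h
        exact h.resolve_left (fun h => hp h.symm))]
      simp only [Function.update_of_ne hp]
      ring

theorem pairProd_update_smul {A B : Type} [DecidableEq A] (β : V →ₗ[k] W →ₗ[k] k)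
    (l : List (A × B)) (hl : (l.map Prod.fst).Nodup) (v : A → V) (w : B → W) (a : A) (c : k)
    (x : V) (h : a ∈ l.map Prod.fst) :
    pairProd β l (Function.update v a (c • x)) w
      = c * pairProd β l (Function.update v a x) w := by
  induction l with
  | nil => simp at h
  | cons p l ih =>
    have hc : ∀ z, pairProd β (p :: l) (Function.update v a z) w
        = β (Function.update v a z p.1) (w p.2) * pairProd β l (Function.update v a z) w := by
      intro z; simp [pairProd]
    rw [hc, hc]
    rw [List.map_cons, List.nodup_cons] at hl
    by_cases hp : p.1 = a
    · subst hp
      simp only [Function.update_self, map_smul, LinearMap.smul_apply, smul_eq_mul]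
      rw [pairProd_update_of_notMem _ _ _ _ _ _ hl.1, pairProd_update_of_notMem _ _ _ _ _ _ hl.1]
      ring
    · rw [ih hl.2 (by
        rw [List.map_cons, List.mem_cons] at h
        exact h.resolve_left (fun h => hp h.symm))]
      simp only [Function.update_of_ne hp]
      ring

/-- The multilinear map that evaluates the entries matched by a list of pairs and restricts the
other entries along an injection. -/
def contrMulti {A B C : Type} (β : V →ₗ[k] W →ₗ[k] k) (l : List (A × B)) (i : C → A)
    (hi : Function.Injective i) (hl : (l.map Prod.fst).Nodup)
    (hm : ∀ a, a ∈ l.map Prod.fst ↔ a ∉ Set.range i) (w : B → W) :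
    MultilinearMap k (fun _ : A => V) (⨂[k] _ : C, V) where
  toFun v := pairProd β l v w • PiTensorProduct.tprod k (v ∘ i)
  map_update_add' {_} v a x y := by
    by_cases h : a ∈ l.map Prod.fst
    · have h2 : ∀ z, Function.update v a z ∘ i = v ∘ i := by
        intro z
        funext c
        exact Function.update_of_ne (fun hc => (hm a).1 h ⟨c, hc⟩) _ _
      rw [pairProd_update_add β l hl v w a x y h, add_smul, h2, h2, h2]
    · have h1 : a ∈ Set.range i := not_not.1 (fun h' => h ((hm a).2 h'))
      obtain ⟨c, rfl⟩ := h1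
      classical
      rw [pairProd_update_of_notMem _ _ _ _ _ _ h, pairProd_update_of_notMem _ _ _ _ _ _ h,
        pairProd_update_of_notMem _ _ _ _ _ _ h, Function.update_comp_eq_of_injective _ hi,
        Function.update_comp_eq_of_injective _ hi, Function.update_comp_eq_of_injective _ hi,
        MultilinearMap.map_update_add, smul_add]
  map_update_smul' {_} v a c x := by
    by_cases h : a ∈ l.map Prod.fst
    · have h2 : ∀ z, Function.update v a z ∘ i = v ∘ i := by
        intro z
        funext c
        exact Function.update_of_ne (fun hc => (hm a).1 h ⟨c, hc⟩) _ _
      rw [pairProd_update_smul β l hl v w a c x h, mul_smul, h2, h2]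
    · have h1 : a ∈ Set.range i := not_not.1 (fun h' => h ((hm a).2 h'))
      obtain ⟨c, rfl⟩ := h1
      classical
      rw [pairProd_update_of_notMem _ _ _ _ _ _ h, pairProd_update_of_notMem _ _ _ _ _ _ h,
        Function.update_comp_eq_of_injective _ hi,
        Function.update_comp_eq_of_injective _ hi,
        MultilinearMap.map_update_smul, smul_comm]

end Mixed

section MixedFunctor

variable {k : Type u} [Field k]

/-- The mixed tensors `V^{⊗ X} ⊗ (V^♯)^{⊗ Y}`. -/
abbrev MT (V : Spmon k) (P : Wall) : Type u :=
  (⨂[k] _ : P.left.carrier, V.carrier) ⊗[k] (⨂[k] _ : P.right.carrier, Module.Dual k V.carrier)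

/-- Pure mixed tensors. -/
def mt (V : Spmon k) (P : Wall) (v : P.left.carrier → V.carrier)
    (ξ : P.right.carrier → Module.Dual k V.carrier) : MT V P :=
  PiTensorProduct.tprod k v ⊗ₜ[k] PiTensorProduct.tprod k ξ

theorem mt_ext {V : Spmon k} {P : Wall} {N : Type*} [AddCommGroup N] [Module k N]
    {f g : MT V P →ₗ[k] N} (h : ∀ v ξ, f (mt V P v ξ) = g (mt V P v ξ)) : f = g := by
  apply TensorProduct.ext
  apply PiTensorProduct.ext
  ext v : 1
  apply PiTensorProduct.ext
  ext ξ
  exact h v ξ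

/-- The evaluation pairing of `V` with its dual. -/
abbrev evalPairing (V : Spmon k) : V.carrier →ₗ[k] Module.Dual k V.carrier →ₗ[k] k :=
  Module.Dual.eval k V.carrier

/-- The factor by which a morphism acts on a pure mixed tensor. -/
def mtCoeff (V : Spmon k) {P Q : Wall} (f : P ⟶ Q) (v : P.left.carrier → V.carrier)
    (ξ : P.right.carrier → Module.Dual k V.carrier) : k :=
  pairProd (evalPairing V) (OrdHom.pairs f) v ξ

def contrLeft (V : Spmon k) {P Q : Wall} (f : P ⟶ Q)
    (ξ : P.right.carrier → Module.Dual k V.carrier) :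
    MultilinearMap k (fun _ : P.left.carrier => V.carrier) (⨂[k] _ : Q.left.carrier, V.carrier) :=
  contrMulti (evalPairing V) (OrdHom.pairs f) (OrdHom.i f) (OrdHom.i_inj f)
    (OrdHom.nodup_left f) (OrdHom.mem_left f) ξ

def contrRight (V : Spmon k) {P Q : Wall} (f : P ⟶ Q) (v : P.left.carrier → V.carrier) :
    MultilinearMap k (fun _ : P.right.carrier => Module.Dual k V.carrier)
      (⨂[k] _ : Q.right.carrier, Module.Dual k V.carrier) :=
  contrMulti (evalPairing V).flip ((OrdHom.pairs f).map Prod.swap) (OrdHom.j f) (OrdHom.j_inj f)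
    (by
      have := OrdHom.nodup_right f
      simpa [List.map_map, Function.comp_def] using this)
    (by
      intro a
      have := OrdHom.mem_right f a
      rw [← this]
      simp) v

theorem contrLeft_apply (V : Spmon k) {P Q : Wall} (f : P ⟶ Q) (v ξ) :
    contrLeft V f ξ v = mtCoeff V f v ξ • PiTensorProduct.tprod k (v ∘ OrdHom.i f) := rfl

theorem contrRight_apply (V : Spmon k) {P Q : Wall} (f : P ⟶ Q) (v ξ) :
    contrRight V f v ξ = mtCoeff V f v ξ • PiTensorProduct.tprod k (ξ ∘ OrdHom.j f) := by
  unfold mtCoeff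
  rw [pairProd_swap]
  rfl

/-- The contraction of mixed tensors, with a fixed tensor of vectors. -/
def mtAux (V : Spmon k) {P Q : Wall} (f : P ⟶ Q) (v : P.left.carrier → V.carrier) :
    (⨂[k] _ : P.right.carrier, Module.Dual k V.carrier) →ₗ[k] MT V Q :=
  PiTensorProduct.lift
    ((TensorProduct.mk k _ _ (PiTensorProduct.tprod k (v ∘ OrdHom.i f))).compMultilinearMap
      (contrRight V f v))

theorem mtAux_tprod (V : Spmon k) {P Q : Wall} (f : P ⟶ Q) (v ξ) :
    mtAux V f v (PiTensorProduct.tprod k ξ)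
      = contrLeft V f ξ v ⊗ₜ[k] PiTensorProduct.tprod k (ξ ∘ OrdHom.j f) := by
  simp [mtAux, contrLeft_apply, contrRight_apply, TensorProduct.smul_tmul]

/-- The action of a morphism of the ordered downward walled Brauer category on mixed tensors:
the matched entries are paired by evaluation. -/
def mtMap (V : Spmon k) {P Q : Wall} (f : P ⟶ Q) : MT V P →ₗ[k] MT V Q :=
  TensorProduct.lift (PiTensorProduct.lift
    { toFun := mtAux V f
      map_update_add' := by
        intro _ v a x y
        apply PiTensorProduct.ext
        ext ξ
        simp [mtAux_tprod, TensorProduct.add_tmul]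
      map_update_smul' := by
        intro _ v a c x
        apply PiTensorProduct.ext
        ext ξ
        simp [mtAux_tprod, TensorProduct.smul_tmul'] })

theorem mtMap_mt (V : Spmon k) {P Q : Wall} (f : P ⟶ Q) (v ξ) :
    mtMap V f (mt V P v ξ)
      = mtCoeff V f v ξ • mt V Q (v ∘ OrdHom.i f) (ξ ∘ OrdHom.j f) := by
  have : mtMap V f (mt V P v ξ) = mtAux V f v (PiTensorProduct.tprod k ξ) := by
    simp [mtMap, mt]
  rw [this, mtAux_tprod, contrLeft_apply, mt, TensorProduct.smul_tmul']

theorem mtCoeff_id (V : Spmon k) (P : Wall) (v ξ) : mtCoeff V (𝟙 P) v ξ = 1 := rfl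

theorem mtCoeff_comp (V : Spmon k) {P Q R : Wall} (f : P ⟶ Q) (g : Q ⟶ R) (v ξ) :
    mtCoeff V (f ≫ g) v ξ
      = mtCoeff V f v ξ * mtCoeff V g (v ∘ OrdHom.i f) (ξ ∘ OrdHom.j f) := by
  change pairProd _ (OrdHom.pairs f ++ (OrdHom.pairs g).map _) v ξ = _
  simp [pairProd, mtCoeff, Function.comp_def]

theorem mtMap_swap (V : Spmon k) {P Q : Wall} {f g : P ⟶ Q} (h : SwapRel f g) :
    mtMap V f = mtMap V g := by
  obtain ⟨h1, h2, l, a, b, m, h3, h4⟩ := h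
  apply mt_ext
  intro v ξ
  rw [mtMap_mt, mtMap_mt, h1, h2]
  congr 1
  simp only [mtCoeff, pairProd, h3, h4, List.map_append, List.map_cons, List.prod_append,
    List.prod_cons]
  ring

theorem mtMap_id (V : Spmon k) (P : Wall) : mtMap V (𝟙 P) = LinearMap.id := by
  apply mt_ext
  intro v ξ
  rw [mtMap_mt, mtCoeff_id, one_smul]
  rfl

theorem mtMap_comp (V : Spmon k) {P Q R : Wall} (f : P ⟶ Q) (g : Q ⟶ R) :
    mtMap V (f ≫ g) = mtMap V g ∘ₗ mtMap V f := by
  apply mt_ext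
  intro v ξ
  rw [mtMap_mt, mtCoeff_comp, LinearMap.comp_apply, mtMap_mt, map_smul, mtMap_mt, mul_smul]
  rfl

/-- The mixed tensors of a fixed vector space as a functor on the ordered category. -/
def mixedOrd (V : Spmon k) : Wall ⥤ ModuleCat.{u} k where
  obj P := ModuleCat.of k (MT V P)
  map f := ModuleCat.ofHom (mtMap V f)
  map_id P := by
    rw [mtMap_id]
    rfl
  map_comp f g := by
    rw [mtMap_comp]
    rfl

theorem mixedOrd_swap (V : Spmon k) {P Q : Wall} (f g : P ⟶ Q) (h : SwapRel f g) :
    (mixedOrd V).map f = (1 : k) • (mixedOrd V).map g := by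
  rw [one_smul]
  exact congrArg ModuleCat.ofHom (mtMap_swap V h)

/-- The mixed tensors of a fixed vector space as a module over `kdwb`. -/
def mixedAt (V : Spmon k) : Dwb (1 : k) ⥤ ModuleCat.{u} k :=
  Dwb.lift (mixedOrd V) (mixedOrd_swap V)

theorem mixedAt_map_of (V : Spmon k) {P Q : Dwb (1 : k)} (f : P.toWall ⟶ Q.toWall) :
    (mixedAt V).map (Dwb.of f : P ⟶ Q) = ModuleCat.ofHom (mtMap V f) :=
  Dwb.liftHom_cls (N := (mixedOrd V).obj P.toWall ⟶ (mixedOrd V).obj Q.toWall) _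
    (mixedOrd_swap V) f

/-- The functoriality of the mixed tensors for split monomorphisms,
`i^{⊗ X} ⊗ (p^♯)^{⊗ Y}`. -/
def mtFun {V W : Spmon k} (h : V ⟶ W) (P : Wall) : MT V P →ₗ[k] MT W P :=
  TensorProduct.map (PiTensorProduct.map fun _ => Spmon.inj h)
    (PiTensorProduct.map fun _ => Module.Dual.transpose (Spmon.ret h))

theorem mtFun_mt {V W : Spmon k} (h : V ⟶ W) (P : Wall) (v ξ) :
    mtFun h P (mt V P v ξ)
      = mt W P (fun x => Spmon.inj h (v x)) (fun y => ξ y ∘ₗ Spmon.ret h) := by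
  simp [mtFun, mt]
  rfl

theorem mtCoeff_fun {V W : Spmon k} (h : V ⟶ W) {P Q : Wall} (f : P ⟶ Q) (v ξ) :
    mtCoeff W f (fun x => Spmon.inj h (v x)) (fun y => ξ y ∘ₗ Spmon.ret h)
      = mtCoeff V f v ξ := by
  simp [mtCoeff, pairProd]

theorem mtFun_mtMap {V W : Spmon k} (h : V ⟶ W) {P Q : Wall} (f : P ⟶ Q) :
    mtFun h Q ∘ₗ mtMap V f = mtMap W f ∘ₗ mtFun h P := by
  apply mt_ext
  intro v ξ
  rw [LinearMap.comp_apply, LinearMap.comp_apply, mtMap_mt, mtFun_mt, mtMap_mt, map_smul,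
    mtFun_mt, mtCoeff_fun]
  rfl

/-- The morphism of mixed tensor modules induced by a split monomorphism. -/
def mixedMap {V W : Spmon k} (h : V ⟶ W) : mixedAt V ⟶ mixedAt W where
  app P := ModuleCat.ofHom (mtFun h P.toWall)
  naturality P Q f := by
    have : (Linear.rightComp k ((mixedOrd V).obj P.toWall) (Y := (mixedOrd V).obj Q.toWall)
          (Z := (mixedOrd W).obj Q.toWall) (ModuleCat.ofHom (mtFun h Q.toWall))) ∘ₗ
          Dwb.liftHom (fun f => (mixedOrd V).map f) (mixedOrd_swap V)
        = (Linear.leftComp k ((mixedOrd W).obj Q.toWall) (X := (mixedOrd V).obj P.toWall)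
          (Y := (mixedOrd W).obj P.toWall) (ModuleCat.ofHom (mtFun h P.toWall))) ∘ₗ
          Dwb.liftHom (fun f => (mixedOrd W).map f) (mixedOrd_swap W) :=
      Dwb.hom_ext fun f => by
        simp only [LinearMap.comp_apply, Dwb.liftHom_cls]
        ext1
        exact (mtFun_mtMap h f)
    exact LinearMap.congr_fun this f

/-- The mixed tensor functor, with values in modules over `kdwb`. -/
def mixed (k : Type u) [Field k] : Spmon k ⥤ Dwb (1 : k) ⥤ ModuleCat.{u} k where
  obj V := mixedAt V
  map h := mixedMap h
  map_id V := by
    ext P : 2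
    ext1
    apply mt_ext
    intro v ξ
    exact mtFun_mt _ _ _ _
  map_comp h h' := by
    ext P : 2
    ext1
    apply mt_ext
    intro v ξ
    change mtFun (h ≫ h') P.toWall (mt _ _ v ξ)
      = mtFun h' P.toWall (mtFun h P.toWall (mt _ _ v ξ))
    rw [mtFun_mt, mtFun_mt, mtFun_mt]
    rfl

/-- The mixed tensor functor `T^{m,n}`. -/
abbrev mixedTensor (k : Type u) [Field k] (m n : ℕ) : Spmon k ⥤ ModuleCat.{u} k :=
  (mixed k).flip.obj (sk 1 (m, n))

/-- The Schur functor `T ⊗_{kuwb} -`, from left `kuwb`-modules (right `kdwb`-modules) to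
functors on split monomorphisms. -/
def schur (k : Type u) [Field k] :
    ((Dwb (1 : k))ᵒᵖ ⥤ ModuleCat.{u} k) ⥤ Spmon k ⥤ ModuleCat.{u} k :=
  tens (sk (1 : k)) ⋙ (Functor.whiskeringLeft _ _ _).obj (mixed k)

instance : (schur k).Additive := by
  unfold schur
  infer_instance

/-- The functor that sends a `kuwb`-`(kdwb)_-`-bimodule `B` to the value of the Schur functor on
`B ⊗_{(kdwb)_-} M`. -/
def schurTens (M : Dwb (-1 : k) ⥤ ModuleCat.{u} k) :
    ((Dwb (1 : k))ᵒᵖ ⥤ (Dwb (-1 : k))ᵒᵖ ⥤ ModuleCat.{u} k) ⥤ Spmon k ⥤ ModuleCat.{u} k :=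
  (Functor.whiskeringRight _ _ _).obj ((tens (sk (-1 : k))).flip.obj M) ⋙ schur k

instance (M : Dwb (-1 : k) ⥤ ModuleCat.{u} k) : (schurTens M).Additive := by
  unfold schurTens
  infer_instance

/-- Naturality of `schurTens`. -/
def schurTensMap {M N : Dwb (-1 : k) ⥤ ModuleCat.{u} k} (p : M ⟶ N) :
    schurTens M ⟶ schurTens N :=
  Functor.whiskerRight ((Functor.whiskeringRight _ _ _).map ((tens (sk (-1 : k))).flip.map p))
    (schur k)

/-- The complex of functors given by the Schur functor applied to the Koszul complex
`K ⊗_{(kdwb)_-} M` of a `(kdwb)_-`-module `M`. -/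
def schurKoszul (M : Dwb (-1 : k) ⥤ ModuleCat.{u} k) :
    ChainComplex (Spmon k ⥤ ModuleCat.{u} k) ℕ :=
  ((schurTens M).mapHomologicalComplex _).obj (koszul k)

/-- The morphism of complexes induced by a morphism of modules. -/
def schurKoszulMap {M N : Dwb (-1 : k) ⥤ ModuleCat.{u} k} (p : M ⟶ N) :
    schurKoszul M ⟶ schurKoszul N :=
  (NatTrans.mapHomologicalComplex (schurTensMap p) _).app (koszul k)

end MixedFunctor

/-- The category of `k FB`-modules, that is, `k`-linear species. -/
abbrev Species (k : Type u) [Field k] := FB ⥤ ModuleCat.{u} k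

namespace Species

variable {k : Type u} [Field k]

/-- The value of a species on a finite set. -/
abbrev at' (P : Species k) (X : Type) [Finite X] : Type u := P.obj ⟨X⟩

/-- The relabelling map along a bijection. -/
def relabel (P : Species k) {X X' : Type} [Finite X] [Finite X'] (e : X ≃ X') :
    P.at' X →ₗ[k] P.at' X' :=
  (P.map (X := ⟨X⟩) (Y := ⟨X'⟩) e).hom

@[simp]
theorem relabel_refl (P : Species k) {X : Type} [Finite X] (p : P.at' X) :
    P.relabel (Equiv.refl X) p = p := by
  have := P.map_id ⟨X⟩
  exact LinearMap.congr_fun (congrArg ModuleCat.Hom.hom this) p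

@[simp]
theorem relabel_relabel (P : Species k) {X X' X'' : Type} [Finite X] [Finite X'] [Finite X'']
    (e : X ≃ X') (f : X' ≃ X'') (p : P.at' X) :
    P.relabel f (P.relabel e p) = P.relabel (e.trans f) p := by
  have := P.map_comp (X := ⟨X⟩) (Y := ⟨X'⟩) (Z := ⟨X''⟩) e f
  exact (LinearMap.congr_fun (congrArg ModuleCat.Hom.hom this) p).symm

/-- A species from its values and relabelling maps. -/
def ofData (obj : ∀ (X : Type) [Finite X], Type u)
    [∀ (X : Type) [Finite X], AddCommGroup (obj X)]
    [∀ (X : Type) [Finite X], Module k (obj X)]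
    (map : ∀ {X X' : Type} [Finite X] [Finite X'], (X ≃ X') → obj X →ₗ[k] obj X')
    (map_refl : ∀ (X : Type) [Finite X], map (Equiv.refl X) = LinearMap.id)
    (map_trans : ∀ {X X' X'' : Type} [Finite X] [Finite X'] [Finite X''] (e : X ≃ X')
      (f : X' ≃ X''), map (e.trans f) = map f ∘ₗ map e) : Species k where
  obj P := ModuleCat.of k (obj P.carrier)
  map {P Q} f := ModuleCat.ofHom (map (X := P.carrier) (X' := Q.carrier) f)
  map_id P := by
    ext1
    exact map_refl _
  map_comp f g := by
    ext1
    exact map_trans _ _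

end Species

/-- A natural family of insertion maps: a structure operation with a marked input `*` receives at
this input an operation of the second species. -/
structure Insertion {k : Type u} [Field k] (P O : Species k) where
  ins : ∀ {A Z : Type} [Finite A] [Finite Z],
    P.at' (A ⊕ Fin 1) →ₗ[k] O.at' Z →ₗ[k] P.at' (A ⊕ Z)
  ins_relabel : ∀ {A A' Z Z' : Type} [Finite A] [Finite A'] [Finite Z] [Finite Z'] (e : A ≃ A')
    (f : Z ≃ Z') (p : P.at' (A ⊕ Fin 1)) (o : O.at' Z),
    ins (P.relabel (e.sumCongr (Equiv.refl (Fin 1))) p) (O.relabel f o)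
      = P.relabel (e.sumCongr f) (ins p o)

namespace Insertion

variable {k : Type u} [Field k] {P O : Species k}

/-- Sequential associativity of a right action with respect to a composition. -/
def Sequential (I : Insertion P O) (J : Insertion O O) : Prop :=
  ∀ {A B C : Type} [Finite A] [Finite B] [Finite C] (p : P.at' (A ⊕ Fin 1))
    (b : O.at' (B ⊕ Fin 1)) (c : O.at' C),
    I.ins p (J.ins b c) = P.relabel (Equiv.sumAssoc A B C)
      (I.ins (P.relabel (Equiv.sumAssoc A B (Fin 1)).symm (I.ins p b)) c)

/-- The bijection `(A ⊔ B) ⊔ C ≃ (A ⊔ C) ⊔ B`. -/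
def rightComm (A B C : Type) : (A ⊕ B) ⊕ C ≃ (A ⊕ C) ⊕ B :=
  (Equiv.sumAssoc A B C).trans
    (((Equiv.refl A).sumCongr (Equiv.sumComm B C)).trans (Equiv.sumAssoc A C B).symm)

/-- Parallel associativity: insertions at two distinct inputs commute. -/
def Parallel (I : Insertion P O) : Prop :=
  ∀ {A B C : Type} [Finite A] [Finite B] [Finite C] (p : P.at' ((A ⊕ Fin 1) ⊕ Fin 1))
    (b : O.at' B) (c : O.at' C),
    I.ins (P.relabel (rightComm A (Fin 1) B) (I.ins p b)) c
      = P.relabel (rightComm A C B)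
        (I.ins (P.relabel (rightComm A (Fin 1) C)
          (I.ins (P.relabel (rightComm A (Fin 1) (Fin 1)) p) c)) b)

/-- Insertion with arbitrary labels: `A ⊔ {*} ≃ X` exhibits the marked input of an element of
`P(X)` and `A ⊔ Z ≃ Y` labels the inputs of the result. -/
def cmp (I : Insertion P O) {A Z X Y : Type} [Finite A] [Finite Z] [Finite X] [Finite Y]
    (e : A ⊕ Fin 1 ≃ X) (g : A ⊕ Z ≃ Y) (p : P.at' X) (o : O.at' Z) : P.at' Y :=
  P.relabel g (I.ins (P.relabel e.symm p) o)

theorem cmp_relabel (I : Insertion P O) {A Z X Y A' Z' X' Y' : Type} [Finite A] [Finite Z]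
    [Finite X] [Finite Y] [Finite A'] [Finite Z'] [Finite X'] [Finite Y']
    {e : A ⊕ Fin 1 ≃ X} {g : A ⊕ Z ≃ Y} {e' : A' ⊕ Fin 1 ≃ X'} {g' : A' ⊕ Z' ≃ Y'}
    (f : X ≃ X') (z : Z ≃ Z') (h : A ≃ A') (y : Y ≃ Y')
    (H1 : ∀ a, f (e (Sum.inl a)) = e' (Sum.inl (h a)))
    (H2 : f (e (Sum.inr 0)) = e' (Sum.inr 0))
    (H3 : ∀ a, y (g (Sum.inl a)) = g' (Sum.inl (h a)))
    (H4 : ∀ x, y (g (Sum.inr x)) = g' (Sum.inr (z x))) (p : P.at' X) (o : O.at' Z) :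
    I.cmp e' g' (P.relabel f p) (O.relabel z o) = P.relabel y (I.cmp e g p o) := by
  unfold cmp
  have h1 : P.relabel e'.symm (P.relabel f p)
      = P.relabel (h.sumCongr (Equiv.refl (Fin 1))) (P.relabel e.symm p) := by
    rw [Species.relabel_relabel, Species.relabel_relabel]
    congr 2
    ext x
    obtain ⟨t, rfl⟩ := e.surjective x
    rw [Equiv.trans_apply, Equiv.symm_apply_eq, Equiv.trans_apply, Equiv.symm_apply_apply]
    rcases t with a | t
    · exact H1 a
    · obtain rfl : t = 0 := Subsingleton.elim _ _
      exact H2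
  rw [h1, I.ins_relabel, Species.relabel_relabel, Species.relabel_relabel]
  congr 2
  ext x
  rcases x with a | x
  · exact (H3 a).symm
  · exact (H4 x).symm

theorem cmp_relabel_left (I : Insertion P O) {A Z X Y A' X' : Type} [Finite A] [Finite Z]
    [Finite X] [Finite Y] [Finite A'] [Finite X']
    {e : A ⊕ Fin 1 ≃ X} {g : A ⊕ Z ≃ Y} {e' : A' ⊕ Fin 1 ≃ X'} {g' : A' ⊕ Z ≃ Y}
    (f : X ≃ X') (h : A ≃ A')
    (H1 : ∀ a, f (e (Sum.inl a)) = e' (Sum.inl (h a)))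
    (H2 : f (e (Sum.inr 0)) = e' (Sum.inr 0))
    (H3 : ∀ a, g (Sum.inl a) = g' (Sum.inl (h a)))
    (H4 : ∀ x, g (Sum.inr x) = g' (Sum.inr x)) (p : P.at' X) (o : O.at' Z) :
    I.cmp e' g' (P.relabel f p) o = I.cmp e g p o := by
  have := I.cmp_relabel f (Equiv.refl Z) h (Equiv.refl Y) H1 H2 H3 H4 p o
  simpa using this

theorem relabel_cmp (I : Insertion P O) {A Z X Y Y' : Type} [Finite A] [Finite Z]
    [Finite X] [Finite Y] [Finite Y'] (e : A ⊕ Fin 1 ≃ X) (g : A ⊕ Z ≃ Y) (y : Y ≃ Y')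
    (p : P.at' X) (o : O.at' Z) :
    P.relabel y (I.cmp e g p o) = I.cmp e (g.trans y) p o := by
  simp [cmp]

theorem ins_eq_cmp (I : Insertion P O) {A Z : Type} [Finite A] [Finite Z]
    (p : P.at' (A ⊕ Fin 1)) (o : O.at' Z) :
    I.ins p o = I.cmp (Equiv.refl _) (Equiv.refl _) p o := by
  simp [cmp]

end Insertion

/-- An operad without unit, given by partial compositions. -/
structure Operad (k : Type u) [Field k] where
  sp : Species k
  comp : Insertion sp sp
  sequential : comp.Sequential comp
  parallel : comp.Parallel

/-- A right module over an operad, given by partial actions. -/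
structure RightModule {k : Type u} [Field k] (O : Operad k) where
  sp : Species k
  act : Insertion sp O.sp
  sequential : act.Sequential O.comp
  parallel : act.Parallel

namespace Insertion
variable {k : Type u} [Field k] {P O : Species k}

theorem sequential_cmp {I : Insertion P O} {J : Insertion O O} (h : I.Sequential J)
    {A B C X Y Z T : Type} [Finite A] [Finite B] [Finite C] [Finite X] [Finite Y] [Finite Z]
    [Finite T] (e : A ⊕ Fin 1 ≃ X) (e' : B ⊕ Fin 1 ≃ Y) (g' : B ⊕ C ≃ Z) (g : A ⊕ Z ≃ T)
    (p : P.at' X) (b : O.at' Y) (c : O.at' C) :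
    I.cmp e g p (J.cmp e' g' b c)
      = I.cmp (Equiv.refl ((A ⊕ B) ⊕ Fin 1))
        ((Equiv.sumAssoc A B C).trans (((Equiv.refl A).sumCongr g').trans g))
        (I.cmp e (((Equiv.refl A).sumCongr e'.symm).trans (Equiv.sumAssoc A B (Fin 1)).symm) p b)
        c := by
  have h1 := h (P.relabel e.symm p) (O.relabel e'.symm b) c
  have h2 : I.ins (P.relabel e.symm p) (O.relabel e'.symm b)
      = P.relabel ((Equiv.refl A).sumCongr e'.symm) (I.ins (P.relabel e.symm p) b) := by
    have := I.ins_relabel (Equiv.refl A) e'.symm (P.relabel e.symm p) b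
    simpa using this
  have h3 := I.ins_relabel (Equiv.refl A) g' (P.relabel e.symm p)
    (J.ins (O.relabel e'.symm b) c)
  simp only [Equiv.sumCongr_refl, Species.relabel_refl] at h3
  unfold cmp
  rw [h3, h1, h2]
  simp only [Species.relabel_relabel]
  rfl

end Insertion

section Points

open Classical in
/-- The bijection `(X ∖ {x}) ⊔ {*} ≃ X` sending `*` to `x`. -/
def ptEquiv {X : Type} (x : X) : {y : X // y ≠ x} ⊕ Fin 1 ≃ X where
  toFun := Sum.elim Subtype.val (fun _ => x)
  invFun y := if h : y = x then Sum.inr 0 else Sum.inl ⟨y, h⟩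
  left_inv := by
    rintro (y | y)
    · simp [y.2]
    · simp [Subsingleton.elim y 0]
  right_inv y := by
    by_cases h : y = x <;> simp [h]

@[simp] theorem ptEquiv_inl {X : Type} (x : X) (y : {y : X // y ≠ x}) :
    ptEquiv x (Sum.inl y) = y.1 := rfl

@[simp] theorem ptEquiv_inr {X : Type} (x : X) (y : Fin 1) :
    ptEquiv x (Sum.inr y) = x := rfl

/-- A bijection restricts to the complements of a point and of its image. -/
def neEquiv {X X' : Type} (f : X ≃ X') (x : X) : {y : X // y ≠ x} ≃ {y : X' // y ≠ f x} :=
  f.subtypeEquiv (by simp)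

end Points

namespace Insertion
variable {k : Type u} [Field k] {P O : Species k}

theorem parallel_cmp {I : Insertion P O} (h : I.Parallel)
    {A B C X T : Type} [Finite A] [Finite B] [Finite C] [Finite X]
    [Finite T] (e : (A ⊕ Fin 1) ⊕ Fin 1 ≃ X) (g : (A ⊕ B) ⊕ C ≃ T)
    (p : P.at' X) (b : O.at' B) (c : O.at' C) :
    I.cmp (Equiv.refl _) g (I.cmp e (rightComm A (Fin 1) B) p b) c
      = I.cmp (Equiv.refl _) ((rightComm A C B).trans g)
        (I.cmp ((rightComm A (Fin 1) (Fin 1)).trans e) (rightComm A (Fin 1) C) p c) b := by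
  have h1 := h (P.relabel e.symm p) b c
  unfold cmp
  simp only [Equiv.refl_symm, Species.relabel_refl]
  rw [h1]
  simp only [Species.relabel_relabel]
  rfl

theorem cmp_relabel_symm (I : Insertion P O) {A Z X X' Y : Type} [Finite A] [Finite Z] [Finite X]
    [Finite X'] [Finite Y] (e : A ⊕ Fin 1 ≃ X') (g : A ⊕ Z ≃ Y) (f : X ≃ X') (p : P.at' X)
    (o : O.at' Z) : I.cmp e g (P.relabel f p) o = I.cmp (e.trans f.symm) g p o := by
  simp [cmp]

theorem cmp_cmp_congr (I : Insertion P O) {A A' B B' X Y Y' Z C T : Type} [Finite A] [Finite A']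
    [Finite B] [Finite B'] [Finite X] [Finite Y] [Finite Y'] [Finite Z] [Finite C] [Finite T]
    {e : A ⊕ Fin 1 ≃ X} {g : A ⊕ Z ≃ Y} {e' : A' ⊕ Fin 1 ≃ X} {g' : A' ⊕ Z ≃ Y'}
    {e₁ : B ⊕ Fin 1 ≃ Y} {g₁ : B ⊕ C ≃ T} {e₁' : B' ⊕ Fin 1 ≃ Y'} {g₁' : B' ⊕ C ≃ T}
    (y : Y ≃ Y') (h : A ≃ A') (h₁ : B ≃ B')
    (H1 : ∀ a, e (Sum.inl a) = e' (Sum.inl (h a)))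
    (H2 : e (Sum.inr 0) = e' (Sum.inr 0))
    (H3 : ∀ a, y (g (Sum.inl a)) = g' (Sum.inl (h a)))
    (H4 : ∀ z, y (g (Sum.inr z)) = g' (Sum.inr z))
    (K1 : ∀ b, y (e₁ (Sum.inl b)) = e₁' (Sum.inl (h₁ b)))
    (K2 : y (e₁ (Sum.inr 0)) = e₁' (Sum.inr 0))
    (K3 : ∀ b, g₁ (Sum.inl b) = g₁' (Sum.inl (h₁ b)))
    (K4 : ∀ z, g₁ (Sum.inr z) = g₁' (Sum.inr z))
    (p : P.at' X) (b : O.at' Z) (c : O.at' C) :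
    I.cmp e₁ g₁ (I.cmp e g p b) c = I.cmp e₁' g₁' (I.cmp e' g' p b) c := by
  have h1 := I.cmp_relabel (Equiv.refl X) (Equiv.refl Z) h y H1 H2 H3 H4 p b
  simp only [Species.relabel_refl] at h1
  rw [h1]
  exact (I.cmp_relabel_left y h₁ K1 K2 K3 K4 _ c).symm

end Insertion

section Deriv

variable {k : Type u} [Field k]

/-- The derivative `X ↦ P(X ⊔ {*})` of a species. -/
def deriv (P : Species k) : Species k :=
  Species.ofData (fun X _ => P.at' (X ⊕ Fin 1))
    (fun e => P.relabel (e.sumCongr (Equiv.refl (Fin 1))))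
    (by
      intro X _
      ext p
      simp)
    (by
      intro X X' X'' _ _ _ e f
      ext p
      rw [LinearMap.comp_apply, Species.relabel_relabel]
      congr 2
      ext x
      rcases x with x | x <;> rfl)

theorem deriv_relabel (P : Species k) {X X' : Type} [Finite X] [Finite X'] (e : X ≃ X')
    (p : P.at' (X ⊕ Fin 1)) :
    (deriv P).relabel e p = P.relabel (e.sumCongr (Equiv.refl (Fin 1))) p := rfl

/-- The insertion at an input different from the marked one. -/
def derivIns {P O : Species k} (I : Insertion P O) {A Z : Type} [Finite A] [Finite Z] :
    P.at' ((A ⊕ Fin 1) ⊕ Fin 1) →ₗ[k] O.at' Z →ₗ[k] P.at' ((A ⊕ Z) ⊕ Fin 1) :=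
  (I.ins.compl₁₂ (P.relabel (Insertion.rightComm A (Fin 1) (Fin 1))) LinearMap.id).compr₂
    (P.relabel (Insertion.rightComm A (Fin 1) Z))

theorem derivIns_eq {P O : Species k} (I : Insertion P O) {A Z : Type} [Finite A] [Finite Z]
    (p : P.at' ((A ⊕ Fin 1) ⊕ Fin 1)) (o : O.at' Z) :
    derivIns I p o = I.cmp (Insertion.rightComm A (Fin 1) (Fin 1))
      (Insertion.rightComm A (Fin 1) Z) p o := rfl

theorem derivIns_relabel {P O : Species k} (I : Insertion P O) {A A' Z Z' : Type} [Finite A]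
    [Finite A'] [Finite Z] [Finite Z'] (e : A ≃ A') (f : Z ≃ Z')
    (p : P.at' ((A ⊕ Fin 1) ⊕ Fin 1)) (o : O.at' Z) :
    derivIns I (P.relabel ((e.sumCongr (Equiv.refl (Fin 1))).sumCongr (Equiv.refl (Fin 1))) p)
        (O.relabel f o)
      = P.relabel ((e.sumCongr f).sumCongr (Equiv.refl (Fin 1))) (derivIns I p o) := by
  rw [derivIns_eq, derivIns_eq]
  apply I.cmp_relabel _ _ (e.sumCongr (Equiv.refl (Fin 1)))
  · rintro (a | a) <;> rfl
  · rfl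
  · rintro (a | a) <;> rfl
  · intro x; rfl

/-- The insertion maps of the derivative. -/
def derivInsertion {P O : Species k} (I : Insertion P O) : Insertion (deriv P) O where
  ins {A Z} _ _ := derivIns I (A := A) (Z := Z)
  ins_relabel e f p o := derivIns_relabel I e f p o

theorem derivInsertion_cmp {P O : Species k} (I : Insertion P O) {A Z X Y : Type} [Finite A]
    [Finite Z] [Finite X] [Finite Y] (e : A ⊕ Fin 1 ≃ X) (g : A ⊕ Z ≃ Y)
    (p : P.at' (X ⊕ Fin 1)) (o : O.at' Z) :
    (derivInsertion I).cmp e g p o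
      = I.cmp ((Insertion.rightComm A (Fin 1) (Fin 1)).trans (e.sumCongr (Equiv.refl (Fin 1))))
        ((Insertion.rightComm A (Fin 1) Z).trans (g.sumCongr (Equiv.refl (Fin 1)))) p o := by
  change P.relabel _ (derivIns I (P.relabel _ p) o) = _
  rw [derivIns_eq, Insertion.relabel_cmp]
  apply I.cmp_relabel_left _ (Equiv.refl _)
  · rintro (a | a)
    · simp [Insertion.rightComm]
    · simp [Insertion.rightComm]
  · simp [Insertion.rightComm]
  · intro a; rfl
  · intro a; rfl

theorem derivIns_sequential {P O : Species k} {I : Insertion P O} {J : Insertion O O}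
    (h : I.Sequential J) {A B C : Type} [Finite A] [Finite B] [Finite C]
    (p : P.at' ((A ⊕ Fin 1) ⊕ Fin 1)) (b : O.at' (B ⊕ Fin 1)) (c : O.at' C) :
    derivIns I p (J.ins b c)
      = P.relabel ((Equiv.sumAssoc A B C).sumCongr (Equiv.refl (Fin 1)))
        (derivIns I (P.relabel ((Equiv.sumAssoc A B (Fin 1)).symm.sumCongr (Equiv.refl (Fin 1)))
          (derivIns I p b)) c) := by
  rw [J.ins_eq_cmp, derivIns_eq, derivIns_eq, derivIns_eq, Insertion.sequential_cmp h,
    Insertion.relabel_cmp, Insertion.relabel_cmp]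
  symm
  refine I.cmp_cmp_congr ((((Equiv.sumAssoc A B (Fin 1)).sumCongr (Equiv.refl (Fin 1))).trans
    (Insertion.rightComm A (B ⊕ Fin 1) (Fin 1))).trans
      (Equiv.sumAssoc (A ⊕ Fin 1) B (Fin 1)).symm)
    (Equiv.refl _) (Insertion.rightComm A B (Fin 1)) ?_ ?_ ?_ ?_ ?_ ?_ ?_ ?_ p b c
  · intro a; rfl
  · rfl
  · rintro (a | a) <;> rfl
  · rintro (a | a) <;> rfl
  · rintro ((a | a) | a) <;> rfl
  · rfl
  · rintro ((a | a) | a) <;> rfl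
  · intro x; rfl

theorem derivIns_parallel {P O : Species k} {I : Insertion P O}
    (h : I.Parallel) {A B C : Type} [Finite A] [Finite B] [Finite C]
    (p : P.at' (((A ⊕ Fin 1) ⊕ Fin 1) ⊕ Fin 1)) (b : O.at' B) (c : O.at' C) :
    derivIns I (P.relabel ((Insertion.rightComm A (Fin 1) B).sumCongr (Equiv.refl (Fin 1)))
        (derivIns I p b)) c
      = P.relabel ((Insertion.rightComm A C B).sumCongr (Equiv.refl (Fin 1)))
        (derivIns I (P.relabel ((Insertion.rightComm A (Fin 1) C).sumCongr (Equiv.refl (Fin 1)))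
          (derivIns I (P.relabel ((Insertion.rightComm A (Fin 1) (Fin 1)).sumCongr
            (Equiv.refl (Fin 1))) p) c)) b) := by
  simp only [derivIns_eq, Insertion.relabel_cmp, Insertion.cmp_relabel_symm]
  have key := Insertion.parallel_cmp h
    (((Insertion.rightComm A (Fin 1) (Fin 1)).sumCongr (Equiv.refl (Fin 1))).trans
      (Insertion.rightComm (A ⊕ Fin 1) (Fin 1) (Fin 1)))
    (((Insertion.rightComm A (Fin 1) B).sumCongr (Equiv.refl C)).trans
      (Insertion.rightComm (A ⊕ B) (Fin 1) C)) p b c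
  refine Eq.trans ?_ (key.trans ?_)
  · refine I.cmp_cmp_congr ((Insertion.rightComm (A ⊕ B) (Fin 1) (Fin 1)).trans
        ((Insertion.rightComm A B (Fin 1)).sumCongr (Equiv.refl (Fin 1))))
      (Insertion.rightComm A (Fin 1) (Fin 1)) (Insertion.rightComm A B (Fin 1))
      ?_ ?_ ?_ ?_ ?_ ?_ ?_ ?_ p b c
    · rintro ((a | a) | a) <;> rfl
    · rfl
    · rintro ((a | a) | a) <;> rfl
    · intro a; rfl
    · rintro ((a | a) | a) <;> rfl
    · rfl
    · rintro ((a | a) | a) <;> rfl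
    · intro x; rfl
  · refine I.cmp_cmp_congr (((Insertion.rightComm A (Fin 1) C).sumCongr (Equiv.refl (Fin 1))).trans
        (Insertion.rightComm (A ⊕ C) (Fin 1) (Fin 1)))
      (Insertion.rightComm A (Fin 1) (Fin 1)) (Insertion.rightComm A (Fin 1) C)
      ?_ ?_ ?_ ?_ ?_ ?_ ?_ ?_ p c b
    · rintro ((a | a) | a) <;> rfl
    · rfl
    · rintro ((a | a) | a) <;> rfl
    · intro a; rfl
    · rintro ((a | a) | a) <;> rfl
    · rfl
    · rintro ((a | a) | a) <;> rfl
    · intro x; rfl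

theorem derivInsertion_sequential {P O : Species k} {I : Insertion P O} {J : Insertion O O}
    (h : I.Sequential J) : (derivInsertion I).Sequential J :=
  fun p b c => derivIns_sequential h p b c

theorem derivInsertion_parallel {P O : Species k} {I : Insertion P O}
    (h : I.Parallel) : (derivInsertion I).Parallel :=
  fun p b c => derivIns_parallel h p b c

end Deriv

theorem exists_restrict {A B : Type} (s : B ⊕ Fin 1 ≃ A ⊕ Fin 1)
    (hs : s (Sum.inr 0) = Sum.inr 0) :
    ∃ h : B ≃ A, s = h.sumCongr (Equiv.refl (Fin 1)) := by
  have h1 : ∀ b, (s (Sum.inl b)).isLeft = true := by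
    intro b
    rcases h : s (Sum.inl b) with a | a
    · rfl
    · obtain rfl : a = 0 := Subsingleton.elim _ _
      rw [← hs] at h
      exact absurd (s.injective h) (by simp)
  have hs' : s.symm (Sum.inr 0) = Sum.inr 0 := by rw [Equiv.symm_apply_eq, hs]
  have h2 : ∀ a, (s.symm (Sum.inl a)).isLeft = true := by
    intro b
    rcases h : s.symm (Sum.inl b) with a | a
    · rfl
    · obtain rfl : a = 0 := Subsingleton.elim _ _
      rw [← hs'] at h
      exact absurd (s.symm.injective h) (by simp)
  refine ⟨⟨fun b => (s (Sum.inl b)).getLeft (h1 b), fun a => (s.symm (Sum.inl a)).getLeft (h2 a),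
    fun b => by simp, fun a => by simp⟩, ?_⟩
  ext x
  rcases x with x | x
  · simp
  · obtain rfl : x = 0 := Subsingleton.elim _ _
    simp [hs]

section Wheel

variable {k : Type u} [Field k] (O : Operad k)

/-- The product of two operations with a marked input: the output of `b` is plugged into the
marked input of `a`, and the marked input of `b` becomes the marked input of the result. -/
def markedMul {X₁ X₂ X : Type} [Finite X₁] [Finite X₂] [Finite X] (e : X₁ ⊕ X₂ ≃ X)
    (a : O.sp.at' (X₁ ⊕ Fin 1)) (b : O.sp.at' (X₂ ⊕ Fin 1)) : O.sp.at' (X ⊕ Fin 1) :=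
  O.comp.cmp (Equiv.refl _)
    ((Equiv.sumAssoc X₁ X₂ (Fin 1)).symm.trans (e.sumCongr (Equiv.refl (Fin 1)))) a b

/-- The commutators in `δ_{1,1} O`. -/
def commRel (X : Type) [Finite X] : Submodule k (O.sp.at' (X ⊕ Fin 1)) :=
  Submodule.span k {z | ∃ (X₁ X₂ : Type) (_ : Finite X₁) (_ : Finite X₂) (e : X₁ ⊕ X₂ ≃ X)
    (a : O.sp.at' (X₁ ⊕ Fin 1)) (b : O.sp.at' (X₂ ⊕ Fin 1)),
    z = markedMul O e a b - markedMul O ((Equiv.sumComm X₂ X₁).trans e) b a}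

variable {O}

theorem markedMul_relabel_left {X₁ X₁' X₂ X : Type} [Finite X₁] [Finite X₁'] [Finite X₂] [Finite X]
    (f : X₁' ≃ X₁) (e : X₁ ⊕ X₂ ≃ X) (a : O.sp.at' (X₁' ⊕ Fin 1)) (b : O.sp.at' (X₂ ⊕ Fin 1)) :
    markedMul O e (O.sp.relabel (f.sumCongr (Equiv.refl _)) a) b
      = markedMul O ((f.sumCongr (Equiv.refl _)).trans e) a b := by
  apply O.comp.cmp_relabel_left _ f
  · intro a; rfl
  · rfl
  · intro a; rfl
  · rintro (a | a) <;> rfl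

theorem markedMul_relabel_right {X₁ X₂ X₂' X : Type} [Finite X₁] [Finite X₂'] [Finite X₂]
    [Finite X] (f : X₂' ≃ X₂) (e : X₁ ⊕ X₂ ≃ X) (a : O.sp.at' (X₁ ⊕ Fin 1))
    (b : O.sp.at' (X₂' ⊕ Fin 1)) :
    markedMul O e a (O.sp.relabel (f.sumCongr (Equiv.refl _)) b)
      = markedMul O (((Equiv.refl _).sumCongr f).trans e) a b := by
  have := O.comp.cmp_relabel (e := Equiv.refl (X₁ ⊕ Fin 1)) (e' := Equiv.refl (X₁ ⊕ Fin 1))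
    (g := ((Equiv.sumAssoc X₁ X₂' (Fin 1)).symm.trans
      ((((Equiv.refl _).sumCongr f).trans e).sumCongr (Equiv.refl (Fin 1)))))
    (g' := ((Equiv.sumAssoc X₁ X₂ (Fin 1)).symm.trans (e.sumCongr (Equiv.refl (Fin 1)))))
    (Equiv.refl _) (f.sumCongr (Equiv.refl _)) (Equiv.refl _) (Equiv.refl _)
    (fun _ => rfl) rfl (fun _ => rfl) (by rintro (x | x) <;> rfl) a b
  simpa [markedMul] using this

theorem relabel_markedMul {X₁ X₂ X X' : Type} [Finite X₁] [Finite X₂] [Finite X] [Finite X']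
    (e : X₁ ⊕ X₂ ≃ X) (f : X ≃ X') (a : O.sp.at' (X₁ ⊕ Fin 1)) (b : O.sp.at' (X₂ ⊕ Fin 1)) :
    O.sp.relabel (f.sumCongr (Equiv.refl _)) (markedMul O e a b)
      = markedMul O (e.trans f) a b := by
  unfold markedMul
  rw [Insertion.relabel_cmp]
  congr 1
  ext x
  rcases x with x | (x | x) <;> rfl

theorem derivIns_markedMul_left {A₁ X₂ A Z : Type} [Finite A₁] [Finite X₂] [Finite A] [Finite Z]
    (h : A₁ ⊕ X₂ ≃ A) (a : O.sp.at' ((A₁ ⊕ Fin 1) ⊕ Fin 1)) (b : O.sp.at' (X₂ ⊕ Fin 1))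
    (o : O.sp.at' Z) :
    derivIns O.comp (markedMul O ((Insertion.rightComm A₁ (Fin 1) X₂).trans
        (h.sumCongr (Equiv.refl (Fin 1)))) a b) o
      = markedMul O ((Insertion.rightComm A₁ Z X₂).trans (h.sumCongr (Equiv.refl Z)))
        (derivIns O.comp a o) b := by
  rw [derivIns_eq, derivIns_eq]
  unfold markedMul
  have key := Insertion.parallel_cmp O.parallel (Equiv.refl ((A₁ ⊕ Fin 1) ⊕ Fin 1))
    (((Equiv.sumAssoc A₁ X₂ (Fin 1)).symm.sumCongr (Equiv.refl Z)).trans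
      ((Insertion.rightComm (A₁ ⊕ X₂) (Fin 1) Z).trans
        ((h.sumCongr (Equiv.refl Z)).sumCongr (Equiv.refl (Fin 1))))) a b o
  refine Eq.trans ?_ (key.trans ?_)
  · symm
    refine O.comp.cmp_cmp_congr
      (((Equiv.sumAssoc A₁ X₂ (Fin 1)).symm.sumCongr (Equiv.refl (Fin 1))).trans
        ((Insertion.rightComm (A₁ ⊕ X₂) (Fin 1) (Fin 1)).trans
          ((h.sumCongr (Equiv.refl _)).sumCongr (Equiv.refl (Fin 1)))))
      (Equiv.refl _) ((Equiv.sumAssoc A₁ X₂ (Fin 1)).symm.trans (h.sumCongr (Equiv.refl _)))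
      ?_ ?_ ?_ ?_ ?_ ?_ ?_ ?_ a b o
    · intro a; rfl
    · rfl
    · rintro (a | a) <;> rfl
    · rintro (a | a) <;> rfl
    · rintro (a | (a | a)) <;> rfl
    · rfl
    · rintro (a | (a | a)) <;> rfl
    · intro x; rfl
  · refine O.comp.cmp_cmp_congr (Equiv.refl _) (Equiv.refl _) (Equiv.refl _)
      ?_ ?_ ?_ ?_ ?_ ?_ ?_ ?_ a o b
    · rintro (a | a) <;> rfl
    · rfl
    · rintro (a | a) <;> rfl
    · intro a; rfl
    · rintro (a | a) <;> rfl
    · rfl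
    · rintro (a | a) <;> rfl
    · rintro (x | x) <;> rfl

theorem derivIns_markedMul_right {A₁ X₂ A Z : Type} [Finite A₁] [Finite X₂] [Finite A] [Finite Z]
    (h : A₁ ⊕ X₂ ≃ A) (a : O.sp.at' ((A₁ ⊕ Fin 1) ⊕ Fin 1)) (b : O.sp.at' (X₂ ⊕ Fin 1))
    (o : O.sp.at' Z) :
    derivIns O.comp (markedMul O ((Equiv.sumComm _ _).trans
        ((Insertion.rightComm A₁ (Fin 1) X₂).trans (h.sumCongr (Equiv.refl (Fin 1))))) b a) o
      = markedMul O ((Equiv.sumComm _ _).trans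
          ((Insertion.rightComm A₁ Z X₂).trans (h.sumCongr (Equiv.refl Z))))
        b (derivIns O.comp a o) := by
  rw [derivIns_eq, derivIns_eq]
  unfold markedMul
  rw [Insertion.sequential_cmp O.sequential]
  symm
  refine O.comp.cmp_cmp_congr
    (((Equiv.sumAssoc X₂ A₁ (Fin 1)).symm.sumCongr (Equiv.refl (Fin 1))).trans
      ((Insertion.rightComm (X₂ ⊕ A₁) (Fin 1) (Fin 1)).trans
        ((((Equiv.sumComm X₂ A₁).trans h).sumCongr (Equiv.refl _)).sumCongr
          (Equiv.refl (Fin 1)))))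
    (Equiv.refl _)
    ((Equiv.sumAssoc X₂ A₁ (Fin 1)).symm.trans
      (((Equiv.sumComm X₂ A₁).trans h).sumCongr (Equiv.refl _)))
    ?_ ?_ ?_ ?_ ?_ ?_ ?_ ?_ b a o
  · intro a; rfl
  · rfl
  · intro a; rfl
  · rintro ((a | a) | a) <;> rfl
  · rintro (a | (a | a)) <;> rfl
  · rfl
  · rintro (a | (a | a)) <;> rfl
  · intro x; rfl

theorem derivIns_commutator {X₁ X₂ A Z : Type} [Finite X₁] [Finite X₂] [Finite A] [Finite Z]
    (e : X₁ ⊕ X₂ ≃ A ⊕ Fin 1) (a : O.sp.at' (X₁ ⊕ Fin 1)) (b : O.sp.at' (X₂ ⊕ Fin 1))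
    (o : O.sp.at' Z) (x : X₁) (hx : e (Sum.inl x) = Sum.inr 0) :
    derivIns O.comp (markedMul O e a b - markedMul O ((Equiv.sumComm X₂ X₁).trans e) b a) o
      ∈ commRel O (A ⊕ Z) := by
  obtain ⟨h, hh⟩ := exists_restrict ((Insertion.rightComm {y // y ≠ x} (Fin 1) X₂).symm.trans
    (((ptEquiv x).sumCongr (Equiv.refl X₂)).trans e)) (by
      simpa [Insertion.rightComm] using hx)
  have he : e = ((ptEquiv x).symm.sumCongr (Equiv.refl X₂)).trans
      ((Insertion.rightComm {y // y ≠ x} (Fin 1) X₂).trans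
        (h.sumCongr (Equiv.refl (Fin 1)))) := by
    rw [← hh]
    ext y
    rcases y with y | y <;> simp
  have ha : a = O.sp.relabel ((ptEquiv x).sumCongr (Equiv.refl (Fin 1)))
      (O.sp.relabel ((ptEquiv x).symm.sumCongr (Equiv.refl (Fin 1))) a) := by
    rw [Species.relabel_relabel]
    simp
  rw [ha]
  generalize O.sp.relabel ((ptEquiv x).symm.sumCongr (Equiv.refl (Fin 1))) a = a₀
  rw [markedMul_relabel_left, markedMul_relabel_right]
  have e1 : ((ptEquiv x).sumCongr (Equiv.refl X₂)).trans e
      = (Insertion.rightComm {y // y ≠ x} (Fin 1) X₂).trans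
        (h.sumCongr (Equiv.refl (Fin 1))) := by
    rw [he]
    ext y
    rcases y with y | y <;> simp
  have e2 : ((Equiv.refl X₂).sumCongr (ptEquiv x)).trans ((Equiv.sumComm X₂ X₁).trans e)
      = (Equiv.sumComm _ _).trans ((Insertion.rightComm {y // y ≠ x} (Fin 1) X₂).trans
        (h.sumCongr (Equiv.refl (Fin 1)))) := by
    rw [← e1]
    ext y
    rcases y with y | y <;> simp
  rw [e1, e2, map_sub, LinearMap.sub_apply, derivIns_markedMul_left, derivIns_markedMul_right]
  exact Submodule.subset_span ⟨_, _, inferInstance, inferInstance, _, _, _, rfl⟩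

variable (O) in
theorem derivIns_commRel {A Z : Type} [Finite A] [Finite Z] (r : O.sp.at' ((A ⊕ Fin 1) ⊕ Fin 1))
    (hr : r ∈ commRel O (A ⊕ Fin 1)) (o : O.sp.at' Z) :
    derivIns O.comp r o ∈ commRel O (A ⊕ Z) := by
  induction hr using Submodule.span_induction with
  | mem z hz =>
    obtain ⟨X₁, X₂, _, _, e, a, b, rfl⟩ := hz
    rcases h : e.symm (Sum.inr 0) with x | x
    · exact derivIns_commutator e a b o x (by rw [← h]; simp)
    · have := derivIns_commutator ((Equiv.sumComm X₂ X₁).trans e) b a o x (by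
        simp [← h])
      rw [← neg_mem_iff, ← LinearMap.neg_apply, ← map_neg, neg_sub]
      convert this using 5
      ext y
      simp
  | zero => simp
  | add x y _ _ hx hy =>
    rw [map_add]
    exact add_mem hx hy
  | smul c x _ hx =>
    rw [map_smul]
    exact Submodule.smul_mem _ _ hx

variable (O) in
theorem relabel_commRel {X X' : Type} [Finite X] [Finite X'] (f : X ≃ X') :
    commRel O X ≤ (commRel O X').comap (O.sp.relabel (f.sumCongr (Equiv.refl (Fin 1)))) := by
  rw [commRel, Submodule.span_le]
  rintro z ⟨X₁, X₂, _, _, e, a, b, rfl⟩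
  refine Submodule.subset_span ⟨X₁, X₂, ‹_›, ‹_›, e.trans f, a, b, ?_⟩
  rw [map_sub, relabel_markedMul, relabel_markedMul]
  rfl

variable (O) in
/-- The wheel part `|δ_{1,1} O|`: the quotient of `δ_{1,1} O` by commutators. -/
def wheelSp : Species k :=
  Species.ofData (fun X _ => O.sp.at' (X ⊕ Fin 1) ⧸ commRel O X)
    (fun f => Submodule.mapQ _ _ (O.sp.relabel (f.sumCongr (Equiv.refl (Fin 1))))
      (relabel_commRel O f))
    (by
      intro X _
      apply Submodule.linearMap_qext
      ext p
      simp)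
    (by
      intro X X' X'' _ _ _ e f
      apply Submodule.linearMap_qext
      ext p
      simp only [LinearMap.comp_apply, Submodule.mkQ_apply, Submodule.mapQ_apply,
        Species.relabel_relabel]
      congr 3
      ext x
      rcases x with x | x <;> rfl)

variable (O) in
/-- The projection `δ_{1,1} O → |δ_{1,1} O|`. -/
def wheelProj (X : Type) [Finite X] : O.sp.at' (X ⊕ Fin 1) →ₗ[k] (wheelSp O).at' X :=
  (commRel O X).mkQ

theorem wheelProj_surjective (X : Type) [Finite X] : Function.Surjective (wheelProj O X) :=
  Submodule.mkQ_surjective _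

theorem wheelProj_relabel {X X' : Type} [Finite X] [Finite X'] (f : X ≃ X')
    (p : O.sp.at' (X ⊕ Fin 1)) :
    wheelProj O X' (O.sp.relabel (f.sumCongr (Equiv.refl (Fin 1))) p)
      = (wheelSp O).relabel f (wheelProj O X p) := rfl

theorem wheelProj_comm {X₁ X₂ X : Type} [Finite X₁] [Finite X₂] [Finite X] (e : X₁ ⊕ X₂ ≃ X)
    (a : O.sp.at' (X₁ ⊕ Fin 1)) (b : O.sp.at' (X₂ ⊕ Fin 1)) :
    wheelProj O X (markedMul O e a b)
      = wheelProj O X (markedMul O ((Equiv.sumComm X₂ X₁).trans e) b a) :=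
  (Submodule.Quotient.eq _).2 (Submodule.subset_span ⟨_, _, ‹_›, ‹_›, e, a, b, rfl⟩)

variable (O) in
/-- The insertion maps of the wheel part. -/
def wheelIns {A Z : Type} [Finite A] [Finite Z] :
    (wheelSp O).at' (A ⊕ Fin 1) →ₗ[k] O.sp.at' Z →ₗ[k] (wheelSp O).at' (A ⊕ Z) :=
  (commRel O (A ⊕ Fin 1)).liftQ ((derivIns O.comp).compr₂ (wheelProj O (A ⊕ Z))) (by
    intro r hr
    ext o
    exact (Submodule.Quotient.mk_eq_zero _).2 (derivIns_commRel O r hr o))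

theorem wheelIns_proj {A Z : Type} [Finite A] [Finite Z] (p : O.sp.at' ((A ⊕ Fin 1) ⊕ Fin 1))
    (o : O.sp.at' Z) :
    wheelIns O (wheelProj O (A ⊕ Fin 1) p) o = wheelProj O (A ⊕ Z) (derivIns O.comp p o) := rfl

variable (O) in
/-- The right `O`-module structure of the wheel part. -/
def wheel : RightModule O where
  sp := wheelSp O
  act :=
    { ins := wheelIns O
      ins_relabel := by
        intro A A' Z Z' _ _ _ _ e f p o
        obtain ⟨p, rfl⟩ := wheelProj_surjective _ p
        rw [← wheelProj_relabel, wheelIns_proj, wheelIns_proj, derivIns_relabel,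
          wheelProj_relabel] }
  sequential := by
    intro A B C _ _ _ p b c
    obtain ⟨p, rfl⟩ := wheelProj_surjective _ p
    exact congrArg (wheelProj O _) (derivIns_sequential O.sequential p b c)
  parallel := by
    intro A B C _ _ _ p b c
    obtain ⟨p, rfl⟩ := wheelProj_surjective _ p
    exact congrArg (wheelProj O _) (derivIns_parallel O.parallel p b c)

end Wheel

section Sch

variable {k : Type u} [Field k] (P : Species k) (V : Type u) [AddCommGroup V] [Module k V]

/-- The direct sum of the spaces `P(n) ⊗ V^{⊗ n}`. -/
abbrev SchSum : Type u := ⨁ n : ℕ, P.at' (Fin n) ⊗[k] (⨂[k] _ : Fin n, V)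

/-- An element of a summand. -/
def schSumMk (n : ℕ) (p : P.at' (Fin n)) (v : Fin n → V) : SchSum P V :=
  DirectSum.lof k ℕ (fun n => P.at' (Fin n) ⊗[k] (⨂[k] _ : Fin n, V)) n
    (p ⊗ₜ[k] PiTensorProduct.tprod k v)

/-- The relations of the coinvariants for the symmetric groups. -/
def schRel : Submodule k (SchSum P V) :=
  Submodule.span k {z | ∃ (n : ℕ) (s : Equiv.Perm (Fin n)) (p : P.at' (Fin n)) (v : Fin n → V),
    z = schSumMk P V n (P.relabel s p) v - schSumMk P V n p (v ∘ s)}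

/-- The value `P(V) = ⨁_n P(n) ⊗_{𝔖_n} V^{⊗ n}` of the Schur functor of a species. -/
def Sch : Type u := SchSum P V ⧸ schRel P V

instance : AddCommGroup (Sch P V) := inferInstanceAs (AddCommGroup (SchSum P V ⧸ schRel P V))
instance : Module k (Sch P V) := inferInstanceAs (Module k (SchSum P V ⧸ schRel P V))

namespace Sch

variable {P V}

variable (P V) in
/-- The projection to the coinvariants. -/
def proj : SchSum P V →ₗ[k] Sch P V := (schRel P V).mkQ

/-- The class of an element of `P(X) ⊗ V^{⊗ X}`, for a finite set `X`. -/
def mk {X : Type} [Finite X] : P.at' X →ₗ[k] (⨂[k] _ : X, V) →ₗ[k] Sch P V :=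
  (((TensorProduct.mk k _ _).compr₂ (DirectSum.lof k ℕ
    (fun n => P.at' (Fin n) ⊗[k] (⨂[k] _ : Fin n, V)) (Nat.card X))).compl₁₂
      (P.relabel (Finite.equivFin X))
      (PiTensorProduct.reindex k (fun _ => V) (Finite.equivFin X)).toLinearMap).compr₂
    (proj P V)

/-- The class of `p ⊗ ⨂ v_x`. -/
def gen {X : Type} [Finite X] (p : P.at' X) (v : X → V) : Sch P V :=
  mk p (PiTensorProduct.tprod k v)

theorem mk_tprod {X : Type} [Finite X] (p : P.at' X) (v : X → V) :
    mk p (PiTensorProduct.tprod k v) = gen p v := rfl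

theorem gen_eq {X : Type} [Finite X] (p : P.at' X) (v : X → V) :
    gen p v = proj P V (schSumMk P V (Nat.card X) (P.relabel (Finite.equivFin X) p)
      (v ∘ (Finite.equivFin X).symm)) := by
  simp only [gen, mk, schSumMk, LinearMap.compr₂_apply, LinearMap.compl₁₂_apply,
    LinearEquiv.coe_coe, PiTensorProduct.reindex_tprod, TensorProduct.mk_apply]
  rfl

theorem gen_fin {n : ℕ} (s : Equiv.Perm (Fin n)) (p : P.at' (Fin n)) (v : Fin n → V) :
    proj P V (schSumMk P V n (P.relabel s p) v)
      = proj P V (schSumMk P V n p (v ∘ s)) :=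
  (Submodule.Quotient.eq _).2 (Submodule.subset_span ⟨n, s, p, v, rfl⟩)

theorem gen_relabel {X X' : Type} [Finite X] [Finite X'] (f : X ≃ X') (p : P.at' X) (v : X' → V) :
    gen (P.relabel f p) v = gen p (v ∘ f) := by
  have aux : ∀ (m n : ℕ) (h : m = n) (e : X ≃ Fin m) (e' : X' ≃ Fin n),
      proj P V (schSumMk P V n (P.relabel e' (P.relabel f p)) (v ∘ e'.symm))
        = proj P V (schSumMk P V m (P.relabel e p) ((v ∘ f) ∘ e.symm)) := by
    intro m n h e e'
    subst h
    have := gen_fin (e.symm.trans (f.trans e')) (P.relabel e p) (v ∘ e'.symm)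
    rw [Species.relabel_relabel] at this ⊢
    have h1 : e.trans (e.symm.trans (f.trans e')) = f.trans e' := by ext; simp
    have h2 : (v ∘ e'.symm) ∘ (e.symm.trans (f.trans e')) = (v ∘ f) ∘ e.symm := by
      funext x; simp
    rw [h1, h2] at this
    exact this
  rw [gen_eq, gen_eq]
  exact aux _ _ (Nat.card_congr f) _ _

theorem ext {N : Type*} [AddCommGroup N] [Module k N] {φ ψ : Sch P V →ₗ[k] N}
    (h : ∀ (X : Type) [Finite X] (p : P.at' X) (v : X → V), φ (gen p v) = ψ (gen p v)) :
    φ = ψ := by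
  apply Submodule.linearMap_qext
  apply DirectSum.linearMap_ext
  intro n
  apply TensorProduct.ext
  ext p v
  have key : proj P V (schSumMk P V n p v) = gen p v := by
    rw [gen_eq]
    have : ∀ (m : ℕ) (h : n = m) (e : Fin n ≃ Fin m), proj P V (schSumMk P V n p v)
        = proj P V (schSumMk P V m (P.relabel e p) (v ∘ e.symm)) := by
      intro m h e
      subst h
      rw [gen_fin]
      congr 2
      funext x
      exact congrArg v (e.symm_apply_apply x).symm
    exact this _ (by simp) _
  have h1 := h (Fin n) p v
  rw [← key] at h1
  exact h1

/-- A linear map out of `P(V)` from a natural family. -/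
def lift {N : Type*} [AddCommGroup N] [Module k N]
    (F : ∀ (X : Type) [Finite X], P.at' X →ₗ[k] (⨂[k] _ : X, V) →ₗ[k] N)
    (hF : ∀ (X X' : Type) [Finite X] [Finite X'] (f : X ≃ X') (p : P.at' X) (v : X' → V),
      F X' (P.relabel f p) (PiTensorProduct.tprod k v)
        = F X p (PiTensorProduct.tprod k (v ∘ f))) : Sch P V →ₗ[k] N :=
  (schRel P V).liftQ (DirectSum.toModule k ℕ N fun n => TensorProduct.lift (F (Fin n))) (by
    rw [schRel, Submodule.span_le]
    rintro z ⟨n, s, p, v, rfl⟩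
    simp [schSumMk, DirectSum.toModule_lof, hF])

theorem lift_gen {N : Type*} [AddCommGroup N] [Module k N]
    (F : ∀ (X : Type) [Finite X], P.at' X →ₗ[k] (⨂[k] _ : X, V) →ₗ[k] N)
    (hF : ∀ (X X' : Type) [Finite X] [Finite X'] (f : X ≃ X') (p : P.at' X) (v : X' → V),
      F X' (P.relabel f p) (PiTensorProduct.tprod k v)
        = F X p (PiTensorProduct.tprod k (v ∘ f)))
    {X : Type} [Finite X] (p : P.at' X) (v : X → V) :
    lift F hF (gen p v) = F X p (PiTensorProduct.tprod k v) := by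
  rw [gen_eq]
  change DirectSum.toModule k ℕ N (fun n => TensorProduct.lift (F (Fin n))) (schSumMk _ _ _ _ _) = _
  simp only [schSumMk, DirectSum.toModule_lof, TensorProduct.lift.tmul, hF]
  congr 2
  funext x
  simp

end Sch

/-- A natural family of maps between species. -/
structure SpMap (P Q : Species k) where
  app : ∀ (X : Type) [Finite X], P.at' X →ₗ[k] Q.at' X
  nat : ∀ {X X' : Type} [Finite X] [Finite X'] (f : X ≃ X') (p : P.at' X),
    app X' (P.relabel f p) = Q.relabel f (app X p)

/-- A natural family of bilinear maps `P(A) ⊗ O(Z) → Q(A ⊔ Z)`. -/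
structure Pairing (P O Q : Species k) where
  op : ∀ {A Z : Type} [Finite A] [Finite Z], P.at' A →ₗ[k] O.at' Z →ₗ[k] Q.at' (A ⊕ Z)
  nat : ∀ {A A' Z Z' : Type} [Finite A] [Finite A'] [Finite Z] [Finite Z'] (e : A ≃ A')
    (f : Z ≃ Z') (p : P.at' A) (o : O.at' Z),
    op (P.relabel e p) (O.relabel f o) = Q.relabel (e.sumCongr f) (op p o)

/-- The pairing given by insertion at the marked input. -/
def Insertion.pairing {P O : Species k} (I : Insertion P O) : Pairing (deriv P) O P where
  op {A Z} _ _ := I.ins (A := A) (Z := Z)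
  nat e f p o := I.ins_relabel e f p o

/-- The identity map of a species. -/
def SpMap.id (P : Species k) : SpMap P P := ⟨fun _ _ => LinearMap.id, fun _ _ => rfl⟩

namespace Sch

variable {P V} {W W' : Type u} [AddCommGroup W] [Module k W] [AddCommGroup W'] [Module k W']

/-- Functoriality of the Schur functor in the species and in the vector space. -/
def map {Q : Species k} (θ : SpMap P Q) (i : V →ₗ[k] W) : Sch P V →ₗ[k] Sch Q W :=
  lift (fun X _ => (mk (P := Q) (V := W)).compl₁₂ (θ.app X) (PiTensorProduct.map fun _ => i)) (by
    intro X X' _ _ f p v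
    simp only [LinearMap.compl₁₂_apply, PiTensorProduct.map_tprod, mk_tprod, θ.nat, gen_relabel]
    rfl)

theorem map_gen {Q : Species k} (θ : SpMap P Q) (i : V →ₗ[k] W) {X : Type} [Finite X]
    (p : P.at' X) (v : X → V) : map θ i (gen p v) = gen (θ.app X p) (i ∘ v) := by
  rw [map, lift_gen]
  simp only [LinearMap.compl₁₂_apply, PiTensorProduct.map_tprod, mk_tprod]
  rfl

/-- The splitting of a tensor power at a point. -/
def splitAt {X : Type} [Finite X] (x : X) :
    (⨂[k] _ : X, V) →ₗ[k] (⨂[k] _ : {y : X // y ≠ x}, V) ⊗[k] V :=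
  (TensorProduct.map LinearMap.id
      (PiTensorProduct.subsingletonEquiv (R := k) (s := fun _ => V) (0 : Fin 1)).toLinearMap) ∘ₗ
    (PiTensorProduct.tmulEquiv k V).symm.toLinearMap ∘ₗ
    (PiTensorProduct.reindex k (fun _ => V) (ptEquiv x).symm).toLinearMap

theorem splitAt_tprod {X : Type} [Finite X] (x : X) (v : X → V) :
    splitAt x (PiTensorProduct.tprod k v)
      = (PiTensorProduct.tprod k fun y : {y : X // y ≠ x} => v y.1) ⊗ₜ[k] v x := by
  simp only [splitAt, LinearMap.comp_apply, LinearEquiv.coe_coe, PiTensorProduct.reindex_tprod]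
  erw [PiTensorProduct.tmulEquiv_symm_apply]
  simp

/-- The contribution of a point to the derivative. -/
def diffAt {X : Type} [Finite X] (x : X) :
    P.at' X →ₗ[k] (⨂[k] _ : X, V) →ₗ[k] Sch (deriv P) V ⊗[k] V :=
  LinearMap.mk₂ k (fun p t => TensorProduct.map
        (mk (P := deriv P) (P.relabel (ptEquiv x).symm p)) LinearMap.id (splitAt x t))
      (by intros; rw [map_add]; erw [map_add]; simp [TensorProduct.map_add_left])
      (by intros; rw [map_smul]; erw [map_smul]; simp [TensorProduct.map_smul_left])
      (by intros; simp) (by intros; simp)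

/-- An element of `∂P` from an element of `P` with a chosen point. -/
def markAt {X : Type} [Finite X] (x : X) (p : P.at' X) : (deriv P).at' {y : X // y ≠ x} :=
  P.relabel (ptEquiv x).symm p

theorem diffAt_tprod {X : Type} [Finite X] (x : X) (p : P.at' X) (v : X → V) :
    diffAt x p (PiTensorProduct.tprod k v)
      = gen (P := deriv P) (markAt x p) (fun y : {y : X // y ≠ x} => v y.1) ⊗ₜ[k] v x := by
  simp only [diffAt, LinearMap.mk₂_apply, splitAt_tprod]
  simp only [TensorProduct.map_tmul]
  rfl

theorem markAt_relabel {X X' : Type} [Finite X] [Finite X'] (f : X ≃ X') (x : X) (p : P.at' X) :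
    markAt (f x) (P.relabel f p) = (deriv P).relabel (neEquiv f x) (markAt x p) := by
  change P.relabel _ (P.relabel f p)
    = P.relabel ((neEquiv f x).sumCongr (Equiv.refl (Fin 1))) (P.relabel (ptEquiv x).symm p)
  rw [Species.relabel_relabel, Species.relabel_relabel]
  congr 2
  ext y
  obtain ⟨y, rfl⟩ := (ptEquiv x).surjective y
  simp only [Equiv.trans_apply, Equiv.symm_apply_apply, Equiv.symm_apply_eq]
  rcases y with y | y <;> rfl

open Classical in
/-- The derivative `P(V) → (∂P)(V) ⊗ V`. -/
def diff : Sch P V →ₗ[k] Sch (deriv P) V ⊗[k] V :=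
  lift (fun X _ =>
    haveI := Fintype.ofFinite X
    ∑ x : X, diffAt x) (by
    intro X X' _ _ f p v
    simp only [LinearMap.sum_apply, diffAt_tprod]
    rw [← @Equiv.sum_comp _ _ _ (Fintype.ofFinite X) (Fintype.ofFinite X') _ f]
    refine Finset.sum_congr rfl fun x _ => ?_
    rw [markAt_relabel, gen_relabel]
    rfl)

theorem diff_gen {X : Type} [Fintype X] (p : P.at' X) (v : X → V) :
    diff (gen p v) = ∑ x : X,
      gen (P := deriv P) (markAt x p) (fun y : {y : X // y ≠ x} => v y.1) ⊗ₜ[k] v x := by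
  rw [diff, lift_gen]
  simp only [LinearMap.sum_apply, diffAt_tprod]
  congr!

/-- The product of tensors. -/
def tmulTensor (A Z : Type) : (⨂[k] _ : A, V) →ₗ[k] (⨂[k] _ : Z, V) →ₗ[k] ⨂[k] _ : A ⊕ Z, V :=
  TensorProduct.curry (PiTensorProduct.tmulEquiv k V).toLinearMap

theorem tmulTensor_tprod {A Z : Type} (v : A → V) (z : Z → V) :
    tmulTensor A Z (PiTensorProduct.tprod k v) (PiTensorProduct.tprod k z)
      = PiTensorProduct.tprod k (Sum.elim v z) := by
  simp [tmulTensor]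

/-- The product, with a fixed operation and fixed vectors. -/
def prodAux {O Q : Species k} (I : Pairing P O Q) {A : Type} [Finite A] (p : P.at' A)
    (t : ⨂[k] _ : A, V) : Sch O V →ₗ[k] Sch Q V :=
  lift (fun Z _ => (mk (P := Q) (V := V)).compl₁₂ (I.op p) (tmulTensor A Z t)) (by
    intro X X' _ _ f o z
    simp only [LinearMap.compl₁₂_apply]
    have key : (mk (I.op p (O.relabel f o))) ∘ₗ (tmulTensor A X').flip (PiTensorProduct.tprod k z)
        = (mk (I.op p o)) ∘ₗ (tmulTensor A X).flip (PiTensorProduct.tprod k (z ∘ f)) := by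
      apply PiTensorProduct.ext
      ext v
      simp only [LinearMap.compMultilinearMap_apply, LinearMap.comp_apply, LinearMap.flip_apply,
        tmulTensor_tprod, mk_tprod]
      have := I.nat (Equiv.refl A) f p o
      rw [Species.relabel_refl] at this
      rw [this, gen_relabel]
      congr 1
      funext x
      rcases x with x | x <;> rfl
    exact LinearMap.congr_fun key t)

theorem prodAux_gen {O Q : Species k} (I : Pairing P O Q) {A Z : Type} [Finite A] [Finite Z]
    (p : P.at' A) (t : ⨂[k] _ : A, V) (o : O.at' Z) (z : Z → V) :
    prodAux I p t (gen o z)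
      = mk (I.op p o) (tmulTensor A Z t (PiTensorProduct.tprod k z)) := by
  rw [prodAux, lift_gen]
  rfl

/-- The map `P(V) ⊗ O(V) → Q(V)` induced by a pairing. -/
def prod {O Q : Species k} (I : Pairing P O Q) : Sch P V →ₗ[k] Sch O V →ₗ[k] Sch Q V :=
  lift (fun A _ => LinearMap.mk₂ k (fun p t => prodAux I p t)
      (fun p p' t => by
        apply Sch.ext
        intro Z _ o z
        rw [LinearMap.add_apply, prodAux_gen, prodAux_gen, prodAux_gen]
        simp)
      (fun c p t => by
        apply Sch.ext
        intro Z _ o z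
        rw [LinearMap.smul_apply, prodAux_gen, prodAux_gen]
        simp)
      (fun p t t' => by
        apply Sch.ext
        intro Z _ o z
        rw [LinearMap.add_apply, prodAux_gen, prodAux_gen, prodAux_gen]
        simp)
      (fun c p t => by
        apply Sch.ext
        intro Z _ o z
        rw [LinearMap.smul_apply, prodAux_gen, prodAux_gen]
        simp))
    (by
      intro A A' _ _ f p v
      apply Sch.ext
      intro Z _ o z
      simp only [LinearMap.mk₂_apply]
      rw [prodAux_gen, prodAux_gen, tmulTensor_tprod, tmulTensor_tprod, mk_tprod, mk_tprod]
      have := I.nat f (Equiv.refl Z) p o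
      rw [Species.relabel_refl] at this
      rw [this, gen_relabel]
      congr 1
      funext x
      rcases x with x | x <;> rfl)

theorem prod_gen {O Q : Species k} (I : Pairing P O Q) {A Z : Type} [Finite A] [Finite Z]
    (p : P.at' A) (v : A → V) (o : O.at' Z) (z : Z → V) :
    prod I (gen p v) (gen o z) = gen (I.op p o) (Sum.elim v z) := by
  rw [prod, lift_gen, LinearMap.mk₂_apply, prodAux_gen, tmulTensor_tprod, mk_tprod]

/-- Insertion `(∂P)(V) ⊗ O(V) → P(V)`. -/
def insert {O : Species k} (I : Insertion P O) :
    Sch (deriv P) V →ₗ[k] Sch O V →ₗ[k] Sch P V := prod I.pairing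

theorem insert_gen {O : Species k} (I : Insertion P O) {A Z : Type} [Finite A] [Finite Z]
    (p : P.at' (A ⊕ Fin 1)) (v : A → V) (o : O.at' Z) (z : Z → V) :
    insert I (gen (P := deriv P) p v) (gen o z) = gen (I.ins p o) (Sum.elim v z) :=
  prod_gen _ _ _ _ _

theorem gen_add {X : Type} [Finite X] (p p' : P.at' X) (v : X → V) :
    gen (p + p') v = gen p v + gen p' v := by simp [gen]

theorem gen_smul {X : Type} [Finite X] (c : k) (p : P.at' X) (v : X → V) :
    gen (c • p) v = c • gen p v := by simp [gen]

theorem ind {C : Sch P V → Prop} (hgen : ∀ (X : Type) [Finite X] (p : P.at' X) (v : X → V),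
    C (gen p v)) (hadd : ∀ a b, C a → C b → C (a + b)) (s : Sch P V) : C s := by
  let G : Submodule k (Sch P V) := Submodule.span k
    {z | ∃ (X : Type) (_ : Finite X) (p : P.at' X) (v : X → V), z = gen p v}
  have hG : G = ⊤ := by
    rw [← Submodule.ker_mkQ G, LinearMap.ker_eq_top]
    apply Sch.ext
    intro X _ p v
    exact (Submodule.Quotient.mk_eq_zero _).2 (Submodule.subset_span ⟨X, ‹_›, p, v, rfl⟩)
  have hs : s ∈ G := hG ▸ Submodule.mem_top
  have hz : C 0 := by
    have := hgen (Fin 0) (0 : P.at' (Fin 0)) (fun _ => 0)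
    simpa [gen] using this
  have : ∀ c : k, C (c • s) := by
    induction hs using Submodule.span_induction with
    | mem z hz =>
      obtain ⟨X, _, p, v, rfl⟩ := hz
      intro c
      rw [← gen_smul]
      exact hgen X _ v
    | zero => intro c; rwa [smul_zero]
    | add x y _ _ hx hy =>
      intro c
      rw [smul_add]
      exact hadd _ _ (hx c) (hy c)
    | smul c' x _ hx =>
      intro c
      rw [smul_smul]
      exact hx _
  simpa using this 1

end Sch
end Sch

section Points2

/-- The complement of a point in the left summand. -/
def neInl {A : Type} (Z : Type) (a : A) :
    {x : A // x ≠ a} ⊕ Z ≃ {y : A ⊕ Z // y ≠ Sum.inl a} where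
  toFun := Sum.elim (fun x => ⟨Sum.inl x.1, by simpa using x.2⟩) (fun z => ⟨Sum.inr z, by simp⟩)
  invFun y := match y with
    | ⟨Sum.inl x, h⟩ => Sum.inl ⟨x, by simpa using h⟩
    | ⟨Sum.inr z, _⟩ => Sum.inr z
  left_inv := by rintro (x | x) <;> rfl
  right_inv := by rintro ⟨(x | x), h⟩ <;> rfl

/-- The complement of a point in the right summand. -/
def neInr (A : Type) {Z : Type} (z : Z) :
    A ⊕ {x : Z // x ≠ z} ≃ {y : A ⊕ Z // y ≠ Sum.inr z} where
  toFun := Sum.elim (fun a => ⟨Sum.inl a, by simp⟩) (fun x => ⟨Sum.inr x.1, by simpa using x.2⟩)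
  invFun y := match y with
    | ⟨Sum.inl a, _⟩ => Sum.inl a
    | ⟨Sum.inr x, h⟩ => Sum.inr ⟨x, by simpa using h⟩
  left_inv := by rintro (x | x) <;> rfl
  right_inv := by rintro ⟨(x | x), h⟩ <;> rfl

/-- The two orders of removing two points. -/
def neNe {X : Type} (x y : X) (hxy : y ≠ x) :
    {z : {z : X // z ≠ x} // z ≠ ⟨y, hxy⟩} ≃ {z : {z : X // z ≠ y} // z ≠ ⟨x, hxy.symm⟩} where
  toFun z := ⟨⟨z.1.1, fun h => z.2 (Subtype.ext h)⟩, fun h => z.1.2 (congrArg Subtype.val h)⟩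
  invFun z := ⟨⟨z.1.1, fun h => z.2 (Subtype.ext h)⟩, fun h => z.1.2 (congrArg Subtype.val h)⟩
  left_inv _ := rfl
  right_inv _ := rfl

end Points2

section Calculus

variable {k : Type u} [Field k] {P Q : Species k}

/-- The derivative of a map of species. -/
def SpMap.deriv (θ : SpMap P Q) : SpMap (deriv P) (deriv Q) where
  app X _ := θ.app (X ⊕ Fin 1)
  nat f p := θ.nat _ p

theorem derivSwap_nat {X X' : Type} [Finite X] [Finite X'] (f : X ≃ X')
    (p : P.at' ((X ⊕ Fin 1) ⊕ Fin 1)) :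
    P.relabel (Insertion.rightComm X' (Fin 1) (Fin 1))
      (P.relabel ((f.sumCongr (Equiv.refl (Fin 1))).sumCongr (Equiv.refl (Fin 1))) p)
    = P.relabel ((f.sumCongr (Equiv.refl (Fin 1))).sumCongr (Equiv.refl (Fin 1)))
      (P.relabel (Insertion.rightComm X (Fin 1) (Fin 1)) p) := by
  rw [Species.relabel_relabel, Species.relabel_relabel]
  congr 2
  ext x
  rcases x with (x | x) | x <;> rfl

/-- The exchange of the two marked points of the second derivative. -/
def derivSwap (P : Species k) : SpMap (deriv (deriv P)) (deriv (deriv P)) where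
  app X _ := P.relabel (Insertion.rightComm X (Fin 1) (Fin 1))
  nat f p := derivSwap_nat f p

namespace Sch

variable {V : Type u} [AddCommGroup V] [Module k V]

theorem diff_map {W : Type u} [AddCommGroup W] [Module k W] (θ : SpMap P Q) (i : V →ₗ[k] W)
    (s : Sch P V) :
    diff (map θ i s) = TensorProduct.map (map θ.deriv i) i (diff s) := by
  induction s using ind with
  | hadd a b ha hb => simp only [map_add, ha, hb]
  | hgen X p v =>
    haveI := Fintype.ofFinite X
    rw [map_gen, diff_gen, diff_gen, map_sum]
    refine Finset.sum_congr rfl fun x _ => ?_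
    rw [TensorProduct.map_tmul, map_gen]
    have : markAt x (θ.app X p) = θ.deriv.app _ (markAt x p) := (θ.nat _ p).symm
    rw [this]
    rfl

theorem markAt_markAt {X : Type} [Finite X] (x y : X) (hxy : y ≠ x) (p : P.at' X) :
    (deriv (deriv P)).relabel (neNe x y hxy) ((derivSwap P).app _
      (markAt (P := deriv P) (⟨y, hxy⟩ : {z : X // z ≠ x}) (markAt x p)))
    = markAt (P := deriv P) (⟨x, hxy.symm⟩ : {z : X // z ≠ y}) (markAt y p) := by
  change P.relabel (((neNe x y hxy).sumCongr (Equiv.refl (Fin 1))).sumCongr (Equiv.refl (Fin 1)))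
    (P.relabel (Insertion.rightComm _ (Fin 1) (Fin 1))
      (P.relabel ((ptEquiv _).symm.sumCongr (Equiv.refl (Fin 1))) (P.relabel (ptEquiv x).symm p)))
    = (P.relabel ((ptEquiv _).symm.sumCongr (Equiv.refl (Fin 1))) (P.relabel (ptEquiv y).symm p))
  simp only [Species.relabel_relabel]
  congr 2
  rw [← Equiv.symm_bijective.injective.eq_iff]
  ext z
  rcases z with (z | z) | z <;> simp [Insertion.rightComm, neNe]

/-- The second derivative. -/
def diff2 : Sch P V →ₗ[k] (Sch (deriv (deriv P)) V ⊗[k] V) ⊗[k] V :=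
  TensorProduct.map diff LinearMap.id ∘ₗ diff

theorem diff2_gen {X : Type} [Fintype X] [DecidableEq X] (p : P.at' X) (v : X → V) :
    diff2 (gen p v) = ∑ x : X, ∑ y : {y : X // y ≠ x},
      (gen (P := deriv (deriv P)) (markAt (P := deriv P) y (markAt x p))
        (fun z => v z.1.1) ⊗ₜ[k] v y) ⊗ₜ[k] v x := by
  rw [diff2, LinearMap.comp_apply, diff_gen, map_sum]
  refine Finset.sum_congr rfl fun x _ => ?_
  rw [TensorProduct.map_tmul, diff_gen, TensorProduct.sum_tmul]
  rfl

/-- The exchange on the target of the second derivative. -/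
def swap2 : (Sch (deriv (deriv P)) V ⊗[k] V) ⊗[k] V →ₗ[k]
    (Sch (deriv (deriv P)) V ⊗[k] V) ⊗[k] V :=
  (TensorProduct.rightComm k _ _ _).toLinearMap ∘ₗ
    TensorProduct.map (TensorProduct.map (map (derivSwap P) LinearMap.id) LinearMap.id)
      LinearMap.id

theorem swap2_tmul (q : Sch (deriv (deriv P)) V) (a b : V) :
    swap2 ((q ⊗ₜ a) ⊗ₜ b) = (map (derivSwap P) LinearMap.id q ⊗ₜ b) ⊗ₜ a := rfl

theorem diff2_symm (s : Sch P V) : swap2 (diff2 s) = diff2 s := by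
  classical
  induction s using ind with
  | hadd a b ha hb => simp only [map_add, ha, hb]
  | hgen X p v =>
    haveI := Fintype.ofFinite X
    rw [diff2_gen]
    simp only [map_sum, swap2_tmul, map_gen]
    rw [Finset.sum_sigma', Finset.sum_sigma']
    refine Finset.sum_bij' (fun q _ => ⟨q.2.1, ⟨q.1, q.2.2.symm⟩⟩)
      (fun q _ => ⟨q.2.1, ⟨q.1, q.2.2.symm⟩⟩) (by simp) (by simp) (by simp) (by simp) ?_
    rintro ⟨x, ⟨y, hxy⟩⟩ -
    rw [← markAt_markAt x y hxy, gen_relabel]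
    rfl

end Sch

end Calculus

section MarkPairing

variable {k : Type u} [Field k] {P O : Species k}

/-- Insertion of an operation with a marked input at the marked input; the marked input of the
result is that of the inserted operation. -/
def Insertion.markPairing (I : Insertion P O) : Pairing (deriv P) (deriv O) (deriv P) where
  op {A Z} _ _ := (I.ins (A := A) (Z := Z ⊕ Fin 1)).compr₂
    (P.relabel (Equiv.sumAssoc A Z (Fin 1)).symm)
  nat {A A' Z Z'} _ _ _ _ e f p o := by
    have := I.ins_relabel e (f.sumCongr (Equiv.refl (Fin 1))) p o
    change P.relabel _ (I.ins (P.relabel _ p) (O.relabel _ o)) = P.relabel _ (P.relabel _ _)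
    rw [this, Species.relabel_relabel, Species.relabel_relabel]
    congr 2
    ext x
    rcases x with x | (x | x) <;> rfl

/-- A family of maps of species compatible with insertions. -/
def InsCompat {P Q O O' : Species k} (I : Insertion P O) (I' : Insertion Q O') (θ : SpMap P Q)
    (ψ : SpMap O O') : Prop :=
  ∀ {A Z : Type} [Finite A] [Finite Z] (p : P.at' (A ⊕ Fin 1)) (o : O.at' Z),
    θ.app _ (I.ins p o) = I'.ins (θ.app _ p) (ψ.app _ o)

end MarkPairing

namespace Sch

variable {k : Type u} [Field k] {P O : Species k} {V : Type u} [AddCommGroup V] [Module k V]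

/-- The map `(∂P)(V) ⊗ (∂O)(V) → (∂P)(V)` induced by insertion. -/
def insMark (I : Insertion P O) :
    Sch (deriv P) V →ₗ[k] Sch (deriv O) V →ₗ[k] Sch (deriv P) V := prod I.markPairing

theorem insert_deriv_gen (I : Insertion P O) {A Z : Type} [Finite A] [Finite Z]
    (p : P.at' ((A ⊕ Fin 1) ⊕ Fin 1)) (v : A → V) (o : O.at' Z) (z : Z → V) :
    insert (derivInsertion I) (gen (P := deriv (deriv P)) p v) (gen o z)
      = gen (P := deriv P) (derivIns I p o) (Sum.elim v z) :=
  insert_gen (derivInsertion I) _ _ _ _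

theorem insMark_gen (I : Insertion P O) {A Z : Type} [Finite A] [Finite Z]
    (p : P.at' (A ⊕ Fin 1)) (v : A → V) (o : O.at' (Z ⊕ Fin 1)) (z : Z → V) :
    insMark I (gen (P := deriv P) p v) (gen (P := deriv O) o z)
      = gen (P := deriv P) (P.relabel (Equiv.sumAssoc A Z (Fin 1)).symm (I.ins p o))
        (Sum.elim v z) :=
  prod_gen _ _ _ _ _

theorem derivIns_swap (I : Insertion P O) {A B : Type} [Finite A] [Finite B]
    (p : P.at' ((A ⊕ Fin 1) ⊕ Fin 1)) (b : O.at' B) :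
    derivIns I (P.relabel (Insertion.rightComm A (Fin 1) (Fin 1)) p) b
      = P.relabel (Insertion.rightComm A (Fin 1) B) (I.ins p b) := by
  change P.relabel _ (I.ins (P.relabel _ (P.relabel _ p)) b) = _
  rw [Species.relabel_relabel]
  have : (Insertion.rightComm A (Fin 1) (Fin 1)).trans
    (Insertion.rightComm A (Fin 1) (Fin 1)) = Equiv.refl _ := by
    ext y
    rcases y with (y | y) | y <;> rfl
  rw [this, Species.relabel_refl]

theorem insert_insert {I : Insertion P O} (h : I.Parallel) (q : Sch (deriv (deriv P)) V)
    (s u : Sch O V) :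
    insert I (insert (derivInsertion I) (map (derivSwap P) LinearMap.id q) s) u
      = insert I (insert (derivInsertion I) q u) s := by
  induction q using ind with
  | hadd a b ha hb => simp only [map_add, LinearMap.add_apply, ha, hb]
  | hgen A p v =>
    induction s using ind with
    | hadd a b ha hb => simp only [map_add, LinearMap.add_apply, ha, hb]
    | hgen B b w =>
      induction u using ind with
      | hadd a b ha hb => simp only [map_add, LinearMap.add_apply, ha, hb]
      | hgen C c x =>
        rw [map_gen]
        have e1 := insert_deriv_gen I (P.relabel (Insertion.rightComm A (Fin 1) (Fin 1)) p)
          v b w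
        have e2 := insert_deriv_gen I p v c x
        change insert I (insert (derivInsertion I) (gen (P := deriv (deriv P))
          (P.relabel (Insertion.rightComm A (Fin 1) (Fin 1)) p) v) _) _ = _
        rw [e1, e2, insert_gen, insert_gen]
        have key := h p b c
        have e3 := derivIns_swap I p b
        rw [e3, key, gen_relabel]
        change gen (I.ins (derivIns I p c) b) _ = gen (I.ins (derivIns I p c) b) _
        congr 1
        funext y
        rcases y with (y | y) | y <;> rfl

theorem insert_insMark {I : Insertion P O} {J : Insertion O O} (h : I.Sequential J)
    (q : Sch (deriv P) V) (s : Sch (deriv O) V) (u : Sch O V) :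
    insert I (insMark I q s) u = insert I q (insert J s u) := by
  induction q using ind with
  | hadd a b ha hb => simp only [map_add, LinearMap.add_apply, ha, hb]
  | hgen A p v =>
    induction s using ind with
    | hadd a b ha hb => simp only [map_add, LinearMap.add_apply, ha, hb]
    | hgen B b w =>
      induction u using ind with
      | hadd a b ha hb => simp only [map_add, ha, hb]
      | hgen C c x =>
        have e1 := insMark_gen I p v b w
        have e2 := insert_gen J b w c x
        have e3 := insert_gen I p v (J.ins b c) (Sum.elim w x)
        refine (congrArg (fun y => insert I y (gen c x)) e1).trans ?_
        rw [e2, e3, insert_gen, h p b c, gen_relabel]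
        congr 1
        funext y
        rcases y with (y | y) | y <;> rfl

theorem markAt_inl (I : Insertion P O) {A Z : Type} [Finite A] [Finite Z] (a : A)
    (p : P.at' (A ⊕ Fin 1)) (o : O.at' Z) :
    markAt (Sum.inl a : A ⊕ Z) (I.ins p o) = (deriv P).relabel (neInl Z a)
      (derivIns I (P.relabel (Insertion.rightComm _ (Fin 1) (Fin 1))
        (markAt (P := deriv P) a p)) o) := by
  change P.relabel (ptEquiv (Sum.inl a)).symm (I.ins p o)
    = P.relabel ((neInl Z a).sumCongr (Equiv.refl (Fin 1)))
      (P.relabel (Insertion.rightComm _ (Fin 1) Z)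
        (I.ins (P.relabel (Insertion.rightComm _ (Fin 1) (Fin 1))
          (P.relabel (Insertion.rightComm _ (Fin 1) (Fin 1))
            (P.relabel ((ptEquiv a).symm.sumCongr (Equiv.refl (Fin 1))) p))) o))
  have e1 : P.relabel (Insertion.rightComm _ (Fin 1) (Fin 1))
          (P.relabel (Insertion.rightComm _ (Fin 1) (Fin 1))
            (P.relabel ((ptEquiv a).symm.sumCongr (Equiv.refl (Fin 1))) p))
      = P.relabel ((ptEquiv a).symm.sumCongr (Equiv.refl (Fin 1))) p := by
    rw [Species.relabel_relabel]
    have : (Insertion.rightComm {y // y ≠ a} (Fin 1) (Fin 1)).trans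
      (Insertion.rightComm {y // y ≠ a} (Fin 1) (Fin 1)) = Equiv.refl _ := by
      ext y
      rcases y with (y | y) | y <;> rfl
    rw [this, Species.relabel_refl]
  have e2 := I.ins_relabel (ptEquiv a).symm (Equiv.refl Z) p o
  rw [Species.relabel_refl] at e2
  rw [e1, e2]
  simp only [Species.relabel_relabel]
  congr 2
  rw [← Equiv.symm_bijective.injective.eq_iff]
  ext z
  rcases z with ⟨z | z, hz⟩ | z <;> simp [Insertion.rightComm, neInl]

theorem markAt_inr (I : Insertion P O) {A Z : Type} [Finite A] [Finite Z] (z : Z)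
    (p : P.at' (A ⊕ Fin 1)) (o : O.at' Z) :
    markAt (Sum.inr z : A ⊕ Z) (I.ins p o) = (deriv P).relabel (neInr A z)
      (P.relabel (Equiv.sumAssoc A _ (Fin 1)).symm (I.ins p (markAt z o))) := by
  change P.relabel (ptEquiv (Sum.inr z)).symm (I.ins p o)
    = P.relabel ((neInr A z).sumCongr (Equiv.refl (Fin 1)))
      (P.relabel (Equiv.sumAssoc A _ (Fin 1)).symm (I.ins p (O.relabel (ptEquiv z).symm o)))
  have e2 := I.ins_relabel (Equiv.refl A) (ptEquiv z).symm p o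
  rw [Equiv.sumCongr_refl, Species.relabel_refl] at e2
  rw [e2]
  simp only [Species.relabel_relabel]
  congr 2
  rw [← Equiv.symm_bijective.injective.eq_iff]
  ext y
  rcases y with ⟨y | y, hz⟩ | y <;> simp [neInr]

theorem gen_markAt_inl (I : Insertion P O) {A Z : Type} [Finite A] [Finite Z] (a : A)
    (p : P.at' (A ⊕ Fin 1)) (o : O.at' Z) (v : A → V) (z : Z → V) :
    gen (P := deriv P) (markAt (Sum.inl a : A ⊕ Z) (I.ins p o))
        (fun y : {y : A ⊕ Z // y ≠ Sum.inl a} => Sum.elim v z y.1)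
      = insert (derivInsertion I) (map (derivSwap P) LinearMap.id
        (gen (P := deriv (deriv P)) (markAt (P := deriv P) a p)
          (fun y : {y : A // y ≠ a} => v y.1))) (gen o z) := by
  refine (congrArg (fun w => gen (P := deriv P) w _) (markAt_inl I a p o)).trans ?_
  refine (gen_relabel (P := deriv P) (neInl Z a) _ _).trans ?_
  refine Eq.trans ?_ (congrArg (fun w => insert (derivInsertion I) w (gen o z))
    (map_gen (P := deriv (deriv P)) (derivSwap P) LinearMap.id (markAt (P := deriv P) a p)
      (fun y : {y : A // y ≠ a} => v y.1))).symm
  refine Eq.trans ?_ (insert_deriv_gen I (P.relabel (Insertion.rightComm _ (Fin 1) (Fin 1))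
    (markAt (P := deriv P) a p)) (fun y : {y : A // y ≠ a} => v y.1) o z).symm
  congr 1
  funext y
  rcases y with y | y <;> rfl

theorem gen_markAt_inr (I : Insertion P O) {A Z : Type} [Finite A] [Finite Z] (a : Z)
    (p : P.at' (A ⊕ Fin 1)) (o : O.at' Z) (v : A → V) (z : Z → V) :
    gen (P := deriv P) (markAt (Sum.inr a : A ⊕ Z) (I.ins p o))
        (fun y : {y : A ⊕ Z // y ≠ Sum.inr a} => Sum.elim v z y.1)
      = insMark I (gen (P := deriv P) p v)
        (gen (P := deriv O) (markAt a o) (fun y : {y : Z // y ≠ a} => z y.1)) := by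
  refine (congrArg (fun w => gen (P := deriv P) w _) (markAt_inr I a p o)).trans ?_
  refine (gen_relabel (P := deriv P) (neInr A a) _ _).trans ?_
  refine Eq.trans ?_ (insMark_gen I p v (markAt a o)
    (fun y : {y : Z // y ≠ a} => z y.1)).symm
  congr 1
  funext y
  rcases y with y | y <;> rfl

/-- The Leibniz rule for insertion. -/
theorem diff_insert (I : Insertion P O) (q : Sch (deriv P) V) (s : Sch O V) :
    diff (insert I q s)
      = TensorProduct.map ((insert (derivInsertion I)).flip s ∘ₗ map (derivSwap P) LinearMap.id)
          LinearMap.id (diff q)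
        + TensorProduct.map (insMark I q) LinearMap.id (diff s) := by
  induction q using ind with
  | hadd a b ha hb =>
    simp only [map_add, LinearMap.add_apply, ha, hb, TensorProduct.map_add_left]
    abel
  | hgen A p v =>
    induction s using ind with
    | hadd a b ha hb =>
      simp only [map_add, ha, hb, LinearMap.add_comp, TensorProduct.map_add_left,
        LinearMap.add_apply]
      abel
    | hgen Z o z =>
      have := Fintype.ofFinite A
      have := Fintype.ofFinite Z
      refine (congrArg diff (insert_gen I p v o z)).trans ?_
      rw [diff_gen, diff_gen, diff_gen, Fintype.sum_sum_type, map_sum, map_sum]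
      congr 1
      · exact Finset.sum_congr rfl fun a _ =>
          congrArg (fun y => y ⊗ₜ[k] v a) (gen_markAt_inl I a p o v z)
      · exact Finset.sum_congr rfl fun a _ =>
          congrArg (fun y => y ⊗ₜ[k] z a) (gen_markAt_inr I a p o v z)

theorem map_insert {Q O' : Species k} {W : Type u} [AddCommGroup W] [Module k W]
    {I : Insertion P O} {I' : Insertion Q O'} {θ : SpMap P Q} {ψ : SpMap O O'}
    (h : InsCompat I I' θ ψ) (i : V →ₗ[k] W) (q : Sch (deriv P) V) (s : Sch O V) :
    map θ i (insert I q s) = insert I' (map θ.deriv i q) (map ψ i s) := by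
  induction q using ind with
  | hadd a b ha hb => simp only [map_add, LinearMap.add_apply, ha, hb]
  | hgen A p v =>
    induction s using ind with
    | hadd a b ha hb => simp only [map_add, ha, hb]
    | hgen Z o z =>
      refine (congrArg (map θ i) (insert_gen I p v o z)).trans ?_
      rw [map_gen, map_gen, map_gen]
      refine Eq.trans ?_ (insert_gen I' (θ.app _ p) (i ∘ v) (ψ.app _ o) (i ∘ z)).symm
      rw [h p o, Sum.comp_elim]

theorem map_map {Q R : Species k} {W X : Type u} [AddCommGroup W] [Module k W]
    [AddCommGroup X] [Module k X] (θ : SpMap P Q) (ψ : SpMap Q R) (φ : SpMap P R)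
    (i : V →ₗ[k] W) (j : W →ₗ[k] X)
    (h : ∀ (Y : Type) [Finite Y] (p : P.at' Y), φ.app Y p = ψ.app Y (θ.app Y p)) (s : Sch P V) :
    map ψ j (map θ i s) = map φ (j ∘ₗ i) s := by
  induction s using ind with
  | hadd a b ha hb => simp only [map_add, ha, hb]
  | hgen A p v =>
    rw [map_gen, map_gen, map_gen, h]
    rfl

theorem map_id (s : Sch P V) : map (SpMap.id P) LinearMap.id s = s := by
  induction s using ind with
  | hadd a b ha hb => simp only [map_add, ha, hb]
  | hgen A p v =>
    rw [map_gen]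
    rfl

end Sch

namespace Sch

variable {k : Type u} [Field k] {P O : Species k} {V : Type u} [AddCommGroup V] [Module k V]

/-- The derivation action: `D_f (p ⊗ v_1 ⊗ ⋯ ⊗ v_n)` is the sum over `i` of the elements obtained
by inserting `f v_i` at the `i`-th input. -/
def derivExt (I : Insertion P O) : (V →ₗ[k] Sch O V) →ₗ[k] Sch P V →ₗ[k] Sch P V :=
  LinearMap.mk₂ k (fun f s => TensorProduct.lift ((insert I).compl₂ f) (diff s))
    (by
      intro f g s
      rw [← LinearMap.add_apply]
      congr 1
      apply TensorProduct.ext'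
      intro q v
      simp)
    (by
      intro c f s
      rw [← LinearMap.smul_apply]
      congr 1
      apply TensorProduct.ext'
      intro q v
      simp)
    (by intros; simp) (by intros; simp)

theorem derivExt_apply (I : Insertion P O) (f : V →ₗ[k] Sch O V) (s : Sch P V) :
    derivExt I f s = TensorProduct.lift ((insert I).compl₂ f) (diff s) := rfl

/-- The part of a second derivation action that involves two distinct inputs. -/
def derivExt2 (I : Insertion P O) (f g : V →ₗ[k] Sch O V) :
    (Sch (deriv (deriv P)) V ⊗[k] V) ⊗[k] V →ₗ[k] Sch P V :=
  TensorProduct.lift ((insert I).compl₁₂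
    (TensorProduct.lift ((insert (derivInsertion I)).compl₂ g)) f)

theorem derivExt2_tmul (I : Insertion P O) (f g : V →ₗ[k] Sch O V)
    (q : Sch (deriv (deriv P)) V) (v w : V) :
    derivExt2 I f g ((q ⊗ₜ v) ⊗ₜ w)
      = insert I (insert (derivInsertion I) q (g v)) (f w) := rfl

theorem derivExt2_swap {I : Insertion P O} (h : I.Parallel) (f g : V →ₗ[k] Sch O V)
    (z : (Sch (deriv (deriv P)) V ⊗[k] V) ⊗[k] V) :
    derivExt2 I f g (swap2 z) = derivExt2 I g f z := by
  have : derivExt2 I f g ∘ₗ swap2 = derivExt2 I g f := by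
    apply TensorProduct.ext_threefold
    intro q v w
    rw [LinearMap.comp_apply, swap2_tmul, derivExt2_tmul, derivExt2_tmul, insert_insert h]
  exact LinearMap.congr_fun this z

theorem derivExt2_symm {I : Insertion P O} (h : I.Parallel) (f g : V →ₗ[k] Sch O V)
    (s : Sch P V) : derivExt2 I f g (diff2 s) = derivExt2 I g f (diff2 s) := by
  conv_lhs => rw [← diff2_symm]
  exact derivExt2_swap h f g _

theorem derivExt_derivExt {I : Insertion P O} {J : Insertion O O} (h : I.Parallel)
    (hs : I.Sequential J) (f g : V →ₗ[k] Sch O V) (s : Sch P V) :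
    derivExt I g (derivExt I f s)
      = derivExt2 I f g (diff2 s) + derivExt I (derivExt J g ∘ₗ f) s := by
  have key : ∀ z : Sch (deriv P) V ⊗[k] V,
      derivExt I g (TensorProduct.lift ((insert I).compl₂ f) z)
        = derivExt2 I f g (TensorProduct.map diff LinearMap.id z)
          + TensorProduct.lift ((insert I).compl₂ (derivExt J g ∘ₗ f)) z := by
    intro z
    induction z using TensorProduct.induction_on with
    | zero => simp
    | add x y hx hy =>
      simp only [map_add, hx, hy]
      abel
    | tmul q v =>
      rw [TensorProduct.lift.tmul, LinearMap.compl₂_apply, derivExt_apply, diff_insert, map_add]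
      congr 1
      · rw [TensorProduct.map_tmul]
        generalize diff q = z
        induction z using TensorProduct.induction_on with
        | zero => simp
        | add x y hx hy => simp only [map_add, TensorProduct.add_tmul, hx, hy]
        | tmul q' w =>
          simp only [TensorProduct.map_tmul, TensorProduct.lift.tmul, LinearMap.compl₂_apply]
          exact insert_insert h q' (f v) (g w)
      · rw [TensorProduct.lift.tmul, LinearMap.compl₂_apply, LinearMap.comp_apply, derivExt_apply]
        generalize diff (f v) = z
        induction z using TensorProduct.induction_on with
        | zero => simp
        | add x y hx hy => simp only [map_add, hx, hy]
        | tmul q' w =>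
          simp only [TensorProduct.map_tmul, TensorProduct.lift.tmul, LinearMap.compl₂_apply]
          exact insert_insMark hs q q' (g w)
  exact key _

/-- The bracket of `Der(O(V)) = Hom(V, O(V))`. -/
def bracket (J : Insertion O O) (f g : V →ₗ[k] Sch O V) : V →ₗ[k] Sch O V :=
  derivExt J f ∘ₗ g - derivExt J g ∘ₗ f

/-- The bracket is the commutator of the derivation actions. -/
theorem derivExt_bracket {I : Insertion P O} {J : Insertion O O} (h : I.Parallel)
    (hs : I.Sequential J) (f g : V →ₗ[k] Sch O V) (s : Sch P V) :
    derivExt I (bracket J f g) s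
      = derivExt I f (derivExt I g s) - derivExt I g (derivExt I f s) := by
  rw [derivExt_derivExt h hs, derivExt_derivExt h hs, derivExt2_symm h, bracket, map_sub,
    LinearMap.sub_apply]
  abel

/-- Naturality of the derivation action. -/
theorem map_derivExt {Q O' : Species k} {W : Type u} [AddCommGroup W] [Module k W]
    {I : Insertion P O} {I' : Insertion Q O'} {θ : SpMap P Q} {ψ : SpMap O O'}
    (h : InsCompat I I' θ ψ) (i : V →ₗ[k] W) (f : V →ₗ[k] Sch O V) (f' : W →ₗ[k] Sch O' W)
    (hf : ∀ v, f' (i v) = map ψ i (f v)) (s : Sch P V) :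
    map θ i (derivExt I f s) = derivExt I' f' (map θ i s) := by
  rw [derivExt_apply, derivExt_apply, diff_map]
  generalize diff s = z
  induction z using TensorProduct.induction_on with
  | zero => simp
  | add x y hx hy => simp only [map_add, hx, hy]
  | tmul q v =>
    rw [TensorProduct.lift.tmul, LinearMap.compl₂_apply, map_insert h, TensorProduct.map_tmul,
      TensorProduct.lift.tmul, LinearMap.compl₂_apply, hf]

/-- Contraction of the derivative with a linear form. -/
def cov : Module.Dual k V →ₗ[k] Sch P V →ₗ[k] Sch (deriv P) V :=
  LinearMap.mk₂ k (fun ξ s => TensorProduct.lift ((LinearMap.lsmul k _).flip.compl₂ ξ) (diff s))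
    (by
      intro f g s
      rw [← LinearMap.add_apply]
      congr 1
      apply TensorProduct.ext'
      intro q v
      simp [add_smul])
    (by
      intro c f s
      rw [← LinearMap.smul_apply]
      congr 1
      apply TensorProduct.ext'
      intro q v
      simp [mul_smul])
    (by intros; simp) (by intros; simp)

theorem cov_apply (ξ : Module.Dual k V) (s : Sch P V) :
    cov ξ s = TensorProduct.lift ((LinearMap.lsmul k _).flip.compl₂ ξ) (diff s) := rfl

theorem derivExt_smulRight (I : Insertion P O) (ξ : Module.Dual k V) (u : Sch O V) (s : Sch P V) :
    derivExt I (ξ.smulRight u) s = insert I (cov ξ s) u := by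
  rw [derivExt_apply, cov_apply]
  generalize diff s = z
  induction z using TensorProduct.induction_on with
  | zero => simp
  | add x y hx hy => simp only [map_add, LinearMap.add_apply, hx, hy]
  | tmul q v => simp

theorem cov_map {Q : Species k} {W : Type u} [AddCommGroup W] [Module k W] (θ : SpMap P Q)
    (i : V →ₗ[k] W) (ξ : Module.Dual k W) (s : Sch P V) :
    cov ξ (map θ i s) = map θ.deriv i (cov (ξ ∘ₗ i) s) := by
  rw [cov_apply, cov_apply, diff_map]
  generalize diff s = z
  induction z using TensorProduct.induction_on with
  | zero => simp
  | add x y hx hy => simp only [map_add, hx, hy]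
  | tmul q v => simp

theorem cov_insert (I : Insertion P O) (ξ : Module.Dual k V) (q : Sch (deriv P) V) (s : Sch O V) :
    cov ξ (insert I q s)
      = insert (derivInsertion I) (map (derivSwap P) LinearMap.id (cov ξ q)) s
        + insMark I q (cov ξ s) := by
  rw [cov_apply, cov_apply, cov_apply, diff_insert, map_add]
  congr 1
  · generalize diff q = z
    induction z using TensorProduct.induction_on with
    | zero => simp
    | add x y hx hy => simp only [map_add, LinearMap.add_apply, hx, hy]
    | tmul q v => simp
  · generalize diff s = z
    induction z using TensorProduct.induction_on with
    | zero => simp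
    | add x y hx hy => simp only [map_add, hx, hy]
    | tmul q v => simp

theorem cov_cov (ξ η : Module.Dual k V) (s : Sch P V) :
    map (derivSwap P) LinearMap.id (cov η (cov ξ s)) = cov ξ (cov η s) := by
  let C : Module.Dual k V → Module.Dual k V →
      (Sch (deriv (deriv P)) V ⊗[k] V) ⊗[k] V →ₗ[k] Sch (deriv (deriv P)) V := fun a b =>
    TensorProduct.lift ((LinearMap.lsmul k _).flip.compl₁₂
      (TensorProduct.lift ((LinearMap.lsmul k _).flip.compl₂ a)) b)
  have h1 : ∀ a b (s : Sch P V), cov a (cov b s) = C a b (diff2 s) := by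
    intro a b s
    rw [cov_apply (P := P), diff2, LinearMap.comp_apply]
    generalize diff s = z
    induction z using TensorProduct.induction_on with
    | zero => simp
    | add x y hx hy => simp only [map_add, hx, hy]
    | tmul q v =>
      simp only [TensorProduct.lift.tmul, LinearMap.compl₂_apply, LinearMap.flip_apply,
        LinearMap.lsmul_apply, map_smul, TensorProduct.map_tmul, C, LinearMap.compl₁₂_apply,
        LinearMap.id_apply]
      rfl
  rw [h1, h1]
  conv_rhs => rw [← diff2_symm]
  generalize diff2 s = z
  have : map (derivSwap P) LinearMap.id ∘ₗ C η ξ = C ξ η ∘ₗ swap2 := by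
    apply TensorProduct.ext_threefold
    intro q v w
    rw [LinearMap.comp_apply, LinearMap.comp_apply, swap2_tmul]
    simp only [C, TensorProduct.lift.tmul, LinearMap.compl₂_apply, LinearMap.flip_apply,
        LinearMap.lsmul_apply, map_smul, LinearMap.compl₁₂_apply, LinearMap.smul_apply]
    rw [smul_comm]
  exact LinearMap.congr_fun this z

end Sch

section SymDer

variable {k : Type u} [Field k] {M M' : Type u} [AddCommGroup M] [Module k M]
  [AddCommGroup M'] [Module k M']

/-- The homomorphism `p ↦ p + ε D p` to the dual numbers, for the derivation `D` of the symmetric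
algebra that extends an endomorphism. -/
def symDerHom (φ : M →ₗ[k] M) :
    SymmetricAlgebra k M →ₐ[k] TrivSqZeroExt (SymmetricAlgebra k M) (SymmetricAlgebra k M) :=
  SymmetricAlgebra.lift ((TrivSqZeroExt.inlAlgHom k (SymmetricAlgebra k M)
      (SymmetricAlgebra k M)).toLinearMap ∘ₗ SymmetricAlgebra.ι k M
    + ((TrivSqZeroExt.inrHom (SymmetricAlgebra k M) (SymmetricAlgebra k M)).restrictScalars k) ∘ₗ
      SymmetricAlgebra.ι k M ∘ₗ φ)

theorem symDerHom_ι (φ : M →ₗ[k] M) (m : M) :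
    symDerHom φ (SymmetricAlgebra.ι k M m)
      = TrivSqZeroExt.inl (SymmetricAlgebra.ι k M m)
        + TrivSqZeroExt.inr (SymmetricAlgebra.ι k M (φ m)) := by
  simp [symDerHom]

theorem fst_symDerHom (φ : M →ₗ[k] M) (p : SymmetricAlgebra k M) :
    (symDerHom φ p).fst = p := by
  have : (TrivSqZeroExt.fstHom k _ _).comp (symDerHom φ) = AlgHom.id k _ := by
    apply SymmetricAlgebra.algHom_ext
    ext m
    simp [symDerHom_ι]
  exact DFunLike.congr_fun this p

/-- The derivation of the symmetric algebra that extends an endomorphism. -/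
def symDer (φ : M →ₗ[k] M) : SymmetricAlgebra k M →ₗ[k] SymmetricAlgebra k M where
  toFun p := (symDerHom φ p).snd
  map_add' := by simp
  map_smul' := by simp

@[simp]
theorem symDer_ι (φ : M →ₗ[k] M) (m : M) :
    symDer φ (SymmetricAlgebra.ι k M m) = SymmetricAlgebra.ι k M (φ m) := by
  simp [symDer, symDerHom_ι]

@[simp]
theorem symDer_one (φ : M →ₗ[k] M) : symDer φ 1 = 0 := by
  simp [symDer]

@[simp]
theorem symDer_mul (φ : M →ₗ[k] M) (p q : SymmetricAlgebra k M) :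
    symDer φ (p * q) = p * symDer φ q + symDer φ p * q := by
  simp [symDer, fst_symDerHom, mul_comm]

theorem sym_ind {C : SymmetricAlgebra k M → Prop} (h1 : C 1)
    (hm : ∀ m p, C p → C (SymmetricAlgebra.ι k M m * p)) (ha : ∀ p q, C p → C q → C (p + q))
    (hs : ∀ (c : k) p, C p → C (c • p)) (p : SymmetricAlgebra k M) : C p := by
  have : ∀ q, C q → C (p * q) := by
    induction p using SymmetricAlgebra.induction with
    | algebraMap r =>
      intro q hq
      rw [← Algebra.smul_def]
      exact hs r q hq
    | ι m => exact hm m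
    | mul a b h1 h2 =>
      intro q hq
      rw [mul_assoc]
      exact h1 _ (h2 q hq)
    | add a b h1 h2 =>
      intro q hq
      rw [add_mul]
      exact ha _ _ (h1 q hq) (h2 q hq)
  simpa using this 1 h1

end SymDer

section CE

variable {k : Type u} [Field k] (g : Type u) [LieRing g] [LieAlgebra k g]
  (N : Type u) [AddCommGroup N] [Module k N]

/-- The space `Λ^*(g) ⊗ N` of Chevalley–Eilenberg chains with coefficients in `N`. -/
def Chains : Type u := ExteriorAlgebra k g ⊗[k] N

instance : AddCommGroup (Chains (k := k) g N) :=
  inferInstanceAs (AddCommGroup (ExteriorAlgebra k g ⊗[k] N))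

instance : Module k (Chains (k := k) g N) :=
  inferInstanceAs (Module k (ExteriorAlgebra k g ⊗[k] N))

variable {g N}

/-- The element `ω ⊗ n`. -/
def Chains.mk : ExteriorAlgebra k g →ₗ[k] N →ₗ[k] Chains (k := k) g N :=
  TensorProduct.mk k (ExteriorAlgebra k g) N

theorem Chains.ind_mk {C : Chains (k := k) g N → Prop} (hm : ∀ ω n, C (Chains.mk ω n))
    (ha : ∀ p q, C p → C q → C (p + q)) (c : Chains (k := k) g N) : C c :=
  TensorProduct.induction_on (motive := C) c
    (by
      have := hm 0 0
      rwa [map_zero] at this) hm ha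

/-- A linear map on chains from a bilinear map. -/
def Chains.lift {T : Type u} [AddCommGroup T] [Module k T]
    (F : ExteriorAlgebra k g →ₗ[k] N →ₗ[k] T) : Chains (k := k) g N →ₗ[k] T :=
  TensorProduct.lift F

@[simp]
theorem Chains.lift_mk {T : Type u} [AddCommGroup T] [Module k T]
    (F : ExteriorAlgebra k g →ₗ[k] N →ₗ[k] T) (ω : ExteriorAlgebra k g) (n : N) :
    Chains.lift F (Chains.mk ω n) = F ω n := TensorProduct.lift.tmul _ _

variable (N) in
/-- The exterior product with an element of `g` on the left. -/
def wedge : g →ₗ[k] Chains (k := k) g N →ₗ[k] Chains (k := k) g N where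
  toFun x := Chains.lift (Chains.mk ∘ₗ LinearMap.mulLeft k (ExteriorAlgebra.ι k x))
  map_add' x y := by
    ext c
    induction c using Chains.ind_mk with
    | ha p q hp hq =>
      refine (LinearMap.map_add _ p q).trans (Eq.trans ?_ (LinearMap.map_add _ p q).symm)
      rw [hp, hq]
    | hm ω n => simp [add_mul]
  map_smul' c x := by
    ext c
    induction c using Chains.ind_mk with
    | ha p q hp hq =>
      refine (LinearMap.map_add _ p q).trans (Eq.trans ?_ (LinearMap.map_add _ p q).symm)
      rw [hp, hq]
    | hm ω n => simp

@[simp]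
theorem wedge_mk (x : g) (ω : ExteriorAlgebra k g) (n : N) :
    wedge N x (Chains.mk ω n) = Chains.mk (ExteriorAlgebra.ι k x * ω) n := by
  simp [wedge]

@[simp]
theorem wedge_wedge (x : g) (c : Chains (k := k) g N) : wedge N x (wedge N x c) = 0 := by
  induction c using Chains.ind_mk with
  | ha x y hx hy => simp only [map_add, hx, hy, add_zero]
  | hm ω n => rw [wedge_mk, wedge_mk, ← mul_assoc, ExteriorAlgebra.ι_sq_zero]; simp

theorem chains_ind {C : Chains (k := k) g N → Prop} (h1 : ∀ n, C (Chains.mk 1 n))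
    (hm : ∀ x c, C c → C (wedge N x c)) (ha : ∀ p q, C p → C q → C (p + q))
    (c : Chains (k := k) g N) : C c := by
  induction c using Chains.ind_mk with
  | ha x y hx hy => exact ha _ _ hx hy
  | hm ω n =>
    induction ω using CliffordAlgebra.left_induction generalizing n with
    | algebraMap r =>
      rw [Algebra.algebraMap_eq_smul_one, map_smul, LinearMap.smul_apply, ← map_smul]
      exact h1 _
    | add a b h1 h2 =>
      rw [map_add, LinearMap.add_apply]
      exact ha _ _ (h1 n) (h2 n)
    | ι_mul ω x h =>
      have := hm x _ (h n)
      rwa [wedge_mk] at this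

section Rec

variable {T : Type u} [AddCommGroup T] [Module k T] (init : N →ₗ[k] T)
  (step : g →ₗ[k] Chains (k := k) g N × T →ₗ[k] T)

/-- The recursion step with a free coefficient. -/
def chainsStep : g →ₗ[k] ExteriorAlgebra k g × (N →ₗ[k] T) →ₗ[k] (N →ₗ[k] T) :=
  LinearMap.mk₂ k (fun x q => step x ∘ₗ (Chains.mk q.1).prod q.2)
    (by intros; ext; simp) (by intros; ext; simp)
    (by
      intro x p q
      ext n
      rw [LinearMap.add_apply, LinearMap.comp_apply, LinearMap.comp_apply, LinearMap.comp_apply,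
        ← map_add]
      congr 1
      exact Prod.ext (by simp) rfl)
    (by
      intro c x p
      ext n
      rw [LinearMap.smul_apply, LinearMap.comp_apply, LinearMap.comp_apply, ← map_smul]
      exact congrArg (step x) (Prod.ext (by simp) rfl))

theorem chainsStep_apply (x : g) (ω : ExteriorAlgebra k g) (D : N →ₗ[k] T) (n : N) :
    chainsStep step x (ω, D) n = step x (Chains.mk ω n, D n) := rfl

theorem chainsStep_chainsStep (hstep : ∀ x c t, step x (wedge N x c, step x (c, t)) = 0) (x : g) (ω : ExteriorAlgebra k g) (D : N →ₗ[k] T) :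
    chainsStep step x (ExteriorAlgebra.ι k x * ω, chainsStep step x (ω, D))
      = (0 : QuadraticForm k g) x • D := by
  ext n
  rw [chainsStep_apply, chainsStep_apply, ← wedge_mk, hstep]
  simp

/-- The linear map `R` on chains with `R (1 ⊗ n) = init n` and `R (x ∧ c) = step x (c, R c)`. -/
def chainsRec (hstep : ∀ x c t, step x (wedge N x c, step x (c, t)) = 0) :
    Chains (k := k) g N →ₗ[k] T :=
  Chains.lift (CliffordAlgebra.foldr' (0 : QuadraticForm k g) (chainsStep step)
    (chainsStep_chainsStep step hstep) init)

theorem chainsRec_one (hstep : ∀ x c t, step x (wedge N x c, step x (c, t)) = 0) (n : N) : chainsRec init step hstep (Chains.mk 1 n) = init n := by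
  have := CliffordAlgebra.foldr'_algebraMap (0 : QuadraticForm k g) (chainsStep step)
    (chainsStep_chainsStep step hstep) init 1
  rw [map_one, one_smul] at this
  rw [chainsRec, Chains.lift_mk]
  exact LinearMap.congr_fun this n

theorem chainsRec_wedge (hstep : ∀ x c t, step x (wedge N x c, step x (c, t)) = 0) (x : g) (c : Chains (k := k) g N) :
    chainsRec init step hstep (wedge N x c) = step x (c, chainsRec init step hstep c) := by
  induction c using Chains.ind_mk with
  | ha a b ha hb =>
    rw [map_add, map_add, ha, hb, ← map_add, map_add (chainsRec init step hstep)]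
    rfl
  | hm ω n =>
    rw [wedge_mk, chainsRec, Chains.lift_mk, Chains.lift_mk]
    exact LinearMap.congr_fun (CliffordAlgebra.foldr'_ι_mul (0 : QuadraticForm k g)
      (chainsStep step) (chainsStep_chainsStep step hstep) init x ω) n

end Rec

theorem wedge_anticomm (x y : g) (c : Chains (k := k) g N) :
    wedge N x (wedge N y c) = - wedge N y (wedge N x c) := by
  have := wedge_wedge (x + y) c
  simp only [map_add, LinearMap.add_apply, wedge_wedge, zero_add, add_zero] at this
  exact eq_neg_of_add_eq_zero_right this

variable (ρ : g →ₗ[k] N →ₗ[k] N)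

variable (k g) in
/-- The bracket as a bilinear map. -/
def lieB : g →ₗ[k] g →ₗ[k] g :=
  LinearMap.mk₂ k (fun x y => ⁅x, y⁆) add_lie smul_lie lie_add (fun c x y => lie_smul c x y)

@[simp]
theorem lieB_apply (x y : g) : lieB k g x y = ⁅x, y⁆ := rfl

/-- The recursion step for the action of `g` on chains. -/
def lieStep : g →ₗ[k] Chains (k := k) g N × (g →ₗ[k] Chains (k := k) g N) →ₗ[k]
    (g →ₗ[k] Chains (k := k) g N) :=
  LinearMap.mk₂ k (fun y q => LinearMap.flip (wedge N) q.1 ∘ₗ (lieB k g).flip y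
      + wedge N y ∘ₗ q.2)
    (by
      intros; ext
      simp
      abel)
    (by intros; ext; simp)
    (by
      intros; ext
      simp
      abel)
    (by intros; ext; simp)

theorem lieStep_apply (y x : g) (c : Chains (k := k) g N) (D : g →ₗ[k] Chains (k := k) g N) :
    lieStep y (c, D) x = wedge N ⁅x, y⁆ c + wedge N y (D x) := rfl

theorem lieStep_lieStep (y : g) (c : Chains (k := k) g N) (D : g →ₗ[k] Chains (k := k) g N) :
    lieStep y (wedge N y c, lieStep y (c, D)) = 0 := by
  apply LinearMap.ext
  intro x
  rw [lieStep_apply, lieStep_apply, map_add, wedge_wedge, wedge_anticomm]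
  simp

/-- The action of `g` on chains: `x · (1 ⊗ n) = 1 ⊗ ρ(x) n` and
`x · (y ∧ c) = [x,y] ∧ c + y ∧ (x · c)`. -/
def lieChains : g →ₗ[k] Chains (k := k) g N →ₗ[k] Chains (k := k) g N :=
  LinearMap.flip (chainsRec (ρ.flip.compr₂ (Chains.mk 1))
    lieStep lieStep_lieStep)

@[simp]
theorem lieChains_one (x : g) (n : N) : lieChains ρ x (Chains.mk 1 n) = Chains.mk 1 (ρ x n) :=
  LinearMap.congr_fun (chainsRec_one _ _ _ n) x

@[simp]
theorem lieChains_wedge (x y : g) (c : Chains (k := k) g N) :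
    lieChains ρ x (wedge N y c) = wedge N ⁅x, y⁆ c + wedge N y (lieChains ρ x c) :=
  LinearMap.congr_fun (chainsRec_wedge _ _ _ y c) x

theorem lieChains_lie (hρ : ∀ x y n, ρ ⁅x, y⁆ n = ρ x (ρ y n) - ρ y (ρ x n)) (x y : g)
    (c : Chains (k := k) g N) :
    lieChains ρ ⁅x, y⁆ c = lieChains ρ x (lieChains ρ y c) - lieChains ρ y (lieChains ρ x c) := by
  induction c using chains_ind with
  | h1 n => simp [hρ]
  | hm z c hc =>
    simp only [lieChains_wedge, map_add, hc, map_sub, lie_lie]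
    simp only [LinearMap.sub_apply]
    abel
  | ha p q hp hq =>
    simp only [map_add, hp, hq]
    abel

/-- The recursion step for the differential. -/
def ceStep : g →ₗ[k] Chains (k := k) g N × Chains (k := k) g N →ₗ[k] Chains (k := k) g N :=
  LinearMap.mk₂ k (fun x q => lieChains ρ x q.1 - wedge N x q.2)
    (by intros; simp; abel) (by intros; simp [smul_sub]) (by intros; simp; abel)
    (by intros; simp [smul_sub])

theorem ceStep_apply (x : g) (c D : Chains (k := k) g N) :
    ceStep ρ x (c, D) = lieChains ρ x c - wedge N x D := rfl

/-- The Chevalley–Eilenberg differential: `d (1 ⊗ n) = 0` and `d (x ∧ c) = x · c - x ∧ d c`. -/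
def ceD : Chains (k := k) g N →ₗ[k] Chains (k := k) g N :=
  chainsRec 0 (ceStep ρ) (by
    intro x c t
    rw [ceStep_apply, ceStep_apply, map_sub, wedge_wedge, lieChains_wedge, lie_self]
    simp)

@[simp]
theorem ceD_one (n : N) : ceD (g := g) ρ (Chains.mk 1 n) = 0 := chainsRec_one _ _ _ n

@[simp]
theorem ceD_wedge (x : g) (c : Chains (k := k) g N) :
    ceD ρ (wedge N x c) = lieChains ρ x c - wedge N x (ceD ρ c) := chainsRec_wedge _ _ _ x c

theorem ceD_lieChains (hρ : ∀ x y n, ρ ⁅x, y⁆ n = ρ x (ρ y n) - ρ y (ρ x n)) (x : g)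
    (c : Chains (k := k) g N) : ceD ρ (lieChains ρ x c) = lieChains ρ x (ceD ρ c) := by
  induction c using chains_ind with
  | h1 n => simp
  | hm y c hc =>
    simp only [lieChains_wedge, map_add, ceD_wedge, map_sub, hc, lieChains_lie ρ hρ x y c]
    abel
  | ha p q hp hq => simp only [map_add, hp, hq]

theorem ceD_ceD (hρ : ∀ x y n, ρ ⁅x, y⁆ n = ρ x (ρ y n) - ρ y (ρ x n))
    (c : Chains (k := k) g N) : ceD ρ (ceD ρ c) = 0 := by
  induction c using chains_ind with
  | h1 n => simp
  | hm y c hc =>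
    simp only [map_sub, ceD_wedge, ceD_lieChains ρ hρ, hc]
    simp
  | ha p q hp hq => simp only [map_add, hp, hq, add_zero]

end CE

section Grading

variable {k : Type u} [Field k] {g : Type u} [LieRing g] [LieAlgebra k g]
  {N : Type u} [AddCommGroup N] [Module k N]

variable (k g N) in
/-- The subspace `Λ^n(g) ⊗ N` of chains of degree `n`. -/
def chainsDeg (n : ℕ) : Submodule k (Chains (k := k) g N) :=
  Submodule.map₂ Chains.mk (⋀[k]^n g) ⊤

theorem wedge_mem {n : ℕ} (x : g) {c : Chains (k := k) g N} (hc : c ∈ chainsDeg k g N n) :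
    wedge N x c ∈ chainsDeg k g N (n + 1) := by
  have : chainsDeg k g N n ≤ (chainsDeg k g N (n + 1)).comap (wedge N x) := by
    refine Submodule.map₂_le.2 fun ω hω m _ => ?_
    rw [Submodule.mem_comap, wedge_mk]
    refine Submodule.apply_mem_map₂ _ ?_ Submodule.mem_top
    change _ ∈ LinearMap.range _ ^ (n + 1)
    rw [pow_succ']
    exact Submodule.mul_mem_mul ⟨x, rfl⟩ hω
  exact this hc

theorem chainsDeg_zero_le {S : Submodule k (Chains (k := k) g N)}
    (h : ∀ n, Chains.mk 1 n ∈ S) : chainsDeg k g N 0 ≤ S := by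
  refine Submodule.map₂_le.2 fun ω hω m _ => ?_
  change ω ∈ LinearMap.range _ ^ 0 at hω
  rw [pow_zero, Submodule.mem_one] at hω
  obtain ⟨r, rfl⟩ := hω
  rw [Algebra.algebraMap_eq_smul_one, map_smul, LinearMap.smul_apply]
  exact S.smul_mem _ (h m)

theorem chainsDeg_succ_le {n : ℕ} {S : Submodule k (Chains (k := k) g N)}
    (h : ∀ x c, c ∈ chainsDeg k g N n → wedge N x c ∈ S) : chainsDeg k g N (n + 1) ≤ S := by
  refine Submodule.map₂_le.2 fun ω hω m _ => ?_
  change ω ∈ LinearMap.range _ ^ (n + 1) at hω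
  rw [pow_succ'] at hω
  induction hω using Submodule.mul_induction_on' with
  | mem_mul_mem a ha b hb =>
    obtain ⟨x, rfl⟩ := ha
    have := h x (Chains.mk b m) (Submodule.apply_mem_map₂ _ hb Submodule.mem_top)
    rwa [wedge_mk] at this
  | add a _ b _ h1 h2 =>
    rw [map_add, LinearMap.add_apply]
    exact S.add_mem h1 h2

variable (ρ : g →ₗ[k] N →ₗ[k] N)

theorem lieChains_mem (x : g) (n : ℕ) :
    chainsDeg k g N n ≤ (chainsDeg k g N n).comap (lieChains ρ x) := by
  induction n with
  | zero =>
    refine chainsDeg_zero_le fun n => ?_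
    rw [Submodule.mem_comap, lieChains_one]
    refine Submodule.apply_mem_map₂ _ ?_ Submodule.mem_top
    change _ ∈ LinearMap.range _ ^ 0
    rw [pow_zero]
    exact Submodule.mem_one.2 ⟨1, map_one _⟩
  | succ n ih =>
    refine chainsDeg_succ_le fun y c hc => ?_
    rw [Submodule.mem_comap, lieChains_wedge]
    exact add_mem (wedge_mem _ hc) (wedge_mem _ (ih hc))

theorem ceD_mem (n : ℕ) :
    chainsDeg k g N (n + 1) ≤ (chainsDeg k g N n).comap (ceD ρ) := by
  induction n with
  | zero =>
    refine chainsDeg_succ_le fun y c hc => ?_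
    have h0 : chainsDeg k g N 0 ≤ LinearMap.ker (ceD ρ) :=
      chainsDeg_zero_le fun n => ceD_one ρ n
    rw [Submodule.mem_comap, ceD_wedge, LinearMap.mem_ker.1 (h0 hc), map_zero, sub_zero]
    exact lieChains_mem ρ y 0 hc
  | succ n ih =>
    refine chainsDeg_succ_le fun y c hc => ?_
    rw [Submodule.mem_comap, ceD_wedge]
    exact sub_mem (lieChains_mem ρ y _ hc) (wedge_mem _ (ih hc))

end Grading

section ChainsMap

variable {k : Type u} [Field k] {g g' : Type u} [LieRing g] [LieAlgebra k g] [LieRing g']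
  [LieAlgebra k g'] {N N' : Type u} [AddCommGroup N] [Module k N] [AddCommGroup N'] [Module k N']

/-- Functoriality of chains in the Lie algebra and the coefficients. -/
def chainsMap (f : g →ₗ[k] g') (φ : N →ₗ[k] N') : Chains (k := k) g N →ₗ[k] Chains (k := k) g' N' :=
  Chains.lift (Chains.mk.compl₁₂ (ExteriorAlgebra.map f).toLinearMap φ)

@[simp]
theorem chainsMap_mk (f : g →ₗ[k] g') (φ : N →ₗ[k] N') (ω : ExteriorAlgebra k g) (n : N) :
    chainsMap f φ (Chains.mk ω n) = Chains.mk (ExteriorAlgebra.map f ω) (φ n) := by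
  simp [chainsMap]

@[simp]
theorem chainsMap_wedge (f : g →ₗ[k] g') (φ : N →ₗ[k] N') (x : g) (c : Chains (k := k) g N) :
    chainsMap f φ (wedge N x c) = wedge N' (f x) (chainsMap f φ c) := by
  induction c using Chains.ind_mk with
  | ha p q hp hq => simp only [map_add, hp, hq]
  | hm ω n => simp

theorem chainsMap_mem (f : g →ₗ[k] g') (φ : N →ₗ[k] N') (n : ℕ) :
    chainsDeg k g N n ≤ (chainsDeg k g' N' n).comap (chainsMap f φ) := by
  induction n with
  | zero =>
    refine chainsDeg_zero_le fun n => ?_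
    rw [Submodule.mem_comap, chainsMap_mk, map_one]
    refine Submodule.apply_mem_map₂ _ ?_ Submodule.mem_top
    change _ ∈ LinearMap.range _ ^ 0
    rw [pow_zero]
    exact Submodule.mem_one.2 ⟨1, map_one _⟩
  | succ n ih =>
    refine chainsDeg_succ_le fun y c hc => ?_
    rw [Submodule.mem_comap, chainsMap_wedge]
    exact wedge_mem _ (ih hc)

theorem chainsMap_lieChains {ρ : g →ₗ[k] N →ₗ[k] N} {ρ' : g' →ₗ[k] N' →ₗ[k] N'}
    {f : g →ₗ[k] g'} {φ : N →ₗ[k] N'} (hf : ∀ x y, f ⁅x, y⁆ = ⁅f x, f y⁆)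
    (hφ : ∀ x n, φ (ρ x n) = ρ' (f x) (φ n)) (x : g) (c : Chains (k := k) g N) :
    chainsMap f φ (lieChains ρ x c) = lieChains ρ' (f x) (chainsMap f φ c) := by
  induction c using chains_ind with
  | h1 n => simp [hφ]
  | hm y c hc => simp [hf, hc]
  | ha p q hp hq => simp only [map_add, hp, hq]

theorem chainsMap_ceD {ρ : g →ₗ[k] N →ₗ[k] N} {ρ' : g' →ₗ[k] N' →ₗ[k] N'}
    {f : g →ₗ[k] g'} {φ : N →ₗ[k] N'} (hf : ∀ x y, f ⁅x, y⁆ = ⁅f x, f y⁆)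
    (hφ : ∀ x n, φ (ρ x n) = ρ' (f x) (φ n)) (c : Chains (k := k) g N) :
    chainsMap f φ (ceD ρ c) = ceD ρ' (chainsMap f φ c) := by
  induction c using chains_ind with
  | h1 n => simp
  | hm y c hc => simp [hc, chainsMap_lieChains hf hφ]
  | ha p q hp hq => simp only [map_add, hp, hq]

end ChainsMap

/-- A differential graded Lie algebra concentrated in homological degrees `0` and `-1`. It
amounts to a Lie algebra `deg0`, a module `degNeg` over it (the bracket of an element of degree `0`
with an element of degree `-1`; the bracket of two elements of degree `-1` lies in degree `-2` and
vanishes) and a differential that satisfies the Leibniz rule. -/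
structure DGLie (k : Type u) [Field k] where
  deg0 : Type u
  degNeg : Type u
  [lieRing : LieRing deg0]
  [lieAlgebra : LieAlgebra k deg0]
  [addCommGroup : AddCommGroup degNeg]
  [module : Module k degNeg]
  act : deg0 →ₗ[k] degNeg →ₗ[k] degNeg
  act_lie : ∀ x y m, act ⁅x, y⁆ m = act x (act y m) - act y (act x m)
  diff : deg0 →ₗ[k] degNeg
  diff_lie : ∀ x y, diff ⁅x, y⁆ = act x (diff y) - act y (diff x)

namespace DGLie

attribute [instance] DGLie.lieRing DGLie.lieAlgebra DGLie.addCommGroup DGLie.module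

variable {k : Type u} [Field k]

/-- Morphisms of differential graded Lie algebras. -/
@[ext]
structure Hom (L L' : DGLie k) where
  map0 : L.deg0 →ₗ[k] L'.deg0
  mapNeg : L.degNeg →ₗ[k] L'.degNeg
  map_lie : ∀ x y, map0 ⁅x, y⁆ = ⁅map0 x, map0 y⁆
  map_act : ∀ x m, mapNeg (L.act x m) = L'.act (map0 x) (mapNeg m)
  map_diff : ∀ x, mapNeg (L.diff x) = L'.diff (map0 x)

instance : Category (DGLie k) where
  Hom := Hom
  id L := ⟨LinearMap.id, LinearMap.id, fun _ _ => rfl, fun _ _ => rfl, fun _ => rfl⟩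
  comp f g := ⟨g.map0 ∘ₗ f.map0, g.mapNeg ∘ₗ f.mapNeg, by simp [f.map_lie, g.map_lie],
    by simp [f.map_act, g.map_act], by simp [f.map_diff, g.map_diff]⟩

variable (L : DGLie k)

theorem symDer_add {M : Type u} [AddCommGroup M] [Module k M] (φ ψ : M →ₗ[k] M)
    (p : SymmetricAlgebra k M) : symDer (φ + ψ) p = symDer φ p + symDer ψ p := by
  induction p using sym_ind with
  | h1 => simp
  | hm m p hp => simp only [symDer_mul, hp, symDer_ι, LinearMap.add_apply, map_add]; ring
  | ha p q hp hq => simp only [map_add, hp, hq]; ring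
  | hs c p hp => simp only [map_smul, hp, smul_add]

theorem symDer_smul {M : Type u} [AddCommGroup M] [Module k M] (c : k) (φ : M →ₗ[k] M)
    (p : SymmetricAlgebra k M) : symDer (c • φ) p = c • symDer φ p := by
  induction p using sym_ind with
  | h1 => simp
  | hm m p hp => simp [hp]
  | ha p q hp hq => simp only [map_add, hp, hq, smul_add]
  | hs d p hp => rw [map_smul, map_smul, hp, smul_comm]

/-- The action of `x` in degree `0` on the symmetric algebra on `degNeg`: the extension of the
action on `degNeg` to a derivation, plus the multiplication by the differential of `x`. -/
def twist : L.deg0 →ₗ[k] SymmetricAlgebra k L.degNeg →ₗ[k] SymmetricAlgebra k L.degNeg :=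
  LinearMap.mk₂ k (fun x p => symDer (L.act x) p + SymmetricAlgebra.ι k _ (L.diff x) * p)
    (by intros; simp only [map_add, symDer_add]; ring)
    (by intros; simp [symDer_smul])
    (by intros; simp only [map_add]; ring)
    (by intros; simp)

theorem twist_apply (x : L.deg0) (p : SymmetricAlgebra k L.degNeg) :
    L.twist x p = symDer (L.act x) p + SymmetricAlgebra.ι k _ (L.diff x) * p := rfl

theorem symDer_lie (x y : L.deg0) (p : SymmetricAlgebra k L.degNeg) :
    symDer (L.act ⁅x, y⁆) p
      = symDer (L.act x) (symDer (L.act y) p) - symDer (L.act y) (symDer (L.act x) p) := by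
  induction p using sym_ind with
  | h1 => simp
  | hm m p hp => simp only [symDer_mul, hp, symDer_ι, L.act_lie, map_add, map_sub]; ring
  | ha p q hp hq => simp only [map_add, hp, hq]; ring
  | hs c p hp => simp only [map_smul, hp, smul_sub]

theorem twist_lie (x y : L.deg0) (p : SymmetricAlgebra k L.degNeg) :
    L.twist ⁅x, y⁆ p = L.twist x (L.twist y p) - L.twist y (L.twist x p) := by
  simp only [twist_apply, symDer_lie, L.diff_lie, map_add, map_sub, symDer_mul, symDer_ι]
  ring

/-- The Chevalley–Eilenberg complex of a differential graded Lie algebra concentrated in degrees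
`0` and `-1`: the symmetric algebra (with Koszul signs) on the suspension is
`Λ^*(deg0) ⊗ S^*(degNeg)`, graded by the exterior degree. The differential is given by
`d (1 ⊗ p) = 0` and `d (x ∧ c) = x · c - x ∧ d c`, where `x` acts on chains by the Lie bracket,
by the action on `degNeg` and by the multiplication by its differential. -/
def ce : ChainComplex (ModuleCat.{u} k) ℕ :=
  ChainComplex.of (fun n => ModuleCat.of k (chainsDeg k L.deg0 (SymmetricAlgebra k L.degNeg) n))
    (fun n => ModuleCat.ofHom ((ceD L.twist).restrict (ceD_mem L.twist n)))
    (by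
      intro n
      ext c
      exact ceD_ceD L.twist L.twist_lie _)

theorem ce_d (n : ℕ) :
    L.ce.d (n + 1) n = ModuleCat.ofHom ((ceD L.twist).restrict (ceD_mem L.twist n)) :=
  ChainComplex.of_d
    (fun n => ModuleCat.of k (chainsDeg k L.deg0 (SymmetricAlgebra k L.degNeg) n))
    (fun n => ModuleCat.ofHom ((ceD L.twist).restrict (ceD_mem L.twist n))) n

variable {L} {L' : DGLie k}

/-- The map of symmetric algebras. -/
def symMap {M M' : Type u} [AddCommGroup M] [Module k M] [AddCommGroup M'] [Module k M']
    (φ : M →ₗ[k] M') : SymmetricAlgebra k M →ₐ[k] SymmetricAlgebra k M' :=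
  SymmetricAlgebra.lift (SymmetricAlgebra.ι k M' ∘ₗ φ)

@[simp]
theorem symMap_ι {M M' : Type u} [AddCommGroup M] [Module k M] [AddCommGroup M'] [Module k M']
    (φ : M →ₗ[k] M') (m : M) :
    symMap φ (SymmetricAlgebra.ι k M m) = SymmetricAlgebra.ι k M' (φ m) := by
  simp [symMap]

theorem symMap_twist (f : L ⟶ L') (x : L.deg0) (p : SymmetricAlgebra k L.degNeg) :
    symMap (Hom.mapNeg f) (L.twist x p) = L'.twist (Hom.map0 f x) (symMap (Hom.mapNeg f) p) := by
  have key : ∀ p, symMap (Hom.mapNeg f) (symDer (L.act x) p)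
      = symDer (L'.act (Hom.map0 f x)) (symMap (Hom.mapNeg f) p) := by
    intro p
    induction p using sym_ind with
    | h1 => simp
    | hm m p hp =>
      simp only [symDer_mul, symDer_ι, map_add, map_mul, hp, symMap_ι, Hom.map_act]
    | ha p q hp hq => simp only [map_add, hp, hq]
    | hs c p hp => simp only [map_smul, hp]
  rw [twist_apply, twist_apply, map_add, map_mul, key]
  simp [symMap, Hom.map_diff]

/-- The chain map given by a morphism of differential graded Lie algebras. -/
def ceMap (f : L ⟶ L') : L.ce ⟶ L'.ce :=
  ChainComplex.ofHom
    (fun n => ModuleCat.ofHom ((chainsMap (Hom.map0 f)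
      (symMap (Hom.mapNeg f)).toLinearMap).restrict (chainsMap_mem _ _ n)))
    (by
      intro n
      rw [ce_d, ce_d]
      ext c
      refine Subtype.ext ?_
      exact (chainsMap_ceD (ρ := L.twist) (ρ' := L'.twist)
        (φ := (symMap (Hom.mapNeg f)).toLinearMap) (Hom.map_lie f)
        (fun x p => symMap_twist f x p) c.1).symm)

theorem symMap_id {M : Type u} [AddCommGroup M] [Module k M] (p : SymmetricAlgebra k M) :
    symMap (LinearMap.id : M →ₗ[k] M) p = p := by
  have : symMap (LinearMap.id : M →ₗ[k] M) = AlgHom.id k _ := by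
    apply SymmetricAlgebra.algHom_ext
    ext m
    simp
  exact DFunLike.congr_fun this p

theorem symMap_comp {M M' M'' : Type u} [AddCommGroup M] [Module k M] [AddCommGroup M']
    [Module k M'] [AddCommGroup M''] [Module k M''] (φ : M →ₗ[k] M') (ψ : M' →ₗ[k] M'')
    (p : SymmetricAlgebra k M) : symMap (ψ ∘ₗ φ) p = symMap ψ (symMap φ p) := by
  have : symMap (ψ ∘ₗ φ) = (symMap ψ).comp (symMap φ) := by
    apply SymmetricAlgebra.algHom_ext
    ext m
    simp
  exact DFunLike.congr_fun this p

theorem chainsMap_id (c : Chains (k := k) L.deg0 (SymmetricAlgebra k L.degNeg)) :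
    (chainsMap (Hom.map0 (𝟙 L)) (symMap (Hom.mapNeg (𝟙 L))).toLinearMap c) = c := by
  induction c using Chains.ind_mk with
  | ha p q hp hq => simp only [map_add, hp, hq]
  | hm ω p =>
    rw [chainsMap_mk]
    exact congrArg₂ (fun a b => Chains.mk a b) (DFunLike.congr_fun ExteriorAlgebra.map_id ω)
      (symMap_id p)

theorem chainsMap_comp {L'' : DGLie k} (f : L ⟶ L') (h : L' ⟶ L'')
    (c : Chains (k := k) L.deg0 (SymmetricAlgebra k L.degNeg)) :
    (chainsMap (Hom.map0 (f ≫ h)) (symMap (Hom.mapNeg (f ≫ h))).toLinearMap c)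
      = chainsMap (Hom.map0 h) (symMap (Hom.mapNeg h)).toLinearMap
        (chainsMap (Hom.map0 f) (symMap (Hom.mapNeg f)).toLinearMap c) := by
  induction c using Chains.ind_mk with
  | ha p q hp hq => simp only [map_add, hp, hq]
  | hm ω p =>
    rw [chainsMap_mk, chainsMap_mk, chainsMap_mk]
    refine congrArg₂ (fun a b => Chains.mk a b) ?_ (symMap_comp _ _ p)
    exact (DFunLike.congr_fun (ExteriorAlgebra.map_comp_map (Hom.map0 f) (Hom.map0 h)) ω).symm

variable (k) in
/-- The Chevalley–Eilenberg complex as a functor. -/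
def ceFunctor : DGLie k ⥤ ChainComplex (ModuleCat.{u} k) ℕ where
  obj L := L.ce
  map f := ceMap f
  map_id L := by
    apply HomologicalComplex.hom_ext
    intro n
    ext c
    exact Subtype.ext (chainsMap_id c.1)
  map_comp f g := by
    apply HomologicalComplex.hom_ext
    intro n
    ext c
    exact Subtype.ext (chainsMap_comp f g c.1)

end DGLie

section Der

variable {k : Type u} [Field k] (O : Operad k) (V : Type u) [AddCommGroup V] [Module k V]

/-- The Lie algebra `Der(O(V)) = Hom(V, O(V))` of derivations of the free `O`-algebra `O(V)`: a
derivation is given by its values on the generators. -/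
def Der : Type u := V →ₗ[k] Sch O.sp V

instance : AddCommGroup (Der O V) := inferInstanceAs (AddCommGroup (V →ₗ[k] Sch O.sp V))
instance : Module k (Der O V) := inferInstanceAs (Module k (V →ₗ[k] Sch O.sp V))

variable {O V}

/-- A derivation as a linear map defined on the generators. -/
def Der.toMap : Der O V ≃ₗ[k] (V →ₗ[k] Sch O.sp V) := LinearEquiv.refl k _

instance : CoeFun (Der O V) fun _ => V → Sch O.sp V := ⟨fun f => Der.toMap f⟩

/-- The action of a derivation on `O(V)`. -/
def Der.ad : Der O V →ₗ[k] Sch O.sp V →ₗ[k] Sch O.sp V :=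
  Sch.derivExt O.comp ∘ₗ Der.toMap.toLinearMap

/-- The action of a derivation on `|∂O(V)|`. -/
def Der.act : Der O V →ₗ[k] Sch (wheelSp O) V →ₗ[k] Sch (wheelSp O) V :=
  Sch.derivExt (P := wheelSp O) (wheel O).act ∘ₗ Der.toMap.toLinearMap

instance : Bracket (Der O V) (Der O V) := ⟨fun f g => Der.toMap.symm (Sch.bracket O.comp f.toMap g.toMap)⟩

theorem Der.bracket_apply (f g : Der O V) (v : V) :
    (⁅f, g⁆ : Der O V) v = Der.ad f (g v) - Der.ad g (f v) := rfl

theorem Der.ad_lie (f g : Der O V) (s : Sch O.sp V) :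
    Der.ad ⁅f, g⁆ s = Der.ad f (Der.ad g s) - Der.ad g (Der.ad f s) :=
  Sch.derivExt_bracket O.parallel O.sequential f.toMap g.toMap s

theorem Der.act_lie (f g : Der O V) (s : Sch (wheelSp O) V) :
    Der.act ⁅f, g⁆ s = Der.act f (Der.act g s) - Der.act g (Der.act f s) :=
  Sch.derivExt_bracket (P := wheelSp O) (wheel O).parallel (wheel O).sequential f.toMap g.toMap s

@[ext]
theorem Der.ext {f g : Der O V} (h : ∀ v, f v = g v) : f = g :=
  Der.toMap.injective (LinearMap.ext h)

@[simp]
theorem Der.add_apply (f g : Der O V) (v : V) : (f + g : Der O V) v = f v + g v := rfl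

@[simp]
theorem Der.smul_apply (c : k) (f : Der O V) (v : V) : (c • f : Der O V) v = c • f v := rfl

instance : LieRing (Der O V) where
  add_lie f f' g := by
    ext v
    simp only [Der.bracket_apply, map_add, LinearMap.add_apply]
    abel
  lie_add f g g' := by
    ext v
    simp only [Der.bracket_apply, map_add, LinearMap.add_apply]
    abel
  lie_self f := by
    ext v
    rw [Der.bracket_apply, sub_self]
    rfl
  leibniz_lie f g h := by
    ext v
    simp only [Der.bracket_apply, Der.add_apply, map_sub, Der.ad_lie]
    abel

instance : LieAlgebra k (Der O V) where
  lie_smul c f g := by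
    ext v
    simp only [Der.bracket_apply, Der.smul_apply, map_smul, LinearMap.smul_apply, smul_sub]

variable (O) in
/-- The projection `π : δ_{1,1} O → |δ_{1,1} O|`. -/
def wheelPi : SpMap (deriv O.sp) (wheelSp O) where
  app X _ := wheelProj O X
  nat f p := wheelProj_relabel f p

variable (O) in
theorem wheelPi_compat :
    InsCompat (derivInsertion O.comp) (wheel O).act (wheelPi O) (SpMap.id O.sp) :=
  fun _ _ => rfl

theorem wheelPi_markPairing {A Z : Type} [Finite A] [Finite Z] (p : O.sp.at' (A ⊕ Fin 1))
    (o : O.sp.at' (Z ⊕ Fin 1)) :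
    wheelProj O (A ⊕ Z) (O.sp.relabel (Equiv.sumAssoc A Z (Fin 1)).symm (O.comp.ins p o))
      = (wheelSp O).relabel (Equiv.sumComm Z A)
        (wheelProj O (Z ⊕ A) (O.sp.relabel (Equiv.sumAssoc Z A (Fin 1)).symm
          (O.comp.ins o p))) := by
  have h1 : ∀ {X₁ X₂ : Type} [Finite X₁] [Finite X₂] (a : O.sp.at' (X₁ ⊕ Fin 1))
      (b : O.sp.at' (X₂ ⊕ Fin 1)),
      O.sp.relabel (Equiv.sumAssoc X₁ X₂ (Fin 1)).symm (O.comp.ins a b)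
        = markedMul O (Equiv.refl _) a b := by
    intro X₁ X₂ _ _ a b
    simp [markedMul, Insertion.cmp]
  have h2 := wheelProj_comm (Equiv.refl (A ⊕ Z)) p o
  have h3 : markedMul O ((Equiv.sumComm Z A).trans (Equiv.refl (A ⊕ Z))) o p
      = O.sp.relabel ((Equiv.sumComm Z A).sumCongr (Equiv.refl (Fin 1)))
        (markedMul O (Equiv.refl _) o p) :=
    (relabel_markedMul (Equiv.refl _) (Equiv.sumComm Z A) o p).symm
  rw [h3, wheelProj_relabel] at h2
  rw [h1, h1]
  exact h2

theorem wheelPi_insMark_gen {A Z : Type} [Finite A] [Finite Z] (p : O.sp.at' (A ⊕ Fin 1))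
    (o : O.sp.at' (Z ⊕ Fin 1)) (v : A → V) (z : Z → V) :
    Sch.map (wheelPi O) LinearMap.id (Sch.insMark O.comp (Sch.gen (P := deriv O.sp) p v)
        (Sch.gen (P := deriv O.sp) o z))
      = Sch.gen (P := wheelSp O) (wheelProj O (A ⊕ Z) (O.sp.relabel
        (Equiv.sumAssoc A Z (Fin 1)).symm (O.comp.ins p o))) (Sum.elim v z) :=
  (congrArg (Sch.map (wheelPi O) LinearMap.id) (Sch.insMark_gen O.comp p v o z)).trans
    (Sch.map_gen (P := deriv O.sp) (wheelPi O) LinearMap.id _ _)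

theorem wheelPi_insMark (q q' : Sch (deriv O.sp) V) :
    Sch.map (wheelPi O) LinearMap.id (Sch.insMark O.comp q q')
      = Sch.map (wheelPi O) LinearMap.id (Sch.insMark O.comp q' q) := by
  induction q using Sch.ind with
  | hadd a b ha hb => simp only [map_add, LinearMap.add_apply, ha, hb]
  | hgen A p v =>
    induction q' using Sch.ind with
    | hadd a b ha hb => simp only [map_add, LinearMap.add_apply, ha, hb]
    | hgen Z o z =>
      refine (wheelPi_insMark_gen p o v z).trans (Eq.trans ?_ (wheelPi_insMark_gen o p z v).symm)
      refine (congrArg (fun w => Sch.gen w _) (wheelPi_markPairing p o)).trans ?_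
      rw [Sch.gen_relabel]
      congr 1
      funext x
      rcases x with x | x <;> rfl

variable (O V) in
/-- The map `ξ ⊗ s ↦ π(∂_ξ s)`, where `∂_ξ s` is obtained by evaluating `ξ` on one of the vectors
of `s` and marking the corresponding input. -/
def divTensor : Module.Dual k V ⊗[k] Sch O.sp V →ₗ[k] Sch (wheelSp O) V :=
  TensorProduct.lift (Sch.cov.compr₂ (Sch.map (wheelPi O) LinearMap.id))

/-- The derivation `v ↦ ξ(v) s`. -/
def Der.elem (ξ : Module.Dual k V) (s : Sch O.sp V) : Der O V :=
  Der.toMap.symm (ξ.smulRight s)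

@[simp]
theorem Der.elem_apply (ξ : Module.Dual k V) (s : Sch O.sp V) (v : V) :
    (Der.elem ξ s) v = ξ v • s := rfl

theorem Der.act_elem (ξ : Module.Dual k V) (u : Sch O.sp V) (s : Sch (wheelSp O) V) :
    Der.act (Der.elem ξ u) s = Sch.insert (P := wheelSp O) (wheel O).act (Sch.cov ξ s) u :=
  Sch.derivExt_smulRight (P := wheelSp O) (wheel O).act ξ u s

theorem Der.ad_elem (ξ : Module.Dual k V) (u : Sch O.sp V) (s : Sch O.sp V) :
    Der.ad (Der.elem ξ u) s = Sch.insert O.comp (Sch.cov ξ s) u :=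
  Sch.derivExt_smulRight O.comp ξ u s

theorem Der.lie_elem (ξ η : Module.Dual k V) (s u : Sch O.sp V) :
    (⁅Der.elem ξ s, Der.elem η u⁆ : Der O V)
      = Der.elem η (Der.ad (Der.elem ξ s) u) - Der.elem ξ (Der.ad (Der.elem η u) s)
      := by
  ext v
  rw [Der.bracket_apply]
  change Der.ad _ (η v • u) - Der.ad _ (ξ v • s) = η v • _ - ξ v • _
  rw [map_smul, map_smul]

variable [FiniteDimensional k V]

/-- The divergence. -/
def Der.div : Der O V →ₗ[k] Sch (wheelSp O) V :=
  divTensor O V ∘ₗ (Der.toMap.trans (dualTensorHomEquiv k V (Sch O.sp V)).symm).toLinearMap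

theorem Der.div_elem (ξ : Module.Dual k V) (s : Sch O.sp V) :
    Der.div (Der.elem ξ s) = Sch.map (wheelPi O) LinearMap.id (Sch.cov ξ s) := by
  have : (dualTensorHomEquiv k V (Sch O.sp V)).symm (Der.elem ξ s).toMap = ξ ⊗ₜ s := by
    rw [LinearEquiv.symm_apply_eq]
    ext v
    simp
  unfold Der.div
  rw [LinearMap.comp_apply, LinearEquiv.coe_coe, LinearEquiv.trans_apply, this]
  simp [divTensor]

theorem Der.ind {C : Der O V → Prop} (he : ∀ ξ s, C (Der.elem ξ s))
    (ha : ∀ f g, C f → C g → C (f + g)) (f : Der O V) : C f := by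
  obtain ⟨z, rfl⟩ := ((dualTensorHomEquiv k V (Sch O.sp V)).trans Der.toMap.symm).surjective f
  induction z using TensorProduct.induction_on with
  | zero =>
    have := he 0 0
    convert this
    ext v
    simp
  | add x y hx hy =>
    rw [map_add]
    exact ha _ _ hx hy
  | tmul ξ s =>
    convert he ξ s
    ext v
    simp

/-- The divergence is a `1`-cocycle. -/
theorem Der.div_lie (f g : Der O V) :
    Der.div ⁅f, g⁆ = Der.act f (Der.div g) - Der.act g (Der.div f) := by
  induction f using Der.ind with
  | ha a b ha hb =>
    simp only [add_lie, map_add, LinearMap.add_apply, ha, hb]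
    abel
  | he ξ s =>
    induction g using Der.ind with
    | ha a b ha hb =>
      simp only [lie_add, map_add, LinearMap.add_apply, ha, hb]
      abel
    | he η u =>
      have key : ∀ (ξ η : Module.Dual k V) (s u : Sch O.sp V),
          Sch.map (wheelPi O) LinearMap.id (Sch.cov η (Der.ad (Der.elem ξ s) u))
            = Der.act (Der.elem ξ s) (Der.div (Der.elem η u))
              + Sch.map (wheelPi O) LinearMap.id
                (Sch.insMark O.comp (Sch.cov ξ u) (Sch.cov η s)) := by
        intro ξ η s u
        have h1 : Der.ad (Der.elem ξ s) u = Sch.insert O.comp (Sch.cov ξ u) s :=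
          Der.ad_elem _ _ _
        rw [Der.act_elem, Der.div_elem]
        have h2 : Sch.cov ξ (Sch.map (wheelPi O) LinearMap.id (Sch.cov η u))
            = Sch.map (wheelPi O).deriv LinearMap.id (Sch.cov ξ (Sch.cov η u)) := by
          rw [Sch.cov_map, LinearMap.comp_id]
        have h3 := Sch.map_insert (wheelPi_compat O) LinearMap.id (Sch.cov ξ (Sch.cov η u)) s
        rw [Sch.map_id] at h3
        have h4 := congrArg (Sch.map (wheelPi O) LinearMap.id) (Sch.cov_insert O.comp η
          (Sch.cov ξ u) s)
        rw [map_add, Sch.cov_cov] at h4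
        refine (congrArg (fun w => Sch.map (wheelPi O) LinearMap.id (Sch.cov η w)) h1).trans ?_
        refine h4.trans ?_
        exact congrArg (fun w => w + Sch.map (wheelPi O) LinearMap.id
            (Sch.insMark O.comp (Sch.cov ξ u) (Sch.cov η s)))
          (h3.trans (congrArg (fun w => Sch.insert (P := wheelSp O) (wheel O).act w s) h2.symm))
      rw [Der.lie_elem, map_sub, Der.div_elem, Der.div_elem, key, key, wheelPi_insMark]
      abel

section Functoriality

variable {V W : Type u} [AddCommGroup V] [Module k V] [AddCommGroup W] [Module k W]
  (i : V →ₗ[k] W) (p : W →ₗ[k] V)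

variable (O) in
/-- Functoriality of `Der(O(V)) = Hom(V, O(V))` for a pair of maps `i : V → W`, `p : W → V`. -/
def Der.map : Der O V →ₗ[k] Der O W :=
  Der.toMap.symm.toLinearMap ∘ₗ LinearMap.lcomp k _ p ∘ₗ
    LinearMap.llcomp k V _ _ (Sch.map (SpMap.id O.sp) i) ∘ₗ Der.toMap.toLinearMap

@[simp]
theorem Der.map_apply (f : Der O V) (w : W) :
    (Der.map O i p f) w = Sch.map (SpMap.id O.sp) i (f (p w)) := rfl

variable {i p} (h : ∀ v, p (i v) = v)

theorem Der.map_ad (h : ∀ v, p (i v) = v) (f : Der O V) (s : Sch O.sp V) :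
    Sch.map (SpMap.id O.sp) i (Der.ad f s)
      = Der.ad (Der.map O i p f) (Sch.map (SpMap.id O.sp) i s) := by
  have hc : InsCompat O.comp O.comp (SpMap.id O.sp) (SpMap.id O.sp) := fun _ _ => rfl
  exact Sch.map_derivExt hc i f.toMap (Der.map O i p f).toMap
    (fun v => by rw [Der.map_apply, h]) s

theorem Der.map_act (h : ∀ v, p (i v) = v) (f : Der O V) (s : Sch (wheelSp O) V) :
    Sch.map (SpMap.id (wheelSp O)) i (Der.act f s)
      = Der.act (Der.map O i p f) (Sch.map (SpMap.id (wheelSp O)) i s) := by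
  have hc : InsCompat (P := wheelSp O) (Q := wheelSp O) (wheel O).act (wheel O).act
    (SpMap.id (wheelSp O)) (SpMap.id O.sp) := fun _ _ => rfl
  exact Sch.map_derivExt hc i f.toMap (Der.map O i p f).toMap
    (fun v => by rw [Der.map_apply, h]) s

theorem Der.map_lie (h : ∀ v, p (i v) = v) (f g : Der O V) :
    Der.map O i p ⁅f, g⁆ = ⁅Der.map O i p f, Der.map O i p g⁆ := by
  ext w
  rw [Der.map_apply, Der.bracket_apply, Der.bracket_apply, map_sub, Der.map_ad h, Der.map_ad h]
  rfl

theorem Der.map_elem (ξ : Module.Dual k V) (s : Sch O.sp V) :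
    Der.map O i p (Der.elem ξ s) = Der.elem (ξ ∘ₗ p) (Sch.map (SpMap.id O.sp) i s) := by
  ext w
  simp

theorem Der.map_div [FiniteDimensional k V] [FiniteDimensional k W] (h : ∀ v, p (i v) = v)
    (f : Der O V) :
    Sch.map (SpMap.id (wheelSp O)) i (Der.div f) = Der.div (Der.map O i p f) := by
  induction f using Der.ind with
  | ha a b ha hb => simp only [map_add, ha, hb]
  | he ξ s =>
    rw [Der.map_elem, Der.div_elem, Der.div_elem, Sch.cov_map]
    have h1 : (ξ ∘ₗ p) ∘ₗ i = ξ := by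
      ext v
      simp [h]
    rw [h1, Sch.map_map (wheelPi O) (SpMap.id _) (wheelPi O) LinearMap.id i (fun _ _ _ => rfl)]
    rw [Sch.map_map (SpMap.id O.sp).deriv (wheelPi O) (wheelPi O) i LinearMap.id
      (fun _ _ _ => rfl), LinearMap.comp_id, LinearMap.id_comp]

end Functoriality

end Der

section Functors

variable {k : Type u} [Field k] (O : Operad k)

/-- The differential graded Lie algebra `Der(O(V)) ⊕ s⁻¹|∂O(V)|`: the semi-direct product, with
the divergence as differential. -/
def derWheelObj (V : Spmon k) : DGLie k where
  deg0 := Der O V.carrier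
  degNeg := Sch (wheelSp O) V.carrier
  act := Der.act
  act_lie := Der.act_lie
  diff := Der.div
  diff_lie := Der.div_lie

/-- The functor `V ↦ Der(O(V)) ⊕ s⁻¹|∂O(V)|` on split monomorphisms. -/
def derWheel : Spmon k ⥤ DGLie k where
  obj V := derWheelObj O V
  map {V W} h :=
    { map0 := Der.map O (Spmon.inj h) (Spmon.ret h)
      mapNeg := Sch.map (SpMap.id (wheelSp O)) (Spmon.inj h)
      map_lie := Der.map_lie (Spmon.ret_inj h)
      map_act := Der.map_act (Spmon.ret_inj h)
      map_diff := Der.map_div (Spmon.ret_inj h) }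
  map_id V := by
    apply DGLie.Hom.ext
    · exact LinearMap.ext fun (f : Der O V.carrier) => Der.ext fun v => Sch.map_id (f v)
    · exact LinearMap.ext fun s => Sch.map_id s
  map_comp {V W X} h h' := by
    apply DGLie.Hom.ext
    · exact LinearMap.ext fun (f : Der O V.carrier) => Der.ext fun x =>
        (Sch.map_map (SpMap.id O.sp) (SpMap.id O.sp) (SpMap.id O.sp) (Spmon.inj h)
          (Spmon.inj h') (fun _ _ _ => rfl) (f (Spmon.ret h (Spmon.ret h' x)))).symm
    · exact LinearMap.ext fun s =>
        (Sch.map_map (SpMap.id (wheelSp O)) (SpMap.id (wheelSp O)) (SpMap.id (wheelSp O))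
          (Spmon.inj h) (Spmon.inj h') (fun _ _ _ => rfl) s).symm

/-- The Lie algebra `Der(O(V))`, as a differential graded Lie algebra with zero differential. -/
def derPlainObj (V : Spmon k) : DGLie k where
  deg0 := Der O V.carrier
  degNeg := PUnit
  act := 0
  act_lie _ _ _ := rfl
  diff := 0
  diff_lie _ _ := rfl

/-- The functor `V ↦ Der(O(V))` on split monomorphisms. -/
def derPlain : Spmon k ⥤ DGLie k where
  obj V := derPlainObj O V
  map {V W} h :=
    { map0 := Der.map O (Spmon.inj h) (Spmon.ret h)
      mapNeg := 0
      map_lie := Der.map_lie (Spmon.ret_inj h)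
      map_act _ _ := rfl
      map_diff _ := rfl }
  map_id V := by
    apply DGLie.Hom.ext
    · exact LinearMap.ext fun (f : Der O V.carrier) => Der.ext fun v => Sch.map_id (f v)
    · exact LinearMap.ext fun s => Subsingleton.elim (α := PUnit) _ _
  map_comp {V W X} h h' := by
    apply DGLie.Hom.ext
    · exact LinearMap.ext fun (f : Der O V.carrier) => Der.ext fun x =>
        (Sch.map_map (SpMap.id O.sp) (SpMap.id O.sp) (SpMap.id O.sp) (Spmon.inj h)
          (Spmon.inj h') (fun _ _ _ => rfl) (f (Spmon.ret h (Spmon.ret h' x)))).symm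
    · exact LinearMap.ext fun s => Subsingleton.elim (α := PUnit) _ _

/-- The morphism `Der(O(V)) ⊕ s⁻¹|∂O(V)| → Der(O(V))` that sends `s⁻¹|∂O(V)|` to zero. -/
def derProj : derWheel O ⟶ derPlain O where
  app V :=
    { map0 := LinearMap.id
      mapNeg := 0
      map_lie _ _ := rfl
      map_act _ _ := rfl
      map_diff _ := rfl }
  naturality V W h := by
    apply DGLie.Hom.ext
    · rfl
    · exact LinearMap.ext fun s => Subsingleton.elim (α := PUnit) _ _

end Functors

/-- A functor with values in chain complexes, as a chain complex of functors. -/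
def complexOfFunctors {C D : Type*} [Category C] [Category D] [Limits.HasZeroMorphisms D]
    (F : C ⥤ ChainComplex D ℕ) : ChainComplex (C ⥤ D) ℕ where
  X n := F ⋙ HomologicalComplex.eval D _ n
  d i j :=
    { app V := (F.obj V).d i j
      naturality V W f := (F.map f).comm i j }
  shape i j h := by
    ext V
    exact (F.obj V).shape i j h
  d_comp_d' i j l _ _ := by
    ext V
    exact (F.obj V).d_comp_d i j l

/-- A natural transformation of functors with values in chain complexes, as a morphism of complexes
of functors. -/
def complexOfFunctorsMap {C D : Type*} [Category C] [Category D] [Limits.HasZeroMorphisms D]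
    {F G : C ⥤ ChainComplex D ℕ} (θ : F ⟶ G) : complexOfFunctors F ⟶ complexOfFunctors G where
  f n := Functor.whiskerRight θ (HomologicalComplex.eval D _ n)
  comm' i j _ := by
    ext V
    exact (θ.app V).comm i j

section CE

variable {k : Type u} [Field k] (O : Operad k)

/-- The Chevalley–Eilenberg complex `Λ^* Der(O(V)) ⊗ S^* |∂O(V)|` of the differential graded Lie
algebra `Der(O(V)) ⊕ s⁻¹|∂O(V)|`, as a complex of functors of `V`. -/
def ceWheel : ChainComplex (Spmon k ⥤ ModuleCat.{u} k) ℕ :=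
  complexOfFunctors (derWheel O ⋙ DGLie.ceFunctor k)

/-- The Chevalley–Eilenberg complex `Λ^* Der(O(V))` of the Lie algebra `Der(O(V))`, as a complex of
functors of `V`. -/
def cePlain : ChainComplex (Spmon k ⥤ ModuleCat.{u} k) ℕ :=
  complexOfFunctors (derPlain O ⋙ DGLie.ceFunctor k)

/-- The morphism of Chevalley–Eilenberg complexes
`Λ^* Der(O(V)) ⊗ S^* |∂O(V)| → Λ^* Der(O(V))`. -/
def ceProj : ceWheel O ⟶ cePlain O :=
  complexOfFunctorsMap (Functor.whiskerRight (derProj O) (DGLie.ceFunctor k))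

end CE

section Bimodules

variable {k : Type u} [Field k]

/-- A species as a bimodule supported on pairs `(X, Y)` where `Y` has `n` elements, with
trivial action of the bijections of `Y`. -/
def Species.bimod (P : Species k) (n : ℕ) : FBMod k :=
  FBMod.ofData (fun X Y _ _ => PLift (Nat.card Y = n) → P.at' X)
    (fun e e' => LinearMap.pi fun h =>
      P.relabel e ∘ₗ LinearMap.proj ⟨(Nat.card_congr e').trans h.down⟩)
    (by
      intro X Y _ _
      exact LinearMap.ext fun f => funext fun h => Species.relabel_refl P (X := X) (f h))
    (by
      intro X Y X' Y' X'' Y'' _ _ _ _ _ _ e e' f f'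
      exact LinearMap.ext fun g => funext fun h =>
        (Species.relabel_relabel P e f (g _)).symm)

/-- The element of the bimodule given by an element of the species. -/
def Species.elt (P : Species k) (n : ℕ) {X : Type} [Finite X] (a : P.at' X) :
    (P.bimod n).at' X (Fin n) :=
  fun _ : PLift (Nat.card (Fin n) = n) => a

variable (O : Operad k)

/-- The operad as a bimodule, supported on pairs `(X, Y)` where `Y` has one element (the root). -/
abbrev Operad.bimod : FBMod k := O.sp.bimod 1

/-- The bimodule `|δ_{1,1}O|`, supported on pairs `(X, ∅)`. -/
abbrev Operad.wheelBimod : FBMod k := (wheelSp O).bimod 0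

/-- The bimodule `Λ^* O`. -/
abbrev Operad.extBimod : FBMod k := powAlg O.bimod (-1)

/-- The bimodule `Λ^* O ⊚ S^* |δ_{1,1}O|`. -/
abbrev Operad.extSymBimod : FBMod k := Conv O.extBimod (powAlg O.wheelBimod 1)

/-- The element `t ⊗ s` of `Λ^* O ⊚ S^* |δ_{1,1}O|` given by `t` in `O^{⊚ d}` and `s`
in `|δ_{1,1}O|^{⊚ r}`. -/
def Operad.elt {d r : ℕ} {X₁ X₂ Y₁ Y₂ X Y : Type} [Finite X₁] [Finite X₂] [Finite Y₁] [Finite Y₂]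
    [Finite X] [Finite Y] (e : X₁ ⊕ X₂ ≃ X) (e' : Y₁ ⊕ Y₂ ≃ Y)
    (t : (convPow O.bimod d).at' X₁ Y₁) (s : (convPow O.wheelBimod r).at' X₂ Y₂) :
    O.extSymBimod.at' X Y :=
  convMk _ _ e e' (powMk _ _ t) (powMk _ _ s)

end Bimodules

section Labels

variable (A B C D E : Type)

/-- Labels for the contraction of an input and the root of the same operation. -/
def loopEquiv : ((A ⊕ Fin 1) ⊕ B) ⊕ C ≃ (B ⊕ (A ⊕ C)) ⊕ Fin 1 where
  toFun
    | .inl (.inl (.inl a)) => .inl (.inr (.inl a))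
    | .inl (.inl (.inr x)) => .inr x
    | .inl (.inr b) => .inl (.inl b)
    | .inr c => .inl (.inr (.inr c))
  invFun
    | .inl (.inr (.inl a)) => .inl (.inl (.inl a))
    | .inr x => .inl (.inl (.inr x))
    | .inl (.inl b) => .inl (.inr b)
    | .inl (.inr (.inr c)) => .inr c
  left_inv := by rintro (((_ | _) | _) | _) <;> rfl
  right_inv := by rintro ((_ | (_ | _)) | _) <;> rfl

def loopRootEquiv : (Fin 1 ⊕ B) ⊕ C ≃ (B ⊕ (Fin 0 ⊕ C)) ⊕ Fin 1 where
  toFun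
    | .inl (.inl y) => .inr y
    | .inl (.inr b) => .inl (.inl b)
    | .inr c => .inl (.inr (.inr c))
  invFun
    | .inr y => .inl (.inl y)
    | .inl (.inl b) => .inl (.inr b)
    | .inl (.inr (.inr c)) => .inr c
  left_inv := by rintro ((_ | _) | _) <;> rfl
  right_inv := by rintro ((_ | (i | _)) | _) <;> first | rfl | exact i.elim0

/-- Labels for the contraction of an input of an operation and the root of another one. -/
def treeEquiv : (B ⊕ ((A ⊕ Fin 1) ⊕ C)) ⊕ D ≃ (((A ⊕ B) ⊕ C) ⊕ D) ⊕ Fin 1 where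
  toFun
    | .inl (.inl b) => .inl (.inl (.inl (.inr b)))
    | .inl (.inr (.inl (.inl a))) => .inl (.inl (.inl (.inl a)))
    | .inl (.inr (.inl (.inr x))) => .inr x
    | .inl (.inr (.inr c)) => .inl (.inl (.inr c))
    | .inr d => .inl (.inr d)
  invFun
    | .inl (.inl (.inl (.inr b))) => .inl (.inl b)
    | .inl (.inl (.inl (.inl a))) => .inl (.inr (.inl (.inl a)))
    | .inr x => .inl (.inr (.inl (.inr x)))
    | .inl (.inl (.inr c)) => .inl (.inr (.inr c))
    | .inl (.inr d) => .inr d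
  left_inv := by rintro ((_ | ((_ | _) | _)) | _) <;> rfl
  right_inv := by rintro ((((_ | _) | _) | _) | _) <;> rfl

def treeRootEquiv : (Fin 1 ⊕ (Fin 1 ⊕ C)) ⊕ D ≃ ((Fin 1 ⊕ C) ⊕ D) ⊕ Fin 1 where
  toFun
    | .inl (.inl y) => .inr y
    | .inl (.inr z) => .inl (.inl z)
    | .inr d => .inl (.inr d)
  invFun
    | .inr y => .inl (.inl y)
    | .inl (.inl z) => .inl (.inr z)
    | .inl (.inr d) => .inr d
  left_inv := by rintro ((_ | _) | _) <;> rfl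
  right_inv := by rintro ((_ | _) | _) <;> rfl

/-- Labels for the contraction of an input of a wheel and the root of an operation. -/
def wheelEquiv : (B ⊕ C) ⊕ ((A ⊕ Fin 1) ⊕ D) ≃ (C ⊕ ((A ⊕ B) ⊕ D)) ⊕ Fin 1 where
  toFun
    | .inl (.inl b) => .inl (.inr (.inl (.inr b)))
    | .inl (.inr c) => .inl (.inl c)
    | .inr (.inl (.inl a)) => .inl (.inr (.inl (.inl a)))
    | .inr (.inl (.inr x)) => .inr x
    | .inr (.inr d) => .inl (.inr (.inr d))
  invFun
    | .inl (.inr (.inl (.inr b))) => .inl (.inl b)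
    | .inl (.inl c) => .inl (.inr c)
    | .inl (.inr (.inl (.inl a))) => .inr (.inl (.inl a))
    | .inr x => .inr (.inl (.inr x))
    | .inl (.inr (.inr d)) => .inr (.inr d)
  left_inv := by rintro ((_ | _) | ((_ | _) | _)) <;> rfl
  right_inv := by rintro ((_ | ((_ | _) | _)) | _) <;> rfl

def wheelRootEquiv : (Fin 1 ⊕ C) ⊕ (Fin 0 ⊕ D) ≃ (C ⊕ (Fin 0 ⊕ D)) ⊕ Fin 1 where
  toFun
    | .inl (.inl y) => .inr y
    | .inl (.inr c) => .inl (.inl c)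
    | .inr z => .inl (.inr z)
  invFun
    | .inr y => .inl (.inl y)
    | .inl (.inl c) => .inl (.inr c)
    | .inl (.inr z) => .inr z
  left_inv := by rintro ((_ | _) | _) <;> rfl
  right_inv := by rintro ((_ | _) | _) <;> rfl

end Labels

/-- The surjection of `(kdwb)_-`-modules `Λ^* O ⊚ S^* |δ_{1,1}O| → Λ^* O`: the modules are
functors `M`, `N` on `(kdwb)_-` with the given underlying bimodules, and the contraction of a pair
`(x, y)` is the sum of the terms where the root `y` of an operation `b`
is grafted on the input `x` of an operation (by the composition) or of a wheel (by the action `α`),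
or closed up with an input of `b` itself (by the projection `π`). The contractions and
the bijections generate `(kdwb)_-`, so that the formulas `map_loop`, `map_tree`, `map_wheel`
determine `M` up to a unique isomorphism over the identity of the underlying bimodule. -/
structure OperadModules {k : Type u} [Field k] (O : Operad k) where
  M : Dwb (-1 : k) ⥤ ModuleCat.{u} k
  N : Dwb (-1 : k) ⥤ ModuleCat.{u} k
  [additiveM : M.Additive]
  [linearM : M.Linear k]
  [additiveN : N.Additive]
  [linearN : N.Linear k]
  eM : ∀ (X Y : Type) [Finite X] [Finite Y], M.obj ⟨wall X Y⟩ ≃ₗ[k] O.extSymBimod.at' X Y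
  eN : ∀ (X Y : Type) [Finite X] [Finite Y], N.obj ⟨wall X Y⟩ ≃ₗ[k] O.extBimod.at' X Y
  eM_relabel : ∀ {X Y X' Y' : Type} [Finite X] [Finite Y] [Finite X'] [Finite Y'] (e : X ≃ X')
    (e' : Y ≃ Y') (m : M.obj ⟨wall X Y⟩),
    eM X' Y' (M.map (Dwb.of (P := ⟨wall X Y⟩) (Q := ⟨wall X' Y'⟩) (bijHom e e')) m)
      = O.extSymBimod.relabel e e' (eM X Y m)
  eN_relabel : ∀ {X Y X' Y' : Type} [Finite X] [Finite Y] [Finite X'] [Finite Y'] (e : X ≃ X')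
    (e' : Y ≃ Y') (n : N.obj ⟨wall X Y⟩),
    eN X' Y' (N.map (Dwb.of (P := ⟨wall X Y⟩) (Q := ⟨wall X' Y'⟩) (bijHom e e')) n)
      = O.extBimod.relabel e e' (eN X Y n)
  /-- `a ∧ t ⊗ s ↦ t ⊗ π(a) s`, for the contraction of the root of `a` with its input `*`. -/
  map_loop : ∀ {d r : ℕ} {A X₁ X₂ Y₁ Y₂ : Type} [Finite A] [Finite X₁] [Finite X₂] [Finite Y₁]
    [Finite Y₂] (a : O.sp.at' (A ⊕ Fin 1)) (t : (convPow O.bimod d).at' X₁ Y₁)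
    (s : (convPow O.wheelBimod r).at' X₂ Y₂),
    eM _ _ (M.map (Dwb.of (Q := ⟨wall (X₁ ⊕ (A ⊕ X₂)) (Y₁ ⊕ (Fin 0 ⊕ Y₂))⟩) (contrHom _ _))
      ((eM _ _).symm (O.elt (loopEquiv A X₁ X₂) (loopRootEquiv Y₁ Y₂)
        (powCons O.bimod d (Equiv.refl _) (Equiv.refl _) (O.sp.elt 1 a) t) s)))
      = O.elt (Equiv.refl _) (Equiv.refl _) t
        (powCons O.wheelBimod r (Equiv.refl _) (Equiv.refl _)
          ((wheelSp O).elt 0 (wheelProj O A a)) s)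
  /-- `b ∧ a ∧ t ⊗ s ↦ (a ∘ b) ∧ t ⊗ s`, for the contraction of the root of `b` with the
  input `*` of `a`. -/
  map_tree : ∀ {d r : ℕ} {A B X₁ X₂ Y₁ Y₂ : Type} [Finite A] [Finite B] [Finite X₁] [Finite X₂]
    [Finite Y₁] [Finite Y₂] (a : O.sp.at' (A ⊕ Fin 1)) (b : O.sp.at' B)
    (t : (convPow O.bimod d).at' X₁ Y₁) (s : (convPow O.wheelBimod r).at' X₂ Y₂),
    eM _ _ (M.map (Dwb.of
        (Q := ⟨wall (((A ⊕ B) ⊕ X₁) ⊕ X₂) ((Fin 1 ⊕ Y₁) ⊕ Y₂)⟩) (contrHom _ _))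
      ((eM _ _).symm (O.elt (treeEquiv A B X₁ X₂) (treeRootEquiv Y₁ Y₂)
        (powCons O.bimod (d + 1) (Equiv.refl _) (Equiv.refl _) (O.sp.elt 1 b)
          (powCons O.bimod d (Equiv.refl _) (Equiv.refl _) (O.sp.elt 1 a) t)) s)))
      = O.elt (Equiv.refl _) (Equiv.refl _)
        (powCons O.bimod d (Equiv.refl _) (Equiv.refl _) (O.sp.elt 1 (O.comp.ins a b)) t) s
  /-- `b ∧ t ⊗ w s ↦ t ⊗ α(w, b) s`, for the contraction of the root of `b` with the
  input `*` of `w`. -/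
  map_wheel : ∀ {d r : ℕ} {A B X₁ X₂ Y₁ Y₂ : Type} [Finite A] [Finite B] [Finite X₁] [Finite X₂]
    [Finite Y₁] [Finite Y₂] (w : (wheelSp O).at' (A ⊕ Fin 1)) (b : O.sp.at' B)
    (t : (convPow O.bimod d).at' X₁ Y₁) (s : (convPow O.wheelBimod r).at' X₂ Y₂),
    eM _ _ (M.map (Dwb.of
        (Q := ⟨wall (X₁ ⊕ ((A ⊕ B) ⊕ X₂)) (Y₁ ⊕ (Fin 0 ⊕ Y₂))⟩) (contrHom _ _))
      ((eM _ _).symm (O.elt (wheelEquiv A B X₁ X₂) (wheelRootEquiv Y₁ Y₂)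
        (powCons O.bimod d (Equiv.refl _) (Equiv.refl _) (O.sp.elt 1 b) t)
        (powCons O.wheelBimod r (Equiv.refl _) (Equiv.refl _) ((wheelSp O).elt 0 w) s))))
      = O.elt (Equiv.refl _) (Equiv.refl _) t
        (powCons O.wheelBimod r (Equiv.refl _) (Equiv.refl _)
          ((wheelSp O).elt 0 ((wheel O).act.ins w b)) s)
  /-- The projection `Λ^* O ⊚ S^* |δ_{1,1}O| → Λ^* O ⊚ S^0 |δ_{1,1}O| = Λ^* O`. -/
  p : M ⟶ N
  p_zero : ∀ {d : ℕ} {X₁ X₂ Y₁ Y₂ X Y : Type} [Finite X₁] [Finite X₂] [Finite Y₁] [Finite Y₂]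
    [Finite X] [Finite Y] [IsEmpty X₂] [IsEmpty Y₂] (e : X₁ ⊕ X₂ ≃ X) (e' : Y₁ ⊕ Y₂ ≃ Y)
    (t : (convPow O.bimod d).at' X₁ Y₁) (c : k),
    eN X Y (p.app _ ((eM X Y).symm (O.elt (r := 0) e e' t
        (fun _ : PLift (IsEmpty X₂ ∧ IsEmpty Y₂) => c))))
      = c • powMk O.bimod (-1) ((convPow O.bimod d).relabel
        ((Equiv.sumEmpty X₁ X₂).symm.trans e) ((Equiv.sumEmpty Y₁ Y₂).symm.trans e') t)
  p_succ : ∀ {d r : ℕ} {X₁ X₂ Y₁ Y₂ X Y : Type} [Finite X₁] [Finite X₂] [Finite Y₁] [Finite Y₂]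
    [Finite X] [Finite Y] (e : X₁ ⊕ X₂ ≃ X) (e' : Y₁ ⊕ Y₂ ≃ Y)
    (t : (convPow O.bimod d).at' X₁ Y₁) (s : (convPow O.wheelBimod (r + 1)).at' X₂ Y₂),
    p.app _ ((eM X Y).symm (O.elt e e' t s)) = 0

/-- A functor on split monomorphisms is algebraic if it is a subquotient of a direct sum of mixed
tensor functors `T^{m,n}`. -/
def IsAlgebraic {k : Type u} [Field k] (F : Spmon k ⥤ ModuleCat.{u} k) : Prop :=
  ∃ (ι : Type u) (m n : ι → ℕ) (G : Spmon k ⥤ ModuleCat.{u} k)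
    (i : G ⟶ ∐ fun x => mixedTensor k (m x) (n x)) (q : G ⟶ F), Mono i ∧ Epi q

end KWB

end

noncomputable section

namespace KWB

section MixedTensors

variable {k : Type u} [Field k] {V U V' U' : Type u} [AddCommGroup V] [Module k V]
  [AddCommGroup U] [Module k U] [AddCommGroup V'] [Module k V'] [AddCommGroup U'] [Module k U']

variable (k V U) in
/-- The mixed tensors `V^{⊗ X} ⊗ U^{⊗ Y}`. -/
abbrev MTU (X Y : Type) : Type u := (⨂[k] _ : X, V) ⊗[k] (⨂[k] _ : Y, U)

variable (k) in
/-- Pure mixed tensors. -/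
def mtu {X Y : Type} (v : X → V) (ξ : Y → U) : MTU k V U X Y :=
  PiTensorProduct.tprod k v ⊗ₜ[k] PiTensorProduct.tprod k ξ

theorem mtu_ext {X Y : Type} {N : Type*} [AddCommMonoid N] [Module k N]
    {f g : MTU k V U X Y →ₗ[k] N} (h : ∀ v ξ, f (mtu k v ξ) = g (mtu k v ξ)) : f = g := by
  apply TensorProduct.ext
  apply PiTensorProduct.ext
  ext v : 1
  apply PiTensorProduct.ext
  ext ξ
  exact h v ξ

/-- Relabelling of mixed tensors. -/
def mtuReindex {X Y X' Y' : Type} (e : X ≃ X') (e' : Y ≃ Y') :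
    MTU k V U X Y →ₗ[k] MTU k V U X' Y' :=
  TensorProduct.map (PiTensorProduct.reindex k (fun _ => V) e).toLinearMap
    (PiTensorProduct.reindex k (fun _ => U) e').toLinearMap

theorem mtuReindex_mtu {X Y X' Y' : Type} (e : X ≃ X') (e' : Y ≃ Y') (v : X → V) (ξ : Y → U) :
    mtuReindex e e' (mtu k v ξ) = mtu k (v ∘ e.symm) (ξ ∘ e'.symm) := by
  simp only [mtuReindex, mtu, TensorProduct.map_tmul, LinearEquiv.coe_coe,
    PiTensorProduct.reindex_tprod]
  rfl

/-- The product of mixed tensors. -/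
def mtuMul (X₁ Y₁ X₂ Y₂ : Type) : MTU k V U X₁ Y₁ ⊗[k] MTU k V U X₂ Y₂ ≃ₗ[k]
    MTU k V U (X₁ ⊕ X₂) (Y₁ ⊕ Y₂) :=
  (TensorProduct.tensorTensorTensorComm k _ _ _ _).trans
    (TensorProduct.congr (PiTensorProduct.tmulEquiv k V) (PiTensorProduct.tmulEquiv k U))

theorem mtuMul_mtu {X₁ Y₁ X₂ Y₂ : Type} (v : X₁ → V) (ξ : Y₁ → U) (v' : X₂ → V) (ξ' : Y₂ → U) :
    mtuMul X₁ Y₁ X₂ Y₂ (mtu k v ξ ⊗ₜ mtu k v' ξ') = mtu k (Sum.elim v v') (Sum.elim ξ ξ') := by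
  simp [mtuMul, mtu]

/-- The decomposition of a set into the fibres of a two-colouring. -/
def fibSum {X : Type} (p : X → Bool) : Fib p true ⊕ Fib p false ≃ X where
  toFun := Sum.elim Subtype.val Subtype.val
  invFun x := if h : p x = true then Sum.inl ⟨x, h⟩ else Sum.inr ⟨x, by simpa using h⟩
  left_inv := by rintro (⟨x, h⟩ | ⟨x, h⟩) <;> simp [h]
  right_inv x := by by_cases h : p x = true <;> simp [h]

/-- The splitting of mixed tensors along a decomposition of the labels. -/
def mtuSplit {X Y : Type} (p : X → Bool) (q : Y → Bool) : MTU k V U X Y →ₗ[k]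
    MTU k V U (Fib p true) (Fib q true) ⊗[k] MTU k V U (Fib p false) (Fib q false) :=
  (mtuMul _ _ _ _).symm.toLinearMap ∘ₗ mtuReindex (fibSum p).symm (fibSum q).symm

theorem mtuSplit_mtu {X Y : Type} (p : X → Bool) (q : Y → Bool) (v : X → V) (ξ : Y → U) :
    mtuSplit p q (mtu k v ξ) = mtu k (fun x : Fib p true => v x) (fun y : Fib q true => ξ y) ⊗ₜ
      mtu k (fun x : Fib p false => v x) (fun y : Fib q false => ξ y) := by
  rw [mtuSplit, LinearMap.comp_apply, mtuReindex_mtu, LinearEquiv.coe_coe,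
    LinearEquiv.symm_apply_eq, mtuMul_mtu]
  congr 1 <;> funext x <;> rcases x with x | x <;> rfl

end MixedTensors

section Evaluations

variable {k : Type u} [Field k]

/-- A natural family of maps `F(X,Y) ⊗ V^{⊗ X} ⊗ U^{⊗ Y} → A`. -/
structure Ev (F : FBMod k) (V U A : Type u) [AddCommGroup V] [Module k V] [AddCommGroup U]
    [Module k U] [AddCommGroup A] [Module k A] where
  app : ∀ (X Y : Type) [Finite X] [Finite Y], F.at' X Y →ₗ[k] MTU k V U X Y →ₗ[k] A
  nat : ∀ {X Y X' Y' : Type} [Finite X] [Finite Y] [Finite X'] [Finite Y'] (e : X ≃ X')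
    (e' : Y ≃ Y') (a : F.at' X Y) (v : X' → V) (ξ : Y' → U),
    app X' Y' (F.relabel e e' a) (mtu k v ξ) = app X Y a (mtu k (v ∘ e) (ξ ∘ e'))

namespace Ev

variable {F G : FBMod k} {V U A B : Type u} [AddCommGroup V] [Module k V] [AddCommGroup U]
  [Module k U] [AddCommGroup A] [Module k A] [AddCommGroup B] [Module k B]

/-- The value of a natural family on pure tensors. -/
def val (φ : Ev F V U A) {X Y : Type} [Finite X] [Finite Y] (a : F.at' X Y) (v : X → V)
    (ξ : Y → U) : A := φ.app X Y a (mtu k v ξ)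

/-- The value of a natural family on pure tensors, as a linear map. -/
def valₗ (φ : Ev F V U A) {X Y : Type} [Finite X] [Finite Y] (v : X → V)
    (ξ : Y → U) : F.at' X Y →ₗ[k] A := (φ.app X Y).flip (mtu k v ξ)

theorem valₗ_apply (φ : Ev F V U A) {X Y : Type} [Finite X] [Finite Y] (v : X → V)
    (ξ : Y → U) (a : F.at' X Y) : φ.valₗ v ξ a = φ.val a v ξ := rfl

theorem val_relabel (φ : Ev F V U A) {X Y X' Y' : Type} [Finite X] [Finite Y] [Finite X']
    [Finite Y'] (e : X ≃ X') (e' : Y ≃ Y') (a : F.at' X Y) (v : X' → V) (ξ : Y' → U) :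
    φ.val (F.relabel e e' a) v ξ = φ.val a (v ∘ e) (ξ ∘ e') := φ.nat e e' a v ξ

@[simp] theorem val_add (φ : Ev F V U A) {X Y : Type} [Finite X] [Finite Y] (a b : F.at' X Y)
    (v : X → V) (ξ : Y → U) : φ.val (a + b) v ξ = φ.val a v ξ + φ.val b v ξ := by simp [val]

@[simp] theorem val_smul (φ : Ev F V U A) {X Y : Type} [Finite X] [Finite Y] (c : k)
    (a : F.at' X Y) (v : X → V) (ξ : Y → U) : φ.val (c • a) v ξ = c • φ.val a v ξ := by simp [val]

@[simp] theorem val_zero (φ : Ev F V U A) {X Y : Type} [Finite X] [Finite Y]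
    (v : X → V) (ξ : Y → U) : φ.val (0 : F.at' X Y) v ξ = 0 := by simp [val]

theorem val_neg (φ : Ev F V U A) {X Y : Type} [Finite X] [Finite Y] (a : F.at' X Y)
    (v : X → V) (ξ : Y → U) : φ.val (-a) v ξ = -φ.val a v ξ := by simp [val]

/-- Composition with a linear map. -/
def comp (φ : Ev F V U A) (f : A →ₗ[k] B) : Ev F V U B where
  app X Y _ _ := (φ.app X Y).compr₂ f
  nat e e' a v ξ := congrArg f (φ.nat e e' a v ξ)

theorem comp_val (φ : Ev F V U A) (f : A →ₗ[k] B) {X Y : Type} [Finite X] [Finite Y]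
    (a : F.at' X Y) (v : X → V) (ξ : Y → U) : (φ.comp f).val a v ξ = f (φ.val a v ξ) := rfl

open Classical in
/-- The product of two natural families on the Day convolution product, on a pair of sets. -/
def convApp (φ : Ev F V U A) (ψ : Ev G V U B) (X Y : Type) [Finite X] [Finite Y] :
    ConvObj F G X Y →ₗ[k] MTU k V U X Y →ₗ[k] A ⊗[k] B :=
  DirectSum.toModule k _ _ fun c => (LinearMap.lcomp k _ (mtuSplit c.1 c.2)) ∘ₗ
    TensorProduct.lift ((TensorProduct.mapBilinear (RingHom.id k) _ _ A B).compl₁₂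
      (φ.app (Fib c.1 true) (Fib c.2 true)) (ψ.app (Fib c.1 false) (Fib c.2 false)))

theorem convApp_of (φ : Ev F V U A) (ψ : Ev G V U B) {X Y : Type} [Finite X] [Finite Y]
    (p : X → Bool) (q : Y → Bool) (a b) (v : X → V) (ξ : Y → U) :
    convApp φ ψ X Y (convOf F G p q a b) (mtu k v ξ)
      = φ.val a (fun x : Fib p true => v x) (fun y : Fib q true => ξ y)
        ⊗ₜ ψ.val b (fun x : Fib p false => v x) (fun y : Fib q false => ξ y) := by
  simp only [convApp, convOf, LinearMap.compr₂_apply, DirectSum.toModule_lof,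
    LinearMap.comp_apply, LinearMap.lcomp_apply, TensorProduct.mk_apply, mtuSplit_mtu,
    TensorProduct.lift.tmul, LinearMap.compl₁₂_apply, TensorProduct.mapBilinear_apply,
    TensorProduct.map_tmul]
  rfl

/-- The product of two natural families on the Day convolution product. -/
def conv (φ : Ev F V U A) (ψ : Ev G V U B) : Ev (Conv F G) V U (A ⊗[k] B) where
  app X Y _ _ := convApp φ ψ X Y
  nat {X Y X' Y'} _ _ _ _ e e' a v ξ := by
    have : (convApp φ ψ X' Y').flip (mtu k v ξ) ∘ₗ convMap F G e e'
        = (convApp φ ψ X Y).flip (mtu k (v ∘ e) (ξ ∘ e')) := by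
      apply convObj_ext
      intro p q a b
      rw [LinearMap.comp_apply, LinearMap.flip_apply, LinearMap.flip_apply, convMap_of,
        convApp_of, convApp_of, val_relabel, val_relabel]
      rfl
    exact LinearMap.congr_fun this a

theorem conv_of (φ : Ev F V U A) (ψ : Ev G V U B) {X Y : Type} [Finite X] [Finite Y]
    (p : X → Bool) (q : Y → Bool) (a b) (v : X → V) (ξ : Y → U) :
    (φ.conv ψ).val (F := Conv F G) (convOf F G p q a b) v ξ
      = φ.val a (fun x : Fib p true => v x) (fun y : Fib q true => ξ y)
        ⊗ₜ ψ.val b (fun x : Fib p false => v x) (fun y : Fib q false => ξ y) :=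
  convApp_of φ ψ p q a b v ξ

theorem conv_mk (φ : Ev F V U A) (ψ : Ev G V U B) {X₁ X₂ Y₁ Y₂ X Y : Type} [Finite X₁] [Finite X₂]
    [Finite Y₁] [Finite Y₂] [Finite X] [Finite Y] (e : X₁ ⊕ X₂ ≃ X) (e' : Y₁ ⊕ Y₂ ≃ Y) (a b)
    (v : X → V) (ξ : Y → U) :
    (φ.conv ψ).val (convMk F G e e' a b) v ξ
      = φ.val a (v ∘ e ∘ Sum.inl) (ξ ∘ e' ∘ Sum.inl)
        ⊗ₜ ψ.val b (v ∘ e ∘ Sum.inr) (ξ ∘ e' ∘ Sum.inr) := by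
  refine (conv_of φ ψ _ _ _ _ v ξ).trans ?_
  rw [val_relabel, val_relabel]
  rfl

/-- Mixed tensors on empty label sets are scalars. -/
def mtuEmpty (k V U : Type u) [Field k] [AddCommGroup V] [Module k V] [AddCommGroup U]
    [Module k U] (X Y : Type) [IsEmpty X] [IsEmpty Y] : MTU k V U X Y →ₗ[k] k :=
  TensorProduct.lift ((LinearMap.lsmul k k).compl₁₂
    (PiTensorProduct.isEmptyEquiv (R := k) (s := fun _ : X => V) X).toLinearMap
    (PiTensorProduct.isEmptyEquiv (R := k) (s := fun _ : Y => U) Y).toLinearMap)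

theorem mtuEmpty_mtu {X Y : Type} [IsEmpty X] [IsEmpty Y] (v : X → V) (ξ : Y → U) :
    mtuEmpty k V U X Y (mtu k v ξ) = 1 := by
  simp [mtuEmpty, mtu]

open Classical in
/-- The natural family on the unit. -/
def unit (a : A) : Ev (convUnit k) V U A where
  app X Y _ _ := if h : IsEmpty X ∧ IsEmpty Y then
      (haveI := h.1; haveI := h.2
       ((LinearMap.lsmul k (MTU k V U X Y →ₗ[k] A)).flip
          ((LinearMap.toSpanSingleton k A a) ∘ₗ mtuEmpty k V U X Y)) ∘ₗ
          (LinearMap.proj (R := k) (φ := fun _ : PLift (IsEmpty X ∧ IsEmpty Y) => k) ⟨h⟩))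
      else 0
  nat {X Y X' Y'} _ _ _ _ e e' f v ξ := by
    by_cases h : IsEmpty X ∧ IsEmpty Y
    · have h' : IsEmpty X' ∧ IsEmpty Y' :=
        ⟨e.isEmpty_congr.1 h.1, e'.isEmpty_congr.1 h.2⟩
      have := h.1; have := h.2; have := h'.1; have := h'.2
      rw [dif_pos h, dif_pos h']
      change (show PLift (IsEmpty X ∧ IsEmpty Y) → k from f) ⟨h⟩ •
          (mtuEmpty k V U X' Y' (mtu k v ξ) • a)
        = (show PLift (IsEmpty X ∧ IsEmpty Y) → k from f) ⟨h⟩ •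
          (mtuEmpty k V U X Y (mtu k (v ∘ e) (ξ ∘ e')) • a)
      rw [mtuEmpty_mtu, mtuEmpty_mtu]
    · have h' : ¬ (IsEmpty X' ∧ IsEmpty Y') := fun h' =>
        h ⟨e.isEmpty_congr.2 h'.1, e'.isEmpty_congr.2 h'.2⟩
      rw [dif_neg h, dif_neg h']
      rfl

theorem unit_val (a : A) {X Y : Type} [Finite X] [Finite Y] (h : IsEmpty X ∧ IsEmpty Y)
    (f : (convUnit k).at' X Y) (v : X → V) (ξ : Y → U) :
    (unit a).val f v ξ = (show PLift (IsEmpty X ∧ IsEmpty Y) → k from f) ⟨h⟩ • a := by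
  have := h.1; have := h.2
  unfold unit val
  simp only [dif_pos h]
  change (show PLift (IsEmpty X ∧ IsEmpty Y) → k from f) ⟨h⟩ •
          (mtuEmpty k V U X Y (mtu k v ξ) • a) = _
  rw [mtuEmpty_mtu, one_smul]

end Ev

section Powers

variable {F : FBMod k} {V U A : Type u} [AddCommGroup V] [Module k V] [AddCommGroup U]
  [Module k U] [Ring A] [Algebra k A]

namespace Ev

/-- The powers of a natural family with values in an algebra. -/
def pow (φ : Ev F V U A) : ∀ d : ℕ, Ev (convPow F d) V U A
  | 0 => unit 1
  | d + 1 => (conv φ (pow φ d)).comp (LinearMap.mul' k A)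

theorem pow_cons (φ : Ev F V U A) (d : ℕ) {X₁ X₂ Y₁ Y₂ X Y : Type} [Finite X₁] [Finite X₂]
    [Finite Y₁] [Finite Y₂] [Finite X] [Finite Y] (e : X₁ ⊕ X₂ ≃ X) (e' : Y₁ ⊕ Y₂ ≃ Y) (a t)
    (v : X → V) (ξ : Y → U) :
    (φ.pow (d + 1)).val (powCons F d e e' a t) v ξ
      = φ.val a (v ∘ e ∘ Sum.inl) (ξ ∘ e' ∘ Sum.inl)
        * (φ.pow d).val t (v ∘ e ∘ Sum.inr) (ξ ∘ e' ∘ Sum.inr) :=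
  (congrArg (LinearMap.mul' k A) (conv_mk φ (φ.pow d) e e' a t v ξ)).trans
    (LinearMap.mul'_apply)

theorem pow_powRel (φ : Ev F V U A) (ε : k)
    (hφ : ∀ {X₁ Y₁ X₂ Y₂ : Type} [Finite X₁] [Finite Y₁] [Finite X₂] [Finite Y₂]
      (a : F.at' X₁ Y₁) (b : F.at' X₂ Y₂) (v ξ v' ξ'),
      φ.val a v ξ * φ.val b v' ξ' = ε • (φ.val b v' ξ' * φ.val a v ξ))
    {d : ℕ} {X Y : Type} [Finite X] [Finite Y] {r : (convPow F d).at' X Y}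
    (h : PowRel F ε d X Y r) (v : X → V) (ξ : Y → U) : (φ.pow d).val r v ξ = 0 := by
  induction h with
  | swap e e' a b t =>
    rw [sub_eq_add_neg, val_add, ← neg_one_smul k, val_smul, val_smul, pow_cons, pow_cons,
      pow_cons, pow_cons, ← mul_assoc, ← mul_assoc, hφ, smul_mul_assoc, neg_one_smul, add_neg_eq_zero]
    rfl
  | cons e e' a r h ih => rw [pow_cons, ih, mul_zero]

end Ev

theorem relabel_powMk (F : FBMod k) (ε : k) {d : ℕ} {X Y X' Y' : Type} [Finite X] [Finite Y]
    [Finite X'] [Finite Y'] (e : X ≃ X') (e' : Y ≃ Y') (t : (convPow F d).at' X Y) :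
    (powAlg F ε).relabel e e' (powMk F ε t) = powMk F ε ((convPow F d).relabel e e' t) := by
  classical exact DirectSum.lmap_lof ..

open Classical in
theorem powAlg_ext {F : FBMod k} {ε : k} {X Y : Type} [Finite X] [Finite Y] {N : Type*}
    [AddCommMonoid N] [Module k N] {f g : (powAlg F ε).at' X Y →ₗ[k] N}
    (h : ∀ d (t : (convPow F d).at' X Y), f (powMk F ε t) = g (powMk F ε t)) : f = g := by
  refine DirectSum.linearMap_ext (R := k) (M := fun d => (powQuot F ε d).at' X Y) (ψ := f) (ψ' := g)
    fun d => ?_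
  refine LinearMap.ext fun t => ?_
  obtain ⟨t, rfl⟩ := Submodule.mkQ_surjective (powRel F ε d X Y) t
  exact h d t

theorem powAlg_ind {F : FBMod k} {ε : k} {X Y : Type} [Finite X] [Finite Y]
    {S : Submodule k ((powAlg F ε).at' X Y)}
    (h : ∀ d (t : (convPow F d).at' X Y), powMk F ε t ∈ S) (a) : a ∈ S := by
  have : S.mkQ = 0 := powAlg_ext fun d t => (Submodule.Quotient.mk_eq_zero _).2 (h d t)
  rw [← Submodule.ker_mkQ S, this]
  rfl

open Classical in
/-- A linear map out of the symmetric or exterior algebra. -/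
def powAlgLift {F : FBMod k} {ε : k} {X Y : Type} [Finite X] [Finite Y] {N : Type*}
    [AddCommGroup N] [Module k N] (f : ∀ d, (convPow F d).at' X Y →ₗ[k] N)
    (h : ∀ d r, PowRel F ε d X Y r → f d r = 0) : (powAlg F ε).at' X Y →ₗ[k] N :=
  DirectSum.toModule k ℕ N fun d => (powRel F ε d X Y).liftQ (f d) (by
      rw [powRel, Submodule.span_le]
      intro r hr
      exact h d r hr)

theorem powAlgLift_mk {F : FBMod k} {ε : k} {X Y : Type} [Finite X] [Finite Y] {N : Type*}
    [AddCommGroup N] [Module k N] (f : ∀ d, (convPow F d).at' X Y →ₗ[k] N)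
    (h : ∀ d r, PowRel F ε d X Y r → f d r = 0) {d : ℕ} (t : (convPow F d).at' X Y) :
    powAlgLift f h (powMk F ε t) = f d t := by
  classical
  exact DirectSum.toModule_lof k (M := fun d => (powQuot F ε d).at' X Y) (N := N) d
    ((powRel F ε d X Y).mkQ t)

namespace Ev

section

variable (φ : Ev F V U A) (ε : k)
    (hφ : ∀ {X₁ Y₁ X₂ Y₂ : Type} [Finite X₁] [Finite Y₁] [Finite X₂] [Finite Y₂]
      (a : F.at' X₁ Y₁) (b : F.at' X₂ Y₂) (v ξ v' ξ'),
      φ.val a v ξ * φ.val b v' ξ' = ε • (φ.val b v' ξ' * φ.val a v ξ))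

theorem pow_app_powRel (φ : Ev F V U A) (ε : k)
    (hφ : ∀ {X₁ Y₁ X₂ Y₂ : Type} [Finite X₁] [Finite Y₁] [Finite X₂] [Finite Y₂]
      (a : F.at' X₁ Y₁) (b : F.at' X₂ Y₂) (v ξ v' ξ'),
      φ.val a v ξ * φ.val b v' ξ' = ε • (φ.val b v' ξ' * φ.val a v ξ)) (d : ℕ) {X Y : Type} [Finite X] [Finite Y] (r : (convPow F d).at' X Y)
    (h : PowRel F ε d X Y r) : (φ.pow d).app X Y r = 0 :=
  mtu_ext fun v ξ => pow_powRel φ ε hφ h v ξ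

/-- The extension of a natural family with values in an algebra to the symmetric or
exterior algebra, on a pair of sets. -/
def algApp (X Y : Type) [Finite X] [Finite Y] :
    (powAlg F ε).at' X Y →ₗ[k] MTU k V U X Y →ₗ[k] A :=
  powAlgLift (fun d => (φ.pow d).app X Y) fun d r hr => pow_app_powRel φ ε hφ d r hr

theorem algApp_mk {X Y : Type} [Finite X] [Finite Y] {d : ℕ} (t : (convPow F d).at' X Y) :
    algApp φ ε hφ X Y (powMk F ε t) = (φ.pow d).app X Y t := powAlgLift_mk _ _ t

/-- The extension of a natural family with values in an algebra to the symmetric or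
exterior algebra. -/
def alg : Ev (powAlg F ε) V U A where
  app X Y _ _ := algApp φ ε hφ X Y
  nat {X Y X' Y'} _ _ _ _ e e' a v ξ := by
    refine LinearMap.congr_fun (f := LinearMap.flip (algApp φ ε hφ X' Y') (mtu k v ξ) ∘ₗ
      (powAlg F ε).relabel e e')
      (g := LinearMap.flip (algApp φ ε hφ X Y) (mtu k (v ∘ e) (ξ ∘ e')))
        (powAlg_ext fun d t => ?_) a
    rw [LinearMap.comp_apply, relabel_powMk, LinearMap.flip_apply, LinearMap.flip_apply,
      algApp_mk, algApp_mk]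
    exact (φ.pow d).nat e e' t v ξ

theorem alg_val {d : ℕ} {X Y : Type} [Finite X] [Finite Y]
    (t : (convPow F d).at' X Y) (v : X → V) (ξ : Y → U) :
    (φ.alg ε hφ).val (powMk F ε t) v ξ = (φ.pow d).val t v ξ :=
  LinearMap.congr_fun (algApp_mk φ ε hφ t) (mtu k v ξ)

end

end Ev

end Powers

end Evaluations

section MixedSchur

variable {k : Type u} [Field k] (F : FBMod k) (V U : Type u) [AddCommGroup V] [Module k V]
  [AddCommGroup U] [Module k U]

/-- The direct sum of the spaces `F(m,n) ⊗ V^{⊗ m} ⊗ U^{⊗ n}`. -/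
abbrev MixSum : Type u :=
  ⨁ p : ℕ × ℕ, F.at' (Fin p.1) (Fin p.2) ⊗[k] MTU k V U (Fin p.1) (Fin p.2)

/-- An element of a summand. -/
def mixSumMk (p : ℕ × ℕ) :
    F.at' (Fin p.1) (Fin p.2) →ₗ[k] MTU k V U (Fin p.1) (Fin p.2) →ₗ[k] MixSum F V U :=
  (TensorProduct.mk k _ _).compr₂ (DirectSum.lof k (ℕ × ℕ)
    (fun p => F.at' (Fin p.1) (Fin p.2) ⊗[k] MTU k V U (Fin p.1) (Fin p.2)) p)

/-- The relations of the coinvariants for the symmetric groups. -/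
def mixRel : Submodule k (MixSum F V U) :=
  Submodule.span k {z | ∃ (p : ℕ × ℕ) (s : Equiv.Perm (Fin p.1)) (s' : Equiv.Perm (Fin p.2))
    (a : F.at' (Fin p.1) (Fin p.2)) (v : Fin p.1 → V) (ξ : Fin p.2 → U),
    z = mixSumMk F V U p (F.relabel s s' a) (mtu k v ξ)
      - mixSumMk F V U p a (mtu k (v ∘ s) (ξ ∘ s'))}

/-- The value `⨁ F(m,n) ⊗_{𝔖_m × 𝔖_n} V^{⊗ m} ⊗ U^{⊗ n}` of the mixed Schur functor
of a bimodule. -/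
def MixSch : Type u := MixSum F V U ⧸ mixRel F V U

instance : AddCommGroup (MixSch F V U) :=
  inferInstanceAs (AddCommGroup (MixSum F V U ⧸ mixRel F V U))
instance : Module k (MixSch F V U) :=
  inferInstanceAs (Module k (MixSum F V U ⧸ mixRel F V U))

namespace MixSch

variable {F V U}

/-- The class of an element of a summand. -/
def mkFin (p : ℕ × ℕ) :
    F.at' (Fin p.1) (Fin p.2) →ₗ[k] MTU k V U (Fin p.1) (Fin p.2) →ₗ[k] MixSch F V U :=
  (mixSumMk F V U p).compr₂ (mixRel F V U).mkQ

theorem mkFin_relabel (p : ℕ × ℕ) (s : Equiv.Perm (Fin p.1)) (s' : Equiv.Perm (Fin p.2))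
    (a : F.at' (Fin p.1) (Fin p.2)) (v : Fin p.1 → V) (ξ : Fin p.2 → U) :
    mkFin p (F.relabel s s' a) (mtu k v ξ) = mkFin p a (mtu k (v ∘ s) (ξ ∘ s')) :=
  (Submodule.Quotient.eq _).2 (Submodule.subset_span ⟨p, s, s', a, v, ξ, rfl⟩)

theorem mkFin_congr {X Y : Type} [Finite X] [Finite Y] (p q : ℕ × ℕ) (h : p = q)
    (e : X ≃ Fin p.1) (e' : Y ≃ Fin p.2) (f : X ≃ Fin q.1) (f' : Y ≃ Fin q.2)
    (a : F.at' X Y) (v : X → V) (ξ : Y → U) :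
    mkFin p (F.relabel e e' a) (mtu k (v ∘ e.symm) (ξ ∘ e'.symm))
      = mkFin q (F.relabel f f' a) (mtu k (v ∘ f.symm) (ξ ∘ f'.symm)) := by
  subst h
  have h1 : F.relabel f f' a = F.relabel (e.symm.trans f) (e'.symm.trans f') (F.relabel e e' a) := by
    rw [FBMod.relabel_relabel]
    congr 2 <;> ext x <;> simp
  rw [h1, mkFin_relabel]
  congr 3 <;> ext x <;> simp

/-- The universal natural family. -/
def gen : Ev F V U (MixSch F V U) where
  app X Y _ _ := (mkFin (Nat.card X, Nat.card Y)).compl₁₂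
    (F.relabel (Finite.equivFin X) (Finite.equivFin Y))
    (mtuReindex (Finite.equivFin X) (Finite.equivFin Y))
  nat {X Y X' Y'} _ _ _ _ e e' a v ξ := by
    rw [LinearMap.compl₁₂_apply, LinearMap.compl₁₂_apply, mtuReindex_mtu, mtuReindex_mtu,
      FBMod.relabel_relabel]
    refine Eq.trans ?_ (mkFin_congr (Nat.card X', Nat.card Y') (Nat.card X, Nat.card Y)
      (Prod.ext (Nat.card_congr e).symm (Nat.card_congr e').symm)
      (e.trans (Finite.equivFin X')) (e'.trans (Finite.equivFin Y'))
      (Finite.equivFin X) (Finite.equivFin Y) a (v ∘ e) (ξ ∘ e'))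
    congr 3 <;> ext x <;> simp

theorem gen_val {X Y : Type} [Finite X] [Finite Y] (a : F.at' X Y) (v : X → V) (ξ : Y → U) :
    gen.val a v ξ = mkFin (Nat.card X, Nat.card Y)
      (F.relabel (Finite.equivFin X) (Finite.equivFin Y) a)
      (mtu k (v ∘ (Finite.equivFin X).symm) (ξ ∘ (Finite.equivFin Y).symm)) :=
  congrArg (mkFin (Nat.card X, Nat.card Y) (F.relabel (Finite.equivFin X) (Finite.equivFin Y) a))
    (mtuReindex_mtu _ _ v ξ)

theorem mkFin_eq (p : ℕ × ℕ) (a : F.at' (Fin p.1) (Fin p.2)) (v : Fin p.1 → V) (ξ : Fin p.2 → U) :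
    mkFin p a (mtu k v ξ) = gen.val a v ξ := by
  rw [gen_val]
  have := mkFin_congr p (Nat.card (Fin p.1), Nat.card (Fin p.2)) (by simp) (Equiv.refl _)
    (Equiv.refl _) (Finite.equivFin _) (Finite.equivFin _) a v ξ
  rw [FBMod.relabel_refl] at this
  exact this

theorem ext {N : Type*} [AddCommGroup N] [Module k N] {φ ψ : MixSch F V U →ₗ[k] N}
    (h : ∀ (X Y : Type) [Finite X] [Finite Y] (a : F.at' X Y) (v : X → V) (ξ : Y → U),
      φ (gen.val a v ξ) = ψ (gen.val a v ξ)) : φ = ψ := by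
  classical
  apply Submodule.linearMap_qext
  apply DirectSum.linearMap_ext
  intro p
  apply TensorProduct.ext
  ext a : 1
  refine mtu_ext fun v ξ => ?_
  have := h _ _ a v ξ
  rw [← mkFin_eq] at this
  exact this

/-- The linear map given by a natural family. -/
def lift {N : Type u} [AddCommGroup N] [Module k N] (φ : Ev F V U N) : MixSch F V U →ₗ[k] N :=
  (mixRel F V U).liftQ (DirectSum.toModule k (ℕ × ℕ) N fun p =>
    TensorProduct.lift (φ.app (Fin p.1) (Fin p.2))) (by
      rw [mixRel, Submodule.span_le]
      rintro z ⟨p, s, s', a, v, ξ, rfl⟩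
      have h : ∀ a t, DirectSum.toModule k (ℕ × ℕ) N (fun p =>
          TensorProduct.lift (φ.app (Fin p.1) (Fin p.2))) (mixSumMk F V U p a t)
            = φ.app (Fin p.1) (Fin p.2) a t := fun a t => by
        simp only [mixSumMk, LinearMap.compr₂_apply, DirectSum.toModule_lof,
          TensorProduct.mk_apply, TensorProduct.lift.tmul]
      rw [SetLike.mem_coe, LinearMap.mem_ker, map_sub, h, h, sub_eq_zero]
      exact φ.nat s s' a v ξ)

theorem lift_gen {N : Type u} [AddCommGroup N] [Module k N] (φ : Ev F V U N) {X Y : Type}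
    [Finite X] [Finite Y] (a : F.at' X Y) (v : X → V) (ξ : Y → U) :
    lift φ (gen.val a v ξ) = φ.val a v ξ := by
  have h : ∀ p a t, lift φ (mkFin p a t) = φ.app (Fin p.1) (Fin p.2) a t := fun p a t => by
    change DirectSum.toModule k (ℕ × ℕ) N (fun p =>
          TensorProduct.lift (φ.app (Fin p.1) (Fin p.2))) (mixSumMk F V U p a t) = _
    simp only [mixSumMk, LinearMap.compr₂_apply, DirectSum.toModule_lof,
          TensorProduct.mk_apply, TensorProduct.lift.tmul]
  rw [gen_val, h]
  refine (φ.nat _ _ a _ _).trans ?_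
  rw [Ev.val]
  congr 2 <;> ext x <;> simp

end MixSch

end MixedSchur

/-- A natural family of bilinear maps `F(X₁,Y₁) ⊗ G(X₂,Y₂) → H(X₁ ⊔ X₂, Y₁ ⊔ Y₂)`. -/
structure BiPairing {k : Type u} [Field k] (F G H : FBMod k) where
  op : ∀ {X₁ Y₁ X₂ Y₂ : Type} [Finite X₁] [Finite Y₁] [Finite X₂] [Finite Y₂],
    F.at' X₁ Y₁ →ₗ[k] G.at' X₂ Y₂ →ₗ[k] H.at' (X₁ ⊕ X₂) (Y₁ ⊕ Y₂)
  nat_left : ∀ {X₁ Y₁ X₂ Y₂ X₁' Y₁' : Type} [Finite X₁] [Finite Y₁] [Finite X₂]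
    [Finite Y₂] [Finite X₁'] [Finite Y₁'] (e : X₁ ≃ X₁') (e' : Y₁ ≃ Y₁')
    (a : F.at' X₁ Y₁) (b : G.at' X₂ Y₂),
    op (F.relabel e e' a) b = H.relabel (e.sumCongr (Equiv.refl _)) (e'.sumCongr (Equiv.refl _))
      (op a b)
  nat_right : ∀ {X₁ Y₁ X₂ Y₂ X₂' Y₂' : Type} [Finite X₁] [Finite Y₁] [Finite X₂]
    [Finite Y₂] [Finite X₂'] [Finite Y₂'] (f : X₂ ≃ X₂') (f' : Y₂ ≃ Y₂')
    (a : F.at' X₁ Y₁) (b : G.at' X₂ Y₂),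
    op a (G.relabel f f' b) = H.relabel ((Equiv.refl _).sumCongr f) ((Equiv.refl _).sumCongr f')
      (op a b)

namespace MixSch

variable {k : Type u} [Field k] {F G H : FBMod k} {V U : Type u} [AddCommGroup V] [Module k V]
  [AddCommGroup U] [Module k U] (I : BiPairing F G H)

/-- The product with a fixed mixed tensor. -/
def prodAux {X₁ Y₁ : Type} [Finite X₁] [Finite Y₁] (a : F.at' X₁ Y₁) (t : MTU k V U X₁ Y₁) :
    MixSch G V U →ₗ[k] MixSch H V U :=
  lift
    { app := fun X₂ Y₂ _ _ => (gen.app (X₁ ⊕ X₂) (Y₁ ⊕ Y₂)).compl₁₂ (I.op a)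
        ((mtuMul X₁ Y₁ X₂ Y₂).toLinearMap ∘ₗ TensorProduct.mk k _ _ t)
      nat := fun {X₂ Y₂ X₂' Y₂'} _ _ _ _ f f' b v ξ => by
        have key : (gen.app (X₁ ⊕ X₂') (Y₁ ⊕ Y₂') (I.op a (G.relabel f f' b))) ∘ₗ
            (mtuMul X₁ Y₁ X₂' Y₂').toLinearMap ∘ₗ (TensorProduct.mk k _ _).flip (mtu k v ξ)
            = (gen.app (X₁ ⊕ X₂) (Y₁ ⊕ Y₂) (I.op a b)) ∘ₗ
            (mtuMul X₁ Y₁ X₂ Y₂).toLinearMap ∘ₗ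
              (TensorProduct.mk k _ _).flip (mtu k (v ∘ f) (ξ ∘ f')) := by
          refine mtu_ext fun v' ξ' => ?_
          simp only [LinearMap.comp_apply, LinearMap.flip_apply, TensorProduct.mk_apply,
            LinearEquiv.coe_coe, mtuMul_mtu]
          rw [I.nat_right]
          refine (gen.nat _ _ _ _ _).trans ?_
          congr 2 <;> funext x <;> rcases x with x | x <;> rfl
        exact LinearMap.congr_fun key t }

theorem prodAux_gen {X₁ Y₁ X₂ Y₂ : Type} [Finite X₁] [Finite Y₁] [Finite X₂] [Finite Y₂]
    (a : F.at' X₁ Y₁) (t : MTU k V U X₁ Y₁) (b : G.at' X₂ Y₂) (v : X₂ → V) (ξ : Y₂ → U) :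
    prodAux I a t (gen.val b v ξ)
      = gen.app (X₁ ⊕ X₂) (Y₁ ⊕ Y₂) (I.op a b) (mtuMul X₁ Y₁ X₂ Y₂ (t ⊗ₜ mtu k v ξ)) :=
  lift_gen _ b v ξ

/-- The bilinear map of mixed Schur functors given by a pairing. -/
def prod : MixSch F V U →ₗ[k] MixSch G V U →ₗ[k] MixSch H V U :=
  lift
    { app := fun X₁ Y₁ _ _ => LinearMap.mk₂ k (fun a t => prodAux I a t)
        (fun a a' t => ext fun X₂ Y₂ _ _ b v ξ => by
          rw [LinearMap.add_apply, prodAux_gen, prodAux_gen, prodAux_gen, map_add,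
            LinearMap.add_apply, map_add, LinearMap.add_apply])
        (fun c a t => ext fun X₂ Y₂ _ _ b v ξ => by
          rw [LinearMap.smul_apply, prodAux_gen, prodAux_gen, map_smul,
            LinearMap.smul_apply, map_smul, LinearMap.smul_apply])
        (fun a t t' => ext fun X₂ Y₂ _ _ b v ξ => by
          rw [LinearMap.add_apply, prodAux_gen, prodAux_gen, prodAux_gen, TensorProduct.add_tmul,
            map_add, map_add])
        (fun c a t => ext fun X₂ Y₂ _ _ b v ξ => by
          rw [LinearMap.smul_apply, prodAux_gen, prodAux_gen, ← TensorProduct.smul_tmul',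
            map_smul, map_smul])
      nat := fun {X₁ Y₁ X₁' Y₁'} _ _ _ _ e e' a v ξ => ext fun X₂ Y₂ _ _ b v' ξ' => by
        rw [LinearMap.mk₂_apply, LinearMap.mk₂_apply, prodAux_gen, prodAux_gen, mtuMul_mtu,
          mtuMul_mtu, I.nat_left]
        refine (gen.nat _ _ _ _ _).trans ?_
        congr 2 <;> funext x <;> rcases x with x | x <;> rfl }

theorem prod_gen {X₁ Y₁ X₂ Y₂ : Type} [Finite X₁] [Finite Y₁] [Finite X₂] [Finite Y₂]
    (a : F.at' X₁ Y₁) (v : X₁ → V) (ξ : Y₁ → U) (b : G.at' X₂ Y₂) (v' : X₂ → V) (ξ' : Y₂ → U) :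
    prod I (gen.val a v ξ) (gen.val b v' ξ')
      = gen.val (I.op a b) (Sum.elim v v') (Sum.elim ξ ξ') := by
  have h : prod I (gen.val a v ξ) = prodAux (V := V) I a (mtu k v ξ) := lift_gen _ a v ξ
  rw [h, prodAux_gen, mtuMul_mtu]
  rfl

end MixSch

/-! ### Combinatorics of the Day convolution product -/

section ConvCombinatorics

variable {k : Type u} [Field k] {F G : FBMod k}

theorem convOf_congr {X Y : Type} [Finite X] [Finite Y] {p p' : X → Bool} {q q' : Y → Bool}
    {X₁ Y₁ X₂ Y₂ : Type} [Finite X₁] [Finite Y₁] [Finite X₂] [Finite Y₂]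
    (hp : p = p') (hq : q = q')
    (f : X₁ ≃ Fib p true) (g : Y₁ ≃ Fib q true) (f' : X₁ ≃ Fib p' true) (g' : Y₁ ≃ Fib q' true)
    (h : X₂ ≃ Fib p false) (l : Y₂ ≃ Fib q false) (h' : X₂ ≃ Fib p' false)
    (l' : Y₂ ≃ Fib q' false)
    (hf : ∀ x, (f x).1 = (f' x).1) (hg : ∀ x, (g x).1 = (g' x).1)
    (hh : ∀ x, (h x).1 = (h' x).1) (hl : ∀ x, (l x).1 = (l' x).1)
    (a : F.at' X₁ Y₁) (b : G.at' X₂ Y₂) :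
    convOf F G p q (F.relabel f g a) (G.relabel h l b)
      = convOf F G p' q' (F.relabel f' g' a) (G.relabel h' l' b) := by
  subst hp hq
  obtain rfl : f = f' := Equiv.ext fun x => Subtype.ext (hf x)
  obtain rfl : g = g' := Equiv.ext fun x => Subtype.ext (hg x)
  obtain rfl : h = h' := Equiv.ext fun x => Subtype.ext (hh x)
  obtain rfl : l = l' := Equiv.ext fun x => Subtype.ext (hl x)
  rfl

theorem convMk_relabel {X₁ Y₁ X₂ Y₂ X₁' Y₁' X₂' Y₂' X Y : Type} [Finite X₁] [Finite Y₁]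
    [Finite X₂] [Finite Y₂] [Finite X₁'] [Finite Y₁'] [Finite X₂'] [Finite Y₂'] [Finite X]
    [Finite Y] (f : X₁ ≃ X₁') (f' : Y₁ ≃ Y₁') (g : X₂ ≃ X₂') (g' : Y₂ ≃ Y₂')
    (e : X₁' ⊕ X₂' ≃ X) (e' : Y₁' ⊕ Y₂' ≃ Y) (a : F.at' X₁ Y₁) (b : G.at' X₂ Y₂) :
    convMk F G e e' (F.relabel f f' a) (G.relabel g g' b)
      = convMk F G ((f.sumCongr g).trans e) ((f'.sumCongr g').trans e') a b := by
  change convOf F G _ _ (F.relabel _ _ (F.relabel f f' a)) (G.relabel _ _ (G.relabel g g' b))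
    = convOf F G _ _ (F.relabel _ _ a) (G.relabel _ _ b)
  rw [FBMod.relabel_relabel, FBMod.relabel_relabel]
  refine convOf_congr ?_ ?_ _ _ _ _ _ _ _ _ ?_ ?_ ?_ ?_ a b
  · funext x
    rcases h : e.symm x with y | y <;> simp [h]
  · funext x
    rcases h : e'.symm x with y | y <;> simp [h]
  all_goals intro x; rfl

theorem convOf_eq {X Y : Type} [Finite X] [Finite Y] (p : X → Bool) (q : Y → Bool) (a b) :
    convOf F G p q a b = convMk F G (fibSum p) (fibSum q) a b := by
  change _ = convOf F G _ _ (F.relabel _ _ a) (G.relabel _ _ b)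
  have h := convOf_congr (F := F) (G := G) (p := p) (q := q)
    (p' := fun x => ((fibSum p).symm x).isLeft) (q' := fun x => ((fibSum q).symm x).isLeft)
    (by funext x; by_cases h : p x = true <;> simp [fibSum, h])
    (by funext x; by_cases h : q x = true <;> simp [fibSum, h])
    (Equiv.refl _) (Equiv.refl _) (fibInl (fibSum p)) (fibInl (fibSum q)) (Equiv.refl _)
    (Equiv.refl _) (fibInr (fibSum p)) (fibInr (fibSum q)) (fun _ => rfl) (fun _ => rfl)
    (fun _ => rfl) (fun _ => rfl) a b
  rwa [FBMod.relabel_refl, FBMod.relabel_refl] at h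

theorem conv_ext {X Y : Type} [Finite X] [Finite Y] {N : Type*} [AddCommMonoid N] [Module k N]
    {f g : (Conv F G).at' X Y →ₗ[k] N}
    (h : ∀ (X₁ X₂ Y₁ Y₂ : Type) [Finite X₁] [Finite X₂] [Finite Y₁] [Finite Y₂] (e : X₁ ⊕ X₂ ≃ X)
      (e' : Y₁ ⊕ Y₂ ≃ Y) (a : F.at' X₁ Y₁) (b : G.at' X₂ Y₂),
      f (convMk F G e e' a b) = g (convMk F G e e' a b)) : f = g :=
  convObj_ext F G fun p q a b => by
    have := h _ _ _ _ (fibSum p) (fibSum q) a b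
    rw [← convOf_eq] at this
    exact this

theorem conv_ind {X Y : Type} [Finite X] [Finite Y] {S : Submodule k ((Conv F G).at' X Y)}
    (h : ∀ (X₁ X₂ Y₁ Y₂ : Type) [Finite X₁] [Finite X₂] [Finite Y₁] [Finite Y₂] (e : X₁ ⊕ X₂ ≃ X)
      (e' : Y₁ ⊕ Y₂ ≃ Y) (a : F.at' X₁ Y₁) (b : G.at' X₂ Y₂), convMk F G e e' a b ∈ S)
    (z) : z ∈ S := by
  have : S.mkQ = 0 := conv_ext fun _ _ _ _ _ _ _ _ e e' a b =>
    (Submodule.Quotient.mk_eq_zero _).2 (h _ _ _ _ e e' a b)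
  rw [← Submodule.ker_mkQ S, this]
  rfl

theorem convPow_succ_ind {d : ℕ} {X Y : Type} [Finite X] [Finite Y]
    {S : Submodule k ((convPow F (d + 1)).at' X Y)}
    (h : ∀ (X₁ X₂ Y₁ Y₂ : Type) [Finite X₁] [Finite X₂] [Finite Y₁] [Finite Y₂] (e : X₁ ⊕ X₂ ≃ X)
      (e' : Y₁ ⊕ Y₂ ≃ Y) (a : F.at' X₁ Y₁) (b : (convPow F d).at' X₂ Y₂),
      powCons F d e e' a b ∈ S)
    (z) : z ∈ S :=
  conv_ind (F := F) (G := convPow F d) h z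

variable (F G) in
/-- The universal pairing. -/
def convPairing : BiPairing F G (Conv F G) where
  op := convMk F G (Equiv.refl _) (Equiv.refl _)
  nat_left e e' a b := by
    have := convMk_relabel (F := F) (G := G) e e' (Equiv.refl _) (Equiv.refl _) (Equiv.refl _)
      (Equiv.refl _) a b
    rw [FBMod.relabel_refl] at this
    rw [relabel_convMk]
    exact this
  nat_right e e' a b := by
    have := convMk_relabel (F := F) (G := G) (Equiv.refl _) (Equiv.refl _) e e' (Equiv.refl _)
      (Equiv.refl _) a b
    rw [FBMod.relabel_refl] at this
    rw [relabel_convMk]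
    exact this

theorem powMk_eq_zero (F : FBMod k) (ε : k) {d : ℕ} {X Y : Type} [Finite X] [Finite Y]
    {r : (convPow F d).at' X Y} (h : r ∈ powRel F ε d X Y) : powMk F ε r = 0 := by
  classical
  exact (congrArg (DirectSum.lof k ℕ (fun d => (powQuot F ε d).at' X Y) d)
    ((Submodule.Quotient.mk_eq_zero (powRel F ε d X Y)).2 h)).trans (map_zero _)

theorem consAux (F : FBMod k) (ε : k) {X₁ X₂ Y₁ Y₂ X Y : Type} [Finite X₁] [Finite X₂] [Finite Y₁]
    [Finite Y₂] [Finite X] [Finite Y] (e : X₁ ⊕ X₂ ≃ X) (e' : Y₁ ⊕ Y₂ ≃ Y) (d : ℕ)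
    (r : (convPow F d).at' X₂ Y₂) (hr : PowRel F ε d X₂ Y₂ r) :
    ((powCons F d e e').compr₂ (powMk F ε)).flip r = 0 :=
  LinearMap.ext fun a => powMk_eq_zero F ε (Submodule.subset_span (PowRel.cons e e' a r hr))

/-- The product with an element of `F`, on the symmetric or exterior algebra. -/
def consAlg (F : FBMod k) (ε : k) {X₁ X₂ Y₁ Y₂ X Y : Type} [Finite X₁] [Finite X₂] [Finite Y₁]
    [Finite Y₂] [Finite X] [Finite Y] (e : X₁ ⊕ X₂ ≃ X) (e' : Y₁ ⊕ Y₂ ≃ Y) :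
    F.at' X₁ Y₁ →ₗ[k] (powAlg F ε).at' X₂ Y₂ →ₗ[k] (powAlg F ε).at' X Y :=
  LinearMap.flip (powAlgLift (fun d => ((powCons F d e e').compr₂ (powMk F ε)).flip)
    (consAux F ε e e'))

theorem consAlg_mk (F : FBMod k) (ε : k) {X₁ X₂ Y₁ Y₂ X Y : Type} [Finite X₁] [Finite X₂]
    [Finite Y₁] [Finite Y₂] [Finite X] [Finite Y] (e : X₁ ⊕ X₂ ≃ X) (e' : Y₁ ⊕ Y₂ ≃ Y)
    (a : F.at' X₁ Y₁) {d : ℕ} (t : (convPow F d).at' X₂ Y₂) :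
    consAlg F ε e e' a (powMk F ε t) = powMk F ε (powCons F d e e' a t) :=
  LinearMap.congr_fun (powAlgLift_mk (F := F)
    (fun d => ((powCons F d e e').compr₂ (powMk F ε)).flip) (consAux F ε e e') t) a

theorem powMk_swap (F : FBMod k) (ε : k) {d : ℕ} {X₁ X₂ X₃ Y₁ Y₂ Y₃ X Y : Type} [Finite X₁]
    [Finite X₂] [Finite X₃] [Finite Y₁]
      [Finite Y₂] [Finite Y₃] [Finite X] [Finite Y] (e : X₁ ⊕ (X₂ ⊕ X₃) ≃ X)
      (e' : Y₁ ⊕ (Y₂ ⊕ Y₃) ≃ Y) (a : F.at' X₁ Y₁) (b : F.at' X₂ Y₂)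
      (t : (convPow F d).at' X₃ Y₃) :
    powMk F ε (powCons F (d + 1) e e' a (powCons F d (Equiv.refl _) (Equiv.refl _) b t))
      = ε • powMk F ε (powCons F (d + 1)
              ((leftComm X₂ X₁ X₃).trans e) ((leftComm Y₂ Y₁ Y₃).trans e') b
            (powCons F d (Equiv.refl _) (Equiv.refl _) a t)) := by
  have h2 := powMk_eq_zero F ε (Submodule.subset_span (PowRel.swap (ε := ε) e e' a b t))
  rwa [map_sub, map_smul, sub_eq_zero] at h2

/-- The product with elements of `F`, as a pairing. -/
def consPairing (F : FBMod k) (ε : k) : BiPairing F (powAlg F ε) (powAlg F ε) where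
  op := consAlg F ε (Equiv.refl _) (Equiv.refl _)
  nat_left {X₁ Y₁ X₂ Y₂ X₁' Y₁'} _ _ _ _ _ _ e e' a b := by
    refine LinearMap.congr_fun (f := consAlg F ε (Equiv.refl (X₁' ⊕ X₂)) (Equiv.refl (Y₁' ⊕ Y₂))
      (F.relabel e e' a)) (g := (powAlg F ε).relabel (e.sumCongr (Equiv.refl _))
        (e'.sumCongr (Equiv.refl _)) ∘ₗ consAlg F ε (Equiv.refl (X₁ ⊕ X₂)) (Equiv.refl (Y₁ ⊕ Y₂)) a)
      (powAlg_ext fun d t => ?_) b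
    rw [LinearMap.comp_apply, consAlg_mk, consAlg_mk, relabel_powMk]
    exact congrArg _ ((convPairing F (convPow F d)).nat_left e e' a t)
  nat_right {X₁ Y₁ X₂ Y₂ X₂' Y₂'} _ _ _ _ _ _ e e' a b := by
    refine LinearMap.congr_fun (f := consAlg F ε (Equiv.refl (X₁ ⊕ X₂')) (Equiv.refl (Y₁ ⊕ Y₂'))
      a ∘ₗ (powAlg F ε).relabel e e') (g := (powAlg F ε).relabel ((Equiv.refl _).sumCongr e)
        ((Equiv.refl _).sumCongr e') ∘ₗ
          consAlg F ε (Equiv.refl (X₁ ⊕ X₂)) (Equiv.refl (Y₁ ⊕ Y₂)) a)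
      (powAlg_ext fun d t => ?_) b
    rw [LinearMap.comp_apply, LinearMap.comp_apply, consAlg_mk, relabel_powMk, consAlg_mk,
      relabel_powMk]
    exact congrArg _ ((convPairing F (convPow F d)).nat_right e e' a t)

end ConvCombinatorics

section FormalDerivations

variable {k : Type u} [Field k] {O : Operad k} {V U : Type u} [AddCommGroup V] [Module k V]
  [AddCommGroup U] [Module k U]

variable (O V U) in
/-- Derivations with formal linear forms. -/
abbrev FDer : Type u := U ⊗[k] Sch O.sp V

variable (O V) in
/-- The derivation `v ↦ ξ(v) s`, as a bilinear map. -/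
def Der.elemₗ : Module.Dual k V →ₗ[k] Sch O.sp V →ₗ[k] Der O V :=
  (LinearMap.smulRightₗ (R := k) (M₂ := V) (M := Sch O.sp V)).compr₂ Der.toMap.symm.toLinearMap

variable (O V U) in
/-- The derivation given by a realization of the formal linear forms. -/
def toDerₗ : (U →ₗ[k] Module.Dual k V) →ₗ[k] FDer O V U →ₗ[k] Der O V :=
  (TensorProduct.uncurry (RingHom.id k) U (Sch O.sp V) (Der O V)) ∘ₗ
    LinearMap.llcomp k U _ _ (Der.elemₗ O V)

/-- The derivation given by a realization of the formal linear forms. -/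
abbrev toDer (β : U →ₗ[k] Module.Dual k V) : FDer O V U →ₗ[k] Der O V := toDerₗ O V U β

theorem toDer_add (β β' : U →ₗ[k] Module.Dual k V) (f : FDer O V U) :
    toDer (β + β') f = toDer β f + toDer β' f :=
  LinearMap.congr_fun (map_add (toDerₗ O V U) β β') f

theorem toDer_smul (c : k) (β : U →ₗ[k] Module.Dual k V) (f : FDer O V U) :
    toDer (c • β) f = c • toDer β f :=
  LinearMap.congr_fun (map_smul (toDerₗ O V U) c β) f

theorem toDer_tmul (β : U →ₗ[k] Module.Dual k V) (ξ : U) (s : Sch O.sp V) :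
    toDer β (ξ ⊗ₜ s : FDer O V U) = Der.elem (β ξ) s := rfl

/-- The bracket of derivations with formal linear forms. -/
def fbr (β : U →ₗ[k] Module.Dual k V) (f g : FDer O V U) : FDer O V U :=
  (Der.ad (toDer β f)).lTensor U g - (Der.ad (toDer β g)).lTensor U f

theorem toDer_lTensor (β : U →ₗ[k] Module.Dual k V) (f : Der O V) (g : FDer O V U) (v : V) :
    toDer β ((Der.ad f).lTensor U g) v = Der.ad f (toDer β g v) := by
  induction g using TensorProduct.induction_on with
  | zero => rw [map_zero, map_zero]; exact (map_zero _).symm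
  | add a b ha hb =>
    rw [map_add, map_add (toDer β), map_add (toDer β), Der.add_apply, Der.add_apply, map_add, ha,
      hb]
  | tmul ξ s =>
    rw [LinearMap.lTensor_tmul, toDer_tmul, toDer_tmul, Der.elem_apply, Der.elem_apply, map_smul]

theorem toDer_fbr (β : U →ₗ[k] Module.Dual k V) (f g : FDer O V U) :
    toDer β (fbr β f g) = ⁅toDer β f, toDer β g⁆ := by
  ext v
  rw [Der.bracket_apply, ← toDer_lTensor, ← toDer_lTensor, fbr, map_sub]
  rfl

theorem ad_lTensor_lie (f g : Der O V) (h : FDer O V U) :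
    (Der.ad ⁅f, g⁆).lTensor U h = (Der.ad f).lTensor U ((Der.ad g).lTensor U h)
      - (Der.ad g).lTensor U ((Der.ad f).lTensor U h) := by
  have : Der.ad ⁅f, g⁆ = Der.ad f ∘ₗ Der.ad g - Der.ad g ∘ₗ Der.ad f :=
    LinearMap.ext fun s => Der.ad_lie f g s
  rw [this, LinearMap.lTensor_sub, LinearMap.lTensor_comp, LinearMap.lTensor_comp]
  rfl

theorem lTensor_ad_add (f g : Der O V) (h : FDer O V U) :
    (Der.ad (f + g)).lTensor U h = (Der.ad f).lTensor U h + (Der.ad g).lTensor U h := by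
  rw [map_add, LinearMap.lTensor_add, LinearMap.add_apply]

theorem lTensor_ad_smul (c : k) (f : Der O V) (h : FDer O V U) :
    (Der.ad (c • f)).lTensor U h = c • (Der.ad f).lTensor U h := by
  rw [map_smul, LinearMap.lTensor_smul, LinearMap.smul_apply]

/-- The Lie algebra of derivations with formal linear forms, for a realization
of the linear forms. -/
def DerB (O : Operad k) (_β : U →ₗ[k] Module.Dual k V) : Type u := FDer O V U

variable (β : U →ₗ[k] Module.Dual k V)

instance : AddCommGroup (DerB O β) := inferInstanceAs (AddCommGroup (FDer O V U))
instance : Module k (DerB O β) := inferInstanceAs (Module k (FDer O V U))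
instance : Bracket (DerB O β) (DerB O β) := ⟨fun f g => fbr (O := O) β f g⟩

theorem fbr_add_left (f f' g : FDer O V U) : fbr β (f + f') g = fbr β f g + fbr β f' g := by
  unfold fbr
  rw [map_add, lTensor_ad_add, map_add]
  abel

theorem fbr_skew (f g : FDer O V U) : fbr β f g = - fbr β g f := (neg_sub _ _).symm

theorem fbr_add_right (f g g' : FDer O V U) : fbr β f (g + g') = fbr β f g + fbr β f g' := by
  rw [fbr_skew, fbr_add_left, fbr_skew β g, fbr_skew β g', neg_add, neg_neg, neg_neg]

theorem fbr_smul_right (c : k) (f g : FDer O V U) : fbr β f (c • g) = c • fbr β f g := by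
  unfold fbr
  rw [map_smul, map_smul, lTensor_ad_smul, smul_sub]

theorem fbr_leibniz (f g h : FDer O V U) :
    fbr β f (fbr β g h) = fbr β (fbr β f g) h + fbr β g (fbr β f h) := by
  have e : ∀ f g h : FDer O V U, fbr β f (fbr β g h) =
      (Der.ad (toDer β f)).lTensor U ((Der.ad (toDer β g)).lTensor U h)
      - (Der.ad (toDer β f)).lTensor U ((Der.ad (toDer β h)).lTensor U g)
      - ((Der.ad (toDer β g)).lTensor U ((Der.ad (toDer β h)).lTensor U f)
        - (Der.ad (toDer β h)).lTensor U ((Der.ad (toDer β g)).lTensor U f)) := by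
    intro f g h
    rw [fbr, toDer_fbr, ad_lTensor_lie, fbr, map_sub]
  rw [fbr_skew β (fbr β f g) h, e, e, e]
  abel

instance : LieRing (DerB O β) where
  add_lie f f' g := fbr_add_left (O := O) β f f' g
  lie_add f g g' := fbr_add_right (O := O) β f g g'
  lie_self _ := sub_self _
  leibniz_lie f g h := fbr_leibniz (O := O) β f g h

instance : LieAlgebra k (DerB O β) where
  lie_smul c f g := fbr_smul_right (O := O) β c f g

end FormalDerivations

/-- A natural family of differential graded Lie algebras of the form `Der(O(V)) ⊕ s⁻¹ S(V)`. -/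
structure Coeff {k : Type u} [Field k] (O : Operad k) where
  S : Spmon k → Type u
  [acg : ∀ V, AddCommGroup (S V)]
  [mod : ∀ V, Module k (S V)]
  act : ∀ {V : Spmon k}, Der O V.carrier →ₗ[k] S V →ₗ[k] S V
  act_lie : ∀ {V : Spmon k} (f g : Der O V.carrier) m,
    act ⁅f, g⁆ m = act f (act g m) - act g (act f m)
  diff : ∀ {V : Spmon k}, Der O V.carrier →ₗ[k] S V
  diff_lie : ∀ {V : Spmon k} (f g : Der O V.carrier), diff ⁅f, g⁆ = act f (diff g) - act g (diff f)
  map : ∀ {V W : Spmon k}, (V.carrier →ₗ[k] W.carrier) → S V →ₗ[k] S W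
  map_act : ∀ {V W : Spmon k} (i : V.carrier →ₗ[k] W.carrier) (ξ : Module.Dual k W.carrier)
    (s : Sch O.sp V.carrier) (m : S V), map i (act (Der.elem (ξ ∘ₗ i) s) m)
      = act (Der.elem ξ (Sch.map (SpMap.id O.sp) i s)) (map i m)
  map_diff : ∀ {V W : Spmon k} (i : V.carrier →ₗ[k] W.carrier) (ξ : Module.Dual k W.carrier)
    (s : Sch O.sp V.carrier), map i (diff (Der.elem (ξ ∘ₗ i) s))
      = diff (Der.elem ξ (Sch.map (SpMap.id O.sp) i s))

attribute [instance] Coeff.acg Coeff.mod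

section CoeffInstances

variable {k : Type u} [Field k] (O : Operad k)

/-- The coefficients `|∂O(V)|`. -/
abbrev wheelCoeff : Coeff O where
  S V := Sch (wheelSp O) V.carrier
  act := Der.act
  act_lie := Der.act_lie
  diff := Der.div
  diff_lie := Der.div_lie
  map i := Sch.map (SpMap.id (wheelSp O)) i
  map_act {V W} i ξ s m := by
    have hc : InsCompat (P := wheelSp O) (Q := wheelSp O) (wheel O).act (wheel O).act
      (SpMap.id (wheelSp O)) (SpMap.id O.sp) := fun _ _ => rfl
    have h := Sch.map_derivExt hc i (Der.elem (ξ ∘ₗ i) s).toMap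
      (Der.elem ξ (Sch.map (SpMap.id O.sp) i s)).toMap
      (fun v => (map_smul (Sch.map (SpMap.id O.sp) i) (ξ (i v)) s).symm) m
    exact h
  map_diff {V W} i ξ s := by
    rw [Der.div_elem, Der.div_elem, Sch.cov_map,
      Sch.map_map (wheelPi O) (SpMap.id _) (wheelPi O) LinearMap.id i (fun _ _ _ => rfl),
      Sch.map_map (SpMap.id O.sp).deriv (wheelPi O) (wheelPi O) i LinearMap.id
        (fun _ _ _ => rfl), LinearMap.comp_id, LinearMap.id_comp]

/-- The trivial coefficients. -/
abbrev plainCoeff : Coeff O where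
  S _ := PUnit
  act := 0
  act_lie _ _ _ := rfl
  diff := 0
  diff_lie _ _ := rfl
  map _ := 0
  map_act _ _ _ _ := rfl
  map_diff _ _ _ := rfl

end CoeffInstances

section FormalChains

variable {k : Type u} [Field k] {O : Operad k} (K : Coeff O) {V W : Spmon k} {U U' : Type u}
  [AddCommGroup U] [Module k U] [AddCommGroup U'] [Module k U']

theorem Coeff.act_fbr (β : U →ₗ[k] Module.Dual k V.carrier) (f g : FDer O V.carrier U)
    (m : K.S V) : K.act (toDer β (fbr β f g)) m
      = K.act (toDer β f) (K.act (toDer β g) m) - K.act (toDer β g) (K.act (toDer β f) m) := by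
  rw [toDer_fbr, K.act_lie]

theorem Coeff.diff_fbr (β : U →ₗ[k] Module.Dual k V.carrier) (f g : FDer O V.carrier U) :
    K.diff (toDer β (fbr β f g))
      = K.act (toDer β f) (K.diff (toDer β g)) - K.act (toDer β g) (K.diff (toDer β f)) := by
  rw [toDer_fbr, K.diff_lie]

/-- The differential graded Lie algebra of derivations with formal linear forms. -/
def Coeff.dgl (β : U →ₗ[k] Module.Dual k V.carrier) : DGLie k where
  deg0 := DerB O β
  degNeg := K.S V
  act := K.act ∘ₗ toDer β
  act_lie f g m := K.act_fbr β f g m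
  diff := K.diff ∘ₗ toDer β
  diff_lie f g := K.diff_fbr β f g

/-- The differential graded Lie algebra `Der(O(V)) ⊕ s⁻¹ S(V)`. -/
def Coeff.dglie (V : Spmon k) : DGLie k where
  deg0 := Der O V.carrier
  degNeg := K.S V
  act := K.act
  act_lie := K.act_lie
  diff := K.diff
  diff_lie := K.diff_lie

variable (V U) in
/-- Chevalley–Eilenberg chains of the derivations with formal linear forms. -/
abbrev Coeff.Ch : Type u :=
  ExteriorAlgebra k (FDer O V.carrier U) ⊗[k] SymmetricAlgebra k (K.S V)

/-- The exterior product with a derivation. -/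
def Coeff.wdg : FDer O V.carrier U →ₗ[k] K.Ch V U →ₗ[k] K.Ch V U :=
  (LinearMap.rTensorHom (SymmetricAlgebra k (K.S V))) ∘ₗ
    (LinearMap.mul k _) ∘ₗ ExteriorAlgebra.ι k

theorem Coeff.ch_ind {C : K.Ch V U → Prop} (h1 : ∀ p, C (1 ⊗ₜ p))
    (hm : ∀ x c, C c → C (K.wdg x c)) (ha : ∀ p q, C p → C q → C (p + q)) (c : K.Ch V U) : C c := by
  induction c using TensorProduct.induction_on with
  | zero => simpa using h1 0
  | add x y hx hy => exact ha _ _ hx hy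
  | tmul ω n =>
    induction ω using CliffordAlgebra.left_induction generalizing n with
    | algebraMap r =>
      rw [Algebra.algebraMap_eq_smul_one, TensorProduct.smul_tmul]
      exact h1 _
    | add a b h1 h2 =>
      rw [TensorProduct.add_tmul]
      exact ha _ _ (h1 n) (h2 n)
    | ι_mul ω x h => exact hm x _ (h n)

variable (β : U →ₗ[k] Module.Dual k V.carrier)

/-- The Chevalley–Eilenberg differential given by a realization of the formal linear forms. -/
def Coeff.dB : K.Ch V U →ₗ[k] K.Ch V U := ceD (g := DerB O β) (K.dgl β).twist

/-- The action on the symmetric algebra. -/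
def Coeff.tw : FDer O V.carrier U →ₗ[k] SymmetricAlgebra k (K.S V) →ₗ[k]
    SymmetricAlgebra k (K.S V) := (K.dgl β).twist

/-- The Lie action on chains given by a realization of the formal linear forms. -/
def Coeff.lieB : FDer O V.carrier U →ₗ[k] K.Ch V U →ₗ[k] K.Ch V U :=
  lieChains (g := DerB O β) (K.dgl β).twist

theorem Coeff.tw_apply (f : FDer O V.carrier U) (p : SymmetricAlgebra k (K.S V)) :
    K.tw β f p = symDer (K.act (toDer β f)) p + SymmetricAlgebra.ι k _ (K.diff (toDer β f)) * p :=
  rfl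

theorem Coeff.wdg_eq (x : FDer O V.carrier U) (c : K.Ch V U) :
    K.wdg x c = wedge (g := DerB O β) (SymmetricAlgebra k (K.S V)) x c := by
  induction c using TensorProduct.induction_on with
  | zero => exact (map_zero (K.wdg x)).trans (map_zero (wedge (g := DerB O β) _ x)).symm
  | add a b ha hb =>
    exact (map_add (K.wdg x) a b).trans ((congrArg₂ (· + ·) ha hb).trans
      (map_add (wedge (g := DerB O β) _ x) a b).symm)
  | tmul ω p => exact (wedge_mk (g := DerB O β) x ω p).symm

theorem Coeff.dB_one (p : SymmetricAlgebra k (K.S V)) :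
    K.dB β (1 ⊗ₜ p : K.Ch V U) = 0 := ceD_one (g := DerB O β) (K.dgl β).twist p

theorem Coeff.lieB_one (x : FDer O V.carrier U) (p : SymmetricAlgebra k (K.S V)) :
    K.lieB β x (1 ⊗ₜ p : K.Ch V U) = 1 ⊗ₜ K.tw β x p :=
  lieChains_one (g := DerB O β) (K.dgl β).twist x p

theorem Coeff.lieB_wdg (x y : FDer O V.carrier U) (c : K.Ch V U) :
    K.lieB β x (K.wdg y c) = K.wdg (fbr β x y) c + K.wdg y (K.lieB β x c) := by
  rw [K.wdg_eq β, K.wdg_eq β, K.wdg_eq β]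
  exact lieChains_wedge (g := DerB O β) (K.dgl β).twist x y c

theorem Coeff.dB_wdg (x : FDer O V.carrier U) (c : K.Ch V U) :
    K.dB β (K.wdg x c) = K.lieB β x c - K.wdg x (K.dB β c) := by
  rw [K.wdg_eq β, K.wdg_eq β]
  exact ceD_wedge (g := DerB O β) (K.dgl β).twist x c

theorem Coeff.dB_dB (c : K.Ch V U) : K.dB β (K.dB β c) = 0 :=
  ceD_ceD (g := DerB O β) (K.dgl β).twist (K.dgl β).twist_lie c

theorem fbr_add (β β' : U →ₗ[k] Module.Dual k V.carrier) (f g : FDer O V.carrier U) :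
    fbr (β + β') f g = fbr β f g + fbr β' f g := by
  unfold fbr
  rw [toDer_add, toDer_add, lTensor_ad_add, lTensor_ad_add]
  abel

theorem fbr_smul (c : k) (β : U →ₗ[k] Module.Dual k V.carrier) (f g : FDer O V.carrier U) :
    fbr (c • β) f g = c • fbr β f g := by
  unfold fbr
  rw [toDer_smul, toDer_smul, lTensor_ad_smul, lTensor_ad_smul,
    smul_sub]

theorem Coeff.tw_add (β β' : U →ₗ[k] Module.Dual k V.carrier) (f : FDer O V.carrier U) (p) :
    K.tw (β + β') f p = K.tw β f p + K.tw β' f p := by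
  rw [tw_apply, tw_apply, tw_apply, toDer_add, map_add, map_add, map_add,
    DGLie.symDer_add, add_mul]
  abel

theorem Coeff.tw_smul (c : k) (β : U →ₗ[k] Module.Dual k V.carrier) (f : FDer O V.carrier U) (p) :
    K.tw (c • β) f p = c • K.tw β f p := by
  rw [tw_apply, tw_apply, toDer_smul, map_smul, map_smul, map_smul,
    DGLie.symDer_smul, smul_add, smul_mul_assoc]

theorem Coeff.lieB_add (β β' : U →ₗ[k] Module.Dual k V.carrier) (f : FDer O V.carrier U)
    (c : K.Ch V U) : K.lieB (β + β') f c = K.lieB β f c + K.lieB β' f c := by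
  induction c using K.ch_ind with
  | h1 p => rw [lieB_one, lieB_one, lieB_one, tw_add, TensorProduct.tmul_add]
  | hm y c hc =>
    rw [lieB_wdg, lieB_wdg, lieB_wdg, hc, fbr_add, map_add, map_add, LinearMap.add_apply]
    abel
  | ha p q hp hq =>
    rw [map_add, map_add, map_add, hp, hq]
    abel

theorem Coeff.lieB_smul (r : k) (β : U →ₗ[k] Module.Dual k V.carrier) (f : FDer O V.carrier U)
    (c : K.Ch V U) : K.lieB (r • β) f c = r • K.lieB β f c := by
  induction c using K.ch_ind with
  | h1 p => rw [lieB_one, lieB_one, tw_smul, TensorProduct.tmul_smul]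
  | hm y c hc =>
    rw [lieB_wdg, lieB_wdg, hc, fbr_smul, map_smul, map_smul, LinearMap.smul_apply, smul_add]
  | ha p q hp hq =>
    rw [map_add, map_add, hp, hq, smul_add]

/-- The differential depends linearly on the realization of the formal linear forms. -/
def Coeff.dBₗ : (U →ₗ[k] Module.Dual k V.carrier) →ₗ[k] K.Ch V U →ₗ[k] K.Ch V U where
  toFun β := K.dB β
  map_add' β β' := LinearMap.ext fun c => by
    rw [LinearMap.add_apply]
    induction c using K.ch_ind with
    | h1 p => rw [dB_one, dB_one, dB_one, add_zero]
    | hm y c hc =>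
      rw [dB_wdg, dB_wdg, dB_wdg, hc, lieB_add, map_add]
      abel
    | ha p q hp hq =>
      rw [map_add, map_add, map_add, hp, hq]
      abel
  map_smul' r β := LinearMap.ext fun c => by
    rw [LinearMap.smul_apply, RingHom.id_apply]
    induction c using K.ch_ind with
    | h1 p => rw [dB_one, dB_one, smul_zero]
    | hm y c hc => rw [dB_wdg, dB_wdg, hc, lieB_smul, map_smul, smul_sub]
    | ha p q hp hq => rw [map_add, map_add, hp, hq, smul_add]

theorem Coeff.dB_anticomm (β β' : U →ₗ[k] Module.Dual k V.carrier) (c : K.Ch V U) :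
    K.dB β (K.dB β' c) = - K.dB β' (K.dB β c) := by
  have e : ∀ c, K.dB (β + β') c = K.dB β c + K.dB β' c := fun c =>
    LinearMap.congr_fun (map_add K.dBₗ β β') c
  have h := K.dB_dB (β + β') c
  rw [e, e, map_add, map_add, dB_dB, dB_dB, zero_add, add_zero] at h
  exact eq_neg_of_add_eq_zero_left h

/-- The map of derivations with formal linear forms. -/
def fmap {V V' : Type u} [AddCommGroup V] [Module k V] [AddCommGroup V'] [Module k V']
    (i : V →ₗ[k] V') (j : U →ₗ[k] U') : FDer O V U →ₗ[k] FDer O V' U' :=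
  TensorProduct.map j (Sch.map (SpMap.id O.sp) i)

theorem map_ad_toDer (i : V.carrier →ₗ[k] W.carrier) (j : U →ₗ[k] U')
    {β : U →ₗ[k] Module.Dual k V.carrier} {β' : U' →ₗ[k] Module.Dual k W.carrier}
    (h : ∀ ξ, β' (j ξ) ∘ₗ i = β ξ) (f : FDer O V.carrier U) (s : Sch O.sp V.carrier) :
    Sch.map (SpMap.id O.sp) i (Der.ad (toDer β f) s)
      = Der.ad (toDer β' (fmap i j f)) (Sch.map (SpMap.id O.sp) i s) := by
  induction f using TensorProduct.induction_on with
  | zero => simp only [map_zero, LinearMap.zero_apply]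
  | add a b ha hb => simp only [map_add, LinearMap.add_apply, ha, hb]
  | tmul ξ u =>
    have hc : InsCompat O.comp O.comp (SpMap.id O.sp) (SpMap.id O.sp) := fun _ _ => rfl
    have e := Sch.map_derivExt hc i (toDer β (ξ ⊗ₜ u)).toMap
      (toDer β' (fmap i j (ξ ⊗ₜ u))).toMap
      (fun v => by
        rw [fmap, TensorProduct.map_tmul, toDer_tmul, toDer_tmul, ← h]
        exact (map_smul (Sch.map (SpMap.id O.sp) i) _ _).symm) s
    exact e

theorem fmap_fbr (i : V.carrier →ₗ[k] W.carrier) (j : U →ₗ[k] U')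
    {β : U →ₗ[k] Module.Dual k V.carrier} {β' : U' →ₗ[k] Module.Dual k W.carrier}
    (h : ∀ ξ, β' (j ξ) ∘ₗ i = β ξ) (f g : FDer O V.carrier U) :
    fmap i j (fbr β f g) = fbr β' (fmap i j f) (fmap i j g) := by
  have key : ∀ f g : FDer O V.carrier U, fmap i j ((Der.ad (toDer β f)).lTensor U g)
      = (Der.ad (toDer β' (fmap i j f))).lTensor U' (fmap i j g) := by
    intro f g
    induction g using TensorProduct.induction_on with
    | zero => simp only [map_zero]
    | add a b ha hb => simp only [map_add, ha, hb]
    | tmul ξ u =>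
      rw [LinearMap.lTensor_tmul]
      change j ξ ⊗ₜ _ = (Der.ad (toDer β' (fmap i j f))).lTensor U' (j ξ ⊗ₜ _)
      rw [LinearMap.lTensor_tmul, map_ad_toDer i j h]
  rw [fbr, map_sub, key, key, fbr]

theorem Coeff.map_act_fmap (i : V.carrier →ₗ[k] W.carrier) (j : U →ₗ[k] U')
    {β : U →ₗ[k] Module.Dual k V.carrier} {β' : U' →ₗ[k] Module.Dual k W.carrier}
    (h : ∀ ξ, β' (j ξ) ∘ₗ i = β ξ) (f : FDer O V.carrier U) (m : K.S V) :
    K.map i (K.act (toDer β f) m) = K.act (toDer β' (fmap i j f)) (K.map i m) := by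
  induction f using TensorProduct.induction_on with
  | zero => simp only [map_zero, LinearMap.zero_apply]
  | add a b ha hb => simp only [map_add, LinearMap.add_apply, ha, hb]
  | tmul ξ u =>
    rw [fmap, TensorProduct.map_tmul, toDer_tmul, toDer_tmul, ← h]
    exact K.map_act i (β' (j ξ)) u m

theorem Coeff.map_diff_fmap (i : V.carrier →ₗ[k] W.carrier) (j : U →ₗ[k] U')
    {β : U →ₗ[k] Module.Dual k V.carrier} {β' : U' →ₗ[k] Module.Dual k W.carrier}
    (h : ∀ ξ, β' (j ξ) ∘ₗ i = β ξ) (f : FDer O V.carrier U) :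
    K.map i (K.diff (toDer β f)) = K.diff (toDer β' (fmap i j f)) := by
  induction f using TensorProduct.induction_on with
  | zero => simp only [map_zero]
  | add a b ha hb => simp only [map_add, ha, hb]
  | tmul ξ u =>
    rw [fmap, TensorProduct.map_tmul, toDer_tmul, toDer_tmul, ← h]
    exact K.map_diff i (β' (j ξ)) u

/-- The morphism of differential graded Lie algebras given by compatible realizations. -/
def Coeff.dglMap (i : V.carrier →ₗ[k] W.carrier) (j : U →ₗ[k] U')
    {β : U →ₗ[k] Module.Dual k V.carrier} {β' : U' →ₗ[k] Module.Dual k W.carrier}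
    (h : ∀ ξ, β' (j ξ) ∘ₗ i = β ξ) : K.dgl β ⟶ K.dgl β' where
  map0 := fmap (O := O) i j
  mapNeg := K.map i
  map_lie f g := fmap_fbr (O := O) i j h f g
  map_act f m := K.map_act_fmap i j h f m
  map_diff f := K.map_diff_fmap i j h f

/-- Functoriality of formal chains. -/
def Coeff.chMap (i : V.carrier →ₗ[k] W.carrier) (j : U →ₗ[k] U') : K.Ch V U →ₗ[k] K.Ch W U' :=
  TensorProduct.map (ExteriorAlgebra.map (fmap (O := O) i j)).toLinearMap
    (DGLie.symMap (K.map i)).toLinearMap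

theorem Coeff.chMap_dB (i : V.carrier →ₗ[k] W.carrier) (j : U →ₗ[k] U')
    {β : U →ₗ[k] Module.Dual k V.carrier} {β' : U' →ₗ[k] Module.Dual k W.carrier}
    (h : ∀ ξ, β' (j ξ) ∘ₗ i = β ξ) (c : K.Ch V U) :
    K.chMap i j (K.dB β c) = K.dB β' (K.chMap i j c) :=
  chainsMap_ceD (ρ := (K.dgl β).twist) (ρ' := (K.dgl β').twist)
    (φ := (DGLie.symMap (K.map i)).toLinearMap) (DGLie.Hom.map_lie (K.dglMap i j h))
    (fun x p => DGLie.symMap_twist (K.dglMap i j h) x p) c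

end FormalChains

section SupportedBimodules

variable {k : Type u} [Field k] (P : Species k) {n : ℕ} {X Y X' Y' : Type} [Finite X] [Finite Y]
  [Finite X'] [Finite Y']

/-- The element of a species underlying an element of a bimodule. -/
def bimodVal (h : Nat.card Y = n) : (P.bimod n).at' X Y →ₗ[k] P.at' X :=
  LinearMap.proj (R := k) (φ := fun _ : PLift (Nat.card Y = n) => P.at' X) ⟨h⟩

theorem bimodVal_relabel (h : Nat.card Y = n) (h' : Nat.card Y' = n) (e : X ≃ X') (e' : Y ≃ Y')
    (a : (P.bimod n).at' X Y) :
    bimodVal P h' ((P.bimod n).relabel e e' a) = P.relabel e (bimodVal P h a) := rfl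

theorem bimod_eq_zero (h : ¬ Nat.card Y = n) (a : (P.bimod n).at' X Y) : a = 0 :=
  funext (β := fun _ : PLift (Nat.card Y = n) => P.at' X) (g := fun _ => 0) fun h' => (h h'.1).elim

theorem bimod_eq_elt (h : Nat.card Y = n) (e : Fin n ≃ Y) (a : (P.bimod n).at' X Y) :
    a = (P.bimod n).relabel (Equiv.refl X) e (P.elt n (bimodVal P h a)) :=
  funext (β := fun _ : PLift (Nat.card Y = n) => P.at' X) (f := a)
    (g := (P.bimod n).relabel (Equiv.refl X) e (P.elt n (bimodVal P h a)))
    fun _ => (Species.relabel_refl P (bimodVal P h a)).symm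

/-- An equivalence with the standard finite set of the given cardinality. -/
def finEquivOf {Y : Type} [Finite Y] {n : ℕ} (h : Nat.card Y = n) : Fin n ≃ Y :=
  (Finite.equivFinOfCardEq h).symm

variable (V U : Type u) [AddCommGroup V] [Module k V] [AddCommGroup U] [Module k U]

/-- Tensors with one factor, given by the unique label. -/
def tensorPoint (h : Nat.card Y = 1) : (⨂[k] _ : Y, U) ≃ₗ[k] U :=
  haveI := (Nat.card_eq_one_iff_unique.1 h).1
  PiTensorProduct.subsingletonEquiv (finEquivOf h 0)

theorem tensorPoint_tprod (h : Nat.card Y = 1) (ξ : Y → U) (y : Y) :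
    tensorPoint (k := k) U h (PiTensorProduct.tprod k ξ) = ξ y := by
  have := (Nat.card_eq_one_iff_unique.1 h).1
  rw [tensorPoint, PiTensorProduct.subsingletonEquiv_apply_tprod, Subsingleton.elim y]

open Classical in
/-- The tautological natural family of a species with one root. -/
def evOne : Ev (P.bimod 1) V U (U ⊗[k] Sch P V) where
  app X Y _ _ := if h : Nat.card Y = 1 then
      (LinearMap.lcomp k _ (TensorProduct.comm k _ _).toLinearMap) ∘ₗ
      ((TensorProduct.mapBilinear (RingHom.id k) (⨂[k] _ : Y, U) (⨂[k] _ : X, V) U (Sch P V)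
        (tensorPoint U h).toLinearMap)) ∘ₗ Sch.mk ∘ₗ bimodVal P h
    else 0
  nat {X Y X' Y'} _ _ _ _ e e' a v ξ := by
    by_cases h : Nat.card Y = 1
    · have h' : Nat.card Y' = 1 := (Nat.card_congr e').symm.trans h
      rw [dif_pos h, dif_pos h']
      change tensorPoint U h' (PiTensorProduct.tprod k ξ) ⊗ₜ[k]
          Sch.gen (bimodVal P h' ((P.bimod 1).relabel e e' a)) v
        = tensorPoint U h (PiTensorProduct.tprod k (ξ ∘ e')) ⊗ₜ[k] Sch.gen (bimodVal P h a) (v ∘ e)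
      rw [bimodVal_relabel P h, Sch.gen_relabel,
        tensorPoint_tprod U h' ξ (e' (finEquivOf h 0)), tensorPoint_tprod U h _ (finEquivOf h 0)]
      rfl
    · have h' : ¬ Nat.card Y' = 1 := fun h' => h ((Nat.card_congr e').trans h')
      rw [dif_neg h, dif_neg h']
      rfl

theorem evOne_val (h : Nat.card Y = 1) (a : (P.bimod 1).at' X Y) (v : X → V) (ξ : Y → U) (y : Y) :
    (evOne P V U).val a v ξ = ξ y ⊗ₜ[k] Sch.gen (bimodVal P h a) v := by
  unfold evOne Ev.val
  simp only [dif_pos h]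
  change tensorPoint U h (PiTensorProduct.tprod k ξ) ⊗ₜ[k] Sch.gen (bimodVal P h a) v = _
  rw [tensorPoint_tprod U h ξ y]

theorem evOne_elt (a : P.at' X) (v : X → V) (ξ : Fin 1 → U) :
    (evOne P V U).val (P.elt 1 a) v ξ = ξ 0 ⊗ₜ[k] Sch.gen a v :=
  evOne_val P V U (Nat.card_fin 1) (P.elt 1 a) v ξ 0

open Classical in
/-- The tautological natural family of a species without root. -/
def evZero : Ev (P.bimod 0) V U (Sch P V) where
  app X Y _ _ := if h : Nat.card Y = 0 then
      haveI : IsEmpty Y := (finEquivOf h).symm.isEmpty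
      (LinearMap.lcomp k _ ((TensorProduct.rid k _).toLinearMap ∘ₗ
        (PiTensorProduct.isEmptyEquiv (R := k) (s := fun _ : Y => U) Y).toLinearMap.lTensor _)) ∘ₗ
      Sch.mk ∘ₗ bimodVal P h
    else 0
  nat {X Y X' Y'} _ _ _ _ e e' a v ξ := by
    by_cases h : Nat.card Y = 0
    · have h' : Nat.card Y' = 0 := (Nat.card_congr e').symm.trans h
      have : IsEmpty Y := (finEquivOf h).symm.isEmpty
      have : IsEmpty Y' := (finEquivOf h').symm.isEmpty
      rw [dif_pos h, dif_pos h']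
      simp only [LinearMap.comp_apply, LinearMap.lcomp_apply, mtu, LinearMap.lTensor_tmul,
        LinearEquiv.coe_coe, PiTensorProduct.isEmptyEquiv_apply_tprod, TensorProduct.rid_tmul,
        one_smul, Sch.mk_tprod]
      rw [bimodVal_relabel P h, Sch.gen_relabel]
    · have h' : ¬ Nat.card Y' = 0 := fun h' => h ((Nat.card_congr e').trans h')
      rw [dif_neg h, dif_neg h']
      rfl

theorem evZero_val (h : Nat.card Y = 0) (a : (P.bimod 0).at' X Y) (v : X → V) (ξ : Y → U) :
    (evZero P V U).val a v ξ = Sch.gen (bimodVal P h a) v := by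
  have : IsEmpty Y := (finEquivOf h).symm.isEmpty
  unfold evZero Ev.val
  simp only [dif_pos h, LinearMap.comp_apply, LinearMap.lcomp_apply, mtu, LinearMap.lTensor_tmul,
        LinearEquiv.coe_coe, PiTensorProduct.isEmptyEquiv_apply_tprod, TensorProduct.rid_tmul,
        one_smul, Sch.mk_tprod]

theorem evZero_elt (a : P.at' X) (v : X → V) (ξ : Fin 0 → U) :
    (evZero P V U).val (P.elt 0 a) v ξ = Sch.gen a v :=
  evZero_val P V U (Nat.card_fin 0) (P.elt 0 a) v ξ

/-- The map to the mixed Schur functor of a species with one root. -/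
def coevOne : U ⊗[k] Sch P V →ₗ[k] MixSch (P.bimod 1) V U :=
  TensorProduct.lift (LinearMap.flip (Sch.lift
    (fun X _ => LinearMap.mk₂ k (fun p t => MixSch.gen.app X (Fin 1) (P.elt 1 p) ∘ₗ
        TensorProduct.mk k _ _ t ∘ₗ (tensorPoint U (Nat.card_fin 1)).symm.toLinearMap)
      (fun p p' t => by
        have : P.elt 1 (p + p') = P.elt 1 p + P.elt 1 p' := rfl
        rw [this, map_add, LinearMap.add_comp])
      (fun c p t => by
        have : P.elt 1 (c • p) = c • P.elt 1 p := rfl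
        rw [this, map_smul, LinearMap.smul_comp])
      (fun p t t' => by rw [map_add, LinearMap.add_comp, LinearMap.comp_add])
      (fun c p t => by rw [map_smul, LinearMap.smul_comp, LinearMap.comp_smul]))
    (fun X X' _ _ f p v => by
      refine LinearMap.ext fun ξ => ?_
      have e : ((tensorPoint U (Nat.card_fin 1)).symm ξ : ⨂[k] _ : Fin 1, U)
          = PiTensorProduct.tprod k fun _ => ξ := by
        rw [LinearEquiv.symm_apply_eq, tensorPoint_tprod U (Nat.card_fin 1) _ 0]
      change MixSch.gen.app X' (Fin 1) ((P.bimod 1).relabel f (Equiv.refl _) (P.elt 1 p))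
        (_ ⊗ₜ (tensorPoint U (Nat.card_fin 1)).symm ξ) = MixSch.gen.app X (Fin 1) (P.elt 1 p)
        (_ ⊗ₜ (tensorPoint U (Nat.card_fin 1)).symm ξ)
      rw [e]
      exact MixSch.gen.nat f (Equiv.refl _) (P.elt 1 p) v (fun _ => ξ))))

theorem coevOne_evOne (a : (P.bimod 1).at' X Y) (v : X → V) (ξ : Y → U) :
    coevOne P V U ((evOne P V U).val a v ξ) = MixSch.gen.val a v ξ := by
  by_cases h : Nat.card Y = 1
  · have key : ∀ (p : P.at' X) (v : X → V) (ξ : Fin 1 → U),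
        coevOne P V U (ξ 0 ⊗ₜ[k] Sch.gen p v) = MixSch.gen.val (P.elt 1 p) v ξ := by
      intro p v ξ
      rw [coevOne, TensorProduct.lift.tmul, LinearMap.flip_apply, Sch.lift_gen]
      have e : ((tensorPoint U (Nat.card_fin 1)).symm (ξ 0) : ⨂[k] _ : Fin 1, U)
          = PiTensorProduct.tprod k ξ := by
        rw [LinearEquiv.symm_apply_eq, tensorPoint_tprod U (Nat.card_fin 1) _ 0]
      exact congrArg (fun t => MixSch.gen.app X (Fin 1) (P.elt 1 p)
        (PiTensorProduct.tprod k v ⊗ₜ t)) e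
    rw [bimod_eq_elt P h (finEquivOf h) a, Ev.val_relabel, Ev.val_relabel, evOne_elt]
    exact key _ _ _
  · rw [bimod_eq_zero P h a, Ev.val_zero, Ev.val_zero, map_zero]

/-- The map to the mixed Schur functor of a species without root. -/
def coevZero : Sch P V →ₗ[k] MixSch (P.bimod 0) V U :=
  Sch.lift
    (fun X _ => LinearMap.mk₂ k (fun p t => MixSch.gen.app X (Fin 0) (P.elt 0 p)
        (t ⊗ₜ PiTensorProduct.tprod k fun i : Fin 0 => i.elim0))
      (fun p p' t => by
        have : P.elt 0 (p + p') = P.elt 0 p + P.elt 0 p' := rfl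
        rw [this, map_add, LinearMap.add_apply])
      (fun c p t => by
        have : P.elt 0 (c • p) = c • P.elt 0 p := rfl
        rw [this, map_smul, LinearMap.smul_apply])
      (fun p t t' => by rw [TensorProduct.add_tmul, map_add])
      (fun c p t => by rw [← TensorProduct.smul_tmul', map_smul]))
    (fun X X' _ _ f p v => (MixSch.gen.nat f (Equiv.refl _) (P.elt 0 p) v
      (fun i : Fin 0 => i.elim0)).trans (congrArg (MixSch.gen.val (P.elt 0 p) (v ∘ f)) (Subsingleton.elim _ _)))

theorem coevZero_evZero (a : (P.bimod 0).at' X Y) (v : X → V) (ξ : Y → U) :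
    coevZero P V U ((evZero P V U).val a v ξ) = MixSch.gen.val a v ξ := by
  by_cases h : Nat.card Y = 0
  · have key : ∀ (p : P.at' X) (v : X → V) (ξ : Fin 0 → U),
        coevZero P V U (Sch.gen p v) = MixSch.gen.val (P.elt 0 p) v ξ := by
      intro p v ξ
      rw [Subsingleton.elim ξ fun i => i.elim0]
      exact Sch.lift_gen _ _ p v
    rw [bimod_eq_elt P h (finEquivOf h) a, Ev.val_relabel, Ev.val_relabel, evZero_elt]
    exact key _ _ _
  · rw [bimod_eq_zero P h a, Ev.val_zero, Ev.val_zero, map_zero]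

end SupportedBimodules

section Products

variable {k : Type u} [Field k] (F : FBMod k) (ε : k) {V U : Type u} [AddCommGroup V] [Module k V]
  [AddCommGroup U] [Module k U]

/-- The unit of the tensor powers. -/
def powUnit (X Y : Type) [Finite X] [Finite Y] [IsEmpty X] [IsEmpty Y] : (convPow F 0).at' X Y :=
  fun _ : PLift (IsEmpty X ∧ IsEmpty Y) => (1 : k)

theorem powZero_eq {X Y : Type} [Finite X] [Finite Y] [IsEmpty X] [IsEmpty Y]
    (t : (convPow F 0).at' X Y) : ∃ c : k, t = c • powUnit F X Y :=
  ⟨(show PLift (IsEmpty X ∧ IsEmpty Y) → k from t) ⟨⟨‹_›, ‹_›⟩⟩,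
    funext (β := fun _ : PLift (IsEmpty X ∧ IsEmpty Y) => k) (f := t)
      fun _ => (mul_one (M := k) _).symm⟩

theorem powZero_eq_zero {X Y : Type} [Finite X] [Finite Y] (h : ¬ (IsEmpty X ∧ IsEmpty Y))
    (t : (convPow F 0).at' X Y) : t = 0 :=
  funext (β := fun _ : PLift (IsEmpty X ∧ IsEmpty Y) => k) (f := t)
    (g := fun _ => 0) fun h' => (h h'.1).elim

theorem Ev.pow_unit {F : FBMod k} {A : Type u} [Ring A] [Algebra k A] (φ : Ev F V U A) {X Y : Type}
    [Finite X] [Finite Y] [IsEmpty X] [IsEmpty Y] (v : X → V) (ξ : Y → U) :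
    (φ.pow 0).val (powUnit F X Y) v ξ = 1 :=
  (Ev.unit_val (1 : A) ⟨‹_›, ‹_›⟩ (powUnit F X Y) v ξ).trans (one_smul k 1)

namespace MixSch

theorem ind₂ {F G : FBMod k} {N : Type*} [AddCommGroup N] [Module k N]
    {f g : MixSch F V U →ₗ[k] MixSch G V U →ₗ[k] N}
    (h : ∀ (X Y X' Y' : Type) [Finite X] [Finite Y] [Finite X'] [Finite Y'] (a : F.at' X Y)
      (b : G.at' X' Y') v ξ v' ξ',
      f (gen.val a v ξ) (gen.val b v' ξ') = g (gen.val a v ξ) (gen.val b v' ξ')) : f = g :=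
  ext fun X Y _ _ a v ξ => ext fun X' Y' _ _ b v' ξ' => h X Y X' Y' a b v ξ v' ξ'

/-- The multiplication by an element of the mixed Schur functor of the generators. -/
def mulL : MixSch F V U →ₗ[k] Module.End k (MixSch (powAlg F ε) V U) := prod (consPairing F ε)

theorem mulL_gen {X₁ Y₁ X₂ Y₂ : Type} [Finite X₁] [Finite Y₁] [Finite X₂] [Finite Y₂]
    (a : F.at' X₁ Y₁) (v : X₁ → V) (ξ : Y₁ → U) {d : ℕ} (t : (convPow F d).at' X₂ Y₂)
    (v' : X₂ → V) (ξ' : Y₂ → U) :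
    mulL F ε (gen.val a v ξ) (gen.val (powMk F ε t) v' ξ')
      = gen.val (powMk F ε (powCons F d (Equiv.refl _) (Equiv.refl _) a t)) (Sum.elim v v')
        (Sum.elim ξ ξ') := by
  rw [mulL, prod_gen]
  exact congrArg (fun z => gen.val z _ _) (consAlg_mk F ε _ _ a t)

theorem mulL_comm (x y : MixSch F V U) :
    mulL F ε x * mulL F ε y = ε • (mulL F ε y * mulL F ε x) := by
  let m : MixSch F V U →ₗ[k] MixSch F V U →ₗ[k] Module.End k (MixSch (powAlg F ε) V U) :=
    (LinearMap.mul k (Module.End k (MixSch (powAlg F ε) V U))).compl₁₂ (mulL F ε) (mulL F ε)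
  suffices h : m = ε • m.flip from LinearMap.congr_fun (LinearMap.congr_fun h x) y
  refine ind₂ fun X₁ Y₁ X₂ Y₂ _ _ _ _ a b v ξ v' ξ' => ext fun X₃ Y₃ _ _ t w ζ => ?_
  change mulL F ε (gen.val a v ξ) (mulL F ε (gen.val b v' ξ') (gen.val t w ζ))
    = ε • (mulL F ε (gen.val b v' ξ') (mulL F ε (gen.val a v ξ) (gen.val t w ζ)))
  refine LinearMap.congr_fun
    (f := mulL F ε (gen.val a v ξ) ∘ₗ mulL F ε (gen.val b v' ξ') ∘ₗ gen.valₗ w ζ)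
    (g := ε • (mulL F ε (gen.val b v' ξ') ∘ₗ mulL F ε (gen.val a v ξ) ∘ₗ gen.valₗ w ζ))
    (powAlg_ext fun d t => ?_) t
  simp only [LinearMap.smul_apply, LinearMap.comp_apply, Ev.valₗ_apply, mulL_gen]
  rw [powMk_swap, Ev.val_smul]
  congr 1
  have := gen.val_relabel (V := V) (U := U) (leftComm X₂ X₁ X₃) (leftComm Y₂ Y₁ Y₃)
    (powMk F ε (powCons F (d + 1) (Equiv.refl _) (Equiv.refl _) b (powCons F d (Equiv.refl _)
      (Equiv.refl _) a t))) (Sum.elim v (Sum.elim v' w)) (Sum.elim ξ (Sum.elim ξ' ζ))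
  rw [relabel_powMk, relabel_powCons] at this
  refine this.trans ?_
  congr 1 <;> funext x <;> rcases x with x | x | x <;> rfl

/-- The unit of the mixed Schur functor of a symmetric or exterior algebra. -/
def one : MixSch (powAlg F ε) V U :=
  gen.val (powMk F ε (powUnit F (Fin 0) (Fin 0))) (fun i => i.elim0) (fun i => i.elim0)

theorem gen_unit {X Y : Type} [Finite X] [Finite Y] [IsEmpty X] [IsEmpty Y] (v : X → V)
    (ξ : Y → U) : gen.val (powMk F ε (powUnit F X Y)) v ξ = one F ε := by
  have h : powUnit F X Y = (convPow F 0).relabel (Equiv.equivOfIsEmpty (Fin 0) X)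
    (Equiv.equivOfIsEmpty (Fin 0) Y) (powUnit F (Fin 0) (Fin 0)) := rfl
  rw [h, ← relabel_powMk, Ev.val_relabel, one]
  congr 1 <;> exact Subsingleton.elim _ _

end MixSch

variable {F ε}

/-- A representation of an algebra on the mixed Schur functor recovers the elements of a
symmetric or exterior algebra from their values. -/
theorem rep_alg {A : Type u} [Ring A] [Algebra k A] (φ : Ev F V U A)
    (hφ : ∀ {X₁ Y₁ X₂ Y₂ : Type} [Finite X₁] [Finite Y₁] [Finite X₂] [Finite Y₂]
      (a : F.at' X₁ Y₁) (b : F.at' X₂ Y₂) (v ξ v' ξ'),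
      φ.val a v ξ * φ.val b v' ξ' = ε • (φ.val b v' ξ' * φ.val a v ξ))
    (ρ : A →ₐ[k] Module.End k (MixSch (powAlg F ε) V U))
    (hρ : ∀ {X Y : Type} [Finite X] [Finite Y] (a : F.at' X Y) v ξ,
      ρ (φ.val a v ξ) = MixSch.mulL F ε (MixSch.gen.val a v ξ))
    {X Y : Type} [Finite X] [Finite Y] (t : (powAlg F ε).at' X Y) (v : X → V) (ξ : Y → U) :
    ρ ((φ.alg ε hφ).val t v ξ) (MixSch.one F ε) = MixSch.gen.val t v ξ := by
  have main : ∀ (d : ℕ) (X Y : Type) [Finite X] [Finite Y] (t : (convPow F d).at' X Y) (v : X → V)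
      (ξ : Y → U), ρ ((φ.pow d).val t v ξ) (MixSch.one F ε) = MixSch.gen.val (powMk F ε t) v ξ := by
    intro d
    induction d with
    | zero =>
      intro X Y _ _ t v ξ
      by_cases h : IsEmpty X ∧ IsEmpty Y
      · have := h.1
        have := h.2
        obtain ⟨c, rfl⟩ := powZero_eq F t
        rw [map_smul, Ev.val_smul, Ev.val_smul, Ev.pow_unit, map_smul, map_one, MixSch.gen_unit]
        rfl
      · rw [powZero_eq_zero F h t, Ev.val_zero, map_zero, map_zero, Ev.val_zero]
        rfl
    | succ d ih =>
      intro X Y _ _ t v ξ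
      let f : (convPow F (d + 1)).at' X Y →ₗ[k] MixSch (powAlg F ε) V U :=
        LinearMap.applyₗ (MixSch.one F ε) ∘ₗ ρ.toLinearMap ∘ₗ (φ.pow (d + 1)).valₗ v ξ
      let g : (convPow F (d + 1)).at' X Y →ₗ[k] MixSch (powAlg F ε) V U :=
        MixSch.gen.valₗ v ξ ∘ₗ powMk F ε
      suffices h : f = g from LinearMap.congr_fun h t
      refine conv_ext (F := F) (G := convPow F d) fun X₁ X₂ Y₁ Y₂ _ _ _ _ e e' a b => ?_
      change ρ ((φ.pow (d + 1)).val (powCons F d e e' a b) v ξ) (MixSch.one F ε)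
        = MixSch.gen.val (powMk F ε (powCons F d e e' a b)) v ξ
      rw [Ev.pow_cons, map_mul, Module.End.mul_apply, ih, hρ, MixSch.mulL_gen]
      have := MixSch.gen.val_relabel (V := V) (U := U) e e' (powMk F ε (powCons F d (Equiv.refl _)
        (Equiv.refl _) a b)) v ξ
      rw [relabel_powMk, relabel_powCons] at this
      refine Eq.trans ?_ this.symm
      congr 1 <;> funext x <;> rcases x with x | x <;> rfl
  let f : (powAlg F ε).at' X Y →ₗ[k] MixSch (powAlg F ε) V U :=
    LinearMap.applyₗ (MixSch.one F ε) ∘ₗ ρ.toLinearMap ∘ₗ (φ.alg ε hφ).valₗ v ξ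
  refine LinearMap.congr_fun (f := f) (g := MixSch.gen.valₗ v ξ) (powAlg_ext fun d t => ?_) t
  refine Eq.trans ?_ (main d X Y t v ξ)
  rw [← Ev.alg_val φ ε hφ]
  rfl

/-- A representation of a symmetric algebra from commuting operators. -/
theorem exists_sym_rep {M N : Type u} [AddCommGroup M] [Module k M] [AddCommGroup N] [Module k N]
    (L : M →ₗ[k] Module.End k N) (hL : ∀ x y, L x * L y = L y * L x) :
    ∃ ρ : SymmetricAlgebra k M →ₐ[k] Module.End k N, ∀ m, ρ (SymmetricAlgebra.ι k M m) = L m := by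
  let S : Subalgebra k (Module.End k N) := Algebra.adjoin k (Set.range L)
  have : IsMulCommutative S := Algebra.isMulCommutative_adjoin k (by
    rintro _ ⟨x, rfl⟩ _ ⟨y, rfl⟩
    exact hL x y)
  let : CommRing S := { (inferInstance : Ring S) with mul_comm := this.is_comm.comm }
  let l : M →ₗ[k] S := L.codRestrict (Subalgebra.toSubmodule S)
    fun m => Algebra.subset_adjoin ⟨m, rfl⟩
  refine ⟨S.val.comp (SymmetricAlgebra.lift l), fun m => ?_⟩
  rw [AlgHom.comp_apply, SymmetricAlgebra.lift_ι_apply]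
  rfl

/-- A representation of an exterior algebra from anticommuting operators. -/
theorem exists_ext_rep [CharZero k] {M N : Type u} [AddCommGroup M] [Module k M] [AddCommGroup N]
    [Module k N] (L : M →ₗ[k] Module.End k N) (hL : ∀ x y, L x * L y = - (L y * L x)) :
    ∃ ρ : ExteriorAlgebra k M →ₐ[k] Module.End k N, ∀ m, ρ (ExteriorAlgebra.ι k m) = L m :=
  ⟨ExteriorAlgebra.lift k ⟨L, fun m => by
    have h := hL m m
    rw [eq_neg_iff_add_eq_zero, ← two_smul k] at h
    exact (smul_eq_zero.1 h).resolve_left two_ne_zero⟩,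
    fun m => ExteriorAlgebra.lift_ι_apply k L _ m⟩

end Products

section OperadEvaluations

variable {k : Type u} [Field k] (O : Operad k) (V U : Type u) [AddCommGroup V] [Module k V]
  [AddCommGroup U] [Module k U]

theorem ext_ι_mul_comm {M : Type u} [AddCommGroup M] [Module k M] (x y : M) :
    ExteriorAlgebra.ι k x * ExteriorAlgebra.ι k y
      = (-1 : k) • (ExteriorAlgebra.ι k y * ExteriorAlgebra.ι k x) := by
  rw [neg_one_smul, eq_neg_iff_add_eq_zero, ExteriorAlgebra.ι_add_mul_swap]

/-- The evaluation of operations in the exterior algebra. -/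
def evExtGen : Ev O.bimod V U (ExteriorAlgebra k (FDer O V U)) :=
  (evOne O.sp V U).comp (ExteriorAlgebra.ι k)

/-- The evaluation of wheels in the symmetric algebra. -/
def evSymGen : Ev O.wheelBimod V U (SymmetricAlgebra k (Sch (wheelSp O) V)) :=
  (evZero (wheelSp O) V U).comp (SymmetricAlgebra.ι k _)

variable {X₁ X₂ Y₁ Y₂ X Y : Type} [Finite X₁] [Finite X₂] [Finite Y₁] [Finite Y₂] [Finite X]
  [Finite Y]

theorem evExtGen_swap (a : O.bimod.at' X₁ Y₁) (b : O.bimod.at' X₂ Y₂) (v ξ v' ξ') :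
    (evExtGen O V U).val a v ξ * (evExtGen O V U).val b v' ξ'
      = (-1 : k) • ((evExtGen O V U).val b v' ξ' * (evExtGen O V U).val a v ξ) :=
  ext_ι_mul_comm _ _

theorem evSymGen_swap (a : O.wheelBimod.at' X₁ Y₁) (b : O.wheelBimod.at' X₂ Y₂) (v ξ v' ξ') :
    (evSymGen O V U).val a v ξ * (evSymGen O V U).val b v' ξ'
      = (1 : k) • ((evSymGen O V U).val b v' ξ' * (evSymGen O V U).val a v ξ) :=
  (mul_comm _ _).trans (one_smul k _).symm

/-- The evaluation of the exterior algebra of an operad. -/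
def evExt : Ev O.extBimod V U (ExteriorAlgebra k (FDer O V U)) :=
  (evExtGen O V U).alg (-1) (evExtGen_swap O V U)

/-- The evaluation of the symmetric algebra of wheels. -/
def evSym : Ev (powAlg O.wheelBimod 1) V U (SymmetricAlgebra k (Sch (wheelSp O) V)) :=
  (evSymGen O V U).alg 1 (evSymGen_swap O V U)

variable {V U}

theorem evExt_mk {d : ℕ} (t : (convPow O.bimod d).at' X Y) (v : X → V) (ξ : Y → U) :
    (evExt O V U).val (powMk O.bimod (-1) t) v ξ = ((evExtGen O V U).pow d).val t v ξ :=
  (evExtGen O V U).alg_val (-1) (evExtGen_swap O V U) t v ξ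

theorem evSym_mk {d : ℕ} (t : (convPow O.wheelBimod d).at' X Y) (v : X → V) (ξ : Y → U) :
    (evSym O V U).val (powMk O.wheelBimod 1 t) v ξ = ((evSymGen O V U).pow d).val t v ξ :=
  (evSymGen O V U).alg_val 1 (evSymGen_swap O V U) t v ξ

theorem evExt_cons {d : ℕ} (e : X₁ ⊕ X₂ ≃ X) (e' : Y₁ ⊕ Y₂ ≃ Y) (a : O.bimod.at' X₁ Y₁)
    (t : (convPow O.bimod d).at' X₂ Y₂) (v : X → V) (ξ : Y → U) :
    (evExt O V U).val (powMk O.bimod (-1) (powCons O.bimod d e e' a t)) v ξ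
      = ExteriorAlgebra.ι k ((evOne O.sp V U).val a (v ∘ e ∘ Sum.inl) (ξ ∘ e' ∘ Sum.inl))
        * (evExt O V U).val (powMk O.bimod (-1) t) (v ∘ e ∘ Sum.inr) (ξ ∘ e' ∘ Sum.inr) := by
  rw [evExt_mk, evExt_mk, Ev.pow_cons]
  rfl

theorem evExt_unit [IsEmpty X] [IsEmpty Y] (v : X → V) (ξ : Y → U) :
    (evExt O V U).val (powMk O.bimod (-1) (powUnit O.bimod X Y)) v ξ = 1 := by
  rw [evExt_mk, Ev.pow_unit]

theorem evSym_cons {d : ℕ} (e : X₁ ⊕ X₂ ≃ X) (e' : Y₁ ⊕ Y₂ ≃ Y) (a : O.wheelBimod.at' X₁ Y₁)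
    (t : (convPow O.wheelBimod d).at' X₂ Y₂) (v : X → V) (ξ : Y → U) :
    (evSym O V U).val (powMk O.wheelBimod 1 (powCons O.wheelBimod d e e' a t)) v ξ
      = SymmetricAlgebra.ι k _ ((evZero (wheelSp O) V U).val a (v ∘ e ∘ Sum.inl)
          (ξ ∘ e' ∘ Sum.inl))
        * (evSym O V U).val (powMk O.wheelBimod 1 t) (v ∘ e ∘ Sum.inr) (ξ ∘ e' ∘ Sum.inr) := by
  rw [evSym_mk, evSym_mk, Ev.pow_cons]
  rfl

theorem evSym_unit [IsEmpty X] [IsEmpty Y] (v : X → V) (ξ : Y → U) :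
    (evSym O V U).val (powMk O.wheelBimod 1 (powUnit O.wheelBimod X Y)) v ξ = 1 := by
  rw [evSym_mk, Ev.pow_unit]

variable (V U) in
/-- The evaluation of the product of the exterior algebra of an operad and the
symmetric algebra of wheels. -/
def evM : Ev O.extSymBimod V U
    (ExteriorAlgebra k (FDer O V U) ⊗[k] SymmetricAlgebra k (Sch (wheelSp O) V)) :=
  (evExt O V U).conv (evSym O V U)

theorem evM_mk (e : X₁ ⊕ X₂ ≃ X) (e' : Y₁ ⊕ Y₂ ≃ Y) (a : O.extBimod.at' X₁ Y₁)
    (b : (powAlg O.wheelBimod 1).at' X₂ Y₂) (v : X → V) (ξ : Y → U) :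
    (evM O V U).val (convMk O.extBimod (powAlg O.wheelBimod 1) e e' a b) v ξ
      = (evExt O V U).val a (v ∘ e ∘ Sum.inl) (ξ ∘ e' ∘ Sum.inl)
        ⊗ₜ (evSym O V U).val b (v ∘ e ∘ Sum.inr) (ξ ∘ e' ∘ Sum.inr) :=
  Ev.conv_mk _ _ e e' a b v ξ

variable (V U) in
/-- The evaluation of the exterior algebra of an operad in chains without coefficients. -/
def evN : Ev O.extBimod V U
    (ExteriorAlgebra k (FDer O V U) ⊗[k] SymmetricAlgebra k PUnit.{u + 1}) :=
  (evExt O V U).comp ((TensorProduct.mk k _ _).flip 1)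

theorem evN_val (a : O.extBimod.at' X Y) (v : X → V) (ξ : Y → U) :
    (evN O V U).val a v ξ = (evExt O V U).val a v ξ ⊗ₜ 1 := rfl

/-! ### Induction principles -/

/-- The tensor powers are spanned by the unit and the products with generators. -/
theorem powAlg_induction {F : FBMod k} {ε : k}
    {C : ∀ (X Y : Type) [Finite X] [Finite Y], Submodule k ((powAlg F ε).at' X Y)}
    (h0 : ∀ (X Y : Type) [Finite X] [Finite Y] [IsEmpty X] [IsEmpty Y],
      powMk F ε (powUnit F X Y) ∈ C X Y)
    (hc : ∀ (d : ℕ) (X₁ X₂ Y₁ Y₂ X Y : Type) [Finite X₁] [Finite X₂] [Finite Y₁] [Finite Y₂]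
      [Finite X] [Finite Y] (e : X₁ ⊕ X₂ ≃ X) (e' : Y₁ ⊕ Y₂ ≃ Y) (a : F.at' X₁ Y₁)
      (t : (convPow F d).at' X₂ Y₂), powMk F ε t ∈ C X₂ Y₂ →
        powMk F ε (powCons F d e e' a t) ∈ C X Y)
    {X Y : Type} [Finite X] [Finite Y] (t : (powAlg F ε).at' X Y) : t ∈ C X Y := by
  have key : ∀ (d : ℕ) (X Y : Type) [Finite X] [Finite Y] (t : (convPow F d).at' X Y),
      powMk F ε t ∈ C X Y := by
    intro d
    induction d with
    | zero =>
      intro X Y _ _ t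
      by_cases h : IsEmpty X ∧ IsEmpty Y
      · have := h.1
        have := h.2
        obtain ⟨c, rfl⟩ := powZero_eq F t
        rw [map_smul]
        exact (C X Y).smul_mem c (h0 X Y)
      · rw [powZero_eq_zero F h t, map_zero]
        exact (C X Y).zero_mem
    | succ d ih =>
      intro X Y _ _ t
      exact convPow_succ_ind (S := (C X Y).comap (powMk F ε))
        (fun X₁ X₂ Y₁ Y₂ _ _ _ _ e e' a b => hc d X₁ X₂ Y₁ Y₂ X Y e e' a b (ih X₂ Y₂ b)) t
  exact powAlg_ind (fun d t => key d X Y t) t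

/-- The exterior powers tensored with symmetric algebras of wheels are spanned by products. -/
theorem extSym_ind {X Y : Type} [Finite X] [Finite Y] {S : Submodule k (O.extSymBimod.at' X Y)}
    (h : ∀ (d r : ℕ) (X₁ X₂ Y₁ Y₂ : Type) [Finite X₁] [Finite X₂] [Finite Y₁] [Finite Y₂]
      (e : X₁ ⊕ X₂ ≃ X) (e' : Y₁ ⊕ Y₂ ≃ Y) (t : (convPow O.bimod d).at' X₁ Y₁)
      (s : (convPow O.wheelBimod r).at' X₂ Y₂), O.elt e e' t s ∈ S) (m) : m ∈ S := by
  refine conv_ind (F := O.extBimod) (G := powAlg O.wheelBimod 1) (fun X₁ X₂ Y₁ Y₂ _ _ _ _ e e' a b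
    => ?_) m
  refine powAlg_ind (S := S.comap ((convMk O.extBimod (powAlg O.wheelBimod 1) e e').flip b))
    (fun d t => ?_) a
  exact powAlg_ind (S := S.comap (convMk O.extBimod (powAlg O.wheelBimod 1) e e'
    (powMk O.bimod (-1) t))) (fun r s => h d r X₁ X₂ Y₁ Y₂ e e' t s) b

/-! ### Naturality -/

variable {V' U' : Type u} [AddCommGroup V'] [Module k V'] [AddCommGroup U'] [Module k U']
  (i : V →ₗ[k] V') (j : U →ₗ[k] U')

theorem fmap_evOne (a : O.bimod.at' X Y) (v : X → V) (ξ : Y → U) :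
    fmap i j ((evOne O.sp V U).val a v ξ : FDer O V U) = (evOne O.sp V' U').val a (i ∘ v) (j ∘ ξ) := by
  by_cases h : Nat.card Y = 1
  · rw [evOne_val O.sp V U h a v ξ (finEquivOf h 0), evOne_val O.sp V' U' h a _ _ (finEquivOf h 0),
      fmap, TensorProduct.map_tmul, Sch.map_gen]
    rfl
  · rw [bimod_eq_zero O.sp h a, Ev.val_zero, Ev.val_zero, map_zero]

theorem map_evZero (P : Species k) (a : (P.bimod 0).at' X Y) (v : X → V) (ξ : Y → U) :
    Sch.map (SpMap.id P) i ((evZero P V U).val a v ξ) = (evZero P V' U').val a (i ∘ v) (j ∘ ξ) := by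
  by_cases h : Nat.card Y = 0
  · rw [evZero_val P V U h a v ξ, evZero_val P V' U' h a, Sch.map_gen]
    rfl
  · rw [bimod_eq_zero P h a, Ev.val_zero, Ev.val_zero, map_zero]

theorem map_evExt (a : O.extBimod.at' X Y) (v : X → V) (ξ : Y → U) :
    ExteriorAlgebra.map (fmap (O := O) i j) ((evExt O V U).val a v ξ)
      = (evExt O V' U').val a (i ∘ v) (j ∘ ξ) := by
  have := powAlg_induction (F := O.bimod) (ε := -1) (C := fun X Y _ _ =>
    ⨅ (v : X → V) (ξ : Y → U), LinearMap.eqLocus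
      ((ExteriorAlgebra.map (fmap (O := O) i j)).toLinearMap ∘ₗ (evExt O V U).valₗ v ξ)
      ((evExt O V' U').valₗ (i ∘ v) (j ∘ ξ))) ?_ ?_ a
  · simp only [Submodule.mem_iInf, LinearMap.mem_eqLocus] at this
    exact this v ξ
  · intro X Y _ _ _ _
    simp only [Submodule.mem_iInf, LinearMap.mem_eqLocus]
    intro v ξ
    change ExteriorAlgebra.map (fmap (O := O) i j) ((evExt O V U).val
      (powMk O.bimod (-1) (powUnit O.bimod X Y)) v ξ) = (evExt O V' U').val (powMk O.bimod (-1) (powUnit O.bimod X Y)) (i ∘ v) (j ∘ ξ)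
    rw [evExt_unit, evExt_unit, map_one]
  · intro d X₁ X₂ Y₁ Y₂ X Y _ _ _ _ _ _ e e' a t h
    simp only [Submodule.mem_iInf, LinearMap.mem_eqLocus] at h ⊢
    intro v ξ
    change ExteriorAlgebra.map (fmap (O := O) i j) ((evExt O V U).val
      (powMk O.bimod (-1) (powCons O.bimod d e e' a t)) v ξ) = (evExt O V' U').val (powMk O.bimod (-1) (powCons O.bimod d e e' a t)) (i ∘ v) (j ∘ ξ)
    rw [evExt_cons, evExt_cons, map_mul, ExteriorAlgebra.map_apply_ι, fmap_evOne]
    exact congrArg _ (h _ _)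

theorem map_evSym (a : (powAlg O.wheelBimod 1).at' X Y) (v : X → V) (ξ : Y → U) :
    DGLie.symMap (Sch.map (SpMap.id (wheelSp O)) i) ((evSym O V U).val a v ξ)
      = (evSym O V' U').val a (i ∘ v) (j ∘ ξ) := by
  have := powAlg_induction (F := O.wheelBimod) (ε := 1) (C := fun X Y _ _ =>
    ⨅ (v : X → V) (ξ : Y → U), LinearMap.eqLocus
      ((DGLie.symMap (Sch.map (SpMap.id (wheelSp O)) i)).toLinearMap ∘ₗ (evSym O V U).valₗ v ξ)
      ((evSym O V' U').valₗ (i ∘ v) (j ∘ ξ))) ?_ ?_ a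
  · simp only [Submodule.mem_iInf, LinearMap.mem_eqLocus] at this
    exact this v ξ
  · intro X Y _ _ _ _
    simp only [Submodule.mem_iInf, LinearMap.mem_eqLocus]
    intro v ξ
    change DGLie.symMap (Sch.map (SpMap.id (wheelSp O)) i) ((evSym O V U).val
      (powMk O.wheelBimod 1 (powUnit O.wheelBimod X Y)) v ξ) = (evSym O V' U').val (powMk O.wheelBimod 1 (powUnit O.wheelBimod X Y)) (i ∘ v) (j ∘ ξ)
    rw [evSym_unit, evSym_unit, map_one]
  · intro d X₁ X₂ Y₁ Y₂ X Y _ _ _ _ _ _ e e' a t h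
    simp only [Submodule.mem_iInf, LinearMap.mem_eqLocus] at h ⊢
    intro v ξ
    change DGLie.symMap (Sch.map (SpMap.id (wheelSp O)) i) ((evSym O V U).val
      (powMk O.wheelBimod 1 (powCons O.wheelBimod d e e' a t)) v ξ) = (evSym O V' U').val (powMk O.wheelBimod 1 (powCons O.wheelBimod d e e' a t)) (i ∘ v) (j ∘ ξ)
    rw [evSym_cons, evSym_cons, map_mul, DGLie.symMap_ι, map_evZero (U := U) (U' := U') i j]
    exact congrArg _ (h _ _)

theorem map_evM (m : O.extSymBimod.at' X Y) (v : X → V) (ξ : Y → U) :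
    TensorProduct.map (ExteriorAlgebra.map (fmap (O := O) i j)).toLinearMap
      (DGLie.symMap (Sch.map (SpMap.id (wheelSp O)) i)).toLinearMap ((evM O V U).val m v ξ)
      = (evM O V' U').val m (i ∘ v) (j ∘ ξ) := by
  refine LinearMap.congr_fun (f := TensorProduct.map (ExteriorAlgebra.map (fmap (O := O) i j)).toLinearMap
      (DGLie.symMap (Sch.map (SpMap.id (wheelSp O)) i)).toLinearMap ∘ₗ (evM O V U).valₗ v ξ)
    (g := (evM O V' U').valₗ (i ∘ v) (j ∘ ξ)) (conv_ext (F := O.extBimod)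
      (G := powAlg O.wheelBimod 1) fun X₁ X₂ Y₁ Y₂ _ _ _ _ e e' a b => ?_) m
  rw [LinearMap.comp_apply, Ev.valₗ_apply, Ev.valₗ_apply, evM_mk, evM_mk, TensorProduct.map_tmul]
  exact congrArg₂ _ (map_evExt O i j a _ _) (map_evSym O i j b _ _)

/-! ### Reconstruction of the universal evaluation -/

variable (V U) in
theorem exists_sym_inv :
    ∃ Ψ : SymmetricAlgebra k (Sch (wheelSp O) V) →ₗ[k] MixSch (powAlg O.wheelBimod 1) V U,
    ∀ (X Y : Type) [Finite X] [Finite Y] (t : (powAlg O.wheelBimod 1).at' X Y) (v : X → V)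
      (ξ : Y → U), Ψ ((evSym O V U).val t v ξ) = MixSch.gen.val t v ξ := by
  obtain ⟨ρ, hρ⟩ := exists_sym_rep (MixSch.mulL O.wheelBimod 1 ∘ₗ coevZero (wheelSp O) V U)
    (fun x y => (MixSch.mulL_comm O.wheelBimod 1 _ _).trans (one_smul k _))
  refine ⟨LinearMap.applyₗ (MixSch.one O.wheelBimod 1) ∘ₗ ρ.toLinearMap, fun X Y _ _ t v ξ => ?_⟩
  refine rep_alg (evSymGen O V U) (evSymGen_swap O V U) ρ (fun a v ξ => ?_) t v ξ
  rw [evSymGen, Ev.comp_val, hρ, LinearMap.comp_apply, coevZero_evZero]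

variable [CharZero k]

variable (V U) in
theorem exists_ext_inv : ∃ Ψ : ExteriorAlgebra k (FDer O V U) →ₗ[k] MixSch O.extBimod V U,
    ∀ (X Y : Type) [Finite X] [Finite Y] (t : O.extBimod.at' X Y) (v : X → V) (ξ : Y → U),
      Ψ ((evExt O V U).val t v ξ) = MixSch.gen.val t v ξ := by
  obtain ⟨ρ, hρ⟩ := exists_ext_rep (MixSch.mulL O.bimod (-1) ∘ₗ coevOne O.sp V U)
    (fun x y => (MixSch.mulL_comm O.bimod (-1) _ _).trans (neg_one_smul k _))
  refine ⟨LinearMap.applyₗ (MixSch.one O.bimod (-1)) ∘ₗ ρ.toLinearMap, fun X Y _ _ t v ξ => ?_⟩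
  refine rep_alg (evExtGen O V U) (evExtGen_swap O V U) ρ (fun a v ξ => ?_) t v ξ
  rw [evExtGen, Ev.comp_val, hρ, LinearMap.comp_apply, coevOne_evOne]

variable (V U) in
theorem exists_evM_inv :
    ∃ Ψ : ExteriorAlgebra k (FDer O V U) ⊗[k] SymmetricAlgebra k (Sch (wheelSp O) V) →ₗ[k]
      MixSch O.extSymBimod V U,
    ∀ (X Y : Type) [Finite X] [Finite Y] (m : O.extSymBimod.at' X Y) (v : X → V) (ξ : Y → U),
      Ψ ((evM O V U).val m v ξ) = MixSch.gen.val m v ξ := by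
  obtain ⟨Ψ₁, h₁⟩ := exists_ext_inv O V U
  obtain ⟨Ψ₂, h₂⟩ := exists_sym_inv O V U
  let Ψ := TensorProduct.lift
    ((MixSch.prod (V := V) (U := U) (convPairing O.extBimod (powAlg O.wheelBimod 1))).compl₁₂ Ψ₁ Ψ₂)
  refine ⟨Ψ, fun X Y _ _ m v ξ => ?_⟩
  refine LinearMap.congr_fun (f := Ψ ∘ₗ (evM O V U).valₗ v ξ) (g := MixSch.gen.valₗ v ξ)
    (conv_ext (F := O.extBimod)
      (G := powAlg O.wheelBimod 1) fun X₁ X₂ Y₁ Y₂ _ _ _ _ e e' a b => ?_) m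
  rw [LinearMap.comp_apply, Ev.valₗ_apply, Ev.valₗ_apply, evM_mk]
  simp only [Ψ, TensorProduct.lift.tmul, LinearMap.compl₁₂_apply]
  rw [h₁, h₂, MixSch.prod_gen]
  have := MixSch.gen.val_relabel (V := V) (U := U) e e' (convMk O.extBimod (powAlg O.wheelBimod 1)
    (Equiv.refl _) (Equiv.refl _) a b) v ξ
  rw [relabel_convMk] at this
  refine Eq.trans ?_ this.symm
  refine congrArg₂ (MixSch.gen.val _) ?_ ?_ <;> funext x <;> rcases x with x | x <;> rfl

variable (V U) in
theorem exists_evN_inv :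
    ∃ Ψ : ExteriorAlgebra k (FDer O V U) ⊗[k] SymmetricAlgebra k PUnit.{u + 1} →ₗ[k]
      MixSch O.extBimod V U,
    ∀ (X Y : Type) [Finite X] [Finite Y] (m : O.extBimod.at' X Y) (v : X → V) (ξ : Y → U),
      Ψ ((evN O V U).val m v ξ) = MixSch.gen.val m v ξ := by
  obtain ⟨Ψ, h⟩ := exists_ext_inv O V U
  refine ⟨TensorProduct.lift ((LinearMap.lsmul k _).flip.compl₁₂ Ψ
    (SymmetricAlgebra.algebraMapInv (R := k) (M := PUnit.{u + 1})).toLinearMap),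
    fun X Y _ _ m v ξ => ?_⟩
  rw [evN_val, TensorProduct.lift.tmul, LinearMap.compl₁₂_apply, AlgHom.toLinearMap_apply, map_one,
    h, LinearMap.flip_apply, LinearMap.lsmul_apply, one_smul]

end OperadEvaluations

section Degrees

variable {k : Type u} [Field k] {O : Operad k} (K : Coeff O) (V : Spmon k) (U : Type u)
  [AddCommGroup U] [Module k U]

/-- The formal chains of a given degree. -/
def Coeff.deg (n : ℕ) : Submodule k (K.Ch V U) :=
  Submodule.map₂ (TensorProduct.mk k _ _) (⋀[k]^n (FDer O V.carrier U)) ⊤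

variable {V U}

theorem Coeff.tmul_mem_deg {n : ℕ} {ω : ExteriorAlgebra k (FDer O V.carrier U)}
    (h : ω ∈ ⋀[k]^n (FDer O V.carrier U)) (p : SymmetricAlgebra k (K.S V)) :
    (ω ⊗ₜ p : K.Ch V U) ∈ K.deg V U n :=
  Submodule.apply_mem_map₂ (TensorProduct.mk k _ _) h Submodule.mem_top

theorem Coeff.deg_zero_le {S : Submodule k (K.Ch V U)} (h : ∀ p, (1 ⊗ₜ p : K.Ch V U) ∈ S) :
    K.deg V U 0 ≤ S :=
  chainsDeg_zero_le (g := DerB O (0 : U →ₗ[k] Module.Dual k V.carrier)) (S := S) h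

theorem Coeff.deg_succ_le {n : ℕ} {S : Submodule k (K.Ch V U)}
    (h : ∀ x c, c ∈ K.deg V U n → K.wdg x c ∈ S) : K.deg V U (n + 1) ≤ S :=
  chainsDeg_succ_le (g := DerB O (0 : U →ₗ[k] Module.Dual k V.carrier)) (S := S) fun x c hc => by
    exact (congrArg (· ∈ S) (K.wdg_eq (0 : U →ₗ[k] Module.Dual k V.carrier) x c)).mp (h x c hc)

/-- The iterated differentials given by a list of realizations of the formal linear forms. -/
def Coeff.dBs : List (U →ₗ[k] Module.Dual k V.carrier) → K.Ch V U →ₗ[k] K.Ch V U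
  | [] => LinearMap.id
  | β :: l => Coeff.dBs l ∘ₗ K.dB β

theorem Coeff.dBs_cons (β : U →ₗ[k] Module.Dual k V.carrier) (l) (c : K.Ch V U) :
    K.dBs (β :: l) c = K.dBs l (K.dB β c) := rfl

theorem Coeff.dBs_append (l l' : List (U →ₗ[k] Module.Dual k V.carrier)) (c : K.Ch V U) :
    K.dBs (l ++ l') c = K.dBs l' (K.dBs l c) := by
  induction l generalizing c with
  | nil => rfl
  | cons β l ih => exact ih _

theorem Coeff.dBs_swap (l m : List (U →ₗ[k] Module.Dual k V.carrier)) (β β') (c : K.Ch V U) :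
    K.dBs (l ++ β :: β' :: m) c = - K.dBs (l ++ β' :: β :: m) c := by
  rw [dBs_append, dBs_append, dBs_cons, dBs_cons, dBs_cons, dBs_cons, dB_anticomm, map_neg]

end Degrees

section Separation

variable {k : Type u} [Field k] (E : FBMod k)

open Classical in
variable (k) in
/-- The elements of the standard basis. -/
def stdv (X : Type) (x : X) : X → k := Pi.single x 1

theorem stdv_self (X : Type) (x : X) : stdv k X x x = 1 := by
  simp [stdv]

theorem stdv_ne (X : Type) {x y : X} (h : y ≠ x) : stdv k X x y = 0 := by
  simp [stdv, h]

variable (k) in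
/-- The product of the coordinates prescribed by a map of label sets. -/
def coordForm {X X' : Type} [Finite X'] (s : X' → X) : (⨂[k] _ : X', X → k) →ₗ[k] k :=
  letI := Fintype.ofFinite X'
  PiTensorProduct.lift ((MultilinearMap.mkPiAlgebra k X' k).compLinearMap fun x =>
    LinearMap.proj (s x))

theorem coordForm_tprod {X X' : Type} [Fintype X'] (s : X' → X) (v : X' → X → k) :
    coordForm k s (PiTensorProduct.tprod k v) = ∏ x, v x (s x) := by
  rw [coordForm, PiTensorProduct.lift.tprod]
  exact @Finset.prod_congr _ _ _ _ _ _ _ (by ext; simp) fun _ _ => rfl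

variable (k) in
/-- The product of the coordinates of mixed tensors prescribed by maps of label sets. -/
def coordForm₂ {X X' Y Y' : Type} [Finite X'] [Finite Y'] (s : X' → X) (t : Y' → Y) :
    MTU k (X → k) (Y → k) X' Y' →ₗ[k] k :=
  LinearMap.mul' k k ∘ₗ TensorProduct.map (coordForm k s) (coordForm k t)

theorem coordForm₂_mtu {X X' Y Y' : Type} [Fintype X'] [Fintype Y'] (s : X' → X) (t : Y' → Y)
    (v : X' → X → k) (ξ : Y' → Y → k) :
    coordForm₂ k s t (mtu k v ξ) = (∏ x, v x (s x)) * ∏ y, ξ y (t y) := by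
  simp only [coordForm₂, mtu, LinearMap.comp_apply, TensorProduct.map_tmul, LinearMap.mul'_apply,
    coordForm_tprod]

variable {E}

/-- The extraction of the multilinear part on a pair of sets. -/
def extractApp (X Y X' Y' : Type) [Finite X] [Finite Y] [Finite X'] [Finite Y'] :
    E.at' X' Y' →ₗ[k] MTU k (X → k) (Y → k) X' Y' →ₗ[k] E.at' X Y :=
  letI := Fintype.ofFinite (X' ≃ X)
  letI := Fintype.ofFinite (Y' ≃ Y)
  ∑ s : X' ≃ X, ∑ t : Y' ≃ Y, (LinearMap.smulRightₗ (coordForm₂ k s t)) ∘ₗ E.relabel s t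

theorem extractApp_mtu {X Y X' Y' : Type} [Finite X] [Finite Y] [Fintype X'] [Fintype Y']
    [Fintype (X' ≃ X)] [Fintype (Y' ≃ Y)] (a : E.at' X' Y') (v : X' → X → k) (ξ : Y' → Y → k) :
    extractApp X Y X' Y' a (mtu k v ξ) = ∑ s : X' ≃ X, ∑ t : Y' ≃ Y,
      ((∏ x, v x (s x)) * ∏ y, ξ y (t y)) • E.relabel s t a := by
  simp only [extractApp, LinearMap.sum_apply, LinearMap.comp_apply, LinearMap.smulRightₗ_apply,
    LinearMap.smulRight_apply, coordForm₂_mtu]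
  convert rfl

/-- The extraction of the multilinear part. -/
def extractEv (X Y : Type) [Finite X] [Finite Y] : Ev E (X → k) (Y → k) (E.at' X Y) where
  app X' Y' _ _ := extractApp X Y X' Y'
  nat {X₁ Y₁ X₂ Y₂} _ _ _ _ e e' a v ξ := by
    let _ := Fintype.ofFinite X₁
    let _ := Fintype.ofFinite Y₁
    let _ := Fintype.ofFinite X₂
    let _ := Fintype.ofFinite Y₂
    let _ := Fintype.ofFinite (X₁ ≃ X)
    let _ := Fintype.ofFinite (Y₁ ≃ Y)
    let _ := Fintype.ofFinite (X₂ ≃ X)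
    let _ := Fintype.ofFinite (Y₂ ≃ Y)
    rw [extractApp_mtu, extractApp_mtu]
    refine Fintype.sum_equiv (Equiv.equivCongr e.symm (Equiv.refl X)) _ _ fun s => ?_
    refine Fintype.sum_equiv (Equiv.equivCongr e'.symm (Equiv.refl Y)) _ _ fun t => ?_
    rw [FBMod.relabel_relabel]
    refine congrArg₂ (· • ·) (congrArg₂ (· * ·) ?_ ?_) rfl
    · exact (Fintype.prod_equiv e _ _ fun x => by simp).symm
    · exact (Fintype.prod_equiv e' _ _ fun x => by simp).symm

theorem prod_stdv {X : Type} [Fintype X] (s : X ≃ X) (hs : s ≠ Equiv.refl X) :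
    ∏ x, stdv k X x (s x) = 0 := by
  obtain ⟨x, hx⟩ : ∃ x, s x ≠ x := by
    by_contra hc
    push Not at hc
    exact hs (Equiv.ext hc)
  exact Finset.prod_eq_zero (Finset.mem_univ x) (stdv_ne X hx)

theorem extractEv_std {X Y : Type} [Finite X] [Finite Y] (m : E.at' X Y) :
    (extractEv X Y).val m (stdv k X) (stdv k Y) = m := by
  let _ := Fintype.ofFinite X
  let _ := Fintype.ofFinite Y
  let _ := Fintype.ofFinite (X ≃ X)
  let _ := Fintype.ofFinite (Y ≃ Y)
  refine (extractApp_mtu m _ _).trans ?_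
  rw [Finset.sum_eq_single (Equiv.refl X), Finset.sum_eq_single (Equiv.refl Y)]
  · rw [Finset.prod_eq_one fun x _ => stdv_self X x, Finset.prod_eq_one fun x _ => stdv_self Y x,
      mul_one, one_smul, FBMod.relabel_refl]
    rfl
  · intro t _ ht
    rw [prod_stdv t ht, mul_zero, zero_smul]
  · simp
  · intro s _ hs
    refine Finset.sum_eq_zero fun t _ => ?_
    rw [prod_stdv s hs, zero_mul, zero_smul]
  · simp

theorem gen_std_injective {X Y : Type} [Finite X] [Finite Y] {m m' : E.at' X Y}
    (h : MixSch.gen.val m (stdv k X) (stdv k Y) = MixSch.gen.val m' (stdv k X) (stdv k Y)) :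
    m = m' := by
  have := congrArg (MixSch.lift (extractEv (E := E) X Y)) h
  rwa [MixSch.lift_gen, MixSch.lift_gen, extractEv_std, extractEv_std] at this

end Separation

section Models

variable {k : Type u} [Field k]

variable (k) in
/-- The free vector space on a finite set. -/
abbrev freeSp (X : Type) [Finite X] : Spmon k := { carrier := X → k }

/-- A family of vectors and a family of linear forms all of whose pairings vanish except one. -/
def IsDelta {V U : Type u} [AddCommGroup V] [Module k V] [AddCommGroup U] [Module k U]
    (β : U →ₗ[k] Module.Dual k V) {X Y : Type} (v : X → V) (ξ : Y → U) (p : X × Y) : Prop :=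
  β (ξ p.2) (v p.1) = 1 ∧ ∀ x y, (x, y) ≠ p → β (ξ y) (v x) = 0

/-- A realization of a bimodule by formal chains. -/
structure Model (O : Operad k) where
  K : Coeff O
  E : FBMod k
  ev : ∀ (V : Spmon k) (U : Type u) [AddCommGroup U] [Module k U], Ev E V.carrier U (K.Ch V U)
  map_ev : ∀ {V V' : Spmon k} {U U' : Type u} [AddCommGroup U] [Module k U] [AddCommGroup U']
    [Module k U'] (i : V.carrier →ₗ[k] V'.carrier) (j : U →ₗ[k] U') {X Y : Type} [Finite X]
    [Finite Y] (m : E.at' X Y) (v : X → V.carrier) (ξ : Y → U),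
    K.chMap i j ((ev V U).val m v ξ) = (ev V' U').val m (i ∘ v) (j ∘ ξ)
  inv : ∀ (V : Spmon k) (U : Type u) [AddCommGroup U] [Module k U],
    ∃ Ψ : K.Ch V U →ₗ[k] MixSch E V.carrier U, ∀ (X Y : Type) [Finite X] [Finite Y]
      (m : E.at' X Y) (v : X → V.carrier) (ξ : Y → U),
      Ψ ((ev V U).val m v ξ) = MixSch.gen.val m v ξ
  mem : ∀ (V : Spmon k) (U : Type u) [AddCommGroup U] [Module k U] {X Y : Type} [Finite X]
    [Finite Y] (m : E.at' X Y) (v : X → V.carrier) (ξ : Y → U),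
    (ev V U).val m v ξ ∈ K.deg V U (Nat.card Y)
  span : ∀ (V : Spmon k) (U : Type u) [AddCommGroup U] [Module k U] (n : ℕ)
    (S : Submodule k (K.Ch V U)), (∀ (X Y : Type) [Finite X] [Finite Y] (m : E.at' X Y)
      (v : X → V.carrier) (ξ : Y → U), Nat.card Y = n → (ev V U).val m v ξ ∈ S) → K.deg V U n ≤ S
  contr : ∀ {X Y : Type} [Finite X] [Finite Y] (m : E.at' (X ⊕ Fin 1) (Y ⊕ Fin 1)),
    ∃ m' : E.at' X Y, ∀ (V : Spmon k) (U : Type u) [AddCommGroup U] [Module k U]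
      (β : U →ₗ[k] Module.Dual k V.carrier) (v : X ⊕ Fin 1 → V.carrier) (ξ : Y ⊕ Fin 1 → U),
      IsDelta β v ξ (Sum.inr 0, Sum.inr 0) →
      K.dB β ((ev V U).val m v ξ) = (ev V U).val m' (v ∘ Sum.inl) (ξ ∘ Sum.inl)

namespace Model

variable {O : Operad k} (D : Model O)

theorem ev_std_injective {X Y : Type} [Finite X] [Finite Y] {m m' : D.E.at' X Y}
    (h : (D.ev (freeSp k X) (Y → k)).val m (stdv k X) (stdv k Y)
      = (D.ev (freeSp k X) (Y → k)).val m' (stdv k X) (stdv k Y)) : m = m' := by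
  obtain ⟨Ψ, hΨ⟩ := D.inv (freeSp k X) (Y → k)
  have := congrArg Ψ h
  rw [hΨ, hΨ] at this
  exact gen_std_injective this

/-- The values of a bimodule on an object of the walled Brauer category. -/
abbrev obj (P : Wall) : Type u := D.E.at' P.left.carrier P.right.carrier

/-- The relation between an element and its image under a contraction. -/
def Rel {P Q : Wall} (f : P ⟶ Q) (m : D.obj P) (n : D.obj Q) : Prop :=
  ∀ (V : Spmon k) (U : Type u) [AddCommGroup U] [Module k U]
    (βs : List (U →ₗ[k] Module.Dual k V.carrier)) (v : P.left.carrier → V.carrier)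
    (ξ : P.right.carrier → U), List.Forall₂ (fun β p => IsDelta β v ξ p) βs f.pairs →
    (D.ev V U).val n (v ∘ f.i) (ξ ∘ f.j) = D.K.dBs βs ((D.ev V U).val m v ξ)

variable {D}

theorem IsDelta.comp {V U : Type u} [AddCommGroup V] [Module k V] [AddCommGroup U] [Module k U]
    {β : U →ₗ[k] Module.Dual k V} {X Y X' Y' : Type} {v : X → V} {ξ : Y → U} {i : X' → X}
    {j : Y' → Y} (hi : Function.Injective i) (hj : Function.Injective j) {p : X' × Y'}
    (h : IsDelta β v ξ (Prod.map i j p)) : IsDelta β (v ∘ i) (ξ ∘ j) p :=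
  ⟨h.1, fun _ _ hxy => h.2 _ _ fun e => hxy (hi.prodMap hj e)⟩

theorem rel_id (P : Wall) (m : D.obj P) : D.Rel (𝟙 P) m m := by
  intro V U _ _ βs v ξ h
  obtain rfl := List.forall₂_nil_right_iff.1 h
  rfl

theorem Rel.comp {P Q R : Wall} {f : P ⟶ Q} {g : Q ⟶ R} {m : D.obj P} {n : D.obj Q} {o : D.obj R}
    (h : D.Rel f m n) (h' : D.Rel g n o) : D.Rel (f ≫ g) m o := by
  intro V U _ _ βs v ξ hβ
  change List.Forall₂ _ βs (f.pairs ++ g.pairs.map (Prod.map f.i f.j)) at hβ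
  have h1 := List.forall₂_take_append _ _ _ hβ
  have h2 := List.forall₂_drop_append _ _ _ hβ
  rw [← List.take_append_drop f.pairs.length βs, Coeff.dBs_append, ← h V U _ v ξ h1]
  refine h' V U _ (v ∘ f.i) (ξ ∘ f.j) ?_
  rw [List.forall₂_map_right_iff] at h2
  exact h2.imp fun β p hp => IsDelta.comp f.i_inj f.j_inj hp

theorem Rel.add {P Q : Wall} {f : P ⟶ Q} {m m' : D.obj P} {n n' : D.obj Q}
    (h : D.Rel f m n) (h' : D.Rel f m' n') : D.Rel f (m + m') (n + n') := by
  intro V U _ _ βs v ξ hβ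
  rw [Ev.val_add, Ev.val_add, map_add, h V U βs v ξ hβ, h' V U βs v ξ hβ]

theorem Rel.smul {P Q : Wall} {f : P ⟶ Q} {m : D.obj P} {n : D.obj Q} (c : k)
    (h : D.Rel f m n) : D.Rel f (c • m) (c • n) := by
  intro V U _ _ βs v ξ hβ
  rw [Ev.val_smul, Ev.val_smul, map_smul, h V U βs v ξ hβ]

theorem Rel.swap {P Q : Wall} {f g : P ⟶ Q} (hfg : SwapRel f g) {m : D.obj P} {n : D.obj Q}
    (h : D.Rel f m n) : D.Rel g m (-n) := by
  obtain ⟨h1, h2, l, a, b, r, h3, h4⟩ := hfg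
  intro V U _ _ βs v ξ hβ
  rw [h4] at hβ
  obtain ⟨βl, βr, hl, hr, rfl⟩ : ∃ βl βr, List.Forall₂ (fun β p => IsDelta β v ξ p) βl l ∧
      List.Forall₂ (fun β p => IsDelta β v ξ p) βr (b :: a :: r) ∧ βs = βl ++ βr :=
    ⟨_, _, List.forall₂_take_append _ _ _ hβ, List.forall₂_drop_append _ _ _ hβ,
      (List.take_append_drop l.length βs).symm⟩
  obtain ⟨βb, βr, hb, hr', rfl⟩ := List.forall₂_cons_right_iff.1 hr
  obtain ⟨βa, βr, ha, hr'', rfl⟩ := List.forall₂_cons_right_iff.1 hr'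
  have := h V U (βl ++ βa :: βb :: βr) v ξ (by
    rw [h3]
    exact List.rel_append hl (.cons ha (.cons hb hr'')))
  rw [Coeff.dBs_swap, ← this, Ev.val_neg, ← h1, ← h2]

theorem rel_bij {X Y X' Y' : Type} [Finite X] [Finite Y] [Finite X'] [Finite Y'] (e : X ≃ X')
    (e' : Y ≃ Y') (m : D.E.at' X Y) : D.Rel (bijHom e e') m (D.E.relabel e e' m) := by
  intro V U _ _ βs v ξ h
  obtain rfl := List.forall₂_nil_right_iff.1 h
  refine (Ev.val_relabel _ _ _ _ _ _).trans ?_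
  change (D.ev V U).val m ((v ∘ e.symm) ∘ e) ((ξ ∘ e'.symm) ∘ e') = (D.ev V U).val m v ξ
  congr 1 <;> funext x <;> simp

theorem exists_rel_contr {X Y : Type} [Finite X] [Finite Y]
    (m : D.E.at' (X ⊕ Fin 1) (Y ⊕ Fin 1)) : ∃ n : D.E.at' X Y, D.Rel (contrHom X Y) m n := by
  obtain ⟨n, hn⟩ := D.contr m
  refine ⟨n, fun V U _ _ βs v ξ h => ?_⟩
  obtain ⟨β, l, hβ, hl, rfl⟩ := List.forall₂_cons_right_iff.1 h
  obtain rfl := List.forall₂_nil_right_iff.1 hl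
  exact (hn V U β v ξ hβ).symm

theorem exists_factor {P Q : Wall} (f : P ⟶ Q) (l) (p) (h : f.pairs = l ++ [p]) :
    ∃ g : P ⟶ wall (Q.left.carrier ⊕ Fin 1) (Q.right.carrier ⊕ Fin 1), g.pairs = l ∧
      f = g ≫ contrHom Q.left.carrier Q.right.carrier := by
  have hl := f.nodup_left
  have hr := f.nodup_right
  have ml := f.mem_left
  have mr := f.mem_right
  rw [h, List.map_append, List.map_cons, List.map_nil] at hl hr
  have hl' := List.nodup_append.1 hl
  have hr' := List.nodup_append.1 hr
  simp only [h, List.map_append, List.mem_append, List.map_cons, List.map_nil,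
    List.mem_singleton] at ml mr
  refine ⟨⟨Sum.elim f.i fun _ => p.1, Sum.elim f.j fun _ => p.2, l, ?_, ?_, hl'.1, hr'.1,
    fun u => ?_, fun u => ?_⟩, rfl, ?_⟩
  · refine f.i_inj.sumElim (Function.injective_of_subsingleton _) fun x _ hx => ?_
    exact (ml p.1).1 (Or.inr rfl) ⟨x, hx⟩
  · refine f.j_inj.sumElim (Function.injective_of_subsingleton _) fun x _ hx => ?_
    exact (mr p.2).1 (Or.inr rfl) ⟨x, hx⟩
  · rw [Set.Sum.elim_range, Set.mem_union, not_or, ← ml u, Set.range_const, Set.mem_singleton_iff]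
    constructor
    · intro hu
      exact ⟨Or.inl hu, fun e => hl'.2.2 _ hu _ (List.mem_singleton.2 rfl) e⟩
    · rintro ⟨hu | hu, hne⟩
      · exact hu
      · exact (hne hu).elim
  · rw [Set.Sum.elim_range, Set.mem_union, not_or, ← mr u, Set.range_const, Set.mem_singleton_iff]
    constructor
    · intro hu
      exact ⟨Or.inl hu, fun e => hr'.2.2 _ hu _ (List.mem_singleton.2 rfl) e⟩
    · rintro ⟨hu | hu, hne⟩
      · exact hu
      · exact (hne hu).elim
  · exact OrdHom.ext rfl rfl h

theorem exists_rel {P Q : Wall} (f : P ⟶ Q) (m : D.obj P) : ∃ n, D.Rel f m n := by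
  obtain ⟨l, hl⟩ : ∃ l, f.pairs = l := ⟨_, rfl⟩
  induction l using List.reverseRecOn generalizing Q with
  | nil =>
    have hi : Function.Bijective f.i := ⟨f.i_inj, fun u => by
      by_contra hu
      have := (f.mem_left u).2 hu
      rw [hl] at this
      exact List.not_mem_nil this⟩
    have hj : Function.Bijective f.j := ⟨f.j_inj, fun u => by
      by_contra hu
      have := (f.mem_right u).2 hu
      rw [hl] at this
      exact List.not_mem_nil this⟩
    have e : f = bijHom (Equiv.ofBijective f.i hi).symm (Equiv.ofBijective f.j hj).symm :=
      OrdHom.ext rfl rfl hl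
    rw [e]
    exact ⟨_, rel_bij _ _ m⟩
  | append_singleton l p ih =>
    obtain ⟨g, hg, rfl⟩ := exists_factor f l p hl
    obtain ⟨n, hn⟩ := ih g hg
    obtain ⟨o, ho⟩ := exists_rel_contr n
    exact ⟨o, hn.comp ho⟩

variable (k) in
/-- The bilinear form given by a pair of coordinates. -/
def coordPairing {X Y : Type} (p : X × Y) : (Y → k) →ₗ[k] Module.Dual k (X → k) :=
  LinearMap.smulRight (LinearMap.proj p.2 : (Y → k) →ₗ[k] k) (LinearMap.proj p.1)

theorem coordPairing_apply {X Y : Type} (p : X × Y) (ξ : Y → k) (v : X → k) :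
    coordPairing k p ξ v = ξ p.2 * v p.1 := rfl

theorem isDelta_coordPairing {X Y : Type} (p : X × Y) :
    IsDelta (coordPairing k p) (stdv k X) (stdv k Y) p := by
  refine ⟨?_, fun x y h => ?_⟩
  · rw [coordPairing_apply, stdv_self, stdv_self, mul_one]
  · rw [coordPairing_apply]
    by_cases hx : p.1 = x
    · have hy : p.2 ≠ y := fun hy => h (by rw [← hx, ← hy])
      rw [stdv_ne Y hy, zero_mul]
    · rw [stdv_ne X hx, mul_zero]

theorem funLeft_stdv {X X' : Type} {i : X' → X} (hi : Function.Injective i) :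
    LinearMap.funLeft k k i ∘ stdv k X ∘ i = stdv k X' := by
  funext x y
  change stdv k X (i x) (i y) = stdv k X' x y
  by_cases h : y = x
  · rw [h, stdv_self, stdv_self]
  · rw [stdv_ne X' h, stdv_ne X (hi.ne h)]

theorem Rel.unique {P Q : Wall} {f : P ⟶ Q} {m : D.obj P} {n n' : D.obj Q} (h : D.Rel f m n)
    (h' : D.Rel f m n') : n = n' := by
  have hβ : List.Forall₂ (fun β p => IsDelta β (stdv k P.left.carrier) (stdv k P.right.carrier) p)
      (f.pairs.map (coordPairing k)) f.pairs := by
    rw [List.forall₂_map_left_iff]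
    exact List.forall₂_same.2 fun p _ => isDelta_coordPairing p
  have e := (h (freeSp k P.left.carrier) (P.right.carrier → k) _ _ _ hβ).trans
    (h' (freeSp k P.left.carrier) (P.right.carrier → k) _ _ _ hβ).symm
  have e' := congrArg (D.K.chMap (V := freeSp k P.left.carrier) (W := freeSp k Q.left.carrier)
    (LinearMap.funLeft k k f.i) (LinearMap.funLeft k k f.j)) e
  rw [D.map_ev, D.map_ev, funLeft_stdv f.i_inj, funLeft_stdv f.j_inj] at e'
  exact ev_std_injective D e'

variable (D)

/-- The action of a contraction. -/
def act {P Q : Wall} (f : P ⟶ Q) : D.obj P →ₗ[k] D.obj Q where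
  toFun m := (exists_rel f m).choose
  map_add' m m' := (exists_rel f _).choose_spec.unique
    ((exists_rel f m).choose_spec.add (exists_rel f m').choose_spec)
  map_smul' c m := (exists_rel f _).choose_spec.unique ((exists_rel f m).choose_spec.smul c)

theorem rel_act {P Q : Wall} (f : P ⟶ Q) (m : D.obj P) : D.Rel f m (D.act f m) :=
  (exists_rel f m).choose_spec

/-- The functor on the ordered category. -/
def wallFunctor : Wall ⥤ ModuleCat.{u} k where
  obj P := D.E.obj (P.left, P.right)
  map f := ModuleCat.ofHom (D.act f)
  map_id P := by
    ext m
    exact (D.rel_act (𝟙 P) m).unique (rel_id P m)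
  map_comp f g := by
    ext m
    exact (D.rel_act (f ≫ g) m).unique ((D.rel_act f m).comp (D.rel_act g _))

/-- The module over the walled Brauer category given by a realization. -/
def functor : Dwb (-1 : k) ⥤ ModuleCat.{u} k :=
  Dwb.lift D.wallFunctor fun {P Q} f g h => by
    ext m
    refine (D.rel_act f m).unique ?_
    change D.Rel f m ((-1 : k) • D.act g m)
    rw [neg_one_smul]
    obtain ⟨h1, h2, l, a, b, r, h3, h4⟩ := h
    exact (D.rel_act g m).swap ⟨h1.symm, h2.symm, l, b, a, r, h4, h3⟩

theorem functor_map_of {P Q : Dwb (-1 : k)} (f : P.toWall ⟶ Q.toWall) (m : D.functor.obj P) :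
    D.functor.map (Dwb.of f) m = D.act f m :=
  congrArg (fun φ : D.wallFunctor.obj P.toWall ⟶ D.wallFunctor.obj Q.toWall => φ.hom m)
    (Dwb.liftHom_cls _ _ f)

theorem rel_functor_map {P Q : Dwb (-1 : k)} (f : P.toWall ⟶ Q.toWall) (m : D.functor.obj P) :
    D.Rel f m (D.functor.map (Dwb.of f) m) := by
  rw [functor_map_of]
  exact D.rel_act f m

instance : D.functor.Additive where
  map_add {_ _ f g} := map_add (Dwb.liftHom (ε := (-1 : k)) (fun f => D.wallFunctor.map f) _) f g

instance : D.functor.Linear k where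
  map_smul f c := map_smul (Dwb.liftHom (ε := (-1 : k)) (fun f => D.wallFunctor.map f) _) c f

end Model

end Models

section Fronts

variable {k : Type u} [Field k]

/-- Up to the relations of a symmetric or exterior algebra, a given label can be moved to the first
factor. -/
theorem powMk_mem_of_front (F : FBMod k) (ε : k) {d : ℕ} {X Y : Type} [Finite X] [Finite Y]
    (t : (convPow F d).at' X Y) (z : X ⊕ Y) (S : Submodule k ((powAlg F ε).at' X Y))
    (hS : ∀ (d : ℕ) (X₁ X₂ Y₁ Y₂ : Type) [Finite X₁] [Finite X₂] [Finite Y₁] [Finite Y₂]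
      (e : X₁ ⊕ X₂ ≃ X) (e' : Y₁ ⊕ Y₂ ≃ Y) (a : F.at' X₁ Y₁) (t : (convPow F d).at' X₂ Y₂)
      (z₀ : X₁ ⊕ Y₁), Sum.map (e ∘ Sum.inl) (e' ∘ Sum.inl) z₀ = z →
      powMk F ε (powCons F d e e' a t) ∈ S) : powMk F ε t ∈ S := by
  induction d generalizing X Y with
  | zero =>
    have : t = 0 := powZero_eq_zero F (fun h => by
      rcases z with z | z
      · exact h.1.elim z
      · exact h.2.elim z) t
    rw [this, map_zero]
    exact S.zero_mem
  | succ d ih =>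
    refine convPow_succ_ind (F := F) (S := S.comap (powMk F ε)) ?_ t
    intro X₁ X₂ Y₁ Y₂ _ _ _ _ e e' a b
    have hz : (∃ z₀ : X₁ ⊕ Y₁, Sum.map (e ∘ Sum.inl) (e' ∘ Sum.inl) z₀ = z) ∨
        ∃ z₁ : X₂ ⊕ Y₂, Sum.map (e ∘ Sum.inr) (e' ∘ Sum.inr) z₁ = z := by
      rcases z with x | y
      · obtain ⟨x | x, rfl⟩ := e.surjective x
        · exact Or.inl ⟨Sum.inl x, rfl⟩
        · exact Or.inr ⟨Sum.inl x, rfl⟩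
      · obtain ⟨y | y, rfl⟩ := e'.surjective y
        · exact Or.inl ⟨Sum.inr y, rfl⟩
        · exact Or.inr ⟨Sum.inr y, rfl⟩
    rcases hz with ⟨z₀, hz⟩ | ⟨z₁, hz⟩
    · exact hS _ _ _ _ _ e e' a b z₀ hz
    · rw [Submodule.mem_comap, ← consAlg_mk]
      refine ih b z₁ (S.comap (consAlg F ε e e' a)) ?_
      intro d X₃ X₄ Y₃ Y₄ _ _ _ _ f f' c t z₀ hz₀
      rw [Submodule.mem_comap, consAlg_mk]
      have h : powCons F (d + 1) e e' a (powCons F d f f' c t)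
          = powCons F (d + 1) (((Equiv.refl X₁).sumCongr f).trans e)
            (((Equiv.refl Y₁).sumCongr f').trans e') a
            (powCons F d (Equiv.refl _) (Equiv.refl _) c t) := by
        have := convMk_relabel (F := F) (G := convPow F (d + 1)) (Equiv.refl X₁) (Equiv.refl Y₁)
          f f' e e' a (powCons F d (Equiv.refl _) (Equiv.refl _) c t)
        rw [FBMod.relabel_refl, relabel_powCons] at this
        exact this
      rw [h, powMk_swap]
      refine S.smul_mem _ (hS _ _ _ _ _ _ _ _ _ z₀ ?_)
      rw [← hz, ← hz₀]
      rcases z₀ with z₀ | z₀ <;> rfl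

variable {O : Operad k}

theorem sym_eq_zero {r : ℕ} {X Y : Type} [Finite X] [Finite Y]
    (s : (convPow O.wheelBimod r).at' X Y) (y : Y) : powMk O.wheelBimod 1 s = 0 := by
  refine (Submodule.mem_bot k).1 (powMk_mem_of_front O.wheelBimod 1 s (Sum.inr y) ⊥ ?_)
  intro d X₁ X₂ Y₁ Y₂ _ _ _ _ e e' a t z₀ hz
  rcases z₀ with z₀ | z₀
  · cases hz
  · have : a = 0 := bimod_eq_zero (wheelSp O) (fun h => (finEquivOf h).symm.isEmpty.elim z₀) a
    rw [this, map_zero, LinearMap.zero_apply, map_zero]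
    exact Submodule.zero_mem _

theorem exists_bimod_eq {P : Species k} {n : ℕ} {X Y : Type} [Finite X] [Finite Y]
    (h : Nat.card Y = n) (a : (P.bimod n).at' X Y) (x : X) :
    ∃ (u : Fin n ≃ Y) (b : P.at' ({y : X // y ≠ x} ⊕ Fin 1)),
      a = (P.bimod n).relabel (ptEquiv x) u (P.elt n b) := by
  refine ⟨finEquivOf h, P.relabel (ptEquiv x).symm (bimodVal P h a), ?_⟩
  refine funext (β := fun _ : PLift (Nat.card Y = n) => P.at' X) (f := a)
    (g := (P.bimod n).relabel (ptEquiv x) (finEquivOf h) (P.elt n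
      (P.relabel (ptEquiv x).symm (bimodVal P h a)))) fun _ => ?_
  refine Eq.trans ?_ (Species.relabel_relabel P (ptEquiv x).symm (ptEquiv x)
    (bimodVal P h a)).symm
  rw [Equiv.symm_trans_self]
  exact (Species.relabel_refl P _).symm

theorem powCons_relabel (F : FBMod k) {d : ℕ} {X₁ X₂ Y₁ Y₂ X₁' Y₁' X Y : Type}
    [Finite X₁] [Finite X₂] [Finite Y₁] [Finite Y₂] [Finite X₁'] [Finite Y₁'] [Finite X] [Finite Y]
    (f : X₁ ≃ X₁') (f' : Y₁ ≃ Y₁') (e : X₁' ⊕ X₂ ≃ X) (e' : Y₁' ⊕ Y₂ ≃ Y) (a : F.at' X₁ Y₁)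
    (t : (convPow F d).at' X₂ Y₂) : powCons F d e e' (F.relabel f f' a) t
      = (convPow F (d + 1)).relabel ((f.sumCongr (Equiv.refl X₂)).trans e)
        ((f'.sumCongr (Equiv.refl Y₂)).trans e')
        (powCons F d (Equiv.refl _) (Equiv.refl _) a t) := by
  have := convMk_relabel (F := F) (G := convPow F d) f f' (Equiv.refl X₂) (Equiv.refl Y₂) e e' a t
  rw [FBMod.relabel_refl] at this
  refine this.trans ?_
  rw [relabel_powCons]
  rfl

theorem powCons_powCons_relabel (F : FBMod k) {d : ℕ} {X₀ Y₀ X₀' Y₀' X₁ X₂ Y₁ Y₂ X Y X' Y' : Type}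
    [Finite X₀] [Finite Y₀] [Finite X₀'] [Finite Y₀']
    [Finite X₁] [Finite X₂] [Finite Y₁] [Finite Y₂] [Finite X] [Finite Y] [Finite X'] [Finite Y']
    (g : X₀ ≃ X₀') (g' : Y₀ ≃ Y₀') (h : X₀' ⊕ X ≃ X') (h' : Y₀' ⊕ Y ≃ Y') (c : F.at' X₀ Y₀)
    (e : X₁ ⊕ X₂ ≃ X) (e' : Y₁ ⊕ Y₂ ≃ Y) (a : F.at' X₁ Y₁)
    (t : (convPow F d).at' X₂ Y₂) :
    powCons F (d + 1) h h' (F.relabel g g' c) (powCons F d e e' a t)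
      = (convPow F (d + 2)).relabel ((g.sumCongr e).trans h) ((g'.sumCongr e').trans h')
        (powCons F (d + 1) (Equiv.refl _) (Equiv.refl _) c
          (powCons F d (Equiv.refl _) (Equiv.refl _) a t)) := by
  have := convMk_relabel (F := F) (G := convPow F (d + 1)) g g' e e' h h' c
    (powCons F d (Equiv.refl _) (Equiv.refl _) a t)
  rw [relabel_powCons] at this
  refine this.trans ?_
  rw [relabel_powCons]
  rfl

variable {X₁ X₂ Y₁ Y₂ X₁' X₂' Y₁' Y₂' X Y X' Y' : Type} [Finite X₁] [Finite X₂] [Finite Y₁]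
  [Finite Y₂] [Finite X₁'] [Finite X₂'] [Finite Y₁'] [Finite Y₂'] [Finite X] [Finite Y] [Finite X']
  [Finite Y']

theorem elt_relabel {d r : ℕ} (f : X₁ ≃ X₁') (f' : Y₁ ≃ Y₁') (g : X₂ ≃ X₂') (g' : Y₂ ≃ Y₂')
    (e : X₁' ⊕ X₂' ≃ X) (e' : Y₁' ⊕ Y₂' ≃ Y) (t : (convPow O.bimod d).at' X₁ Y₁)
    (s : (convPow O.wheelBimod r).at' X₂ Y₂) :
    O.elt e e' ((convPow O.bimod d).relabel f f' t) ((convPow O.wheelBimod r).relabel g g' s)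
      = O.elt ((f.sumCongr g).trans e) ((f'.sumCongr g').trans e') t s := by
  have := convMk_relabel (F := O.extBimod) (G := powAlg O.wheelBimod 1) f f' g g' e e'
    (powMk O.bimod (-1) t) (powMk O.wheelBimod 1 s)
  rw [relabel_powMk, relabel_powMk] at this
  exact this

theorem elt_relabel_left {d r : ℕ} (f : X₁ ≃ X₁') (f' : Y₁ ≃ Y₁')
    (e : X₁' ⊕ X₂ ≃ X) (e' : Y₁' ⊕ Y₂ ≃ Y) (t : (convPow O.bimod d).at' X₁ Y₁)
    (s : (convPow O.wheelBimod r).at' X₂ Y₂) :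
    O.elt e e' ((convPow O.bimod d).relabel f f' t) s
      = O.elt ((f.sumCongr (Equiv.refl X₂)).trans e) ((f'.sumCongr (Equiv.refl Y₂)).trans e')
        t s := by
  have := elt_relabel (O := O) f f' (Equiv.refl X₂) (Equiv.refl Y₂) e e' t s
  rwa [FBMod.relabel_refl] at this

theorem elt_relabel_right {d r : ℕ} (g : X₂ ≃ X₂') (g' : Y₂ ≃ Y₂')
    (e : X₁ ⊕ X₂' ≃ X) (e' : Y₁ ⊕ Y₂' ≃ Y) (t : (convPow O.bimod d).at' X₁ Y₁)
    (s : (convPow O.wheelBimod r).at' X₂ Y₂) :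
    O.elt e e' t ((convPow O.wheelBimod r).relabel g g' s)
      = O.elt (((Equiv.refl X₁).sumCongr g).trans e) (((Equiv.refl Y₁).sumCongr g').trans e')
        t s := by
  have := elt_relabel (O := O) (Equiv.refl X₁) (Equiv.refl Y₁) g g' e e' t s
  rwa [FBMod.relabel_refl] at this

theorem relabel_elt {d r : ℕ} (e : X₁ ⊕ X₂ ≃ X) (e' : Y₁ ⊕ Y₂ ≃ Y) (f : X ≃ X') (f' : Y ≃ Y')
    (t : (convPow O.bimod d).at' X₁ Y₁) (s : (convPow O.wheelBimod r).at' X₂ Y₂) :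
    O.extSymBimod.relabel f f' (O.elt e e' t s) = O.elt (e.trans f) (e'.trans f') t s :=
  relabel_convMk O.extBimod (powAlg O.wheelBimod 1) e e' f f' _ _

theorem elt_zero_left {d r : ℕ} (e : X₁ ⊕ X₂ ≃ X) (e' : Y₁ ⊕ Y₂ ≃ Y)
    (s : (convPow O.wheelBimod r).at' X₂ Y₂) :
    O.elt e e' (0 : (convPow O.bimod d).at' X₁ Y₁) s = 0 := by
  have h0 : O.elt e e' (0 : (convPow O.bimod d).at' X₁ Y₁) s
    = convMk O.extBimod (powAlg O.wheelBimod 1) e e'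
      (powMk O.bimod (-1) (0 : (convPow O.bimod d).at' X₁ Y₁)) (powMk O.wheelBimod 1 s) := rfl
  rw [h0, map_zero, map_zero, LinearMap.zero_apply]

theorem elt_zero_right {d r : ℕ} (e : X₁ ⊕ X₂ ≃ X) (e' : Y₁ ⊕ Y₂ ≃ Y)
    (t : (convPow O.bimod d).at' X₁ Y₁) :
    O.elt e e' t (0 : (convPow O.wheelBimod r).at' X₂ Y₂) = 0 := by
  have h0 : O.elt e e' t (0 : (convPow O.wheelBimod r).at' X₂ Y₂)
    = convMk O.extBimod (powAlg O.wheelBimod 1) e e' (powMk O.bimod (-1) t)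
      (powMk O.wheelBimod 1 (0 : (convPow O.wheelBimod r).at' X₂ Y₂)) := rfl
  rw [h0, map_zero, map_zero]

theorem elt_mem_of_front_left {d r : ℕ} (e : X₁ ⊕ X₂ ≃ X) (e' : Y₁ ⊕ Y₂ ≃ Y)
    (t : (convPow O.bimod d).at' X₁ Y₁) (s : (convPow O.wheelBimod r).at' X₂ Y₂) (z : X₁ ⊕ Y₁)
    (S : Submodule k (O.extSymBimod.at' X Y))
    (hS : ∀ (d : ℕ) (X₃ X₄ Y₃ Y₄ : Type) [Finite X₃] [Finite X₄] [Finite Y₃] [Finite Y₄]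
      (f : X₃ ⊕ X₄ ≃ X₁) (f' : Y₃ ⊕ Y₄ ≃ Y₁) (a : O.bimod.at' X₃ Y₃)
      (t : (convPow O.bimod d).at' X₄ Y₄) (z₀ : X₃ ⊕ Y₃),
      Sum.map (f ∘ Sum.inl) (f' ∘ Sum.inl) z₀ = z →
      O.elt e e' (powCons O.bimod d f f' a t) s ∈ S) : O.elt e e' t s ∈ S :=
  powMk_mem_of_front O.bimod (-1) t z (S.comap
    ((convMk O.extBimod (powAlg O.wheelBimod 1) e e').flip (powMk O.wheelBimod 1 s))) hS

theorem elt_mem_of_front_right {d r : ℕ} (e : X₁ ⊕ X₂ ≃ X) (e' : Y₁ ⊕ Y₂ ≃ Y)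
    (t : (convPow O.bimod d).at' X₁ Y₁) (s : (convPow O.wheelBimod r).at' X₂ Y₂) (z : X₂ ⊕ Y₂)
    (S : Submodule k (O.extSymBimod.at' X Y))
    (hS : ∀ (r : ℕ) (X₃ X₄ Y₃ Y₄ : Type) [Finite X₃] [Finite X₄] [Finite Y₃] [Finite Y₄]
      (f : X₃ ⊕ X₄ ≃ X₂) (f' : Y₃ ⊕ Y₄ ≃ Y₂) (a : O.wheelBimod.at' X₃ Y₃)
      (s : (convPow O.wheelBimod r).at' X₄ Y₄) (z₀ : X₃ ⊕ Y₃),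
      Sum.map (f ∘ Sum.inl) (f' ∘ Sum.inl) z₀ = z →
      O.elt e e' t (powCons O.wheelBimod r f f' a s) ∈ S) : O.elt e e' t s ∈ S :=
  powMk_mem_of_front O.wheelBimod 1 s z (S.comap
    (convMk O.extBimod (powAlg O.wheelBimod 1) e e' (powMk O.bimod (-1) t))) hS

theorem elt_mem_of_front_second {d r : ℕ} {X₃ Y₃ : Type} [Finite X₃] [Finite Y₃]
    (e : X ⊕ X₂ ≃ X') (e' : Y ⊕ Y₂ ≃ Y') (f : X₃ ⊕ X₁ ≃ X) (f' : Y₃ ⊕ Y₁ ≃ Y)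
    (a : O.bimod.at' X₃ Y₃)
    (t : (convPow O.bimod d).at' X₁ Y₁) (s : (convPow O.wheelBimod r).at' X₂ Y₂) (z : X₁ ⊕ Y₁)
    (S : Submodule k (O.extSymBimod.at' X' Y'))
    (hS : ∀ (d : ℕ) (X₅ X₆ Y₅ Y₆ : Type) [Finite X₅] [Finite X₆] [Finite Y₅] [Finite Y₆]
      (g : X₅ ⊕ X₆ ≃ X₁) (g' : Y₅ ⊕ Y₆ ≃ Y₁) (c : O.bimod.at' X₅ Y₅)
      (t : (convPow O.bimod d).at' X₆ Y₆) (z₀ : X₅ ⊕ Y₅),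
      Sum.map (g ∘ Sum.inl) (g' ∘ Sum.inl) z₀ = z →
      O.elt e e' (powCons O.bimod (d + 1) f f' a (powCons O.bimod d g g' c t)) s ∈ S) :
    O.elt e e' (powCons O.bimod d f f' a t) s ∈ S := by
  have key := powMk_mem_of_front O.bimod (-1) t z (S.comap
    (((convMk O.extBimod (powAlg O.wheelBimod 1) e e').flip (powMk O.wheelBimod 1 s)) ∘ₗ
      consAlg O.bimod (-1) f f' a)) (by
    intro d X₅ X₆ Y₅ Y₆ _ _ _ _ g g' c t z₀ hz
    rw [Submodule.mem_comap, LinearMap.comp_apply, consAlg_mk]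
    exact hS d X₅ X₆ Y₅ Y₆ g g' c t z₀ hz)
  rw [Submodule.mem_comap, LinearMap.comp_apply, consAlg_mk] at key
  exact key

/-- The elements with a marked input and a marked root are spanned by those for which the marked
root belongs to the first operation and the marked input to the first or the second operation or to
the first wheel. -/
theorem extSym_front_ind {S : Submodule k (O.extSymBimod.at' (X ⊕ Fin 1) (Y ⊕ Fin 1))}
    (hloop : ∀ (d r : ℕ) (A X₁ X₂ Y₁ Y₂ : Type) [Finite A] [Finite X₁] [Finite X₂] [Finite Y₁]
      [Finite Y₂] (e : ((A ⊕ Fin 1) ⊕ X₁) ⊕ X₂ ≃ X ⊕ Fin 1) (e' : (Fin 1 ⊕ Y₁) ⊕ Y₂ ≃ Y ⊕ Fin 1)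
      (a : O.sp.at' (A ⊕ Fin 1)) (t : (convPow O.bimod d).at' X₁ Y₁)
      (s : (convPow O.wheelBimod r).at' X₂ Y₂), e (.inl (.inl (.inr 0))) = .inr 0 →
      e' (.inl (.inl 0)) = .inr 0 →
      O.elt e e' (powCons O.bimod d (Equiv.refl _) (Equiv.refl _) (O.sp.elt 1 a) t) s ∈ S)
    (htree : ∀ (d r : ℕ) (A B X₁ X₂ Y₁ Y₂ : Type) [Finite A] [Finite B] [Finite X₁] [Finite X₂]
      [Finite Y₁] [Finite Y₂] (e : (B ⊕ ((A ⊕ Fin 1) ⊕ X₁)) ⊕ X₂ ≃ X ⊕ Fin 1)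
      (e' : (Fin 1 ⊕ (Fin 1 ⊕ Y₁)) ⊕ Y₂ ≃ Y ⊕ Fin 1)
      (a : O.sp.at' (A ⊕ Fin 1)) (b : O.sp.at' B) (t : (convPow O.bimod d).at' X₁ Y₁)
      (s : (convPow O.wheelBimod r).at' X₂ Y₂), e (.inl (.inr (.inl (.inr 0)))) = .inr 0 →
      e' (.inl (.inl 0)) = .inr 0 →
      O.elt e e' (powCons O.bimod (d + 1) (Equiv.refl _) (Equiv.refl _) (O.sp.elt 1 b)
          (powCons O.bimod d (Equiv.refl _) (Equiv.refl _) (O.sp.elt 1 a) t)) s ∈ S)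
    (hwheel : ∀ (d r : ℕ) (A B X₁ X₂ Y₁ Y₂ : Type) [Finite A] [Finite B] [Finite X₁] [Finite X₂]
      [Finite Y₁] [Finite Y₂] (e : (B ⊕ X₁) ⊕ ((A ⊕ Fin 1) ⊕ X₂) ≃ X ⊕ Fin 1)
      (e' : (Fin 1 ⊕ Y₁) ⊕ (Fin 0 ⊕ Y₂) ≃ Y ⊕ Fin 1)
      (w : (wheelSp O).at' (A ⊕ Fin 1)) (b : O.sp.at' B) (t : (convPow O.bimod d).at' X₁ Y₁)
      (s : (convPow O.wheelBimod r).at' X₂ Y₂), e (.inr (.inl (.inr 0))) = .inr 0 →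
      e' (.inl (.inl 0)) = .inr 0 →
      O.elt e e' (powCons O.bimod d (Equiv.refl _) (Equiv.refl _) (O.sp.elt 1 b) t)
        (powCons O.wheelBimod r (Equiv.refl _) (Equiv.refl _) ((wheelSp O).elt 0 w) s) ∈ S)
    (m) : m ∈ S := by
  refine extSym_ind O (fun d r X₁ X₂ Y₁ Y₂ _ _ _ _ e e' t s => ?_) m
  obtain ⟨y | y, hy⟩ := e'.surjective (Sum.inr 0)
  swap
  · have : O.elt e e' t s = convMk O.extBimod (powAlg O.wheelBimod 1) e e'
      (powMk O.bimod (-1) t) (powMk O.wheelBimod 1 s) := rfl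
    rw [this, sym_eq_zero s y, map_zero]
    exact S.zero_mem
  refine elt_mem_of_front_left e e' t s (Sum.inr y) S ?_
  intro d X₃ X₄ Y₃ Y₄ _ _ _ _ f f' a t z hz
  rcases z with z | z
  · cases hz
  have hz' : f' (Sum.inl z) = y := Sum.inr_injective hz
  by_cases hc : Nat.card Y₃ = 1
  swap
  · have : a = 0 := bimod_eq_zero O.sp hc a
    rw [this, map_zero, LinearMap.zero_apply]
    rw [elt_zero_left]
    exact S.zero_mem
  have hsub : ∀ v : Fin 1 ≃ Y₃, v 0 = z := fun v => by
    obtain ⟨i, hi⟩ := v.surjective z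
    rw [← hi, Subsingleton.elim i 0]
  obtain ⟨x | x, hx⟩ := e.surjective (Sum.inr 0)
  · obtain ⟨x | x, rfl⟩ := f.surjective x
    · obtain ⟨v, b, rfl⟩ := exists_bimod_eq hc a x
      rw [powCons_relabel, elt_relabel_left]
      refine hloop _ _ _ _ _ _ _ _ _ b t s ?_ ?_
      · simpa using hx
      · simpa [hsub, hz'] using hy
    · obtain ⟨v, b, rfl⟩ : ∃ (v : Fin 1 ≃ Y₃) (b : O.sp.at' X₃),
        a = O.bimod.relabel (Equiv.refl X₃) v (O.sp.elt 1 b) :=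
        ⟨_, _, bimod_eq_elt O.sp hc (finEquivOf hc) a⟩
      refine elt_mem_of_front_second e e' f f' _ t s (Sum.inl x) S ?_
      intro d X₅ X₆ Y₅ Y₆ _ _ _ _ g g' c t w hw
      rcases w with w | w
      swap
      · cases hw
      have hw' : g (Sum.inl w) = x := Sum.inl_injective hw
      by_cases hc' : Nat.card Y₅ = 1
      · obtain ⟨v', c, rfl⟩ := exists_bimod_eq hc' c w
        rw [powCons_relabel O.bimod (ptEquiv w) v', relabel_powCons, powCons_powCons_relabel,
          elt_relabel_left]
        refine htree _ _ _ _ _ _ _ _ _ _ c b t s ?_ ?_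
        · simpa [hw'] using hx
        · simpa [hsub, hz'] using hy
      · have : c = 0 := bimod_eq_zero O.sp hc' c
        rw [this, map_zero, LinearMap.zero_apply, map_zero]
        rw [elt_zero_left]
        exact S.zero_mem
  · obtain ⟨v, b, rfl⟩ : ∃ (v : Fin 1 ≃ Y₃) (b : O.sp.at' X₃),
      a = O.bimod.relabel (Equiv.refl X₃) v (O.sp.elt 1 b) :=
      ⟨_, _, bimod_eq_elt O.sp hc (finEquivOf hc) a⟩
    rw [powCons_relabel, elt_relabel_left]
    refine elt_mem_of_front_right _ _ _ s (Sum.inl x) S ?_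
    intro r X₅ X₆ Y₅ Y₆ _ _ _ _ g g' c s w hw
    rcases w with w | w
    swap
    · cases hw
    have hw' : g (Sum.inl w) = x := Sum.inl_injective hw
    by_cases hc' : Nat.card Y₅ = 0
    · obtain ⟨v', c, rfl⟩ := exists_bimod_eq hc' c w
      rw [powCons_relabel O.wheelBimod (ptEquiv w) v', elt_relabel_right]
      refine hwheel _ _ _ _ _ _ _ _ _ _ c b t s ?_ ?_
      · simpa [hw'] using hx
      · simpa [hsub, hz'] using hy
    · have : c = 0 := bimod_eq_zero (wheelSp O) hc' c
      rw [this, map_zero, LinearMap.zero_apply]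
      rw [elt_zero_right]
      exact S.zero_mem

end Fronts

section ContractionInduction

variable {k : Type u} [Field k] {O : Operad k} {X Y : Type} [Finite X] [Finite Y]

/-- The elements with a marked input and a marked root are spanned by those whose contraction is
prescribed in `OperadModules`. -/
theorem extSym_contr_ind {S : Submodule k (O.extSymBimod.at' (X ⊕ Fin 1) (Y ⊕ Fin 1))}
    (hloop : ∀ (d r : ℕ) (A X₁ X₂ Y₁ Y₂ : Type) [Finite A] [Finite X₁] [Finite X₂] [Finite Y₁]
      [Finite Y₂] (g : X₁ ⊕ (A ⊕ X₂) ≃ X) (g' : Y₁ ⊕ (Fin 0 ⊕ Y₂) ≃ Y)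
      (a : O.sp.at' (A ⊕ Fin 1)) (t : (convPow O.bimod d).at' X₁ Y₁)
      (s : (convPow O.wheelBimod r).at' X₂ Y₂),
      O.extSymBimod.relabel (g.sumCongr (Equiv.refl _)) (g'.sumCongr (Equiv.refl _))
        (O.elt (loopEquiv A X₁ X₂) (loopRootEquiv Y₁ Y₂)
          (powCons O.bimod d (Equiv.refl _) (Equiv.refl _) (O.sp.elt 1 a) t) s) ∈ S)
    (htree : ∀ (d r : ℕ) (A B X₁ X₂ Y₁ Y₂ : Type) [Finite A] [Finite B] [Finite X₁] [Finite X₂]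
      [Finite Y₁] [Finite Y₂] (g : ((A ⊕ B) ⊕ X₁) ⊕ X₂ ≃ X) (g' : (Fin 1 ⊕ Y₁) ⊕ Y₂ ≃ Y)
      (a : O.sp.at' (A ⊕ Fin 1)) (b : O.sp.at' B) (t : (convPow O.bimod d).at' X₁ Y₁)
      (s : (convPow O.wheelBimod r).at' X₂ Y₂),
      O.extSymBimod.relabel (g.sumCongr (Equiv.refl _)) (g'.sumCongr (Equiv.refl _))
        (O.elt (treeEquiv A B X₁ X₂) (treeRootEquiv Y₁ Y₂)
          (powCons O.bimod (d + 1) (Equiv.refl _) (Equiv.refl _) (O.sp.elt 1 b)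
            (powCons O.bimod d (Equiv.refl _) (Equiv.refl _) (O.sp.elt 1 a) t)) s) ∈ S)
    (hwheel : ∀ (d r : ℕ) (A B X₁ X₂ Y₁ Y₂ : Type) [Finite A] [Finite B] [Finite X₁] [Finite X₂]
      [Finite Y₁] [Finite Y₂] (g : X₁ ⊕ ((A ⊕ B) ⊕ X₂) ≃ X) (g' : Y₁ ⊕ (Fin 0 ⊕ Y₂) ≃ Y)
      (w : (wheelSp O).at' (A ⊕ Fin 1)) (b : O.sp.at' B) (t : (convPow O.bimod d).at' X₁ Y₁)
      (s : (convPow O.wheelBimod r).at' X₂ Y₂),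
      O.extSymBimod.relabel (g.sumCongr (Equiv.refl _)) (g'.sumCongr (Equiv.refl _))
        (O.elt (wheelEquiv A B X₁ X₂) (wheelRootEquiv Y₁ Y₂)
          (powCons O.bimod d (Equiv.refl _) (Equiv.refl _) (O.sp.elt 1 b) t)
          (powCons O.wheelBimod r (Equiv.refl _) (Equiv.refl _) ((wheelSp O).elt 0 w) s)) ∈ S)
    (m) : m ∈ S := by
  refine extSym_front_ind ?_ ?_ ?_ m
  · intro d r A X₁ X₂ Y₁ Y₂ _ _ _ _ _ e e' a t s h h'
    obtain ⟨g, hg⟩ := exists_restrict ((loopEquiv A X₁ X₂).symm.trans e) h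
    obtain ⟨g', hg'⟩ := exists_restrict ((loopRootEquiv Y₁ Y₂).symm.trans e') h'
    have := hloop d r A X₁ X₂ Y₁ Y₂ g g' a t s
    rwa [← hg, ← hg', relabel_elt, ← Equiv.trans_assoc, ← Equiv.trans_assoc,
      Equiv.self_trans_symm, Equiv.self_trans_symm, Equiv.refl_trans, Equiv.refl_trans] at this
  · intro d r A B X₁ X₂ Y₁ Y₂ _ _ _ _ _ _ e e' a b t s h h'
    obtain ⟨g, hg⟩ := exists_restrict ((treeEquiv A B X₁ X₂).symm.trans e) h
    obtain ⟨g', hg'⟩ := exists_restrict ((treeRootEquiv Y₁ Y₂).symm.trans e') h'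
    have := htree d r A B X₁ X₂ Y₁ Y₂ g g' a b t s
    rwa [← hg, ← hg', relabel_elt, ← Equiv.trans_assoc, ← Equiv.trans_assoc,
      Equiv.self_trans_symm, Equiv.self_trans_symm, Equiv.refl_trans, Equiv.refl_trans] at this
  · intro d r A B X₁ X₂ Y₁ Y₂ _ _ _ _ _ _ e e' w b t s h h'
    obtain ⟨g, hg⟩ := exists_restrict ((wheelEquiv A B X₁ X₂).symm.trans e) h
    obtain ⟨g', hg'⟩ := exists_restrict ((wheelRootEquiv Y₁ Y₂).symm.trans e') h'
    have := hwheel d r A B X₁ X₂ Y₁ Y₂ g g' w b t s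
    rwa [← hg, ← hg', relabel_elt, ← Equiv.trans_assoc, ← Equiv.trans_assoc,
      Equiv.self_trans_symm, Equiv.self_trans_symm, Equiv.refl_trans, Equiv.refl_trans] at this

end ContractionInduction

section Derivatives

variable {k : Type u} [Field k] {P : Species k} {V : Type u} [AddCommGroup V] [Module k V]

theorem cov_gen {X : Type} [Fintype X] (ξ : Module.Dual k V) (p : P.at' X) (v : X → V) :
    Sch.cov ξ (Sch.gen p v) = ∑ x : X, ξ (v x) •
      Sch.gen (P := deriv P) (Sch.markAt x p) (fun y : {y : X // y ≠ x} => v y.1) := by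
  rw [Sch.cov_apply, Sch.diff_gen, map_sum]
  exact Finset.sum_congr rfl fun x _ => TensorProduct.lift.tmul _ _

theorem cov_gen_eq_zero {X : Type} [Finite X] {ξ : Module.Dual k V} {v : X → V}
    (h : ∀ x, ξ (v x) = 0) (p : P.at' X) : Sch.cov ξ (Sch.gen p v) = 0 := by
  have := Fintype.ofFinite X
  rw [cov_gen]
  refine Finset.sum_eq_zero fun x _ => ?_
  rw [h x, zero_smul]

theorem cov_gen_mark {A : Type} [Finite A] {ξ : Module.Dual k V} {v : A ⊕ Fin 1 → V}
    (h : ξ (v (Sum.inr 0)) = 1) (h' : ∀ a, ξ (v (Sum.inl a)) = 0) (p : P.at' (A ⊕ Fin 1)) :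
    Sch.cov ξ (Sch.gen p v) = Sch.gen (P := deriv P) p (v ∘ Sum.inl) := by
  have := Fintype.ofFinite A
  rw [cov_gen, Fintype.sum_sum_type, Finset.sum_eq_zero, zero_add]
  · rw [Fin.sum_univ_one, h, one_smul]
    obtain ⟨f, hf⟩ := exists_restrict (ptEquiv (Sum.inr 0 : A ⊕ Fin 1)).symm
      ((Equiv.symm_apply_eq _).2 rfl)
    have hv : (fun y : {y : A ⊕ Fin 1 // y ≠ Sum.inr 0} => v y.1) ∘ f = v ∘ Sum.inl :=
      funext fun a => congrArg v (by
        have := congrArg (ptEquiv (Sum.inr 0 : A ⊕ Fin 1)) (DFunLike.congr_fun hf (Sum.inl a))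
        rw [Equiv.apply_symm_apply] at this
        exact this.symm)
    have : Sch.markAt (Sum.inr 0) p = (deriv P).relabel f p :=
      congrArg (fun e => P.relabel e p) hf
    rw [this, ← hv]
    exact Sch.gen_relabel (P := deriv P) f p _
  · intro a _
    rw [h', zero_smul]

end Derivatives

section WheelContractions

variable {k : Type u} [Field k] {O : Operad k} {V : Spmon k} {U : Type u} [AddCommGroup U]
  [Module k U] (β : U →ₗ[k] Module.Dual k V.carrier)

theorem fbr_tmul (ξ η : U) (s u : Sch O.sp V.carrier) :
    fbr β (ξ ⊗ₜ s : FDer O V.carrier U) (η ⊗ₜ u)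
      = η ⊗ₜ Sch.insert O.comp (Sch.cov (β ξ) u) s - ξ ⊗ₜ Sch.insert O.comp (Sch.cov (β η) s) u := by
  rw [fbr, LinearMap.lTensor_tmul, LinearMap.lTensor_tmul, toDer_tmul, toDer_tmul, Der.ad_elem,
    Der.ad_elem]

theorem wheel_tw (ξ : U) (u : Sch O.sp V.carrier)
    (p : SymmetricAlgebra k (Sch (wheelSp O) V.carrier)) :
    (wheelCoeff O).tw β (ξ ⊗ₜ u : FDer O V.carrier U) p
      = symDer (Der.act (Der.elem (β ξ) u)) p
        + SymmetricAlgebra.ι k _ (Sch.map (wheelPi O) LinearMap.id (Sch.cov (β ξ) u)) * p :=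
  (Coeff.tw_apply (wheelCoeff O) β _ p).trans
    (congrArg (fun w : Sch (wheelSp O) V.carrier => (symDer (Der.act (Der.elem (β ξ) u)) p
      + SymmetricAlgebra.ι k (Sch (wheelSp O) V.carrier) w * p :
        SymmetricAlgebra k (Sch (wheelSp O) V.carrier))) (Der.div_elem (β ξ) u))

theorem symDer_act_evSym {ζ : Module.Dual k V.carrier} (u : Sch O.sp V.carrier) {X Y : Type}
    [Finite X] [Finite Y] (s : (powAlg O.wheelBimod 1).at' X Y) (v : X → V.carrier) (ξ : Y → U)
    (h : ∀ x, ζ (v x) = 0) :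
    symDer (Der.act (Der.elem ζ u)) ((evSym O V.carrier U).val s v ξ) = 0 := by
  have key : s ∈ (⨅ v : X → V.carrier, ⨅ ξ : Y → U, ⨅ _ : ∀ x, ζ (v x) = 0,
      LinearMap.ker (symDer (Der.act (Der.elem ζ u)) ∘ₗ (evSym O V.carrier U).valₗ v ξ)) := by
    refine powAlg_induction (F := O.wheelBimod) (ε := 1)
      (C := fun X Y _ _ => ⨅ v : X → V.carrier, ⨅ ξ : Y → U, ⨅ _ : ∀ x, ζ (v x) = 0,
        LinearMap.ker (symDer (Der.act (Der.elem ζ u)) ∘ₗ (evSym O V.carrier U).valₗ v ξ)) ?_ ?_ s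
    · intro X Y _ _ _ _
      simp only [Submodule.mem_iInf, LinearMap.mem_ker, LinearMap.comp_apply, Ev.valₗ_apply]
      intro v ξ h
      rw [evSym_unit, symDer_one]
    · intro d X₁ X₂ Y₁ Y₂ X Y _ _ _ _ _ _ e e' a t ih
      simp only [Submodule.mem_iInf, LinearMap.mem_ker, LinearMap.comp_apply, Ev.valₗ_apply] at ih ⊢
      intro v ξ h
      rw [evSym_cons, symDer_mul, ih (v ∘ e ∘ Sum.inr) (ξ ∘ e' ∘ Sum.inr) fun x => h _,
        mul_zero, zero_add, symDer_ι]
      by_cases hc : Nat.card Y₁ = 0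
      · rw [evZero_val _ _ _ hc, Der.act_elem,
          cov_gen_eq_zero (v := v ∘ e ∘ Sum.inl) fun x => h _, map_zero,
          LinearMap.zero_apply, map_zero, zero_mul]
      · rw [bimod_eq_zero (wheelSp O) hc a, Ev.val_zero, map_zero, map_zero, zero_mul]
  simp only [Submodule.mem_iInf, LinearMap.mem_ker, LinearMap.comp_apply, Ev.valₗ_apply] at key
  exact key v ξ h

theorem lieB_evExt {A : Type} [Finite A] (a : O.sp.at' A) (va : A → V.carrier) (ξ₀ : U)
    (p : SymmetricAlgebra k (Sch (wheelSp O) V.carrier)) {X Y : Type}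
    [Finite X] [Finite Y] (t : O.extBimod.at' X Y) (v : X → V.carrier) (ξ : Y → U)
    (h : ∀ x, β ξ₀ (v x) = 0) (h' : ∀ x y, β (ξ y) (va x) = 0) :
    (wheelCoeff O).lieB β (ξ₀ ⊗ₜ Sch.gen a va) ((evExt O V.carrier U).val t v ξ ⊗ₜ p)
      = (evExt O V.carrier U).val t v ξ ⊗ₜ
        (wheelCoeff O).tw β (ξ₀ ⊗ₜ Sch.gen a va : FDer O V.carrier U) p := by
  have key : t ∈ (⨅ v : X → V.carrier, ⨅ ξ : Y → U, ⨅ _ : ∀ x, β ξ₀ (v x) = 0,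
      ⨅ _ : ∀ x y, β (ξ y) (va x) = 0, LinearMap.eqLocus
        ((wheelCoeff O).lieB β (ξ₀ ⊗ₜ Sch.gen a va) ∘ₗ (TensorProduct.mk k _ _).flip p ∘ₗ
          (evExt O V.carrier U).valₗ v ξ)
        ((TensorProduct.mk k _ _).flip
          ((wheelCoeff O).tw β (ξ₀ ⊗ₜ Sch.gen a va : FDer O V.carrier U) p) ∘ₗ
          (evExt O V.carrier U).valₗ v ξ)) := by
    refine powAlg_induction (F := O.bimod) (ε := -1)
      (C := fun X Y _ _ => ⨅ v : X → V.carrier, ⨅ ξ : Y → U, ⨅ _ : ∀ x, β ξ₀ (v x) = 0,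
      ⨅ _ : ∀ x y, β (ξ y) (va x) = 0, LinearMap.eqLocus
        ((wheelCoeff O).lieB β (ξ₀ ⊗ₜ Sch.gen a va) ∘ₗ (TensorProduct.mk k _ _).flip p ∘ₗ
          (evExt O V.carrier U).valₗ v ξ)
        ((TensorProduct.mk k _ _).flip
          ((wheelCoeff O).tw β (ξ₀ ⊗ₜ Sch.gen a va : FDer O V.carrier U) p) ∘ₗ
          (evExt O V.carrier U).valₗ v ξ)) ?_ ?_ t
    · intro X Y _ _ _ _
      simp only [Submodule.mem_iInf, LinearMap.mem_eqLocus, LinearMap.comp_apply, Ev.valₗ_apply,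
        LinearMap.flip_apply, TensorProduct.mk_apply]
      intro v ξ h h'
      rw [evExt_unit]
      exact Coeff.lieB_one (wheelCoeff O) β _ p
    · intro d X₁ X₂ Y₁ Y₂ X Y _ _ _ _ _ _ e e' b t ih
      simp only [Submodule.mem_iInf, LinearMap.mem_eqLocus, LinearMap.comp_apply, Ev.valₗ_apply,
        LinearMap.flip_apply, TensorProduct.mk_apply] at ih ⊢
      intro v ξ h h'
      rw [evExt_cons]
      generalize hx : (evOne O.sp V.carrier U).val b (v ∘ e ∘ Sum.inl) (ξ ∘ e' ∘ Sum.inl) = x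
      have h0 : fbr β (ξ₀ ⊗ₜ Sch.gen a va : FDer O V.carrier U) x = 0 := by
        by_cases hc : Nat.card Y₁ = 1
        · rw [← hx, evOne_val _ _ _ hc _ _ _ (finEquivOf hc 0), fbr_tmul,
            cov_gen_eq_zero (v := v ∘ e ∘ Sum.inl) fun x => h _,
            cov_gen_eq_zero (ξ := β ((ξ ∘ e' ∘ Sum.inl) (finEquivOf hc 0))) (v := va)
              fun x => h' x _]
          simp
        · rw [← hx, bimod_eq_zero O.sp hc b, Ev.val_zero, fbr, map_zero, toDer, map_zero, map_zero,
            LinearMap.lTensor_zero]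
          simp
      refine (Coeff.lieB_wdg (wheelCoeff O) β (ξ₀ ⊗ₜ Sch.gen a va) x
        ((evExt O V.carrier U).val (powMk O.bimod (-1) t) (v ∘ e ∘ Sum.inr) (ξ ∘ e' ∘ Sum.inr)
          ⊗ₜ p)).trans ?_
      rw [h0, map_zero, LinearMap.zero_apply, zero_add]
      exact congrArg ((wheelCoeff O).wdg x) (ih _ _ (fun x => h _) (fun x y => h' _ _))
  simp only [Submodule.mem_iInf, LinearMap.mem_eqLocus, LinearMap.comp_apply, Ev.valₗ_apply,
    LinearMap.flip_apply, TensorProduct.mk_apply] at key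
  exact key v ξ h h'

/-- The formal chains vanish under the differential if all pairings vanish. -/
theorem dB_evExt (p : SymmetricAlgebra k (Sch (wheelSp O) V.carrier)) {X Y : Type} [Finite X]
    [Finite Y] (t : O.extBimod.at' X Y) (v : X → V.carrier) (ξ : Y → U)
    (h : ∀ x y, β (ξ y) (v x) = 0)
    (h' : ∀ y u, symDer (Der.act (Der.elem (β (ξ y)) u)) p = 0) :
    (wheelCoeff O).dB β ((evExt O V.carrier U).val t v ξ ⊗ₜ p) = 0 := by
  have key : t ∈ (⨅ v : X → V.carrier, ⨅ ξ : Y → U, ⨅ _ : ∀ x y, β (ξ y) (v x) = 0,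
      ⨅ _ : ∀ y u, symDer (Der.act (Der.elem (β (ξ y)) u)) p = 0, LinearMap.ker
        ((wheelCoeff O).dB β ∘ₗ (TensorProduct.mk k _ _).flip p ∘ₗ
          (evExt O V.carrier U).valₗ v ξ)) := by
    refine powAlg_induction (F := O.bimod) (ε := -1)
      (C := fun X Y _ _ => ⨅ v : X → V.carrier, ⨅ ξ : Y → U, ⨅ _ : ∀ x y, β (ξ y) (v x) = 0,
      ⨅ _ : ∀ y u, symDer (Der.act (Der.elem (β (ξ y)) u)) p = 0, LinearMap.ker
        ((wheelCoeff O).dB β ∘ₗ (TensorProduct.mk k _ _).flip p ∘ₗ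
          (evExt O V.carrier U).valₗ v ξ)) ?_ ?_ t
    · intro X Y _ _ _ _
      simp only [Submodule.mem_iInf, LinearMap.mem_ker, LinearMap.comp_apply, Ev.valₗ_apply,
        LinearMap.flip_apply, TensorProduct.mk_apply]
      intro v ξ h h'
      rw [evExt_unit]
      exact Coeff.dB_one (wheelCoeff O) β _
    · intro d X₁ X₂ Y₁ Y₂ X Y _ _ _ _ _ _ e e' b t ih
      simp only [Submodule.mem_iInf, LinearMap.mem_ker, LinearMap.comp_apply, Ev.valₗ_apply,
        LinearMap.flip_apply, TensorProduct.mk_apply] at ih ⊢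
      intro v ξ h h'
      rw [evExt_cons]
      by_cases hc : Nat.card Y₁ = 1
      · rw [evOne_val _ _ _ hc _ _ _ (finEquivOf hc 0)]
        refine (Coeff.dB_wdg (wheelCoeff O) β _ ((evExt O V.carrier U).val
          (powMk O.bimod (-1) t) (v ∘ e ∘ Sum.inr) (ξ ∘ e' ∘ Sum.inr) ⊗ₜ p)).trans ?_
        rw [lieB_evExt β (bimodVal O.sp hc b) (v ∘ e ∘ Sum.inl)
          ((ξ ∘ e' ∘ Sum.inl) (finEquivOf hc 0)) p (powMk O.bimod (-1) t) (v ∘ e ∘ Sum.inr)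
          (ξ ∘ e' ∘ Sum.inr) (fun x => h _ _) (fun x y => h _ _), wheel_tw, Function.comp_apply, h',
          cov_gen_eq_zero (v := v ∘ e ∘ Sum.inl) fun x => h _ _,
          ih (v ∘ e ∘ Sum.inr) (ξ ∘ e' ∘ Sum.inr) (fun x y => h _ _) (fun y => h' _)]
        simp only [map_zero, zero_mul, zero_add, TensorProduct.tmul_zero, sub_zero]
      · rw [bimod_eq_zero O.sp hc b, Ev.val_zero, map_zero, zero_mul, TensorProduct.zero_tmul,
          map_zero]
  simp only [Submodule.mem_iInf, LinearMap.mem_ker, LinearMap.comp_apply, Ev.valₗ_apply,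
    LinearMap.flip_apply, TensorProduct.mk_apply] at key
  exact key v ξ h h'

section

variable {A B X Y X' Y' : Type} [Finite A] [Finite B] [Finite X] [Finite Y] [Finite X'] [Finite Y']
  (b : O.sp.at' B) (vb : B → V.carrier) (ξ₀ : U) (t : O.extBimod.at' X Y) (v : X → V.carrier)
  (ξ : Y → U) (s : (powAlg O.wheelBimod 1).at' X' Y') (v' : X' → V.carrier) (ξ' : Y' → U)

theorem dB_loop (a : O.sp.at' (A ⊕ Fin 1)) (va : A ⊕ Fin 1 → V.carrier)
    (h₁ : β ξ₀ (va (Sum.inr 0)) = 1) (h₂ : ∀ x, β ξ₀ (va (Sum.inl x)) = 0)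
    (h₃ : ∀ x, β ξ₀ (v x) = 0) (h₄ : ∀ x, β ξ₀ (v' x) = 0) (h₅ : ∀ x y, β (ξ y) (va x) = 0)
    (h₆ : ∀ x y, β (ξ y) (v x) = 0) (h₇ : ∀ x y, β (ξ y) (v' x) = 0) :
    (wheelCoeff O).dB β ((ExteriorAlgebra.ι k (ξ₀ ⊗ₜ Sch.gen a va : FDer O V.carrier U)
        * (evExt O V.carrier U).val t v ξ) ⊗ₜ (evSym O V.carrier U).val s v' ξ')
      = (evExt O V.carrier U).val t v ξ ⊗ₜ (SymmetricAlgebra.ι k (Sch (wheelSp O) V.carrier)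
        (Sch.gen (P := wheelSp O) (wheelProj O A a) (va ∘ Sum.inl))
          * (evSym O V.carrier U).val s v' ξ') := by
  refine (Coeff.dB_wdg (wheelCoeff O) β _ ((evExt O V.carrier U).val t v ξ ⊗ₜ
    (evSym O V.carrier U).val s v' ξ')).trans ?_
  rw [dB_evExt β _ t v ξ h₆ fun y u => symDer_act_evSym u s v' ξ' fun x => h₇ x y, map_zero,
    sub_zero, lieB_evExt β _ _ _ _ _ _ _ h₃ h₅, wheel_tw, symDer_act_evSym _ _ _ _ h₄, zero_add,
    cov_gen_mark h₁ h₂]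
  exact congrArg (fun w : Sch (wheelSp O) V.carrier => (evExt O V.carrier U).val t v ξ ⊗ₜ[k]
      (SymmetricAlgebra.ι k (Sch (wheelSp O) V.carrier) w * (evSym O V.carrier U).val s v' ξ'))
    (Sch.map_gen (P := deriv O.sp) (wheelPi O) LinearMap.id a _)

theorem dB_tree (a : O.sp.at' (A ⊕ Fin 1)) (va : A ⊕ Fin 1 → V.carrier) (ξ₁ : U)
    (h₁ : β ξ₀ (va (Sum.inr 0)) = 1) (h₂ : ∀ x, β ξ₀ (va (Sum.inl x)) = 0)
    (h₃ : ∀ x, β ξ₀ (v x) = 0) (h₄ : ∀ x, β ξ₀ (v' x) = 0) (h₅ : ∀ x y, β (ξ y) (va x) = 0)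
    (h₆ : ∀ x y, β (ξ y) (v x) = 0) (h₇ : ∀ x y, β (ξ y) (v' x) = 0)
    (h₈ : ∀ x, β ξ₀ (vb x) = 0) (h₉ : ∀ x, β ξ₁ (vb x) = 0) (h₁₀ : ∀ x y, β (ξ y) (vb x) = 0)
    (h₁₁ : ∀ x, β ξ₁ (va x) = 0) (h₁₂ : ∀ x, β ξ₁ (v x) = 0) (h₁₃ : ∀ x, β ξ₁ (v' x) = 0) :
    (wheelCoeff O).dB β ((ExteriorAlgebra.ι k (ξ₀ ⊗ₜ Sch.gen b vb : FDer O V.carrier U)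
        * (ExteriorAlgebra.ι k (ξ₁ ⊗ₜ Sch.gen a va : FDer O V.carrier U)
        * (evExt O V.carrier U).val t v ξ)) ⊗ₜ (evSym O V.carrier U).val s v' ξ')
      = (ExteriorAlgebra.ι k (ξ₁ ⊗ₜ Sch.gen (O.comp.ins a b) (Sum.elim (va ∘ Sum.inl) vb) :
          FDer O V.carrier U) * (evExt O V.carrier U).val t v ξ) ⊗ₜ
        (evSym O V.carrier U).val s v' ξ' := by
  refine (Coeff.dB_wdg (wheelCoeff O) β _ ((wheelCoeff O).wdg (ξ₁ ⊗ₜ Sch.gen a va)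
    ((evExt O V.carrier U).val t v ξ ⊗ₜ (evSym O V.carrier U).val s v' ξ'))).trans ?_
  have h0 : (wheelCoeff O).lieB β (ξ₀ ⊗ₜ Sch.gen b vb)
      ((evExt O V.carrier U).val t v ξ ⊗ₜ (evSym O V.carrier U).val s v' ξ') = 0 := by
    rw [lieB_evExt β _ _ _ _ _ _ _ h₃ h₁₀, wheel_tw, symDer_act_evSym _ _ _ _ h₄,
      cov_gen_eq_zero h₈, map_zero, map_zero, zero_mul, zero_add, TensorProduct.tmul_zero]
  have h1 : (wheelCoeff O).lieB β (ξ₁ ⊗ₜ Sch.gen a va)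
      ((evExt O V.carrier U).val t v ξ ⊗ₜ (evSym O V.carrier U).val s v' ξ') = 0 := by
    rw [lieB_evExt β _ _ _ _ _ _ _ h₁₂ h₅, wheel_tw, symDer_act_evSym _ _ _ _ h₁₃,
      cov_gen_eq_zero h₁₁, map_zero, map_zero, zero_mul, zero_add, TensorProduct.tmul_zero]
  rw [Coeff.dB_wdg, Coeff.lieB_wdg, h0, h1,
    dB_evExt β _ t v ξ h₆ fun y u => symDer_act_evSym u s v' ξ' fun x => h₇ x y, fbr_tmul,
    cov_gen_mark h₁ h₂, cov_gen_eq_zero h₉]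
  simp only [map_zero, LinearMap.zero_apply, TensorProduct.tmul_zero, sub_zero, add_zero]
  exact congrArg (fun w => (wheelCoeff O).wdg (ξ₁ ⊗ₜ w) _)
    (Sch.insert_gen O.comp a (va ∘ Sum.inl) b vb)

theorem dB_wheel (w : (wheelSp O).at' (A ⊕ Fin 1)) (va : A ⊕ Fin 1 → V.carrier)
    (h₁ : β ξ₀ (va (Sum.inr 0)) = 1) (h₂ : ∀ x, β ξ₀ (va (Sum.inl x)) = 0)
    (h₃ : ∀ x, β ξ₀ (v x) = 0) (h₄ : ∀ x, β ξ₀ (v' x) = 0) (h₅ : ∀ x y, β (ξ y) (va x) = 0)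
    (h₆ : ∀ x y, β (ξ y) (v x) = 0) (h₇ : ∀ x y, β (ξ y) (v' x) = 0)
    (h₈ : ∀ x, β ξ₀ (vb x) = 0) (h₁₀ : ∀ x y, β (ξ y) (vb x) = 0) :
    (wheelCoeff O).dB β ((ExteriorAlgebra.ι k (ξ₀ ⊗ₜ Sch.gen b vb : FDer O V.carrier U)
        * (evExt O V.carrier U).val t v ξ) ⊗ₜ (SymmetricAlgebra.ι k (Sch (wheelSp O) V.carrier)
          (Sch.gen (P := wheelSp O) w va) * (evSym O V.carrier U).val s v' ξ'))
      = (evExt O V.carrier U).val t v ξ ⊗ₜ (SymmetricAlgebra.ι k (Sch (wheelSp O) V.carrier)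
        (Sch.gen (P := wheelSp O) ((wheel O).act.ins w b) (Sum.elim (va ∘ Sum.inl) vb))
          * (evSym O V.carrier U).val s v' ξ') := by
  refine (Coeff.dB_wdg (wheelCoeff O) β _ ((evExt O V.carrier U).val t v ξ ⊗ₜ
    (SymmetricAlgebra.ι k (Sch (wheelSp O) V.carrier)
          (Sch.gen (P := wheelSp O) w va) * (evSym O V.carrier U).val s v' ξ'))).trans ?_
  rw [dB_evExt β _ t v ξ h₆ fun y u => ?_, lieB_evExt β _ _ _ _ _ _ _ h₃ h₁₀, wheel_tw,
    cov_gen_eq_zero h₈, symDer_mul, symDer_act_evSym _ _ _ _ h₄, symDer_ι, Der.act_elem,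
    cov_gen_mark h₁ h₂]
  · simp only [map_zero, mul_zero, zero_mul, zero_add, add_zero, sub_zero]
    exact congrArg (fun w : Sch (wheelSp O) V.carrier => (evExt O V.carrier U).val t v ξ ⊗ₜ[k]
        (SymmetricAlgebra.ι k (Sch (wheelSp O) V.carrier) w * (evSym O V.carrier U).val s v' ξ'))
      (Sch.insert_gen (P := wheelSp O) (wheel O).act w (va ∘ Sum.inl) b vb)
  · rw [symDer_mul, symDer_act_evSym _ _ _ _ fun x => h₇ x y, symDer_ι, Der.act_elem,
      cov_gen_eq_zero fun x => h₅ x y]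
    simp only [map_zero, LinearMap.zero_apply, mul_zero, zero_mul, zero_add]

end

end WheelContractions

section WheelModel

variable {k : Type u} [Field k] {O : Operad k} {V : Spmon k} {U : Type u} [AddCommGroup U]
  [Module k U] {β : U →ₗ[k] Module.Dual k V.carrier}
  {d r : ℕ} {A B X₁ X₂ Y₁ Y₂ : Type} [Finite A] [Finite B] [Finite X₁] [Finite X₂] [Finite Y₁]
  [Finite Y₂]

theorem dB_evM_loop (a : O.sp.at' (A ⊕ Fin 1)) (t : (convPow O.bimod d).at' X₁ Y₁)
    (s : (convPow O.wheelBimod r).at' X₂ Y₂) {v : (X₁ ⊕ (A ⊕ X₂)) ⊕ Fin 1 → V.carrier}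
    {ξ : (Y₁ ⊕ (Fin 0 ⊕ Y₂)) ⊕ Fin 1 → U} (h : IsDelta β v ξ (Sum.inr 0, Sum.inr 0)) :
    (wheelCoeff O).dB β ((evM O V.carrier U).val (O.elt (loopEquiv A X₁ X₂) (loopRootEquiv Y₁ Y₂)
        (powCons O.bimod d (Equiv.refl _) (Equiv.refl _) (O.sp.elt 1 a) t) s) v ξ)
      = (evM O V.carrier U).val (O.elt (Equiv.refl _) (Equiv.refl _) t
        (powCons O.wheelBimod r (Equiv.refl _) (Equiv.refl _)
          ((wheelSp O).elt 0 (wheelProj O A a)) s)) (v ∘ Sum.inl) (ξ ∘ Sum.inl) := by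
  rw [Operad.elt, evM_mk, evExt_cons, evOne_elt, Operad.elt, evM_mk, evSym_cons, evZero_elt]
  have h0 : ∀ x y, (x, y) ≠ (Sum.inr 0, Sum.inr 0) → β (ξ y) (v x) = 0 := h.2
  exact dB_loop β _ _ _ _ _ _ _ a _ h.1 (fun x => h0 _ _ (by simp [loopEquiv]))
    (fun x => h0 _ _ (by simp [loopEquiv])) (fun x => h0 _ _ (by simp [loopEquiv]))
    (fun x y => h0 _ _ (by simp [loopRootEquiv])) (fun x y => h0 _ _ (by simp [loopRootEquiv]))
    (fun x y => h0 _ _ (by simp [loopRootEquiv]))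

theorem dB_evM_tree (a : O.sp.at' (A ⊕ Fin 1)) (b : O.sp.at' B)
    (t : (convPow O.bimod d).at' X₁ Y₁)
    (s : (convPow O.wheelBimod r).at' X₂ Y₂) {v : (((A ⊕ B) ⊕ X₁) ⊕ X₂) ⊕ Fin 1 → V.carrier}
    {ξ : ((Fin 1 ⊕ Y₁) ⊕ Y₂) ⊕ Fin 1 → U} (h : IsDelta β v ξ (Sum.inr 0, Sum.inr 0)) :
    (wheelCoeff O).dB β ((evM O V.carrier U).val (O.elt (treeEquiv A B X₁ X₂) (treeRootEquiv Y₁ Y₂)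
        (powCons O.bimod (d + 1) (Equiv.refl _) (Equiv.refl _) (O.sp.elt 1 b)
          (powCons O.bimod d (Equiv.refl _) (Equiv.refl _) (O.sp.elt 1 a) t)) s) v ξ)
      = (evM O V.carrier U).val (O.elt (Equiv.refl _) (Equiv.refl _)
        (powCons O.bimod d (Equiv.refl _) (Equiv.refl _) (O.sp.elt 1 (O.comp.ins a b)) t) s)
        (v ∘ Sum.inl) (ξ ∘ Sum.inl) := by
  rw [Operad.elt, evM_mk, evExt_cons, evExt_cons, evOne_elt, evOne_elt, Operad.elt, evM_mk,
    evExt_cons, evOne_elt]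
  have h0 : ∀ x y, (x, y) ≠ (Sum.inr 0, Sum.inr 0) → β (ξ y) (v x) = 0 := h.2
  refine (dB_tree β b _ _ _ _ _ _ _ _ a _ _ h.1 (fun x => h0 _ _ (by simp [treeEquiv]))
    (fun x => h0 _ _ (by simp [treeEquiv])) (fun x => h0 _ _ (by simp [treeEquiv]))
    (fun x y => h0 _ _ (by simp [treeRootEquiv])) (fun x y => h0 _ _ (by simp [treeRootEquiv]))
    (fun x y => h0 _ _ (by simp [treeRootEquiv])) (fun x => h0 _ _ (by simp [treeEquiv]))
    (fun x => h0 _ _ (by simp [treeRootEquiv])) (fun x y => h0 _ _ (by simp [treeRootEquiv]))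
    (fun x => h0 _ _ (by simp [treeRootEquiv])) (fun x => h0 _ _ (by simp [treeRootEquiv]))
    (fun x => h0 _ _ (by simp [treeRootEquiv]))).trans ?_
  exact congrArg (fun vv => ((ExteriorAlgebra.ι k
      (ξ (Sum.inl (Sum.inl (Sum.inl 0))) ⊗ₜ Sch.gen (O.comp.ins a b) vv)
    * (evExt O V.carrier U).val (powMk O.bimod (-1) t) _ _) ⊗ₜ _ : (wheelCoeff O).Ch _ _))
    (funext fun x => by rcases x with x | x <;> rfl)

theorem dB_evM_wheel (w : (wheelSp O).at' (A ⊕ Fin 1)) (b : O.sp.at' B)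
    (t : (convPow O.bimod d).at' X₁ Y₁)
    (s : (convPow O.wheelBimod r).at' X₂ Y₂) {v : (X₁ ⊕ ((A ⊕ B) ⊕ X₂)) ⊕ Fin 1 → V.carrier}
    {ξ : (Y₁ ⊕ (Fin 0 ⊕ Y₂)) ⊕ Fin 1 → U} (h : IsDelta β v ξ (Sum.inr 0, Sum.inr 0)) :
    (wheelCoeff O).dB β ((evM O V.carrier U).val (O.elt (wheelEquiv A B X₁ X₂)
        (wheelRootEquiv Y₁ Y₂)
        (powCons O.bimod d (Equiv.refl _) (Equiv.refl _) (O.sp.elt 1 b) t)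
        (powCons O.wheelBimod r (Equiv.refl _) (Equiv.refl _) ((wheelSp O).elt 0 w) s)) v ξ)
      = (evM O V.carrier U).val (O.elt (Equiv.refl _) (Equiv.refl _) t
        (powCons O.wheelBimod r (Equiv.refl _) (Equiv.refl _)
          ((wheelSp O).elt 0 ((wheel O).act.ins w b)) s)) (v ∘ Sum.inl) (ξ ∘ Sum.inl) := by
  rw [Operad.elt, evM_mk, evExt_cons, evOne_elt, evSym_cons, evZero_elt, Operad.elt, evM_mk,
    evSym_cons, evZero_elt (P := wheelSp O) (V := V.carrier) (U := U) ((wheel O).act.ins w b)]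
  have h0 : ∀ x y, (x, y) ≠ (Sum.inr 0, Sum.inr 0) → β (ξ y) (v x) = 0 := h.2
  refine (dB_wheel β b _ _ _ _ _ _ _ _ w _ h.1 (fun x => h0 _ _ (by simp [wheelEquiv]))
    (fun x => h0 _ _ (by simp [wheelEquiv])) (fun x => h0 _ _ (by simp [wheelEquiv]))
    (fun x y => h0 _ _ (by simp [wheelRootEquiv])) (fun x y => h0 _ _ (by simp [wheelRootEquiv]))
    (fun x y => h0 _ _ (by simp [wheelRootEquiv])) (fun x => h0 _ _ (by simp [wheelEquiv]))
    (fun x y => h0 _ _ (by simp [wheelRootEquiv]))).trans ?_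
  exact congrArg (fun vv => ((evExt O V.carrier U).val (powMk O.bimod (-1) t) _ _ ⊗ₜ
      (SymmetricAlgebra.ι k _ (Sch.gen (P := wheelSp O) ((wheel O).act.ins w b) vv)
        * (evSym O V.carrier U).val (powMk O.wheelBimod 1 s) _ _) : (wheelCoeff O).Ch _ _))
    (funext fun x => by rcases x with x | x <;> rfl)

end WheelModel

section Instances

variable {k : Type u} [Field k] {O : Operad k}

theorem evExt_mem {V U : Type u} [AddCommGroup V] [Module k V] [AddCommGroup U] [Module k U]
    {X Y : Type} [Finite X] [Finite Y] (t : O.extBimod.at' X Y)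
    (v : X → V) (ξ : Y → U) : (evExt O V U).val t v ξ ∈ ⋀[k]^(Nat.card Y) (FDer O V U) := by
  have key : t ∈ (⨅ v : X → V, ⨅ ξ : Y → U,
      (⋀[k]^(Nat.card Y) (FDer O V U)).comap ((evExt O V U).valₗ v ξ)) := by
    refine powAlg_induction (F := O.bimod) (ε := -1)
      (C := fun X Y _ _ => ⨅ v : X → V, ⨅ ξ : Y → U,
      (⋀[k]^(Nat.card Y) (FDer O V U)).comap ((evExt O V U).valₗ v ξ)) ?_ ?_ t
    · intro X Y _ _ _ _
      simp only [Submodule.mem_iInf, Submodule.mem_comap, Ev.valₗ_apply]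
      intro v ξ
      rw [evExt_unit, Nat.card_of_isEmpty]
      exact Submodule.one_le.1 (pow_zero _).ge
    · intro d X₁ X₂ Y₁ Y₂ X Y _ _ _ _ _ _ e e' b t ih
      simp only [Submodule.mem_iInf, Submodule.mem_comap, Ev.valₗ_apply] at ih ⊢
      intro v ξ
      rw [evExt_cons]
      by_cases hc : Nat.card Y₁ = 1
      · rw [← Nat.card_congr e', Nat.card_sum, hc, add_comm]
        exact (pow_succ' (LinearMap.range (ExteriorAlgebra.ι k (M := FDer O V U))) _).ge
          (Submodule.mul_mem_mul (LinearMap.mem_range_self _ _) (ih _ _))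
      · rw [bimod_eq_zero O.sp hc b, Ev.val_zero, map_zero, zero_mul]
        exact Submodule.zero_mem _
  simp only [Submodule.mem_iInf, Submodule.mem_comap, Ev.valₗ_apply] at key
  exact key v ξ

theorem evSym_eq_zero {V U : Type u} [AddCommGroup V] [Module k V] [AddCommGroup U] [Module k U]
    {X Y : Type} [Finite X] [Finite Y] (t : (powAlg O.wheelBimod 1).at' X Y)
    (v : X → V) (ξ : Y → U) (y : Y) : (evSym O V U).val t v ξ = 0 := by
  refine powAlg_ind (S := LinearMap.ker ((evSym O V U).valₗ v ξ)) (fun d s => ?_) t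
  rw [sym_eq_zero s y]
  exact Submodule.zero_mem _

/-- The Schur functor of the symmetric algebra of the wheels. -/
theorem sym_top_le {V U : Type u} [AddCommGroup V] [Module k V] [AddCommGroup U] [Module k U]
    (S : Submodule k (SymmetricAlgebra k (Sch (wheelSp O) V)))
    (h : ∀ (r : ℕ) (X Y : Type) [Finite X] [Finite Y] (s : (convPow O.wheelBimod r).at' X Y)
      (v : X → V) (ξ : Y → U), Nat.card Y = 0 → (evSym O V U).val (powMk O.wheelBimod 1 s) v ξ ∈ S)
    (p) : p ∈ S := by
  let T : Submodule k (SymmetricAlgebra k (Sch (wheelSp O) V)) := Submodule.span k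
    {p | ∃ (r : ℕ) (X Y : Type) (_ : Finite X) (_ : Finite Y) (_ : Nat.card Y = 0)
      (s : (convPow O.wheelBimod r).at' X Y)
      (v : X → V) (ξ : Y → U), p = (evSym O V U).val (powMk O.wheelBimod 1 s) v ξ}
  have hT : T ≤ S := Submodule.span_le.2 (by
    rintro _ ⟨r, X, Y, _, _, hY, s, v, ξ, rfl⟩
    exact h r X Y s v ξ hY)
  refine hT ?_
  refine sym_ind (C := fun p => p ∈ T) ?_ ?_ (fun p q => T.add_mem) (fun c p => T.smul_mem c) p
  · refine Submodule.subset_span ⟨0, Fin 0, Fin 0, inferInstance, inferInstance, Nat.card_fin 0,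
      powUnit _ _ _, fun i => i.elim0, fun i => i.elim0, ?_⟩
    rw [evSym_unit]
  · intro m p hp
    refine Sch.ind (P := wheelSp O) (V := V)
      (C := fun m => SymmetricAlgebra.ι k _ m * p ∈ T) ?_ ?_ m
    · intro X _ w v
      refine Submodule.span_induction (p := fun p _ => SymmetricAlgebra.ι k _
        (Sch.gen (P := wheelSp O) w v) * p ∈ T) ?_ ?_ ?_ ?_ hp
      · rintro _ ⟨r, X', Y', _, _, hY, s, v', ξ', rfl⟩
        refine Submodule.subset_span ⟨r + 1, X ⊕ X', Fin 0 ⊕ Y', inferInstance, inferInstance, ?_,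
          powCons O.wheelBimod r (Equiv.refl _) (Equiv.refl _) ((wheelSp O).elt 0 w) s,
          Sum.elim v v', Sum.elim (fun i => i.elim0) ξ', ?_⟩
        · rw [Nat.card_sum, Nat.card_fin, hY]
        · rw [evSym_cons, evZero_elt]
          rfl
      · rw [mul_zero]
        exact T.zero_mem
      · intro x y _ _ hx hy
        rw [mul_add]
        exact T.add_mem hx hy
      · intro c x _ hx
        rw [mul_smul_comm]
        exact T.smul_mem c hx
    · intro x y hx hy
      rw [map_add, add_mul]
      exact T.add_mem hx hy

/-- The formal chains of degree `n` are spanned by products of generators. -/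
theorem deg_le_of_prod (K : Coeff O) (V : Spmon k) (U : Type u) [AddCommGroup U] [Module k U]
    (n : ℕ) (S : Submodule k (K.Ch V U)) (C : SymmetricAlgebra k (K.S V) → Prop)
    (hC : ∀ T : Submodule k (SymmetricAlgebra k (K.S V)), (∀ p, C p → p ∈ T) → T = ⊤)
    (h : ∀ (d : ℕ) (X Y : Type) [Finite X] [Finite Y] (t : (convPow O.bimod d).at' X Y)
      (v : X → V.carrier) (ξ : Y → U) (p : SymmetricAlgebra k (K.S V)), C p → Nat.card Y = n →
      ((evExt O V.carrier U).val (powMk O.bimod (-1) t) v ξ ⊗ₜ p : K.Ch V U) ∈ S) :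
    K.deg V U n ≤ S := by
  let T : ℕ → Submodule k (K.Ch V U) := fun n => Submodule.span k
    {c | ∃ (d : ℕ) (X Y : Type) (_ : Finite X) (_ : Finite Y) (_ : Nat.card Y = n)
      (t : (convPow O.bimod d).at' X Y) (v : X → V.carrier) (ξ : Y → U)
      (p : SymmetricAlgebra k (K.S V)) (_ : C p),
      c = (evExt O V.carrier U).val (powMk O.bimod (-1) t) v ξ ⊗ₜ p}
  have hT : T n ≤ S := Submodule.span_le.2 (by
    rintro _ ⟨d, X, Y, _, _, hY, t, v, ξ, p, hp, rfl⟩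
    exact h d X Y t v ξ p hp hY)
  refine le_trans ?_ hT
  clear hT h
  induction n with
  | zero =>
    refine K.deg_zero_le fun p => ?_
    have := hC ((T 0).comap (TensorProduct.mk k _ _ 1)) fun p hp => Submodule.subset_span
      ⟨0, Fin 0, Fin 0, inferInstance, inferInstance, Nat.card_fin 0, powUnit _ _ _,
        fun i => i.elim0, fun i => i.elim0, p, hp, by rw [evExt_unit]; rfl⟩
    exact (this ▸ Submodule.mem_top : p ∈ (T 0).comap (TensorProduct.mk k _ _ 1))
  | succ n ih =>
    refine K.deg_succ_le fun x c hc => ?_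
    have key : T n ≤ (T (n + 1)).comap (K.wdg x) := Submodule.span_le.2 (by
      rintro _ ⟨d, X, Y, _, _, hY, t, v, ξ, p, hp, rfl⟩
      change K.wdg x _ ∈ T (n + 1)
      induction x using TensorProduct.induction_on with
      | zero =>
        rw [map_zero]
        exact Submodule.zero_mem _
      | add x y hx hy =>
        rw [map_add]
        exact Submodule.add_mem _ hx hy
      | tmul η s =>
        refine Sch.ind (P := O.sp) (C := fun s => K.wdg (η ⊗ₜ s) _ ∈ T (n + 1)) ?_ ?_ s
        · intro A _ a va
          refine Submodule.subset_span ⟨d + 1, A ⊕ X, Fin 1 ⊕ Y, inferInstance, inferInstance, ?_,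
            powCons O.bimod d (Equiv.refl _) (Equiv.refl _) (O.sp.elt 1 a) t,
            Sum.elim va v, Sum.elim (fun _ => η) ξ, p, hp, ?_⟩
          · rw [Nat.card_sum, Nat.card_fin, hY, add_comm]
          · rw [evExt_cons, evOne_elt]
            rfl
        · intro s s' hs hs'
          rw [TensorProduct.tmul_add, map_add]
          exact Submodule.add_mem _ hs hs')
    exact key (ih hc)

end Instances

section Projection

variable {k : Type u} [Field k] (O : Operad k) (V : Spmon k) (U : Type u) [AddCommGroup U]
  [Module k U]

/-- The projection of formal chains with coefficients in wheels to those without. -/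
def prCh : (wheelCoeff O).Ch V U →ₗ[k] (plainCoeff O).Ch V U :=
  TensorProduct.map (ExteriorAlgebra.map (LinearMap.id : FDer O V.carrier U →ₗ[k] _)).toLinearMap
    (DGLie.symMap (0 : Sch (wheelSp O) V.carrier →ₗ[k] PUnit.{u + 1})).toLinearMap

variable {V U}

theorem prCh_tmul (ω : ExteriorAlgebra k (FDer O V.carrier U))
    (p : SymmetricAlgebra k (Sch (wheelSp O) V.carrier)) :
    prCh O V U (ω ⊗ₜ p) = ω ⊗ₜ DGLie.symMap 0 p :=
  (TensorProduct.map_tmul _ _ ω p).trans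
    (congrArg (· ⊗ₜ _) (DFunLike.congr_fun ExteriorAlgebra.map_id ω))

def prDgl (β : U →ₗ[k] Module.Dual k V.carrier) :
    (wheelCoeff O).dgl β ⟶ (plainCoeff O).dgl β where
  map0 := LinearMap.id
  mapNeg := 0
  map_lie _ _ := rfl
  map_act _ _ := rfl
  map_diff _ := rfl

theorem prCh_dB (β : U →ₗ[k] Module.Dual k V.carrier) (c : (wheelCoeff O).Ch V U) :
    prCh O V U ((wheelCoeff O).dB β c) = (plainCoeff O).dB β (prCh O V U c) :=
  chainsMap_ceD (ρ := ((wheelCoeff O).dgl β).twist) (ρ' := ((plainCoeff O).dgl β).twist)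
    (f := LinearMap.id)
    (φ := (DGLie.symMap (0 : Sch (wheelSp O) V.carrier →ₗ[k] PUnit.{u + 1})).toLinearMap)
    (DGLie.Hom.map_lie (prDgl O β)) (fun x p => DGLie.symMap_twist (prDgl O β) x p) c

variable {X₁ X₂ Y₁ Y₂ X Y : Type} [Finite X₁] [Finite X₂] [Finite Y₁] [Finite Y₂] [Finite X]
  [Finite Y] (v : X → V.carrier) (ξ : Y → U)

theorem symMap_zero_evSym {r : ℕ} (s : (convPow O.wheelBimod (r + 1)).at' X Y) :
    DGLie.symMap (0 : Sch (wheelSp O) V.carrier →ₗ[k] PUnit.{u + 1})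
      ((evSym O V.carrier U).val (powMk O.wheelBimod 1 s) v ξ) = 0 := by
  refine convPow_succ_ind (S := (LinearMap.ker ((DGLie.symMap
    (0 : Sch (wheelSp O) V.carrier →ₗ[k] PUnit.{u + 1})).toLinearMap ∘ₗ
    (evSym O V.carrier U).valₗ v ξ)).comap (powMk O.wheelBimod 1))
    (fun X₁ X₂ Y₁ Y₂ _ _ _ _ e e' a t => ?_) s
  change DGLie.symMap _ ((evSym O V.carrier U).val (powMk O.wheelBimod 1
    (powCons O.wheelBimod r e e' a t)) v ξ) = 0
  rw [evSym_cons, map_mul, DGLie.symMap_ι, LinearMap.zero_apply, map_zero, zero_mul]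

theorem prCh_evM_succ {d r : ℕ} (e : X₁ ⊕ X₂ ≃ X) (e' : Y₁ ⊕ Y₂ ≃ Y)
    (t : (convPow O.bimod d).at' X₁ Y₁) (s : (convPow O.wheelBimod (r + 1)).at' X₂ Y₂) :
    prCh O V U ((evM O V.carrier U).val (O.elt e e' t s) v ξ) = 0 := by
  rw [Operad.elt, evM_mk, prCh_tmul, symMap_zero_evSym, TensorProduct.tmul_zero]

theorem prCh_evM_zero [IsEmpty X₂] [IsEmpty Y₂] {d : ℕ} (e : X₁ ⊕ X₂ ≃ X) (e' : Y₁ ⊕ Y₂ ≃ Y)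
    (t : (convPow O.bimod d).at' X₁ Y₁) (c : k) :
    prCh O V U ((evM O V.carrier U).val (O.elt (r := 0) e e' t
        (fun _ : PLift (IsEmpty X₂ ∧ IsEmpty Y₂) => c)) v ξ)
      = (evN O V.carrier U).val (c • powMk O.bimod (-1) ((convPow O.bimod d).relabel
        ((Equiv.sumEmpty X₁ X₂).symm.trans e) ((Equiv.sumEmpty Y₁ Y₂).symm.trans e') t)) v ξ := by
  have hc : (fun _ : PLift (IsEmpty X₂ ∧ IsEmpty Y₂) => c)
      = (c • powUnit O.wheelBimod X₂ Y₂ : (convPow O.wheelBimod 0).at' X₂ Y₂) :=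
    funext (β := fun _ : PLift (IsEmpty X₂ ∧ IsEmpty Y₂) => k) fun _ => (mul_one c).symm
  have h : powMk O.bimod (-1) ((convPow O.bimod d).relabel
        ((Equiv.sumEmpty X₁ X₂).symm.trans e) ((Equiv.sumEmpty Y₁ Y₂).symm.trans e') t)
      = O.extBimod.relabel ((Equiv.sumEmpty X₁ X₂).symm.trans e)
        ((Equiv.sumEmpty Y₁ Y₂).symm.trans e') (powMk O.bimod (-1) t) :=
    (relabel_powMk _ _ _ _ _).symm
  refine (congrArg (fun s => prCh O V U ((evM O V.carrier U).val (O.elt (r := 0) e e' t s) v ξ))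
    hc).trans ?_
  rw [Operad.elt, evM_mk, prCh_tmul, map_smul, Ev.val_smul, map_smul, evSym_unit, map_one, h,
    Ev.val_smul, Ev.val_relabel, evN_val, TensorProduct.tmul_smul]
  rfl

theorem exists_proj (m : O.extSymBimod.at' X Y) : ∃ n : O.extBimod.at' X Y,
    ∀ (V : Spmon k) (U : Type u) [AddCommGroup U] [Module k U] (v : X → V.carrier) (ξ : Y → U),
      prCh O V U ((evM O V.carrier U).val m v ξ) = (evN O V.carrier U).val n v ξ := by
  let S : Submodule k (O.extSymBimod.at' X Y) :=
    { carrier := {m | ∃ n : O.extBimod.at' X Y, ∀ (V : Spmon k) (U : Type u) [AddCommGroup U]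
        [Module k U] (v : X → V.carrier) (ξ : Y → U),
        prCh O V U ((evM O V.carrier U).val m v ξ) = (evN O V.carrier U).val n v ξ}
      add_mem' := by
        rintro m m' ⟨n, h⟩ ⟨n', h'⟩
        refine ⟨n + n', fun V U _ _ v ξ => ?_⟩
        rw [Ev.val_add, Ev.val_add, map_add, h, h']
      zero_mem' := ⟨0, fun V U _ _ v ξ => by rw [Ev.val_zero, Ev.val_zero, map_zero]⟩
      smul_mem' := by
        rintro c m ⟨n, h⟩
        refine ⟨c • n, fun V U _ _ v ξ => ?_⟩
        rw [Ev.val_smul, Ev.val_smul, map_smul, h] }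
  refine extSym_ind O (S := S) (fun d r X₁ X₂ Y₁ Y₂ _ _ _ _ e e' t s => ?_) m
  cases r with
  | zero =>
    by_cases h : IsEmpty X₂ ∧ IsEmpty Y₂
    · have := h.1
      have := h.2
      exact ⟨_, fun V U _ _ v ξ => prCh_evM_zero O v ξ e e' t
        ((show PLift (IsEmpty X₂ ∧ IsEmpty Y₂) → k from s) ⟨h⟩)⟩
    · rw [powZero_eq_zero O.wheelBimod h s, elt_zero_right]
      exact S.zero_mem
  | succ r =>
    exact ⟨0, fun V U _ _ v ξ => (prCh_evM_succ O v ξ e e' t s).trans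
      (Ev.val_zero _ _ _).symm⟩

theorem exists_lift (n : O.extBimod.at' X Y) : ∃ m : O.extSymBimod.at' X Y,
    ∀ (V : Spmon k) (U : Type u) [AddCommGroup U] [Module k U] (v : X → V.carrier) (ξ : Y → U),
      prCh O V U ((evM O V.carrier U).val m v ξ) = (evN O V.carrier U).val n v ξ := by
  refine ⟨convMk O.extBimod (powAlg O.wheelBimod 1) (Equiv.sumEmpty X (Fin 0))
    (Equiv.sumEmpty Y (Fin 0)) n (powMk O.wheelBimod 1 (powUnit _ _ _)), fun V U _ _ v ξ => ?_⟩
  rw [evM_mk, evSym_unit, prCh_tmul, map_one, evN_val]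
  rfl

end Projection

section Instances

variable {k : Type u} [Field k] (O : Operad k)

theorem evM_mem {V U : Type u} [AddCommGroup V] [Module k V] [AddCommGroup U] [Module k U]
    {X Y : Type} [Finite X] [Finite Y] (m : O.extSymBimod.at' X Y) (v : X → V) (ξ : Y → U) :
    (evM O V U).val m v ξ ∈ Submodule.map₂ (TensorProduct.mk k _ _)
      (⋀[k]^(Nat.card Y) (FDer O V U)) ⊤ := by
  refine conv_ind (F := O.extBimod) (G := powAlg O.wheelBimod 1) (S := (Submodule.map₂
    (TensorProduct.mk k _ _) (⋀[k]^(Nat.card Y) (FDer O V U)) ⊤).comap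
      ((evM O V U).valₗ v ξ)) (fun X₁ X₂ Y₁ Y₂ _ _ _ _ e e' a b => ?_) m
  rw [Submodule.mem_comap, Ev.valₗ_apply, evM_mk]
  by_cases h : IsEmpty Y₂
  · refine Submodule.apply_mem_map₂ (TensorProduct.mk k _ _) ?_ Submodule.mem_top
    rw [← Nat.card_congr e', Nat.card_sum, Nat.card_of_isEmpty (α := Y₂), add_zero]
    exact evExt_mem a _ _
  · obtain ⟨y⟩ := not_isEmpty_iff.1 h
    rw [evSym_eq_zero b _ _ y, TensorProduct.tmul_zero]
    exact Submodule.zero_mem _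

/-- The contractions of the elements of `Λ^* O ⊚ S^* |δ_{1,1}O|` exist. -/
theorem exists_contr {X Y : Type} [Finite X] [Finite Y]
    (m : O.extSymBimod.at' (X ⊕ Fin 1) (Y ⊕ Fin 1)) :
    ∃ m' : O.extSymBimod.at' X Y, ∀ (V : Spmon k) (U : Type u) [AddCommGroup U] [Module k U]
      (β : U →ₗ[k] Module.Dual k V.carrier) (v : X ⊕ Fin 1 → V.carrier) (ξ : Y ⊕ Fin 1 → U),
      IsDelta β v ξ (Sum.inr 0, Sum.inr 0) →
      (wheelCoeff O).dB β ((evM O V.carrier U).val m v ξ)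
        = (evM O V.carrier U).val m' (v ∘ Sum.inl) (ξ ∘ Sum.inl) := by
  let S : Submodule k (O.extSymBimod.at' (X ⊕ Fin 1) (Y ⊕ Fin 1)) :=
    { carrier := {m | ∃ m' : O.extSymBimod.at' X Y, ∀ (V : Spmon k) (U : Type u)
        [AddCommGroup U] [Module k U]
        (β : U →ₗ[k] Module.Dual k V.carrier) (v : X ⊕ Fin 1 → V.carrier) (ξ : Y ⊕ Fin 1 → U),
        IsDelta β v ξ (Sum.inr 0, Sum.inr 0) →
        (wheelCoeff O).dB β ((evM O V.carrier U).val m v ξ)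
          = (evM O V.carrier U).val m' (v ∘ Sum.inl) (ξ ∘ Sum.inl)}
      add_mem' := by
        rintro m m' ⟨n, h⟩ ⟨n', h'⟩
        refine ⟨n + n', fun V U _ _ β v ξ hd => ?_⟩
        rw [Ev.val_add, Ev.val_add, map_add, h V U β v ξ hd, h' V U β v ξ hd]
      zero_mem' := ⟨0, fun V U _ _ β v ξ _ => by rw [Ev.val_zero, Ev.val_zero, map_zero]⟩
      smul_mem' := by
        rintro c m ⟨n, h⟩
        refine ⟨c • n, fun V U _ _ β v ξ hd => ?_⟩
        rw [Ev.val_smul, Ev.val_smul, map_smul, h V U β v ξ hd] }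
  have key : ∀ {X' Y' : Type} [Finite X'] [Finite Y'] (g : X' ≃ X) (g' : Y' ≃ Y)
      (m : O.extSymBimod.at' (X' ⊕ Fin 1) (Y' ⊕ Fin 1)) (n : O.extSymBimod.at' X' Y'),
      (∀ (V : Spmon k) (U : Type u) [AddCommGroup U] [Module k U]
        (β : U →ₗ[k] Module.Dual k V.carrier) (v : X' ⊕ Fin 1 → V.carrier) (ξ : Y' ⊕ Fin 1 → U),
        IsDelta β v ξ (Sum.inr 0, Sum.inr 0) →
        (wheelCoeff O).dB β ((evM O V.carrier U).val m v ξ)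
          = (evM O V.carrier U).val n (v ∘ Sum.inl) (ξ ∘ Sum.inl)) →
      O.extSymBimod.relabel (g.sumCongr (Equiv.refl _)) (g'.sumCongr (Equiv.refl _)) m ∈ S := by
    intro X' Y' _ _ g g' m n h
    refine ⟨O.extSymBimod.relabel g g' n, fun V U _ _ β v ξ hd => ?_⟩
    rw [Ev.val_relabel, Ev.val_relabel]
    exact h V U β _ _ (Model.IsDelta.comp (i := g.sumCongr (Equiv.refl _))
      (j := g'.sumCongr (Equiv.refl _)) (Equiv.injective _) (Equiv.injective _)
      (p := (Sum.inr 0, Sum.inr 0)) hd)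
  exact extSym_contr_ind (S := S)
    (fun d r A X₁ X₂ Y₁ Y₂ _ _ _ _ _ g g' a t s => key g g' _ _
      fun V U _ _ β v ξ hd => dB_evM_loop a t s hd)
    (fun d r A B X₁ X₂ Y₁ Y₂ _ _ _ _ _ _ g g' a b t s => key g g' _ _
      fun V U _ _ β v ξ hd => dB_evM_tree a b t s hd)
    (fun d r A B X₁ X₂ Y₁ Y₂ _ _ _ _ _ _ g g' w b t s => key g g' _ _
      fun V U _ _ β v ξ hd => dB_evM_wheel w b t s hd) m

theorem exists_contr_ext {X Y : Type} [Finite X] [Finite Y]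
    (n : O.extBimod.at' (X ⊕ Fin 1) (Y ⊕ Fin 1)) :
    ∃ n' : O.extBimod.at' X Y, ∀ (V : Spmon k) (U : Type u) [AddCommGroup U] [Module k U]
      (β : U →ₗ[k] Module.Dual k V.carrier) (v : X ⊕ Fin 1 → V.carrier) (ξ : Y ⊕ Fin 1 → U),
      IsDelta β v ξ (Sum.inr 0, Sum.inr 0) →
      (plainCoeff O).dB β ((evN O V.carrier U).val n v ξ)
        = (evN O V.carrier U).val n' (v ∘ Sum.inl) (ξ ∘ Sum.inl) := by
  obtain ⟨m, hm⟩ := exists_lift O n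
  obtain ⟨m', hm'⟩ := exists_contr O m
  obtain ⟨n', hn'⟩ := exists_proj O m'
  refine ⟨n', fun V U _ _ β v ξ hd => ?_⟩
  rw [← hm, ← prCh_dB, hm' V U β v ξ hd, hn']

variable [CharZero k]

/-- `Λ^* O ⊚ S^* |δ_{1,1}O|` as a model of the formal chains with coefficients in wheels. -/
def wheelModel : Model O where
  K := wheelCoeff O
  E := O.extSymBimod
  ev V U _ _ := evM O V.carrier U
  map_ev {_ _ _ _} _ _ _ _ i j {_ _} _ _ m v ξ := map_evM O i j m v ξ
  inv V U _ _ := exists_evM_inv O V.carrier U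
  mem V U _ _ {X Y} _ _ m v ξ := evM_mem O m v ξ
  span V U _ _ n S h := by
    refine deg_le_of_prod (wheelCoeff O) V U n S
      (fun p => ∃ (r : ℕ) (X Y : Type) (_ : Finite X) (_ : Finite Y)
        (s : (convPow O.wheelBimod r).at' X Y) (v : X → V.carrier) (ξ : Y → U),
        Nat.card Y = 0 ∧ p = (evSym O V.carrier U).val (powMk O.wheelBimod 1 s) v ξ) ?_ ?_
    · intro T hT
      exact eq_top_iff.2 fun p _ => sym_top_le T
        (fun r X Y _ _ s v ξ hY => hT _ ⟨r, X, Y, ‹_›, ‹_›, s, v, ξ, hY, rfl⟩) p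
    · rintro d X Y _ _ t v ξ _ ⟨r, X', Y', _, _, s, v', ξ', hY', rfl⟩ hY
      have := h _ _ (O.elt (Equiv.refl _) (Equiv.refl _) t s) (Sum.elim v v') (Sum.elim ξ ξ')
        (by rw [Nat.card_sum, hY, hY', add_zero])
      rw [Operad.elt, evM_mk] at this
      exact this
  contr m := exists_contr O m

/-- `Λ^* O` as a model of the formal chains with trivial coefficients. -/
def plainModel : Model O where
  K := plainCoeff O
  E := O.extBimod
  ev V U _ _ := evN O V.carrier U
  map_ev {_ _ _ _} _ _ _ _ i j {_ _} _ _ n v ξ := by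
    rw [evN_val, evN_val]
    refine (TensorProduct.map_tmul _ _ _ _).trans ?_
    exact congrArg₂ (· ⊗ₜ[k] ·) (map_evExt O i j n v ξ) (map_one (DGLie.symMap _))
  inv V U _ _ := exists_evN_inv O V.carrier U
  mem V U _ _ {X Y} _ _ n v ξ := Coeff.tmul_mem_deg _ (evExt_mem n v ξ) 1
  span V U _ _ n S h := by
    refine deg_le_of_prod (plainCoeff O) V U n S (fun p => p = 1) ?_ ?_
    · intro T hT
      refine eq_top_iff.2 fun p _ => ?_
      refine sym_ind (C := fun p => p ∈ T) (hT 1 rfl) ?_ (fun p q => T.add_mem)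
        (fun c p => T.smul_mem c) p
      intro m p _
      rw [Subsingleton.elim (α := PUnit) m 0, map_zero, zero_mul]
      exact T.zero_mem
    · rintro d X Y _ _ t v ξ _ rfl hY
      exact h _ _ _ v ξ hY
  contr n := exists_contr_ext O n

end Instances

section Contractions

variable {k : Type u} [Field k] {O : Operad k}

theorem prCh_dBs {V : Spmon k} {U : Type u} [AddCommGroup U] [Module k U]
    (βs : List (U →ₗ[k] Module.Dual k V.carrier)) (c : (wheelCoeff O).Ch V U) :
    prCh O V U ((wheelCoeff O).dBs βs c) = (plainCoeff O).dBs βs (prCh O V U c) := by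
  induction βs generalizing c with
  | nil => rfl
  | cons β l ih => rw [Coeff.dBs_cons, Coeff.dBs_cons, ih, prCh_dB]

theorem Model.rel_contr {D : Model O} {X Y : Type} [Finite X] [Finite Y]
    {m : D.E.at' (X ⊕ Fin 1) (Y ⊕ Fin 1)} {n : D.E.at' X Y}
    (h : ∀ (V : Spmon k) (U : Type u) [AddCommGroup U] [Module k U]
      (β : U →ₗ[k] Module.Dual k V.carrier) (v : X ⊕ Fin 1 → V.carrier) (ξ : Y ⊕ Fin 1 → U),
      IsDelta β v ξ (Sum.inr 0, Sum.inr 0) →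
      D.K.dB β ((D.ev V U).val m v ξ) = (D.ev V U).val n (v ∘ Sum.inl) (ξ ∘ Sum.inl)) :
    D.Rel (contrHom X Y) m n := by
  rintro V U _ _ βs v ξ hβ
  obtain ⟨β, rfl, hd⟩ : ∃ β, βs = [β] ∧ IsDelta β v ξ (Sum.inr 0, Sum.inr 0) := by
    change List.Forall₂ _ βs [(Sum.inr 0, Sum.inr 0)] at hβ
    rcases hβ with _ | ⟨h1, h2⟩
    cases h2
    exact ⟨_, rfl, h1⟩
  exact (h V U β v ξ hd).symm

theorem Model.functor_map_contr (D : Model O) {X Y : Type} [Finite X] [Finite Y]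
    {m : D.E.at' (X ⊕ Fin 1) (Y ⊕ Fin 1)} {n : D.E.at' X Y}
    (h : ∀ (V : Spmon k) (U : Type u) [AddCommGroup U] [Module k U]
      (β : U →ₗ[k] Module.Dual k V.carrier) (v : X ⊕ Fin 1 → V.carrier) (ξ : Y ⊕ Fin 1 → U),
      IsDelta β v ξ (Sum.inr 0, Sum.inr 0) →
      D.K.dB β ((D.ev V U).val m v ξ) = (D.ev V U).val n (v ∘ Sum.inl) (ξ ∘ Sum.inl)) :
    (D.functor.map (Dwb.of (P := ⟨wall (X ⊕ Fin 1) (Y ⊕ Fin 1)⟩) (Q := ⟨wall X Y⟩)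
      (contrHom X Y)) m : D.E.at' X Y) = n :=
  (D.rel_functor_map (P := ⟨wall (X ⊕ Fin 1) (Y ⊕ Fin 1)⟩) (Q := ⟨wall X Y⟩)
    (contrHom X Y) m).unique (Model.rel_contr h)

theorem Model.functor_map_bij (D : Model O) {X Y X' Y' : Type} [Finite X] [Finite Y] [Finite X']
    [Finite Y'] (e : X ≃ X') (e' : Y ≃ Y') (m : D.E.at' X Y) :
    (D.functor.map (Dwb.of (P := ⟨wall X Y⟩) (Q := ⟨wall X' Y'⟩) (bijHom e e')) m : D.E.at' X' Y')
      = D.E.relabel e e' m :=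
  (D.rel_functor_map (P := ⟨wall X Y⟩) (Q := ⟨wall X' Y'⟩) (bijHom e e') m).unique
    (Model.rel_bij e e' m)

end Contractions

section OperadModuleStructures

variable {k : Type u} [Field k] [CharZero k] (O : Operad k)

theorem evN_std_injective {X Y : Type} [Finite X] [Finite Y] {n n' : O.extBimod.at' X Y}
    (h : ∀ (V : Spmon k) (U : Type u) [AddCommGroup U] [Module k U] (v : X → V.carrier)
      (ξ : Y → U), (evN O V.carrier U).val n v ξ = (evN O V.carrier U).val n' v ξ) : n = n' :=
  (plainModel O).ev_std_injective (h (freeSp k X) (Y → k) (stdv k X) (stdv k Y))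

/-- The projection of `Λ^* O ⊚ S^* |δ_{1,1}O|` to `Λ^* O`. -/
def prMap (X Y : Type) [Finite X] [Finite Y] : O.extSymBimod.at' X Y →ₗ[k] O.extBimod.at' X Y where
  toFun m := (exists_proj O m).choose
  map_add' m m' := evN_std_injective O fun V U _ _ v ξ => by
    rw [← (exists_proj O (m + m')).choose_spec, Ev.val_add, Ev.val_add, map_add,
      (exists_proj O m).choose_spec, (exists_proj O m').choose_spec]
  map_smul' c m := evN_std_injective O fun V U _ _ v ξ => by
    rw [← (exists_proj O (c • m)).choose_spec, Ev.val_smul, Ev.val_smul, map_smul,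
      (exists_proj O m).choose_spec, RingHom.id_apply]

theorem prCh_evM {X Y : Type} [Finite X] [Finite Y] (m : O.extSymBimod.at' X Y) (V : Spmon k)
    (U : Type u) [AddCommGroup U] [Module k U] (v : X → V.carrier) (ξ : Y → U) :
    prCh O V U ((evM O V.carrier U).val m v ξ)
      = (evN O V.carrier U).val (prMap O X Y m) v ξ :=
  (exists_proj O m).choose_spec V U v ξ

theorem rel_prMap {P Q : Wall} {f : P ⟶ Q} {m : (wheelModel O).obj P} {n : (wheelModel O).obj Q}
    (h : (wheelModel O).Rel f m n) :
    (plainModel O).Rel f (prMap O _ _ m) (prMap O _ _ n) := fun V U _ _ βs v ξ hβ =>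
  (prCh_evM O n V U _ _).symm.trans ((congrArg (prCh O V U) (h V U βs v ξ hβ)).trans
    ((prCh_dBs βs _).trans (congrArg ((plainCoeff O).dBs βs) (prCh_evM O m V U v ξ))))

/-- The projection as a morphism of modules. -/
def prNat : (wheelModel O).functor ⟶ (plainModel O).functor where
  app P := ModuleCat.ofHom (prMap O P.toWall.left.carrier P.toWall.right.carrier)
  naturality P Q f := by
    let L : (P ⟶ Q) →ₗ[k] ((wheelModel O).functor.obj P ⟶ (plainModel O).functor.obj Q) :=
      (Linear.rightComp k _ (ModuleCat.ofHom
        (prMap O Q.toWall.left.carrier Q.toWall.right.carrier) :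
          (wheelModel O).functor.obj Q ⟶ (plainModel O).functor.obj Q)) ∘ₗ
        (wheelModel O).functor.mapLinearMap k
    let R : (P ⟶ Q) →ₗ[k] ((wheelModel O).functor.obj P ⟶ (plainModel O).functor.obj Q) :=
      (Linear.leftComp k _ (ModuleCat.ofHom
        (prMap O P.toWall.left.carrier P.toWall.right.carrier) :
          (wheelModel O).functor.obj P ⟶ (plainModel O).functor.obj P)) ∘ₗ
        (plainModel O).functor.mapLinearMap k
    have : L = R := Dwb.hom_ext fun f => by
      ext m
      exact (rel_prMap O ((wheelModel O).rel_functor_map f m)).unique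
        ((plainModel O).rel_functor_map f _)
    exact LinearMap.congr_fun this f

/-- The modules of the operad given by the formal chains. -/
def chainModules : OperadModules O where
  M := (wheelModel O).functor
  N := (plainModel O).functor
  eM X Y _ _ := LinearEquiv.refl k (O.extSymBimod.at' X Y)
  eN X Y _ _ := LinearEquiv.refl k (O.extBimod.at' X Y)
  eM_relabel e e' m := (wheelModel O).functor_map_bij e e' m
  eN_relabel e e' n := (plainModel O).functor_map_bij e e' n
  map_loop a t s := (wheelModel O).functor_map_contr fun _ _ _ _ _ _ _ h => dB_evM_loop a t s h
  map_tree a b t s := (wheelModel O).functor_map_contr fun _ _ _ _ _ _ _ h => dB_evM_tree a b t s h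
  map_wheel w b t s :=
    (wheelModel O).functor_map_contr fun _ _ _ _ _ _ _ h => dB_evM_wheel w b t s h
  p := prNat O
  p_zero e e' t c := evN_std_injective O fun V U _ _ v ξ =>
    (prCh_evM O _ V U v ξ).symm.trans (prCh_evM_zero O v ξ e e' t c)
  p_succ e e' t s := evN_std_injective O fun V U _ _ v ξ =>
    ((prCh_evM O _ V U v ξ).symm.trans (prCh_evM_succ O v ξ e e' t s)).trans
      (Ev.val_zero _ _ _).symm

end OperadModuleStructures

section Realizations

variable {k : Type u} [Field k] {O : Operad k}

namespace Model

variable (D : Model O)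

theorem act_comp {P Q R : Wall} (f : P ⟶ Q) (g : Q ⟶ R) (m : D.obj P) :
    D.act (f ≫ g) m = D.act g (D.act f m) :=
  (D.rel_act _ m).unique ((D.rel_act f m).comp (D.rel_act g _))

theorem act_bijHom {X Y X' Y' : Type} [Finite X] [Finite Y] [Finite X']
    [Finite Y'] (e : X ≃ X') (e' : Y ≃ Y') (m : D.E.at' X Y) :
    D.act (bijHom e e') m = D.E.relabel e e' m :=
  (D.rel_act (bijHom e e') m).unique (Model.rel_bij e e' m)

theorem act_contrHom {X Y : Type} [Finite X] [Finite Y]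
    {m : D.E.at' (X ⊕ Fin 1) (Y ⊕ Fin 1)} {n : D.E.at' X Y}
    (h : ∀ (V : Spmon k) (U : Type u) [AddCommGroup U] [Module k U]
      (β : U →ₗ[k] Module.Dual k V.carrier) (v : X ⊕ Fin 1 → V.carrier) (ξ : Y ⊕ Fin 1 → U),
      IsDelta β v ξ (Sum.inr 0, Sum.inr 0) →
      D.K.dB β ((D.ev V U).val m v ξ) = (D.ev V U).val n (v ∘ Sum.inl) (ξ ∘ Sum.inl)) :
    D.act (contrHom X Y) m = n :=
  (D.rel_act (contrHom X Y) m).unique (Model.rel_contr h)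

/-- A module over `(kdwb)_-` whose structure is that given by the formal chains. -/
structure Realization (M : Dwb (-1 : k) ⥤ ModuleCat.{u} k) where
  e : ∀ P : Wall, M.obj ⟨P⟩ ≃ₗ[k] D.obj P
  map_e : ∀ {P Q : Wall} (f : P ⟶ Q) (m : M.obj ⟨P⟩),
    e Q (M.map (Dwb.of (P := ⟨P⟩) (Q := ⟨Q⟩) f) m) = D.act f (e P m)

variable {D}

theorem bijHom_comp_contrHom {X Y X' Y' : Type} [Finite X] [Finite Y] [Finite X']
    [Finite Y'] (e : X ≃ X') (e' : Y ≃ Y') :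
    bijHom (e.sumCongr (Equiv.refl (Fin 1))) (e'.sumCongr (Equiv.refl (Fin 1))) ≫ contrHom X' Y'
      = contrHom X Y ≫ bijHom e e' :=
  OrdHom.ext rfl rfl rfl

theorem act_contrHom_relabel {X Y X' Y' : Type} [Finite X] [Finite Y] [Finite X']
    [Finite Y'] (e : X ≃ X') (e' : Y ≃ Y') (m : D.E.at' (X ⊕ Fin 1) (Y ⊕ Fin 1)) :
    D.act (contrHom X' Y') (D.E.relabel (e.sumCongr (Equiv.refl (Fin 1)))
      (e'.sumCongr (Equiv.refl (Fin 1))) m)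
      = D.E.relabel e e' (D.act (contrHom X Y) m) :=
  (congrArg (D.act (contrHom X' Y')) (D.act_bijHom _ _ m).symm).trans
    ((D.act_comp (bijHom (e.sumCongr (Equiv.refl (Fin 1)))
      (e'.sumCongr (Equiv.refl (Fin 1)))) (contrHom X' Y') m).symm.trans
      ((congrArg (fun f => D.act f m)
      (bijHom_comp_contrHom e e')).trans ((D.act_comp (contrHom X Y) (bijHom e e') m).trans
        (D.act_bijHom e e' _))))

variable {M : Dwb (-1 : k) ⥤ ModuleCat.{u} k}

theorem map_of_comp {P Q R : Wall} (f : P ⟶ Q) (g : Q ⟶ R) (m : M.obj ⟨P⟩) :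
    M.map (Dwb.of (P := ⟨P⟩) (Q := ⟨R⟩) (f ≫ g)) m
      = M.map (Dwb.of (P := ⟨Q⟩) (Q := ⟨R⟩) g) (M.map (Dwb.of (P := ⟨P⟩) (Q := ⟨Q⟩) f) m) := by
  rw [← Dwb.of_comp (P := ⟨P⟩) (Q := ⟨Q⟩) (R := ⟨R⟩), M.map_comp]
  rfl

/-- The structure is determined by the bijections and the contractions. -/
def Realization.ofContr (e : ∀ (X Y : Type) [Finite X] [Finite Y],
      M.obj ⟨wall X Y⟩ ≃ₗ[k] D.E.at' X Y)
    (hb : ∀ {X Y X' Y' : Type} [Finite X] [Finite Y] [Finite X'] [Finite Y'] (f : X ≃ X')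
      (f' : Y ≃ Y') (m : M.obj ⟨wall X Y⟩),
      e X' Y' (M.map (Dwb.of (P := ⟨wall X Y⟩) (Q := ⟨wall X' Y'⟩) (bijHom f f')) m)
        = D.E.relabel f f' (e X Y m))
    (hc : ∀ {X Y : Type} [Finite X] [Finite Y] (m : M.obj ⟨wall (X ⊕ Fin 1) (Y ⊕ Fin 1)⟩),
      e X Y (M.map (Dwb.of (P := ⟨wall (X ⊕ Fin 1) (Y ⊕ Fin 1)⟩) (Q := ⟨wall X Y⟩)
        (contrHom X Y)) m) = D.act (contrHom X Y) (e _ _ m)) : D.Realization M where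
  e P := e P.left.carrier P.right.carrier
  map_e {P Q} f m := by
    obtain ⟨l, hl⟩ : ∃ l, f.pairs = l := ⟨_, rfl⟩
    induction l using List.reverseRecOn generalizing Q with
    | nil =>
      have hi : Function.Bijective f.i := ⟨f.i_inj, fun u => by
        by_contra hu
        have := (f.mem_left u).2 hu
        rw [hl] at this
        exact List.not_mem_nil this⟩
      have hj : Function.Bijective f.j := ⟨f.j_inj, fun u => by
        by_contra hu
        have := (f.mem_right u).2 hu
        rw [hl] at this
        exact List.not_mem_nil this⟩
      have hf : f = bijHom (Equiv.ofBijective f.i hi).symm (Equiv.ofBijective f.j hj).symm :=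
        OrdHom.ext rfl rfl hl
      rw [hf]
      exact (hb _ _ m).trans (D.act_bijHom _ _ _).symm
    | append_singleton l p ih =>
      obtain ⟨g, hg, rfl⟩ := exists_factor f l p hl
      rw [map_of_comp]
      exact (hc _).trans ((congrArg (D.act (contrHom _ _)) (ih g hg)).trans
        (D.act_comp _ _ _).symm)

end Model

end Realizations

section OperadRealizations

variable {k : Type u} [Field k] [CharZero k] {O : Operad k} (D : OperadModules O)

/-- The module `M` of an operad as a module of formal chains. -/
def wheelRealization : (wheelModel O).Realization D.M :=
  Model.Realization.ofContr (fun X Y _ _ => D.eM X Y) D.eM_relabel fun {X Y} _ _ m => by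
    let A : O.extSymBimod.at' (X ⊕ Fin 1) (Y ⊕ Fin 1) →ₗ[k] O.extSymBimod.at' X Y :=
      (D.eM X Y).toLinearMap ∘ₗ (D.M.map (Dwb.of (P := ⟨wall (X ⊕ Fin 1) (Y ⊕ Fin 1)⟩)
        (Q := ⟨wall X Y⟩) (contrHom X Y))).hom ∘ₗ (D.eM (X ⊕ Fin 1) (Y ⊕ Fin 1)).symm.toLinearMap
    have key : ∀ {X' Y' : Type} [Finite X'] [Finite Y'] (g : X' ≃ X) (g' : Y' ≃ Y)
        (m : O.extSymBimod.at' (X' ⊕ Fin 1) (Y' ⊕ Fin 1)),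
        D.eM X' Y' (D.M.map (Dwb.of (P := ⟨wall (X' ⊕ Fin 1) (Y' ⊕ Fin 1)⟩)
          (Q := ⟨wall X' Y'⟩) (contrHom X' Y')) ((D.eM _ _).symm m))
          = (wheelModel O).act (contrHom X' Y') m →
        O.extSymBimod.relabel (g.sumCongr (Equiv.refl _)) (g'.sumCongr (Equiv.refl _)) m
          ∈ LinearMap.eqLocus A ((wheelModel O).act (contrHom X Y)) := by
      intro X' Y' _ _ g g' m h
      refine Eq.trans ?_ (Model.act_contrHom_relabel (D := wheelModel O) g g' m).symm
      have h1 : (D.eM _ _).symm (O.extSymBimod.relabel (g.sumCongr (Equiv.refl (Fin 1)))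
            (g'.sumCongr (Equiv.refl (Fin 1))) m)
          = D.M.map (Dwb.of (P := ⟨wall (X' ⊕ Fin 1) (Y' ⊕ Fin 1)⟩)
            (Q := ⟨wall (X ⊕ Fin 1) (Y ⊕ Fin 1)⟩) (bijHom (g.sumCongr (Equiv.refl (Fin 1)))
            (g'.sumCongr (Equiv.refl (Fin 1))))) ((D.eM _ _).symm m) := by
        rw [LinearEquiv.symm_apply_eq, D.eM_relabel, LinearEquiv.apply_symm_apply]
      refine (congrArg (fun m => D.eM X Y (D.M.map (Dwb.of
        (P := ⟨wall (X ⊕ Fin 1) (Y ⊕ Fin 1)⟩) (Q := ⟨wall X Y⟩) (contrHom X Y)) m)) h1).trans ?_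
      rw [← Model.map_of_comp, Model.bijHom_comp_contrHom, Model.map_of_comp, D.eM_relabel]
      exact congrArg _ h
    have := extSym_contr_ind (S := LinearMap.eqLocus A ((wheelModel O).act (contrHom X Y)))
      (fun d r A X₁ X₂ Y₁ Y₂ _ _ _ _ _ g g' a t s => key g g' _
        ((D.map_loop a t s).trans (Model.act_contrHom (wheelModel O)
          fun V U _ _ β v ξ hd => dB_evM_loop a t s hd).symm))
      (fun d r A B X₁ X₂ Y₁ Y₂ _ _ _ _ _ _ g g' a b t s => key g g' _
        ((D.map_tree a b t s).trans (Model.act_contrHom (wheelModel O)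
          fun V U _ _ β v ξ hd => dB_evM_tree a b t s hd).symm))
      (fun d r A B X₁ X₂ Y₁ Y₂ _ _ _ _ _ _ g g' w b t s => key g g' _
        ((D.map_wheel w b t s).trans (Model.act_contrHom (wheelModel O)
          fun V U _ _ β v ξ hd => dB_evM_wheel w b t s hd).symm)) (D.eM _ _ m)
    refine Eq.trans ?_ this
    exact congrArg (fun m => D.eM X Y (D.M.map (Dwb.of (P := ⟨wall (X ⊕ Fin 1) (Y ⊕ Fin 1)⟩)
        (Q := ⟨wall X Y⟩) (contrHom X Y)) m)) ((D.eM _ _).symm_apply_apply m).symm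

theorem eN_p {X Y : Type} [Finite X] [Finite Y] (m : D.M.obj ⟨wall X Y⟩) :
    D.eN X Y (D.p.app _ m) = prMap O X Y (D.eM X Y m) := by
  let A : O.extSymBimod.at' X Y →ₗ[k] O.extBimod.at' X Y :=
    (D.eN X Y).toLinearMap ∘ₗ (D.p.app ⟨wall X Y⟩).hom ∘ₗ (D.eM X Y).symm.toLinearMap
  have key : D.eM X Y m ∈ LinearMap.eqLocus A (prMap O X Y) := by
    refine extSym_ind O (fun d r X₁ X₂ Y₁ Y₂ _ _ _ _ e e' t s => ?_) _
    cases r with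
    | zero =>
      by_cases h : IsEmpty X₂ ∧ IsEmpty Y₂
      · have := h.1
        have := h.2
        exact (D.p_zero e e' t ((show PLift (IsEmpty X₂ ∧ IsEmpty Y₂) → k from s) ⟨h⟩)).trans
          (evN_std_injective O fun V U _ _ v ξ =>
            (prCh_evM_zero O v ξ e e' t _).symm.trans (prCh_evM O _ V U v ξ))
      · rw [powZero_eq_zero O.wheelBimod h s, elt_zero_right]
        exact Submodule.zero_mem _
    | succ r =>
      refine ((congrArg (D.eN X Y) (D.p_succ e e' t s)).trans (map_zero _)).trans ?_
      exact (evN_std_injective O fun V U _ _ v ξ =>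
        ((Ev.val_zero _ _ _).trans (prCh_evM_succ O v ξ e e' t s).symm).trans
          (prCh_evM O _ V U v ξ))
  refine Eq.trans ?_ (show _ = _ from key)
  exact congrArg (fun m => D.eN X Y (D.p.app _ m)) ((D.eM _ _).symm_apply_apply m).symm

theorem prMap_surjective (O : Operad k) (X Y : Type) [Finite X] [Finite Y] :
    Function.Surjective (prMap O X Y) := fun n => by
  obtain ⟨m, hm⟩ := exists_lift O n
  exact ⟨m, evN_std_injective O fun V U _ _ v ξ => (prCh_evM O m V U v ξ).symm.trans (hm V U v ξ)⟩

theorem p_surjective (X Y : Type) [Finite X] [Finite Y] :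
    Function.Surjective (D.p.app ⟨wall X Y⟩) := fun n => by
  obtain ⟨m, hm⟩ := prMap_surjective O X Y (D.eN X Y n)
  refine ⟨(D.eM X Y).symm m, (D.eN X Y).injective ?_⟩
  rw [eN_p, LinearEquiv.apply_symm_apply, hm]

/-- The module `N` of an operad as a module of formal chains. -/
def plainRealization : (plainModel O).Realization D.N :=
  Model.Realization.ofContr (fun X Y _ _ => D.eN X Y) D.eN_relabel fun {X Y} _ _ n => by
    obtain ⟨m, rfl⟩ := p_surjective D _ _ n
    have h1 := NatTrans.naturality_apply D.p (Dwb.of (P := ⟨wall (X ⊕ Fin 1) (Y ⊕ Fin 1)⟩)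
      (Q := ⟨wall X Y⟩) (contrHom X Y)) m
    refine (congrArg (D.eN X Y) h1.symm).trans ?_
    refine (eN_p D _).trans ((congrArg (prMap O X Y)
      ((wheelRealization D).map_e (contrHom X Y) m)).trans ?_)
    refine Eq.trans ?_ (congrArg ((plainModel O).act (contrHom X Y)) (eN_p D m)).symm
    exact (rel_prMap O ((wheelModel O).rel_act (contrHom X Y) (D.eM _ _ m))).unique
      ((plainModel O).rel_act (contrHom X Y) (prMap O _ _ (D.eM _ _ m)))

end OperadRealizations

section FaceFormula

variable {k : Type u} [Field k]

/-- The linear map given by the images of the coordinate vectors. -/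
def coordMap {X : Type} [Finite X] {V : Type u} [AddCommGroup V] [Module k V] (v : X → V) :
    (X → k) →ₗ[k] V := (Pi.basisFun k X).constr k v

theorem stdv_eq_basisFun {X : Type} [Finite X] (x : X) : stdv k X x = Pi.basisFun k X x := by
  classical
  rw [Pi.basisFun_apply, stdv]

theorem coordMap_stdv {X : Type} [Finite X] {V : Type u} [AddCommGroup V] [Module k V]
    (v : X → V) (x : X) : coordMap v (stdv k X x) = v x := by
  rw [coordMap, stdv_eq_basisFun, Module.Basis.constr_basis]

theorem coord_hom_ext {X : Type} [Finite X] {V : Type*} [AddCommGroup V] [Module k V]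
    {f g : (X → k) →ₗ[k] V} (h : ∀ x, f (stdv k X x) = g (stdv k X x)) : f = g := by
  refine (Pi.basisFun k X).ext fun x => ?_
  rw [← stdv_eq_basisFun, h]

/-- A pairing in coordinates. -/
theorem pairing_eq_sum {X Y : Type} [Fintype X] [Fintype Y] {V U : Type u} [AddCommGroup V]
    [Module k V] [AddCommGroup U] [Module k U] (β : U →ₗ[k] Module.Dual k V) (v : X → V)
    (ξ : Y → U) :
    (coordMap v).dualMap ∘ₗ β ∘ₗ coordMap ξ
      = ∑ x, ∑ y, β (ξ y) (v x) • Model.coordPairing k (x, y) := by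
  refine coord_hom_ext fun y => coord_hom_ext fun x => ?_
  rw [LinearMap.comp_apply, LinearMap.dualMap_apply, LinearMap.comp_apply, coordMap_stdv,
    coordMap_stdv, LinearMap.sum_apply, LinearMap.sum_apply, Finset.sum_eq_single x,
    LinearMap.sum_apply, LinearMap.sum_apply, Finset.sum_eq_single y, LinearMap.smul_apply,
    LinearMap.smul_apply, Model.coordPairing_apply, stdv_self, stdv_self, mul_one, smul_eq_mul,
    mul_one]
  · intro y' _ h
    rw [LinearMap.smul_apply, LinearMap.smul_apply, Model.coordPairing_apply, stdv_ne Y h, zero_mul,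
      smul_zero]
  · intro h
    exact (h (Finset.mem_univ _)).elim
  · intro x' _ h
    rw [LinearMap.sum_apply, LinearMap.sum_apply]
    refine Finset.sum_eq_zero fun y' _ => ?_
    rw [LinearMap.smul_apply, LinearMap.smul_apply, Model.coordPairing_apply, stdv_ne X h, mul_zero,
      smul_zero]
  · intro h
    exact (h (Finset.mem_univ _)).elim

namespace Model

variable {O : Operad k} (D : Model O) {V : Spmon k} {U : Type u} [AddCommGroup U] [Module k U]
  (β : U →ₗ[k] Module.Dual k V.carrier)

theorem dB_ev_coord {X Y : Type} [Fintype X] [Fintype Y] (m : D.E.at' X Y) (v : X → V.carrier)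
    (ξ : Y → U) :
    D.K.dB β ((D.ev V U).val m v ξ) = ∑ x, ∑ y, β (ξ y) (v x) •
      D.K.chMap (V := freeSp k X) (coordMap v) (coordMap ξ)
        (D.K.dB (coordPairing k (x, y)) ((D.ev (freeSp k X) (Y → k)).val m (stdv k X) (stdv k Y)))
      := by
  have h1 : (D.ev V U).val m v ξ = D.K.chMap (V := freeSp k X) (coordMap v) (coordMap ξ)
      ((D.ev (freeSp k X) (Y → k)).val m (stdv k X) (stdv k Y)) := by
    rw [D.map_ev]
    exact congrArg₂ (fun v ξ => (D.ev V U).val m v ξ)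
      (funext fun x => (coordMap_stdv v x).symm) (funext fun y => (coordMap_stdv ξ y).symm)
  rw [h1, ← D.K.chMap_dB (V := freeSp k X) (coordMap v) (coordMap ξ)
    (β := (coordMap v).dualMap ∘ₗ β ∘ₗ coordMap ξ) (fun _ => rfl), pairing_eq_sum]
  have h2 := LinearMap.congr_fun (map_sum (D.K.dBₗ (V := freeSp k X) (U := Y → k))
    (fun x => ∑ y, β (ξ y) (v x) • coordPairing k (x, y)) Finset.univ)
    ((D.ev (freeSp k X) (Y → k)).val m (stdv k X) (stdv k Y))
  refine (congrArg (D.K.chMap (V := freeSp k X) (coordMap v) (coordMap ξ)) h2).trans ?_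
  rw [LinearMap.sum_apply, map_sum]
  refine Finset.sum_congr rfl fun x _ => ?_
  rw [map_sum, LinearMap.sum_apply, map_sum]
  refine Finset.sum_congr rfl fun y _ => ?_
  rw [map_smul, LinearMap.smul_apply, map_smul]
  rfl

/-- The differential of the formal chains in terms of the contractions. -/
theorem dB_ev_face {a b : ℕ} (m : D.E.at' (Fin (a + 1)) (Fin (b + 1)))
    (v : Fin (a + 1) → V.carrier) (ξ : Fin (b + 1) → U) :
    D.K.dB β ((D.ev V U).val m v ξ) = ∑ x : Fin (a + 1), ∑ y : Fin (b + 1), β (ξ y) (v x) •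
      (D.ev V U).val (D.act (faceHom x y) m : D.E.at' (Fin a) (Fin b)) (v ∘ x.succAbove)
        (ξ ∘ y.succAbove) := by
  rw [dB_ev_coord]
  refine Finset.sum_congr rfl fun x _ => Finset.sum_congr rfl fun y _ => congrArg _ ?_
  have h := D.rel_act (faceHom x y) m (freeSp k (Fin (a + 1))) (Fin (b + 1) → k)
    [coordPairing k (x, y)] (stdv k _) (stdv k _)
    (List.Forall₂.cons (isDelta_coordPairing (x, y)) List.Forall₂.nil)
  refine (congrArg (D.K.chMap (V := freeSp k (Fin (a + 1))) (coordMap v) (coordMap ξ))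
    h.symm).trans ?_
  refine (D.map_ev _ _ _ _ _).trans ?_
  exact congrArg₂ (fun v ξ => (D.ev V U).val (D.act (faceHom x y) m : D.E.at' (Fin a) (Fin b)) v ξ)
    (funext fun _ => coordMap_stdv v _) (funext fun _ => coordMap_stdv ξ _)

theorem dB_ev_of_isEmpty {X Y : Type} [Finite X] [Finite Y] [IsEmpty X] (m : D.E.at' X Y)
    (v : X → V.carrier) (ξ : Y → U) : D.K.dB β ((D.ev V U).val m v ξ) = 0 := by
  have := Fintype.ofFinite X
  have := Fintype.ofFinite Y
  rw [dB_ev_coord]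
  exact Finset.sum_eq_zero fun x _ => isEmptyElim x

end Model

end FaceFormula

section DerivationFunctor

variable {k : Type u} [Field k] {O : Operad k} (K : Coeff O)

/-- The linear forms are realized by themselves. -/
abbrev selfPairing (V : Spmon k) : Module.Dual k V.carrier →ₗ[k] Module.Dual k V.carrier :=
  LinearMap.id

/-- Derivations of the free algebra of a finite-dimensional vector space. -/
def toDerEquiv (O : Operad k) (V : Spmon k) :
    FDer O V.carrier (Module.Dual k V.carrier) ≃ₗ[k] Der O V.carrier :=
  (dualTensorHomEquiv k V.carrier (Sch O.sp V.carrier)).trans Der.toMap.symm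

theorem toDerEquiv_apply (V : Spmon k) (f : FDer O V.carrier (Module.Dual k V.carrier)) :
    toDerEquiv O V f = toDer (selfPairing V) f := by
  induction f using TensorProduct.induction_on with
  | zero => rw [map_zero, map_zero]
  | add a b ha hb => rw [map_add, map_add, ha, hb]
  | tmul ξ s =>
    refine Der.ext fun v => ?_
    exact dualTensorHom_apply ξ v s

/-- The linear forms and values of a derivation. -/
def ofDer (O : Operad k) (V : Spmon k) :
    Der O V.carrier →ₗ[k] FDer O V.carrier (Module.Dual k V.carrier) :=
  (toDerEquiv O V).symm.toLinearMap

theorem toDer_ofDer (V : Spmon k) (f : Der O V.carrier) :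
    toDer (selfPairing V) (ofDer O V f) = f := by
  rw [← toDerEquiv_apply]
  exact (toDerEquiv O V).apply_symm_apply f

theorem ofDer_toDer (V : Spmon k) (f : FDer O V.carrier (Module.Dual k V.carrier)) :
    ofDer O V (toDer (selfPairing V) f) = f := by
  rw [← toDerEquiv_apply]
  exact (toDerEquiv O V).symm_apply_apply f

theorem toDer_fmap {V W : Spmon k} (h : V ⟶ W)
    (f : FDer O V.carrier (Module.Dual k V.carrier)) :
    toDer (selfPairing W) (fmap (O := O) (Spmon.inj h) (Module.Dual.transpose (Spmon.ret h)) f)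
      = Der.map O (Spmon.inj h) (Spmon.ret h) (toDer (selfPairing V) f) := by
  induction f using TensorProduct.induction_on with
  | zero => simp only [map_zero]
  | add a b ha hb => simp only [map_add, ha, hb]
  | tmul ξ s =>
    rw [fmap, TensorProduct.map_tmul, toDer_tmul, toDer_tmul, Der.map_elem]
    rfl

theorem transpose_ret_inj {V W : Spmon k} (h : V ⟶ W) (ξ : Module.Dual k V.carrier) :
    selfPairing W (Module.Dual.transpose (Spmon.ret h) ξ) ∘ₗ Spmon.inj h = selfPairing V ξ :=
  LinearMap.ext fun v => congrArg ξ (Spmon.ret_inj h v)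

theorem exists_toDer (V : Spmon k) (f : Der O V.carrier) :
    ∃ f', toDer (O := O) (selfPairing V) f' = f :=
  ⟨ofDer O V f, toDer_ofDer V f⟩

/-- The functor `V ↦ Der(O(V)) ⊕ s⁻¹ S(V)` on split monomorphisms. -/
def Coeff.der (hid : ∀ V : Spmon k, K.map (LinearMap.id : V.carrier →ₗ[k] V.carrier) = LinearMap.id)
    (hcomp : ∀ {V W X : Spmon k} (i : V.carrier →ₗ[k] W.carrier) (j : W.carrier →ₗ[k] X.carrier),
      K.map (j ∘ₗ i) = K.map j ∘ₗ K.map i) : Spmon k ⥤ DGLie k where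
  obj V := K.dglie V
  map {V W} h :=
    { map0 := Der.map O (Spmon.inj h) (Spmon.ret h)
      mapNeg := K.map (Spmon.inj h)
      map_lie := Der.map_lie (Spmon.ret_inj h)
      map_act f m := by
        obtain ⟨f, rfl⟩ := exists_toDer V f
        have := K.map_act_fmap (Spmon.inj h) (Module.Dual.transpose (Spmon.ret h))
          (transpose_ret_inj h) f m
        rw [toDer_fmap] at this
        exact this
      map_diff f := by
        obtain ⟨f, rfl⟩ := exists_toDer V f
        have := K.map_diff_fmap (Spmon.inj h) (Module.Dual.transpose (Spmon.ret h))
          (transpose_ret_inj h) f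
        rw [toDer_fmap] at this
        exact this }
  map_id V := by
    apply DGLie.Hom.ext
    · exact LinearMap.ext fun (f : Der O V.carrier) => Der.ext fun v => Sch.map_id (f v)
    · exact hid V
  map_comp {V W X} h h' := by
    apply DGLie.Hom.ext
    · exact LinearMap.ext fun (f : Der O V.carrier) => Der.ext fun x =>
        (Sch.map_map (SpMap.id O.sp) (SpMap.id O.sp) (SpMap.id O.sp) (Spmon.inj h)
          (Spmon.inj h') (fun _ _ _ => rfl) (f (Spmon.ret h (Spmon.ret h' x)))).symm
    · exact hcomp (Spmon.inj h) (Spmon.inj h')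

theorem ext_map_map {M N P : Type u} [AddCommGroup M] [Module k M] [AddCommGroup N] [Module k N]
    [AddCommGroup P] [Module k P] (f : M →ₗ[k] N) (g : N →ₗ[k] P) (ω : ExteriorAlgebra k M) :
    ExteriorAlgebra.map g (ExteriorAlgebra.map f ω) = ExteriorAlgebra.map (g ∘ₗ f) ω :=
  DFunLike.congr_fun (ExteriorAlgebra.map_comp_map f g) ω

theorem ext_map_leftInverse {M N : Type u} [AddCommGroup M] [Module k M] [AddCommGroup N]
    [Module k N] (f : M →ₗ[k] N) (g : N →ₗ[k] M) (h : ∀ m, g (f m) = m)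
    (ω : ExteriorAlgebra k M) : ExteriorAlgebra.map g (ExteriorAlgebra.map f ω) = ω := by
  have : g ∘ₗ f = LinearMap.id := LinearMap.ext h
  rw [ext_map_map, this, ExteriorAlgebra.map_id]
  rfl

theorem chainsMap_surjective {g g' N N' : Type u} [LieRing g] [LieAlgebra k g] [LieRing g']
    [LieAlgebra k g'] [AddCommGroup N] [Module k N] [AddCommGroup N'] [Module k N']
    (f : g →ₗ[k] g') (φ : N →ₗ[k] N') (hf : Function.Surjective f) (hφ : Function.Surjective φ) :
    Function.Surjective (chainsMap f φ) := fun c => by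
  induction c using Chains.ind_mk with
  | ha a b ha hb =>
    obtain ⟨a, rfl⟩ := ha
    obtain ⟨b, rfl⟩ := hb
    exact ⟨a + b, map_add _ a b⟩
  | hm ω p =>
    obtain ⟨ω, rfl⟩ := ExteriorAlgebra.map_surjective_iff.2 hf ω
    obtain ⟨p, rfl⟩ := hφ p
    exact ⟨Chains.mk ω p, chainsMap_mk f φ ω p⟩

/-- The chains of `Der(O(V)) ⊕ s⁻¹ S(V)`. -/
abbrev Coeff.DerCh (V : Spmon k) : Type u :=
  Chains (k := k) (Der O V.carrier) (SymmetricAlgebra k (K.S V))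

/-- The formal chains of the linear forms as chains of derivations. -/
def Coeff.toChains (V : Spmon k) : K.Ch V (Module.Dual k V.carrier) →ₗ[k] K.DerCh V :=
  chainsMap (g := DerB O (selfPairing V)) (toDer (selfPairing V)) LinearMap.id

theorem Coeff.toChains_mem (V : Spmon k) (n : ℕ) :
    K.deg V (Module.Dual k V.carrier) n
      ≤ (chainsDeg k (Der O V.carrier) (SymmetricAlgebra k (K.S V)) n).comap (K.toChains V) :=
  chainsMap_mem (g := DerB O (selfPairing V)) (toDer (selfPairing V)) LinearMap.id n

/-- The chains of derivations as formal chains. -/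
def Coeff.ofChains (V : Spmon k) : K.DerCh V →ₗ[k] K.Ch V (Module.Dual k V.carrier) :=
  chainsMap (g' := DerB O (selfPairing V)) (ofDer O V) LinearMap.id

theorem Coeff.ofChains_mem (V : Spmon k) (n : ℕ) :
    chainsDeg k (Der O V.carrier) (SymmetricAlgebra k (K.S V)) n
      ≤ (K.deg V (Module.Dual k V.carrier) n).comap (K.ofChains V) :=
  chainsMap_mem (g' := DerB O (selfPairing V)) (ofDer O V) LinearMap.id n

theorem Coeff.toChains_tmul (V : Spmon k)
    (ω : ExteriorAlgebra k (FDer O V.carrier (Module.Dual k V.carrier))) (p) :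
    K.toChains V (ω ⊗ₜ p) = Chains.mk (ExteriorAlgebra.map (toDer (selfPairing V)) ω) p :=
  TensorProduct.map_tmul _ _ ω p

theorem Coeff.ofChains_mk (V : Spmon k) (ω : ExteriorAlgebra k (Der O V.carrier)) (p) :
    K.ofChains V (Chains.mk ω p)
      = (ExteriorAlgebra.map (ofDer O V) ω) ⊗ₜ p :=
  TensorProduct.map_tmul _ _ ω p

theorem Coeff.ofChains_toChains (V : Spmon k) (c : K.Ch V (Module.Dual k V.carrier)) :
    K.ofChains V (K.toChains V c) = c := by
  induction c using TensorProduct.induction_on with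
  | zero => rw [map_zero, map_zero]
  | add a b ha hb => rw [map_add, map_add, ha, hb]
  | tmul ω p =>
    rw [toChains_tmul, ofChains_mk]
    exact congrArg (· ⊗ₜ[k] p) (ext_map_leftInverse (toDer (selfPairing V)) (ofDer O V)
      (ofDer_toDer V) ω)

theorem Coeff.toChains_surjective (V : Spmon k) : Function.Surjective (K.toChains V) :=
  chainsMap_surjective (g := DerB O (selfPairing V)) (toDer (selfPairing V)) LinearMap.id
    (exists_toDer V) Function.surjective_id

theorem Coeff.toChains_ofChains (V : Spmon k) (c : K.DerCh V) :
    K.toChains V (K.ofChains V c) = c := by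
  obtain ⟨c, rfl⟩ := K.toChains_surjective V c
  rw [K.ofChains_toChains]

def Coeff.dglTo (V : Spmon k) : K.dgl (selfPairing V) ⟶ K.dglie V where
  map0 := toDer (O := O) (selfPairing V)
  mapNeg := LinearMap.id
  map_lie f g := toDer_fbr (O := O) (selfPairing V) f g
  map_act _ _ := rfl
  map_diff _ := rfl

theorem Coeff.toChains_dB (V : Spmon k) (c : K.Ch V (Module.Dual k V.carrier)) :
    K.toChains V (K.dB (selfPairing V) c) = ceD (K.dglie V).twist (K.toChains V c) :=
  chainsMap_ceD (ρ := (K.dgl (selfPairing V)).twist) (ρ' := (K.dglie V).twist)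
    (φ := LinearMap.id) (DGLie.Hom.map_lie (K.dglTo V))
    (fun x p => by
      have := DGLie.symMap_twist (K.dglTo V) x p
      exact (DGLie.symMap_id _).symm.trans
        (this.trans (congrArg ((K.dglie V).twist _) (DGLie.symMap_id p)))) c

theorem Coeff.toChains_chMap {V W : Spmon k} (h : V ⟶ W)
    (c : K.Ch V (Module.Dual k V.carrier)) :
    K.toChains W (K.chMap (Spmon.inj h) (Module.Dual.transpose (Spmon.ret h)) c)
      = chainsMap (Der.map O (Spmon.inj h) (Spmon.ret h))
        (DGLie.symMap (K.map (Spmon.inj h))).toLinearMap (K.toChains V c) := by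
  induction c using TensorProduct.induction_on with
  | zero => simp only [map_zero]
  | add a b ha hb => simp only [map_add, ha, hb]
  | tmul ω p =>
    rw [toChains_tmul, chainsMap_mk]
    refine (congrArg (K.toChains W) (TensorProduct.map_tmul _ _ ω p)).trans ?_
    rw [toChains_tmul]
    refine congrArg (fun ω => Chains.mk ω _) ?_
    rw [ext_map_map]
    exact (ext_map_map (fmap (O := O) (Spmon.inj h) (Module.Dual.transpose (Spmon.ret h)))
      (toDer (selfPairing W)) ω).trans (congrArg (fun f => ExteriorAlgebra.map f ω)
        (LinearMap.ext fun f => toDer_fmap (O := O) h f))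

end DerivationFunctor

section KoszulTensor

variable {k : Type u} [Field k]

section HomFunctor

variable {A₁ A₂ : Type*} [Category A₁] [Category A₂] (M : A₂ ⥤ ModuleCat.{u} k)
  (T : A₁ ⥤ ModuleCat.{u} k) (C : Type u) [AddCommGroup C] [Module k C]

/-- The bilinear maps on the values of two functors, with values in a fixed vector space. -/
def bilinFun : A₁ᵒᵖ ⥤ A₂ᵒᵖ ⥤ ModuleCat.{u} k where
  obj a :=
    { obj b := ModuleCat.of k (M.obj b.unop →ₗ[k] T.obj a.unop →ₗ[k] C)
      map g := ModuleCat.ofHom (LinearMap.lcomp k _ (M.map g.unop).hom)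
      map_id b := by
        ext1
        refine LinearMap.ext fun F => LinearMap.ext fun μ => ?_
        exact congrArg F (LinearMap.congr_fun (congrArg ModuleCat.Hom.hom (M.map_id b.unop)) μ)
      map_comp g g' := by
        ext1
        refine LinearMap.ext fun F => LinearMap.ext fun μ => ?_
        exact congrArg F (LinearMap.congr_fun
          (congrArg ModuleCat.Hom.hom (M.map_comp g'.unop g.unop)) μ) }
  map f :=
    { app b := ModuleCat.ofHom (LinearMap.compRight k (LinearMap.lcomp k C (T.map f.unop).hom))
      naturality b b' g := rfl }
  map_id a := by
    ext b : 2
    ext1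
    refine LinearMap.ext fun F => LinearMap.ext fun μ => LinearMap.ext fun t => ?_
    exact congrArg (F μ) (LinearMap.congr_fun
      (congrArg ModuleCat.Hom.hom (T.map_id a.unop)) t)
  map_comp f f' := by
    ext b : 2
    ext1
    refine LinearMap.ext fun F => LinearMap.ext fun μ => LinearMap.ext fun t => ?_
    exact congrArg (F μ) (LinearMap.congr_fun
      (congrArg ModuleCat.Hom.hom (T.map_comp f'.unop f.unop)) t)

variable {ι₁ ι₂ : Type} (s₁ : ι₁ → A₁) (s₂ : ι₂ → A₂) (B : A₁ᵒᵖ ⥤ A₂ᵒᵖ ⥤ ModuleCat.{u} k)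

/-- The tensor product of a bimodule with modules over the two categories. -/
abbrev Tens₂ : Type u := Tens s₁ (B ⋙ (tens s₂).flip.obj M) T

/-- The elementary tensors with a given element of the bimodule. -/
def tens₂MkHom (i : ι₁) (j : ι₂) (y : (B.obj (Opposite.op (s₁ i))).obj (Opposite.op (s₂ j))) :
    M.obj (s₂ j) →ₗ[k] T.obj (s₁ i) →ₗ[k] Tens₂ M T s₁ s₂ B :=
  (tensMk s₁ (B ⋙ (tens s₂).flip.obj M) T i) ∘ₗ (tensMk s₂ (B.obj (Opposite.op (s₁ i))) M j y)

/-- The class of an elementary tensor. -/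
abbrev tens₂Mk (i : ι₁) (j : ι₂) (y : (B.obj (Opposite.op (s₁ i))).obj (Opposite.op (s₂ j)))
    (μ : M.obj (s₂ j)) (t : T.obj (s₁ i)) : Tens₂ M T s₁ s₂ B := tens₂MkHom M T s₁ s₂ B i j y μ t

variable {M T C B}

theorem tens₂_ext {f g : Tens₂ M T s₁ s₂ B →ₗ[k] C}
    (h : ∀ i j y μ t, f (tens₂Mk M T s₁ s₂ B i j y μ t) = g (tens₂Mk M T s₁ s₂ B i j y μ t)) :
    f = g := by
  apply tens_ext
  intro i y t
  have : f ∘ₗ (tensMk s₁ (B ⋙ (tens s₂).flip.obj M) T i).flip t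
      = g ∘ₗ (tensMk s₁ (B ⋙ (tens s₂).flip.obj M) T i).flip t :=
    tens_ext s₂ fun j y μ => h i j y μ t
  exact LinearMap.congr_fun this y

theorem tens₂Mk_map_right {i : ι₁} {j j' : ι₂} (g : s₂ j ⟶ s₂ j') (y) (μ : M.obj (s₂ j))
    (t : T.obj (s₁ i)) :
    tens₂Mk M T s₁ s₂ B i j ((B.obj (Opposite.op (s₁ i))).map g.op y) μ t
      = tens₂Mk M T s₁ s₂ B i j' y (M.map g μ) t :=
  congrArg (fun z => tensMk s₁ (B ⋙ (tens s₂).flip.obj M) T i z t) (tensMk_rel s₂ _ M g y μ)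

theorem tens₂Mk_map_left {i i' : ι₁} {j : ι₂} (f : s₁ i ⟶ s₁ i') (y) (μ : M.obj (s₂ j))
    (t : T.obj (s₁ i)) :
    tens₂Mk M T s₁ s₂ B i j ((B.map f.op).app (Opposite.op (s₂ j)) y) μ t
      = tens₂Mk M T s₁ s₂ B i' j y μ (T.map f t) := by
  refine Eq.trans (congrArg (fun z => tensMk s₁ (B ⋙ (tens s₂).flip.obj M) T i z t) ?_)
    (tensMk_rel s₁ (B ⋙ (tens s₂).flip.obj M) T f (tensMk s₂ (B.obj _) M j y μ) t)
  exact (tensMap_mk s₂ (B.map f.op) (𝟙 M) j y μ).symm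

/-- The values of a morphism to the bilinear maps. -/
def bilinHom (θ : B ⟶ bilinFun M T C) (a : A₁) (b : A₂) :
    (B.obj (Opposite.op a)).obj (Opposite.op b) →ₗ[k] M.obj b →ₗ[k] T.obj a →ₗ[k] C :=
  ((θ.app (Opposite.op a)).app (Opposite.op b)).hom

theorem bilinHom_map_right (θ : B ⟶ bilinFun M T C) (a : A₁) {b b' : A₂} (g : b ⟶ b') (y) (μ) :
    bilinHom θ a b ((B.obj (Opposite.op a)).map g.op y) μ = bilinHom θ a b' y (M.map g μ) :=
  LinearMap.congr_fun (NatTrans.naturality_apply (θ.app (Opposite.op a)) g.op y :) μ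

theorem bilinHom_map_left (θ : B ⟶ bilinFun M T C) {a a' : A₁} (f : a ⟶ a') (b : A₂) (y) (μ)
    (t) : bilinHom θ a b ((B.map f.op).app (Opposite.op b) y) μ t
      = bilinHom θ a' b y μ (T.map f t) := by
  have := congrArg (fun φ => φ.app (Opposite.op b)) (θ.naturality f.op)
  exact LinearMap.congr_fun (LinearMap.congr_fun
    (LinearMap.congr_fun (congrArg ModuleCat.Hom.hom this) y) μ) t

/-- The linear map given by a morphism to the bilinear maps, with a fixed left index. -/
def tens₂LiftAux (θ : B ⟶ bilinFun M T C) (a : A₁) :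
    Tens s₂ (B.obj (Opposite.op a)) M →ₗ[k] T.obj a →ₗ[k] C :=
  tensLift s₂ (fun j => bilinHom θ a (s₂ j)) fun _ _ g y μ => bilinHom_map_right θ a g y μ

theorem tens₂LiftAux_mk (θ : B ⟶ bilinFun M T C) (a : A₁) (j y μ) :
    tens₂LiftAux s₂ θ a (tensMk s₂ (B.obj (Opposite.op a)) M j y μ)
      = bilinHom θ a (s₂ j) y μ := tensLift_mk s₂ _ _ j y μ

theorem tens₂LiftAux_map (θ : B ⟶ bilinFun M T C) {a a' : A₁} (f : a ⟶ a')
    (y : Tens s₂ (B.obj (Opposite.op a')) M) (t : T.obj a) :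
    tens₂LiftAux s₂ θ a (tensMap s₂ (B.map f.op) (𝟙 M) y) t
      = tens₂LiftAux s₂ θ a' y (T.map f t) := by
  have : (LinearMap.applyₗ t) ∘ₗ (tens₂LiftAux s₂ θ a) ∘ₗ (tensMap s₂ (B.map f.op) (𝟙 M))
      = (LinearMap.applyₗ (T.map f t)) ∘ₗ (tens₂LiftAux s₂ θ a') := by
    refine tens_ext s₂ fun j y μ => ?_
    rw [LinearMap.comp_apply, LinearMap.comp_apply, LinearMap.comp_apply, tensMap_mk,
      tens₂LiftAux_mk, tens₂LiftAux_mk]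
    exact bilinHom_map_left θ f (s₂ j) y μ t
  exact LinearMap.congr_fun this y

/-- The linear map given by a morphism to the bilinear maps. -/
def tens₂Lift (θ : B ⟶ bilinFun M T C) : Tens₂ M T s₁ s₂ B →ₗ[k] C :=
  tensLift s₁ (fun i => tens₂LiftAux s₂ θ (s₁ i)) fun _ _ f y t => tens₂LiftAux_map s₂ θ f y t

theorem tens₂Lift_mk (θ : B ⟶ bilinFun M T C) (i j y μ t) :
    tens₂Lift s₁ s₂ θ (tens₂Mk M T s₁ s₂ B i j y μ t) = bilinHom θ (s₁ i) (s₂ j) y μ t :=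
  (tensLift_mk s₁ _ _ i _ t).trans (LinearMap.congr_fun (tens₂LiftAux_mk s₂ θ (s₁ i) j y μ) t)

/-- The functoriality of the tensor product in the three variables. -/
def tens₂Map {B' : A₁ᵒᵖ ⥤ A₂ᵒᵖ ⥤ ModuleCat.{u} k} {M' : A₂ ⥤ ModuleCat.{u} k}
    {T' : A₁ ⥤ ModuleCat.{u} k} (β : B ⟶ B') (p : M ⟶ M') (τ : T ⟶ T') :
    Tens₂ M T s₁ s₂ B →ₗ[k] Tens₂ M' T' s₁ s₂ B' :=
  tensMap s₁ (Functor.whiskerRight β ((tens s₂).flip.obj M) ≫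
    Functor.whiskerLeft B' ((tens s₂).flip.map p)) τ

theorem tens₂Map_mk {B' : A₁ᵒᵖ ⥤ A₂ᵒᵖ ⥤ ModuleCat.{u} k} {M' : A₂ ⥤ ModuleCat.{u} k}
    {T' : A₁ ⥤ ModuleCat.{u} k} (β : B ⟶ B') (p : M ⟶ M') (τ : T ⟶ T') (i j y μ t) :
    tens₂Map s₁ s₂ β p τ (tens₂Mk M T s₁ s₂ B i j y μ t)
      = tens₂Mk M' T' s₁ s₂ B' i j ((β.app _).app _ y) (p.app _ μ) (τ.app _ t) := by
  refine (tensMap_mk s₁ _ τ i _ t).trans ?_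
  refine congrArg (fun z => tensMk s₁ (B' ⋙ (tens s₂).flip.obj M') T' i z (τ.app _ t)) ?_
  exact (congrArg (tensMap s₂ (𝟙 (B'.obj (Opposite.op (s₁ i)))) p)
    (tensMap_mk s₂ (β.app (Opposite.op (s₁ i))) (𝟙 M) j y μ)).trans (tensMap_mk s₂ _ p j _ _)

end HomFunctor

theorem koszulX_app_ext {n : ℕ} (a : (Dwb (1 : k))ᵒᵖ) (b : (Dwb (-1 : k))ᵒᵖ) {C : Type u}
    [AddCommGroup C] [Module k C] {f g : ((koszulX k n).obj a).obj b →ₗ[k] C}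
    (h : ∀ m, ∀ φ ψ, f (((koszulι k m n).app a).app b (diagMk m n a.unop b.unop φ ψ))
      = g (((koszulι k m n).app a).app b (diagMk m n a.unop b.unop φ ψ))) : f = g := by
  have key : (ModuleCat.ofHom f : ((koszulX k n).obj a).obj b ⟶ ModuleCat.of k C)
      = ModuleCat.ofHom g :=
    (Limits.isColimitOfPreserves ((evaluation _ _).obj a ⋙ (evaluation _ (ModuleCat.{u} k)).obj b)
      (Limits.colimit.isColimit (Discrete.functor fun m : ℕ => diagFun (k := k) m n))).hom_ext
      fun ⟨m⟩ => by
        ext1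
        exact diag_ext (h m)
  exact congrArg ModuleCat.Hom.hom key

variable (M : Dwb (-1 : k) ⥤ ModuleCat.{u} k) (T : Dwb (1 : k) ⥤ ModuleCat.{u} k)

/-- The tensor product of a term of the Koszul complex with modules on both sides. -/
abbrev KTens (n : ℕ) : Type u := Tens₂ M T (sk (1 : k)) (sk (-1 : k)) (koszulX k n)

/-- The generators of the tensor product with a term of the Koszul complex. -/
def kMk (m n : ℕ) {i j : ℕ × ℕ} (φ : sk (1 : k) i ⟶ sk (1 : k) (m, n)) (ψ : sk (-1 : k) j ⟶ sk (-1 : k) (m, n))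
    (μ : M.obj (sk (-1 : k) j)) (t : T.obj (sk (1 : k) i)) : KTens M T n :=
  tens₂Mk M T (sk (1 : k)) (sk (-1 : k)) (koszulX k n) i j
    (((koszulι k m n).app (Opposite.op (sk (1 : k) i))).app (Opposite.op (sk (-1 : k) j))
      (diagMk m n (sk (1 : k) i) (sk (-1 : k) j) φ ψ)) μ t

/-- The generators of the tensor product with a term of the Koszul complex given by identities. -/
def kGen (m n : ℕ) :
    M.obj (sk (-1 : k) (m, n)) →ₗ[k] T.obj (sk (1 : k) (m, n)) →ₗ[k] KTens M T n :=
  tens₂MkHom M T (sk (1 : k)) (sk (-1 : k)) (koszulX k n) (m, n) (m, n)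
    (((koszulι k m n).app (Opposite.op (sk (1 : k) (m, n)))).app (Opposite.op (sk (-1 : k) (m, n)))
      (diagMk m n (sk (1 : k) (m, n)) (sk (-1 : k) (m, n)) (𝟙 _) (𝟙 _)))

variable {M T}

theorem kGen_apply (m n : ℕ) (μ : M.obj (sk (-1 : k) (m, n))) (t : T.obj (sk (1 : k) (m, n))) :
    kGen M T m n μ t = kMk M T m n (𝟙 _) (𝟙 _) μ t := rfl

theorem kMk_comp_right (m n : ℕ) {i j j' : ℕ × ℕ} (φ : sk (1 : k) i ⟶ sk (1 : k) (m, n))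
    (g : sk (-1 : k) j ⟶ sk (-1 : k) j') (ψ : sk (-1 : k) j' ⟶ sk (-1 : k) (m, n)) (μ : M.obj (sk (-1 : k) j))
    (t : T.obj (sk (1 : k) i)) : kMk M T m n φ (g ≫ ψ) μ t = kMk M T m n φ ψ (M.map g μ) t := by
  refine Eq.trans (congrArg (fun y => tens₂Mk M T (sk (1 : k)) (sk (-1 : k)) (koszulX k n) i j y μ t) ?_)
    (tens₂Mk_map_right (sk (1 : k)) (sk (-1 : k)) g _ μ t)
  have h1 := NatTrans.naturality_apply ((koszulι k m n).app (Opposite.op (sk (1 : k) i))) g.op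
    (diagMk m n (sk (1 : k) i) (sk (-1 : k) j') φ ψ)
  refine Eq.trans (congrArg _ ?_) h1
  exact ((diagMap_mk m n (𝟙 (sk (1 : k) i)) g φ ψ).trans (by rw [Category.id_comp])).symm

theorem kMk_comp_left (m n : ℕ) {i i' j : ℕ × ℕ} (f : sk (1 : k) i ⟶ sk (1 : k) i')
    (φ : sk (1 : k) i' ⟶ sk (1 : k) (m, n)) (ψ : sk (-1 : k) j ⟶ sk (-1 : k) (m, n)) (μ : M.obj (sk (-1 : k) j))
    (t : T.obj (sk (1 : k) i)) : kMk M T m n (f ≫ φ) ψ μ t = kMk M T m n φ ψ μ (T.map f t) := by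
  refine Eq.trans (congrArg (fun y => tens₂Mk M T (sk (1 : k)) (sk (-1 : k)) (koszulX k n) i j y μ t) ?_)
    (tens₂Mk_map_left (sk (1 : k)) (sk (-1 : k)) f _ μ t)
  have h1 := LinearMap.congr_fun (congrArg (fun α => (α.app (Opposite.op (sk (-1 : k) j))).hom)
    ((koszulι k m n).naturality f.op)) (diagMk m n (sk (1 : k) i') (sk (-1 : k) j) φ ψ)
  refine Eq.trans (congrArg _ ?_) h1
  exact ((diagMap_mk m n f (𝟙 (sk (-1 : k) j)) φ ψ).trans (by rw [Category.id_comp])).symm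

theorem kMk_eq (m n : ℕ) {i j : ℕ × ℕ} (φ : sk (1 : k) i ⟶ sk (1 : k) (m, n))
    (ψ : sk (-1 : k) j ⟶ sk (-1 : k) (m, n)) (μ : M.obj (sk (-1 : k) j)) (t : T.obj (sk (1 : k) i)) :
    kMk M T m n φ ψ μ t = kGen M T m n (M.map ψ μ) (T.map φ t) := by
  rw [kGen_apply, ← kMk_comp_right, ← kMk_comp_left, Category.comp_id, Category.comp_id]

theorem kGen_bij (m n : ℕ) (s : Equiv.Perm (Fin m)) (s' : Equiv.Perm (Fin n))
    (μ : M.obj (sk (-1 : k) (m, n))) (t : T.obj (sk (1 : k) (m, n))) :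
    kGen M T m n (M.map (Dwb.of (P := sk (-1 : k) (m, n)) (Q := sk (-1 : k) (m, n)) (bijHom s s')) μ)
      (T.map (Dwb.of (P := sk (1 : k) (m, n)) (Q := sk (1 : k) (m, n)) (bijHom s s')) t)
      = kGen M T m n μ t := by
  rw [← kMk_eq, kGen_apply]
  refine congrArg (fun y => tens₂Mk M T (sk (1 : k)) (sk (-1 : k)) (koszulX k n) (m, n) (m, n)
    (((koszulι k m n).app (Opposite.op (sk (1 : k) (m, n)))).app (Opposite.op (sk (-1 : k) (m, n))) y) μ t) ?_
  have := diagMk_rel s s' (𝟙 (sk (1 : k) (m, n))) (𝟙 (sk (-1 : k) (m, n)))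
  rw [Category.id_comp, Category.id_comp] at this
  exact this

theorem kTens_ext {n : ℕ} {C : Type u} [AddCommGroup C] [Module k C]
    {f g : KTens M T n →ₗ[k] C} (h : ∀ m μ t, f (kGen M T m n μ t) = g (kGen M T m n μ t)) :
    f = g := by
  refine tens₂_ext (sk (1 : k)) (sk (-1 : k)) fun i j y μ t => ?_
  let L : ((koszulX k n).obj (Opposite.op (sk (1 : k) i))).obj (Opposite.op (sk (-1 : k) j)) →ₗ[k]
      KTens M T n :=
    (tensMk (sk (1 : k)) (koszulX k n ⋙ (tens (sk (-1 : k))).flip.obj M) T i).flip t ∘ₗ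
      (tensMk (sk (-1 : k)) ((koszulX k n).obj (Opposite.op (sk (1 : k) i))) M j).flip μ
  have : f ∘ₗ L = g ∘ₗ L := koszulX_app_ext _ _ fun m φ ψ => by
    have h1 : L (((koszulι k m n).app (Opposite.op (sk (1 : k) i))).app (Opposite.op (sk (-1 : k) j))
        (diagMk m n (sk (1 : k) i) (sk (-1 : k) j) φ ψ)) = kGen M T m n (M.map ψ μ) (T.map φ t) :=
      kMk_eq m n φ ψ μ t
    exact (congrArg f h1).trans ((h m _ _).trans (congrArg g h1.symm))
  exact LinearMap.congr_fun this y

variable (M T) in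
/-- The differential of the tensor product with the Koszul complex. -/
def kD (n : ℕ) : KTens M T (n + 1) →ₗ[k] KTens M T n :=
  tens₂Map (sk (1 : k)) (sk (-1 : k)) (koszulD k n) (𝟙 M) (𝟙 T)

theorem kD_gen_zero (n : ℕ) (μ : M.obj (sk (-1 : k) (0, n + 1)))
    (t : T.obj (sk (1 : k) (0, n + 1))) : kD M T n (kGen M T 0 (n + 1) μ t) = 0 := by
  refine (tens₂Map_mk _ _ _ _ _ _ _ _ _ _).trans ?_
  have h1 := LinearMap.congr_fun (congrArg (fun α => ((α.app (Opposite.op (sk (1 : k) (0, n + 1)))).app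
    (Opposite.op (sk (-1 : k) (0, n + 1)))).hom) (koszulι_koszulD (k := k) 0 n))
    (diagMk 0 (n + 1) (sk (1 : k) (0, n + 1)) (sk (-1 : k) (0, n + 1)) (𝟙 _) (𝟙 _))
  refine (congrArg (fun y => tens₂Mk M T (sk (1 : k)) (sk (-1 : k)) (koszulX k n) (0, n + 1)
    (0, n + 1) y μ t) h1).trans ?_
  let L : ((koszulX k n).obj (Opposite.op (sk (1 : k) (0, n + 1)))).obj
      (Opposite.op (sk (-1 : k) (0, n + 1))) →ₗ[k] KTens M T n :=
    (tensMk (sk (1 : k)) (koszulX k n ⋙ (tens (sk (-1 : k))).flip.obj M) T (0, n + 1)).flip t ∘ₗ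
      (tensMk (sk (-1 : k)) ((koszulX k n).obj _) M (0, n + 1)).flip μ
  exact map_zero L

theorem kD_gen_succ (m n : ℕ) (μ : M.obj (sk (-1 : k) (m + 1, n + 1)))
    (t : T.obj (sk (1 : k) (m + 1, n + 1))) :
    kD M T n (kGen M T (m + 1) (n + 1) μ t) = ∑ x : Fin (m + 1), ∑ y : Fin (n + 1),
      kGen M T m n
        (M.map (Dwb.of (P := sk (-1 : k) (m + 1, n + 1)) (Q := sk (-1 : k) (m, n)) (faceHom x y)) μ)
        (T.map (Dwb.of (P := sk (1 : k) (m + 1, n + 1)) (Q := sk (1 : k) (m, n)) (faceHom x y)) t)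
      := by
  refine (tens₂Map_mk _ _ _ _ _ _ _ _ _ _).trans ?_
  have h1 := LinearMap.congr_fun (congrArg (fun α =>
    ((α.app (Opposite.op (sk (1 : k) (m + 1, n + 1)))).app
    (Opposite.op (sk (-1 : k) (m + 1, n + 1)))).hom) (koszulι_koszulD (k := k) (m + 1) n))
    (diagMk (m + 1) (n + 1) (sk (1 : k) (m + 1, n + 1)) (sk (-1 : k) (m + 1, n + 1)) (𝟙 _) (𝟙 _))
  refine (congrArg (fun y => tens₂Mk M T (sk (1 : k)) (sk (-1 : k)) (koszulX k n) (m + 1, n + 1)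
    (m + 1, n + 1) y μ t) h1).trans ?_
  let L : ((koszulX k n).obj (Opposite.op (sk (1 : k) (m + 1, n + 1)))).obj
      (Opposite.op (sk (-1 : k) (m + 1, n + 1))) →ₗ[k] KTens M T n :=
    (tensMk (sk (1 : k)) (koszulX k n ⋙ (tens (sk (-1 : k))).flip.obj M) T (m + 1, n + 1)).flip t ∘ₗ
      (tensMk (sk (-1 : k)) ((koszulX k n).obj _) M (m + 1, n + 1)).flip μ
  have h2 := diagD_mk m n (sk (1 : k) (m + 1, n + 1)) (sk (-1 : k) (m + 1, n + 1)) (𝟙 _) (𝟙 _)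
  let L' : Diag m n (sk (1 : k) (m + 1, n + 1)) (sk (-1 : k) (m + 1, n + 1)) →ₗ[k] KTens M T n :=
    L ∘ₗ (((koszulι k m n).app (Opposite.op (sk (1 : k) (m + 1, n + 1)))).app
      (Opposite.op (sk (-1 : k) (m + 1, n + 1)))).hom
  refine (congrArg L' h2).trans ?_
  rw [map_sum]
  refine Finset.sum_congr rfl fun x _ => ?_
  rw [map_sum]
  refine Finset.sum_congr rfl fun y _ => ?_
  rw [← kMk_eq, Category.id_comp, Category.id_comp]
  rfl

section Lift

variable [M.Additive] [M.Linear k] [T.Additive] [T.Linear k] {C : Type u} [AddCommGroup C]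
  [Module k C] {n : ℕ} (F : ∀ m, M.obj (sk (-1 : k) (m, n)) →ₗ[k] T.obj (sk (1 : k) (m, n)) →ₗ[k] C)
  (hF : ∀ m (s : Equiv.Perm (Fin m)) (s' : Equiv.Perm (Fin n)) μ t,
    F m (M.map (Dwb.of (P := sk (-1 : k) (m, n)) (Q := sk (-1 : k) (m, n)) (bijHom s s')) μ)
      (T.map (Dwb.of (P := sk (1 : k) (m, n)) (Q := sk (1 : k) (m, n)) (bijHom s s')) t) = F m μ t)

/-- The bilinear map on a summand of a term of the Koszul complex. -/
def diagBilin {m : ℕ} (F : M.obj (sk (-1 : k) (m, n)) →ₗ[k] T.obj (sk (1 : k) (m, n)) →ₗ[k] C)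
    (hF : ∀ (s : Equiv.Perm (Fin m)) (s' : Equiv.Perm (Fin n)) μ t,
    F (M.map (Dwb.of (P := sk (-1 : k) (m, n)) (Q := sk (-1 : k) (m, n)) (bijHom s s')) μ)
      (T.map (Dwb.of (P := sk (1 : k) (m, n)) (Q := sk (1 : k) (m, n)) (bijHom s s')) t) = F μ t)
    (a : Dwb (1 : k)) (b : Dwb (-1 : k)) : Diag m n a b →ₗ[k] M.obj b →ₗ[k] T.obj a →ₗ[k] C :=
  diagLift (LinearMap.mk₂ k (fun φ ψ => F.compl₁₂ (M.map ψ).hom (T.map φ).hom)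
      (fun φ φ' ψ => LinearMap.ext₂ fun μ t => by
        simp only [LinearMap.compl₁₂_apply, LinearMap.add_apply, Functor.map_add,
          ModuleCat.hom_add, map_add])
      (fun c φ ψ => LinearMap.ext₂ fun μ t => by
        simp only [LinearMap.compl₁₂_apply, LinearMap.smul_apply, Functor.map_smul,
          ModuleCat.hom_smul, map_smul])
      (fun φ ψ ψ' => LinearMap.ext₂ fun μ t => by
        simp only [LinearMap.compl₁₂_apply, LinearMap.add_apply, Functor.map_add,
          ModuleCat.hom_add, map_add])
      (fun c φ ψ => LinearMap.ext₂ fun μ t => by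
        simp only [LinearMap.compl₁₂_apply, LinearMap.smul_apply, Functor.map_smul,
          ModuleCat.hom_smul, map_smul]))
    fun s s' φ ψ => LinearMap.ext₂ fun μ t => by
      refine Eq.trans ?_ (hF s s' (M.map ψ μ) (T.map φ t))
      exact congrArg₂ (fun μ t => F μ t)
        (LinearMap.congr_fun (congrArg ModuleCat.Hom.hom (M.map_comp ψ _)) μ)
        (LinearMap.congr_fun (congrArg ModuleCat.Hom.hom (T.map_comp φ _)) t)

theorem diagBilin_mk {m : ℕ}
    (F : M.obj (sk (-1 : k) (m, n)) →ₗ[k] T.obj (sk (1 : k) (m, n)) →ₗ[k] C)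
    (hF) (a : Dwb (1 : k)) (b : Dwb (-1 : k)) (φ ψ μ t) :
    diagBilin F hF a b (diagMk m n a b φ ψ) μ t = F (M.map ψ μ) (T.map φ t) :=
  LinearMap.congr_fun (LinearMap.congr_fun (diagLift_mk _ _ φ ψ) μ) t

/-- The morphism to the bilinear maps on a summand of a term of the Koszul complex. -/
def diagBilinHom {m : ℕ} (F : M.obj (sk (-1 : k) (m, n)) →ₗ[k] T.obj (sk (1 : k) (m, n)) →ₗ[k] C)
    (hF : ∀ (s : Equiv.Perm (Fin m)) (s' : Equiv.Perm (Fin n)) μ t,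
    F (M.map (Dwb.of (P := sk (-1 : k) (m, n)) (Q := sk (-1 : k) (m, n)) (bijHom s s')) μ)
      (T.map (Dwb.of (P := sk (1 : k) (m, n)) (Q := sk (1 : k) (m, n)) (bijHom s s')) t) = F μ t) :
    diagFun (k := k) m n ⟶ bilinFun M T C where
  app a :=
    { app b := ModuleCat.ofHom (diagBilin F hF a.unop b.unop)
      naturality b b' g := by
        ext1
        refine diag_ext fun φ ψ => LinearMap.ext₂ fun μ t => ?_
        have h1 := diagMap_mk m n (𝟙 a.unop) g.unop φ ψ
        refine (LinearMap.congr_fun (LinearMap.congr_fun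
          (congrArg (diagBilin F hF a.unop b'.unop) h1) μ) t).trans ?_
        refine (diagBilin_mk F hF _ _ _ _ μ t).trans ?_
        refine Eq.trans ?_ (diagBilin_mk F hF a.unop b.unop φ ψ (M.map g.unop μ) t).symm
        rw [Category.id_comp, Functor.map_comp]
        rfl }
  naturality a a' f := by
    ext b : 2
    ext1
    refine diag_ext fun φ ψ => LinearMap.ext₂ fun μ t => ?_
    have h1 := diagMap_mk m n f.unop (𝟙 b.unop) φ ψ
    refine (LinearMap.congr_fun (LinearMap.congr_fun
      (congrArg (diagBilin F hF a'.unop b.unop) h1) μ) t).trans ?_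
    refine (diagBilin_mk F hF _ _ _ _ μ t).trans ?_
    refine Eq.trans ?_ (diagBilin_mk F hF a.unop b.unop φ ψ μ (T.map f.unop t)).symm
    rw [Category.id_comp, Functor.map_comp]
    rfl

/-- The linear map on the tensor product with a term of the Koszul complex given by its values on
the generators. -/
def kLift : KTens M T n →ₗ[k] C :=
  tens₂Lift (sk (1 : k)) (sk (-1 : k))
    (Limits.Sigma.desc fun m => diagBilinHom (F m) (hF m) : koszulX k n ⟶ bilinFun M T C)

theorem kLift_gen (m : ℕ) (μ : M.obj (sk (-1 : k) (m, n))) (t : T.obj (sk (1 : k) (m, n))) :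
    kLift F hF (kGen M T m n μ t) = F m μ t := by
  refine (tens₂Lift_mk (sk (1 : k)) (sk (-1 : k)) _ (m, n) (m, n) _ μ t).trans ?_
  have h1 : koszulι k m n ≫ (Limits.Sigma.desc fun m => diagBilinHom (F m) (hF m) :
      koszulX k n ⟶ bilinFun M T C) = diagBilinHom (F m) (hF m) := Limits.Sigma.ι_desc _ _
  have h2 := LinearMap.congr_fun (congrArg (fun α => ((α.app (Opposite.op (sk (1 : k) (m, n)))).app
    (Opposite.op (sk (-1 : k) (m, n)))).hom) h1)
    (diagMk m n (sk (1 : k) (m, n)) (sk (-1 : k) (m, n)) (𝟙 _) (𝟙 _))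
  refine (LinearMap.congr_fun (LinearMap.congr_fun h2 μ) t).trans ?_
  refine (diagBilin_mk (F m) (hF m) _ _ _ _ μ t).trans ?_
  rw [CategoryTheory.Functor.map_id, CategoryTheory.Functor.map_id]
  rfl

end Lift

end KoszulTensor

section KoszulComparison

variable {k : Type u} [Field k]

instance (V : Spmon k) : (mixedAt V).Additive where
  map_add {_ _ f g} := map_add (Dwb.liftHom (ε := (1 : k)) (fun f => (mixedOrd V).map f) _) f g
instance (V : Spmon k) : (mixedAt V).Linear k where
  map_smul f c := map_smul (Dwb.liftHom (ε := (1 : k)) (fun f => (mixedOrd V).map f) _) c f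

/-- Pure mixed tensors. -/
def mixMk (V : Spmon k) (m n : ℕ) (v : Fin m → V.carrier) (ξ : Fin n → Module.Dual k V.carrier) :
    (mixedAt V).obj (sk (1 : k) (m, n)) := mt V (skW m n) v ξ

theorem mix_ext {V : Spmon k} {m n : ℕ} {C : Type*} [AddCommGroup C] [Module k C]
    {f g : (mixedAt V).obj (sk (1 : k) (m, n)) →ₗ[k] C}
    (h : ∀ v ξ, f (mixMk V m n v ξ) = g (mixMk V m n v ξ)) : f = g :=
  mt_ext (V := V) (P := skW m n) h

theorem mixedAt_map_mixMk (V : Spmon k) {m n m' n' : ℕ} (f : skW m n ⟶ skW m' n') (v ξ) :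
    (mixedAt V).map (Dwb.of (P := sk (1 : k) (m, n)) (Q := sk (1 : k) (m', n')) f) (mixMk V m n v ξ)
      = mtCoeff V f v ξ • mixMk V m' n' (v ∘ OrdHom.i f) (ξ ∘ OrdHom.j f) :=
  (LinearMap.congr_fun (congrArg ModuleCat.Hom.hom
    (mixedAt_map_of V (P := sk (1 : k) (m, n)) (Q := sk (1 : k) (m', n')) f)) _).trans
    (mtMap_mt V f v ξ)

theorem mixedMap_mixMk {V W : Spmon k} (h : V ⟶ W) (m n : ℕ) (v ξ) :
    (mixedMap h).app (sk (1 : k) (m, n)) (mixMk V m n v ξ)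
      = mixMk W m n (Spmon.inj h ∘ v) (Module.Dual.transpose (Spmon.ret h) ∘ ξ) :=
  mtFun_mt h (skW m n) v ξ

theorem kTens_mix_ext {M : Dwb (-1 : k) ⥤ ModuleCat.{u} k} {V : Spmon k} {n : ℕ} {C : Type u}
    [AddCommGroup C] [Module k C] {f g : KTens M (mixedAt V) n →ₗ[k] C}
    (h : ∀ m μ v ξ, f (kGen M (mixedAt V) m n μ (mixMk V m n v ξ))
      = g (kGen M (mixedAt V) m n μ (mixMk V m n v ξ))) : f = g :=
  kTens_ext fun m μ t => LinearMap.congr_fun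
    (mix_ext (f := f ∘ₗ kGen M (mixedAt V) m n μ) (g := g ∘ₗ kGen M (mixedAt V) m n μ) (h m μ)) t

namespace Model.Realization

variable {O : Operad k} {D : Model O} {M : Dwb (-1 : k) ⥤ ModuleCat.{u} k}
  (R : D.Realization M) (V : Spmon k)

/-- The evaluation of the generators of the Koszul complex. -/
def evGen (m n : ℕ) : M.obj (sk (-1 : k) (m, n)) →ₗ[k]
    (mixedAt V).obj (sk (1 : k) (m, n)) →ₗ[k] D.K.Ch V (Module.Dual k V.carrier) :=
  ((D.ev V (Module.Dual k V.carrier)).app (Fin m) (Fin n)) ∘ₗ (R.e (skW m n)).toLinearMap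

theorem evGen_mixMk (m n : ℕ) (μ) (v ξ) : R.evGen V m n μ (mixMk V m n v ξ)
    = (D.ev V (Module.Dual k V.carrier)).val (R.e (skW m n) μ : D.E.at' (Fin m) (Fin n)) v ξ := rfl

theorem e_bijHom {m n m' n' : ℕ} (s : Fin m ≃ Fin m') (s' : Fin n ≃ Fin n') (μ) :
    R.e (skW m' n') (M.map (Dwb.of (P := sk (-1 : k) (m, n)) (Q := sk (-1 : k) (m', n'))
      (bijHom s s')) μ)
      = D.E.relabel s s' (R.e (skW m n) μ : D.E.at' (Fin m) (Fin n)) :=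
  (R.map_e (bijHom s s') μ).trans (D.act_bijHom s s' _)

theorem mixedAt_map_bijHom {m n m' n' : ℕ} (s : Fin m ≃ Fin m') (s' : Fin n ≃ Fin n') (v ξ) :
    (mixedAt V).map (Dwb.of (P := sk (1 : k) (m, n)) (Q := sk (1 : k) (m', n')) (bijHom s s'))
      (mixMk V m n v ξ) = mixMk V m' n' (v ∘ s.symm) (ξ ∘ s'.symm) :=
  (mixedAt_map_mixMk V (bijHom s s') v ξ).trans (one_smul k _)

theorem evGen_bij (m n : ℕ) (s : Equiv.Perm (Fin m)) (s' : Equiv.Perm (Fin n)) (μ t) :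
    R.evGen V m n (M.map (Dwb.of (P := sk (-1 : k) (m, n)) (Q := sk (-1 : k) (m, n))
        (bijHom s s')) μ)
      ((mixedAt V).map (Dwb.of (P := sk (1 : k) (m, n)) (Q := sk (1 : k) (m, n))
        (bijHom s s')) t) = R.evGen V m n μ t := by
  refine LinearMap.congr_fun (mix_ext
    (f := R.evGen V m n (M.map (Dwb.of (P := sk (-1 : k) (m, n)) (Q := sk (-1 : k) (m, n))
        (bijHom s s')) μ) ∘ₗ ((mixedAt V).map (Dwb.of (P := sk (1 : k) (m, n))
        (Q := sk (1 : k) (m, n)) (bijHom s s'))).hom) (g := R.evGen V m n μ) fun v ξ => ?_) t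
  refine (congrArg (R.evGen V m n _) (mixedAt_map_bijHom V s s' v ξ)).trans ?_
  rw [evGen_mixMk, evGen_mixMk, R.e_bijHom s s' μ, Ev.val_relabel]
  refine congrArg₂ (fun v ξ => (D.ev V (Module.Dual k V.carrier)).val
    (R.e (skW m n) μ : D.E.at' (Fin m) (Fin n)) v ξ) ?_ ?_
  · exact funext fun x => congrArg v (s.symm_apply_apply x)
  · exact funext fun x => congrArg ξ (s'.symm_apply_apply x)

/-- The generator of a term of the Koszul complex given by an element of the bimodule and
enumerations. -/
def gen₂ {X Y : Type} [Finite X] [Finite Y] {m n : ℕ} (e : X ≃ Fin m) (e' : Y ≃ Fin n) :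
    D.E.at' X Y →ₗ[k] MTU k V.carrier (Module.Dual k V.carrier) X Y →ₗ[k] KTens M (mixedAt V) n :=
  (kGen M (mixedAt V) m n).compl₁₂ ((R.e (skW m n)).symm.toLinearMap ∘ₗ D.E.relabel e e')
    (mtuReindex e e')

theorem gen₂_mtu {X Y : Type} [Finite X] [Finite Y] {m n : ℕ} (e : X ≃ Fin m) (e' : Y ≃ Fin n)
    (a : D.E.at' X Y) (v ξ) : R.gen₂ V e e' a (mtu k v ξ)
      = kGen M (mixedAt V) m n ((R.e (skW m n)).symm (D.E.relabel e e' a : D.E.at' _ _))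
        (mixMk V m n (v ∘ e.symm) (ξ ∘ e'.symm)) :=
  congrArg (kGen M (mixedAt V) m n ((R.e (skW m n)).symm (D.E.relabel e e' a : D.E.at' _ _)))
    (mtuReindex_mtu e e' v ξ)

theorem gen₂_congr {X Y : Type} [Finite X] [Finite Y] {m m' n : ℕ} (e : X ≃ Fin m)
    (e' : Y ≃ Fin n) (f : X ≃ Fin m') (f' : Y ≃ Fin n) (a : D.E.at' X Y) (v ξ) :
    R.gen₂ V e e' a (mtu k v ξ) = R.gen₂ V f f' a (mtu k v ξ) := by
  obtain rfl : m = m' := by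
    have := Nat.card_congr (e.symm.trans f)
    rwa [Nat.card_fin, Nat.card_fin] at this
  rw [gen₂_mtu, gen₂_mtu, ← kGen_bij m n (e.symm.trans f) (e'.symm.trans f')]
  refine congrArg₂ (fun μ t => kGen M (mixedAt V) m n μ t) ?_ ?_
  · refine (R.e (skW m n)).injective ?_
    refine (R.e_bijHom _ _ _).trans ?_
    rw [LinearEquiv.apply_symm_apply, LinearEquiv.apply_symm_apply, FBMod.relabel_relabel]
    refine congrArg₂ (fun e e' => D.E.relabel e e' a) ?_ ?_
    · exact Equiv.ext fun x => congrArg f (e.symm_apply_apply x)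
    · exact Equiv.ext fun x => congrArg f' (e'.symm_apply_apply x)
  · refine (mixedAt_map_bijHom V _ _ _ _).trans ?_
    refine congrArg₂ (fun v ξ => mixMk V m n v ξ) ?_ ?_
    · exact funext fun x => congrArg v (e.symm_apply_apply _)
    · exact funext fun x => congrArg ξ (e'.symm_apply_apply _)

open Classical in
/-- The generators of a term of the Koszul complex as an evaluation. -/
def genEv (n : ℕ) : Ev D.E V.carrier (Module.Dual k V.carrier) (KTens M (mixedAt V) n) where
  app X Y _ _ := if h : Nat.card Y = n then
    R.gen₂ V (Finite.equivFin X) (Finite.equivFinOfCardEq h) else 0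
  nat {X Y X' Y'} _ _ _ _ e e' a v ξ := by
    by_cases h : Nat.card Y = n
    · have h' : Nat.card Y' = n := (Nat.card_congr e').symm.trans h
      rw [dif_pos h, dif_pos h', R.gen₂_congr V (Finite.equivFin X) (Finite.equivFinOfCardEq h)
        (e.trans (Finite.equivFin X')) (e'.trans (Finite.equivFinOfCardEq h')), gen₂_mtu, gen₂_mtu,
        FBMod.relabel_relabel]
      refine congrArg (kGen M (mixedAt V) _ n _) ?_
      refine congrArg₂ (fun v ξ => mixMk V _ n v ξ) ?_ ?_
      · exact funext fun x => congrArg v (e.apply_symm_apply _).symm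
      · exact funext fun x => congrArg ξ (e'.apply_symm_apply _).symm
    · have h' : Nat.card Y' ≠ n := fun h' => h ((Nat.card_congr e').trans h')
      rw [dif_neg h, dif_neg h']
      rfl

variable [M.Additive] [M.Linear k]

/-- The evaluation of the terms of the Koszul complex as chains of formal derivations. -/
def theta (n : ℕ) : KTens M (mixedAt V) n →ₗ[k] D.K.Ch V (Module.Dual k V.carrier) :=
  kLift (fun m => R.evGen V m n) fun m => R.evGen_bij V m n

theorem theta_gen (m n : ℕ) (μ) (v ξ) :
    R.theta V n (kGen M (mixedAt V) m n μ (mixMk V m n v ξ))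
      = (D.ev V (Module.Dual k V.carrier)).val (R.e (skW m n) μ : D.E.at' (Fin m) (Fin n)) v ξ :=
  kLift_gen _ _ m μ _

theorem theta_injective (n : ℕ) : Function.Injective (R.theta V n) := by
  obtain ⟨Ψ, hΨ⟩ := D.inv V (Module.Dual k V.carrier)
  have : (MixSch.lift (R.genEv V n) ∘ₗ Ψ) ∘ₗ R.theta V n = LinearMap.id := by
    refine kTens_mix_ext fun m μ v ξ => ?_
    refine (congrArg (MixSch.lift (R.genEv V n) ∘ₗ Ψ) (R.theta_gen V m n μ v ξ)).trans ?_
    refine (congrArg (MixSch.lift (R.genEv V n)) (hΨ _ _ _ v ξ)).trans ?_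
    refine (MixSch.lift_gen _ _ v ξ).trans ?_
    have h1 : (R.genEv V n).app (Fin m) (Fin n)
        = R.gen₂ V (Finite.equivFin (Fin m)) (Finite.equivFinOfCardEq (Nat.card_fin n)) :=
      dif_pos (Nat.card_fin n)
    refine (congrArg (fun F => F (R.e (skW m n) μ : D.E.at' (Fin m) (Fin n)) (mtu k v ξ)) h1).trans
      ?_
    refine (R.gen₂_congr V _ _ (Equiv.refl _) (Equiv.refl _) _ v ξ).trans ?_
    rw [gen₂_mtu, FBMod.relabel_refl]
    exact congrArg (fun μ => kGen M (mixedAt V) m n μ (mixMk V m n v ξ))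
      ((R.e (skW m n)).symm_apply_apply μ)
  exact Function.LeftInverse.injective (g := MixSch.lift (R.genEv V n) ∘ₗ Ψ)
    fun z => LinearMap.congr_fun this z

theorem theta_mem (n : ℕ) (z : KTens M (mixedAt V) n) :
    R.theta V n z ∈ D.K.deg V (Module.Dual k V.carrier) n := by
  have : (D.K.deg V (Module.Dual k V.carrier) n).mkQ ∘ₗ R.theta V n = 0 := by
    refine kTens_mix_ext fun m μ v ξ => ?_
    refine (congrArg _ (R.theta_gen V m n μ v ξ)).trans ((Submodule.Quotient.mk_eq_zero _).2 ?_)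
    have := D.mem V (Module.Dual k V.carrier) (R.e (skW m n) μ : D.E.at' (Fin m) (Fin n)) v ξ
    rwa [Nat.card_fin] at this
  exact (Submodule.Quotient.mk_eq_zero _).1 (LinearMap.congr_fun this z)

theorem deg_le_range_theta (n : ℕ) :
    D.K.deg V (Module.Dual k V.carrier) n ≤ LinearMap.range (R.theta V n) := by
  refine D.span V _ n _ fun X Y _ _ a v ξ h => ?_
  refine ⟨kGen M (mixedAt V) (Nat.card X) n ((R.e (skW (Nat.card X) n)).symm
    (D.E.relabel (Finite.equivFin X) (Finite.equivFinOfCardEq h) a : D.E.at' _ _))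
    (mixMk V _ n (v ∘ (Finite.equivFin X).symm) (ξ ∘ (Finite.equivFinOfCardEq h).symm)), ?_⟩
  rw [theta_gen, LinearEquiv.apply_symm_apply]
  refine (Ev.val_relabel _ _ _ _ _ _).trans ?_
  refine congrArg₂ (fun v ξ => (D.ev V (Module.Dual k V.carrier)).val a v ξ) ?_ ?_
  · exact funext fun x => congrArg v ((Finite.equivFin X).symm_apply_apply x)
  · exact funext fun x => congrArg ξ ((Finite.equivFinOfCardEq h).symm_apply_apply x)

theorem theta_kD (n : ℕ) (z : KTens M (mixedAt V) (n + 1)) :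
    R.theta V n (kD M (mixedAt V) n z) = D.K.dB (selfPairing V) (R.theta V (n + 1) z) := by
  refine LinearMap.congr_fun (kTens_mix_ext (f := R.theta V n ∘ₗ kD M (mixedAt V) n)
    (g := D.K.dB (selfPairing V) ∘ₗ R.theta V (n + 1)) fun m μ v ξ => ?_) z
  rw [LinearMap.comp_apply, LinearMap.comp_apply, theta_gen]
  cases m with
  | zero =>
    rw [kD_gen_zero, map_zero]
    exact (D.dB_ev_of_isEmpty (X := Fin 0) (Y := Fin (n + 1)) (selfPairing V) _ v ξ).symm
  | succ m =>
    rw [kD_gen_succ]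
    refine Eq.trans ?_ (D.dB_ev_face (selfPairing V) _ v ξ).symm
    rw [map_sum]
    refine Finset.sum_congr rfl fun x _ => ?_
    rw [map_sum]
    refine Finset.sum_congr rfl fun y _ => ?_
    refine (congrArg (fun t => R.theta V n (kGen M (mixedAt V) m n _ t))
      (mixedAt_map_mixMk V (faceHom x y) v ξ)).trans ?_
    rw [map_smul, map_smul]
    refine congrArg₂ (fun (c : k) z => c • z) ?_ ((R.theta_gen V m n _ _ _).trans ?_)
    · exact mul_one (ξ y (v x))
    · exact congrArg (fun a => (D.ev V (Module.Dual k V.carrier)).val (a : D.E.at' (Fin m) (Fin n))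
        (v ∘ x.succAbove) (ξ ∘ y.succAbove)) (R.map_e (faceHom x y) μ)

theorem theta_map {W : Spmon k} (h : V ⟶ W) (n : ℕ) (z : KTens M (mixedAt V) n) :
    R.theta W n (tensMap (sk (1 : k)) (𝟙 (koszulX k n ⋙ (tens (sk (-1 : k))).flip.obj M))
      (mixedMap h) z)
      = D.K.chMap (Spmon.inj h) (Module.Dual.transpose (Spmon.ret h)) (R.theta V n z) := by
  refine LinearMap.congr_fun (kTens_mix_ext (f := R.theta W n ∘ₗ tensMap (sk (1 : k)) (𝟙 _)
      (mixedMap h))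
    (g := D.K.chMap (Spmon.inj h) (Module.Dual.transpose (Spmon.ret h)) ∘ₗ R.theta V n)
    fun m μ v ξ => ?_) z
  rw [LinearMap.comp_apply, LinearMap.comp_apply, theta_gen, D.map_ev]
  refine (congrArg (R.theta W n) (tensMap_mk (sk (1 : k)) _ (mixedMap h) (m, n) _ _)).trans ?_
  refine (congrArg (fun t => R.theta W n (kGen M (mixedAt W) m n μ t))
    (mixedMap_mixMk h m n v ξ)).trans ?_
  exact R.theta_gen W m n μ _ _

end Model.Realization

end KoszulComparison

section KoszulDifferential

variable {k : Type u} [Field k] {M : Dwb (-1 : k) ⥤ ModuleCat.{u} k}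

theorem schurKoszul_d (n : ℕ) (V : Spmon k) :
    (((schurKoszul M).d (n + 1) n).app V).hom = kD M (mixedAt V) n := by
  have h1 : (koszul k).d (n + 1) n = koszulD k n := ChainComplex.of_d _ _ _
  have h2 : (((schurKoszul M).d (n + 1) n).app V).hom
      = (((schurTens M).map (koszulD k n)).app V).hom :=
    congrArg (fun f => (((schurTens M).map f).app V).hom) h1
  rw [h2, kD, tens₂Map, CategoryTheory.Functor.map_id]
  rfl

end KoszulDifferential

section ComplexComparison

variable {k : Type u} [Field k] {O : Operad k} {D : Model O} {M : Dwb (-1 : k) ⥤ ModuleCat.{u} k}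
  [M.Additive] [M.Linear k] (R : D.Realization M)

namespace Model.Realization

/-- The comparison of the terms of the Koszul complex with the chains of derivations. -/
def toDerChains (n : ℕ) (V : Spmon k) : KTens M (mixedAt V) n →ₗ[k]
    chainsDeg k (Der O V.carrier) (SymmetricAlgebra k (D.K.S V)) n :=
  LinearMap.codRestrict (p := chainsDeg k (Der O V.carrier) (SymmetricAlgebra k (D.K.S V)) n)
    (D.K.toChains V ∘ₗ R.theta V n) fun z => D.K.toChains_mem V n (R.theta_mem V n z)

theorem toDerChains_bijective (n : ℕ) (V : Spmon k) : Function.Bijective (R.toDerChains n V) := by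
  constructor
  · intro z z' h
    refine R.theta_injective V n ?_
    have h' : D.K.toChains V (R.theta V n z) = D.K.toChains V (R.theta V n z') :=
      congrArg Subtype.val h
    rw [← D.K.ofChains_toChains V (R.theta V n z), h', D.K.ofChains_toChains]
  · rintro ⟨c, hc⟩
    obtain ⟨z, hz⟩ := R.deg_le_range_theta V n (D.K.ofChains_mem V n hc)
    refine ⟨z, Subtype.ext ?_⟩
    exact (congrArg (D.K.toChains V) hz).trans (D.K.toChains_ofChains V c)

/-- The isomorphism of a term of the Koszul complex with the chains of derivations. -/
def derChainsEquiv (n : ℕ) (V : Spmon k) : KTens M (mixedAt V) n ≃ₗ[k]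
    chainsDeg k (Der O V.carrier) (SymmetricAlgebra k (D.K.S V)) n :=
  LinearEquiv.ofBijective (R.toDerChains n V) (R.toDerChains_bijective n V)

end Model.Realization

namespace Model.Realization

variable (hid : ∀ V : Spmon k, D.K.map (LinearMap.id : V.carrier →ₗ[k] V.carrier) = LinearMap.id)
  (hcomp : ∀ {V W X : Spmon k} (i : V.carrier →ₗ[k] W.carrier) (j : W.carrier →ₗ[k] X.carrier),
      D.K.map (j ∘ₗ i) = D.K.map j ∘ₗ D.K.map i)

/-- The terms of the comparison of complexes of functors. -/
def termIso (n : ℕ) : (schurKoszul M).X n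
    ≅ (complexOfFunctors (D.K.der hid hcomp ⋙ DGLie.ceFunctor k)).X n :=
  NatIso.ofComponents (fun V => (R.derChainsEquiv n V).toModuleIso) fun {V W} h => by
    ext1
    refine LinearMap.ext fun (z : KTens M (mixedAt V) n) => Subtype.ext ?_
    exact (congrArg (D.K.toChains W) (R.theta_map V h n z)).trans (D.K.toChains_chMap h _)

/-- The comparison of the Koszul complex with the Chevalley–Eilenberg complex. -/
def complexIso : schurKoszul M ≅ complexOfFunctors (D.K.der hid hcomp ⋙ DGLie.ceFunctor k) :=
  HomologicalComplex.Hom.isoOfComponents (R.termIso hid hcomp) fun i n hi => by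
    obtain rfl : n + 1 = i := hi
    ext V : 2
    ext1
    refine LinearMap.ext fun (z : KTens M (mixedAt V) (n + 1)) => Subtype.ext ?_
    have h1 := LinearMap.congr_fun (congrArg ModuleCat.Hom.hom ((D.K.dglie V).ce_d n))
      (R.toDerChains (n + 1) V z)
    have h2 : R.toDerChains n V ((((schurKoszul M).d (n + 1) n).app V).hom z)
        = R.toDerChains n V (kD M (mixedAt V) n z) :=
      congrArg (fun f : KTens M (mixedAt V) (n + 1) →ₗ[k] KTens M (mixedAt V) n =>
        R.toDerChains n V (f z)) (schurKoszul_d n V)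
    refine (congrArg Subtype.val h1).trans (Eq.trans ?_ (congrArg Subtype.val h2).symm)
    exact (D.K.toChains_dB V _).symm.trans (congrArg (D.K.toChains V) (R.theta_kD V n z).symm)

end Model.Realization

end ComplexComparison

section Algebraic

variable {k : Type u} [Field k]

theorem IsAlgebraic.of_epi {F F' : Spmon k ⥤ ModuleCat.{u} k} (h : IsAlgebraic F) (p : F ⟶ F')
    [Epi p] : IsAlgebraic F' := by
  obtain ⟨ι, m, n, G, i, q, hi, hq⟩ := h
  exact ⟨ι, m, n, G, i, q ≫ p, hi, epi_comp q p⟩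

theorem IsAlgebraic.of_mono {F F' : Spmon k ⥤ ModuleCat.{u} k} (h : IsAlgebraic F) (j : F' ⟶ F)
    [Mono j] : IsAlgebraic F' := by
  obtain ⟨ι, m, n, G, i, q, hi, hq⟩ := h
  exact ⟨ι, m, n, Limits.pullback q j, Limits.pullback.fst q j ≫ i, Limits.pullback.snd q j,
    mono_comp _ _, inferInstance⟩

theorem IsAlgebraic.homology {C : ChainComplex (Spmon k ⥤ ModuleCat.{u} k) ℕ} {n : ℕ}
    (h : IsAlgebraic (C.X n)) : IsAlgebraic (C.homology n) :=
  (h.of_mono (C.iCycles n)).of_epi (C.homologyπ n)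

variable (M : Dwb (-1 : k) ⥤ ModuleCat.{u} k)

/-- The morphism from mixed tensors given by an element of the module. -/
def genHom (m n : ℕ) (μ : M.obj (sk (-1 : k) (m, n))) :
    mixedTensor k m n ⟶ (schurKoszul M).X n where
  app V := ModuleCat.ofHom (kGen M (mixedAt V) m n μ)
  naturality V W h := by
    ext1
    refine LinearMap.ext fun t => ?_
    exact (tensMap_mk (sk (1 : k)) (𝟙 (koszulX k n ⋙ (tens (sk (-1 : k))).flip.obj M)) (mixedMap h)
      (m, n) _ t).symm

theorem schurKoszul_hom_ext {n : ℕ} {F : Spmon k ⥤ ModuleCat.{u} k}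
    {f g : (schurKoszul M).X n ⟶ F} (h : ∀ m μ, genHom M m n μ ≫ f = genHom M m n μ ≫ g) :
    f = g := by
  ext V : 2
  ext1
  refine kTens_ext (M := M) (T := mixedAt V) fun m μ t => ?_
  exact LinearMap.congr_fun (congrArg (fun α => (α.app V).hom) (h m μ)) t

theorem isAlgebraic_schurKoszul (n : ℕ) : IsAlgebraic ((schurKoszul M).X n) := by
  refine ⟨Σ m : ℕ, M.obj (sk (-1 : k) (m, n)), fun x => x.1, fun _ => n, _, 𝟙 _,
    Limits.Sigma.desc fun x => genHom M x.1 n x.2, inferInstance, ⟨fun f g h => ?_⟩⟩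
  refine schurKoszul_hom_ext M fun m μ => ?_
  have := congrArg (fun f => Limits.Sigma.ι
    (fun x : Σ m : ℕ, M.obj (sk (-1 : k) (m, n)) => mixedTensor k x.1 n) ⟨m, μ⟩ ≫ f) h
  simp only [Limits.Sigma.ι_desc_assoc] at this
  exact this

variable {M} {N : Dwb (-1 : k) ⥤ ModuleCat.{u} k} (p : M ⟶ N)

theorem genHom_schurKoszulMap (m n : ℕ) (μ : M.obj (sk (-1 : k) (m, n))) :
    genHom M m n μ ≫ (schurKoszulMap p).f n = genHom N m n (p.app _ μ) := by
  ext V : 2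
  ext1
  refine LinearMap.ext fun t => ?_
  refine (tensMap_mk (sk (1 : k)) _ (𝟙 (mixedAt V)) (m, n) _ t).trans ?_
  refine congrArg (fun z => tensMk (sk (1 : k)) (koszulX k n ⋙ (tens (sk (-1 : k))).flip.obj N)
    (mixedAt V) (m, n) z t) ?_
  exact tensMap_mk (sk (-1 : k)) (𝟙 _) p (m, n) _ μ

theorem epi_schurKoszulMap_f (hp : ∀ m n, Function.Surjective (p.app (sk (-1 : k) (m, n))))
    (n : ℕ) : Epi ((schurKoszulMap p).f n) where
  left_cancellation f g h := by
    refine schurKoszul_hom_ext N fun m μ => ?_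
    obtain ⟨μ, rfl⟩ := hp m n μ
    rw [← genHom_schurKoszulMap, Category.assoc, Category.assoc, h]

end Algebraic

section Projection

variable {k : Type u} [Field k] {O : Operad k}

theorem toChains_prCh (V : Spmon k) (c : (wheelCoeff O).Ch V (Module.Dual k V.carrier)) :
    (plainCoeff O).toChains V (prCh O V _ c)
      = chainsMap (LinearMap.id : Der O V.carrier →ₗ[k] _)
        (DGLie.symMap (0 : Sch (wheelSp O) V.carrier →ₗ[k] PUnit.{u + 1})).toLinearMap
        ((wheelCoeff O).toChains V c) := by
  induction c using TensorProduct.induction_on with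
  | zero => simp only [map_zero]
  | add a b ha hb => simp only [map_add, ha, hb]
  | tmul ω p =>
    rw [prCh_tmul, Coeff.toChains_tmul, Coeff.toChains_tmul, chainsMap_mk]
    exact congrArg (fun ω => Chains.mk ω _) (DFunLike.congr_fun ExteriorAlgebra.map_id _).symm

end Projection

section Main

variable {k : Type u} [Field k] [CharZero k] {O : Operad k} (D : OperadModules O)

instance : D.M.Additive := D.additiveM
instance : D.M.Linear k := D.linearM
instance : D.N.Additive := D.additiveN
instance : D.N.Linear k := D.linearN

/-- The comparison of the Koszul complex of `Λ^* O ⊚ S^* |δO|` with the Chevalley–Eilenberg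
complex. -/
def wheelIso : schurKoszul D.M ≅ ceWheel O :=
  (wheelRealization D).complexIso (fun _ => LinearMap.ext fun s => Sch.map_id s)
    (fun i j => LinearMap.ext fun s => (Sch.map_map (SpMap.id (wheelSp O)) (SpMap.id (wheelSp O))
      (SpMap.id (wheelSp O)) i j (fun _ _ _ => rfl) s).symm)

/-- The comparison of the Koszul complex of `Λ^* O` with the Chevalley–Eilenberg complex. -/
def plainIso : schurKoszul D.N ≅ cePlain O :=
  (plainRealization D).complexIso
    (fun _ => LinearMap.ext fun _ => Subsingleton.elim (α := PUnit) _ _)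
    (fun _ _ => LinearMap.ext fun _ => Subsingleton.elim (α := PUnit) _ _)

theorem schurKoszulMap_comp_plainIso :
    schurKoszulMap D.p ≫ (plainIso D).hom = (wheelIso D).hom ≫ ceProj O := by
  apply HomologicalComplex.hom_ext
  intro n
  refine schurKoszul_hom_ext D.M fun m μ => ?_
  rw [HomologicalComplex.comp_f, ← Category.assoc, genHom_schurKoszulMap]
  ext V : 2
  ext1
  refine mix_ext (V := V) (m := m) (n := n) fun v ξ => Subtype.ext ?_
  have h1 := (plainRealization D).theta_gen V m n (D.p.app _ μ) v ξ
  have h2 := (wheelRealization D).theta_gen V m n μ v ξ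
  have h3 : (plainRealization D).e (skW m n) (D.p.app _ μ)
      = prMap O (Fin m) (Fin n) ((wheelRealization D).e (skW m n) μ) := eN_p D μ
  have h4 := prCh_evM O ((wheelRealization D).e (skW m n) μ : O.extSymBimod.at' (Fin m) (Fin n)) V
    (Module.Dual k V.carrier) v ξ
  refine (congrArg ((plainCoeff O).toChains V) (h1.trans ((congrArg
    (fun a : O.extBimod.at' (Fin m) (Fin n) =>
      (evN O V.carrier (Module.Dual k V.carrier)).val a v ξ) h3).trans h4.symm))).trans ?_
  refine (toChains_prCh V _).trans ?_
  exact congrArg (fun c => chainsMap (LinearMap.id : Der O V.carrier →ₗ[k] _)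
    (DGLie.symMap (0 : Sch (wheelSp O) V.carrier →ₗ[k] PUnit.{u + 1})).toLinearMap
    ((wheelCoeff O).toChains V c)) h2.symm

end Main

end KWB

end

theorem mainTheorem1 {k : Type u} [Field k] [CharZero k] (O : KWB.Operad k) :
    Nonempty (KWB.OperadModules O) ∧
    ∀ D : KWB.OperadModules O,
      ∃ (Φ : KWB.schurKoszul D.M ≅ KWB.ceWheel O) (Ψ : KWB.schurKoszul D.N ≅ KWB.cePlain O),
        KWB.schurKoszulMap D.p ≫ Ψ.hom = Φ.hom ≫ KWB.ceProj O ∧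
        (∀ n : ℕ, Epi ((KWB.schurKoszulMap D.p).f n) ∧ Epi ((KWB.ceProj O).f n)) ∧
        (∀ n : ℕ, KWB.IsAlgebraic ((KWB.schurKoszul D.M).X n) ∧
          KWB.IsAlgebraic ((KWB.schurKoszul D.N).X n) ∧
          KWB.IsAlgebraic ((KWB.ceWheel O).X n) ∧ KWB.IsAlgebraic ((KWB.cePlain O).X n)) ∧
        ∀ n : ℕ,
          (HomologicalComplex.homologyMap (KWB.schurKoszulMap D.p) n ≫
              HomologicalComplex.homologyMap Ψ.hom n =
            HomologicalComplex.homologyMap Φ.hom n ≫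
              HomologicalComplex.homologyMap (KWB.ceProj O) n) ∧
          IsIso (HomologicalComplex.homologyMap Φ.hom n) ∧
          IsIso (HomologicalComplex.homologyMap Ψ.hom n) ∧
          KWB.IsAlgebraic ((KWB.schurKoszul D.M).homology n) ∧
          KWB.IsAlgebraic ((KWB.schurKoszul D.N).homology n) ∧
          KWB.IsAlgebraic ((KWB.ceWheel O).homology n) ∧
          KWB.IsAlgebraic ((KWB.cePlain O).homology n) := by
  refine ⟨⟨KWB.chainModules O⟩, fun D => ⟨KWB.wheelIso D, KWB.plainIso D,
    KWB.schurKoszulMap_comp_plainIso D, fun n => ?_, fun n => ?_, fun n => ?_⟩⟩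
  · have h1 : Epi ((KWB.schurKoszulMap D.p).f n) :=
      KWB.epi_schurKoszulMap_f D.p (fun m n => KWB.p_surjective D (Fin m) (Fin n)) n
    refine ⟨h1, ?_⟩
    have h2 : (KWB.schurKoszulMap D.p).f n ≫ (KWB.plainIso D).hom.f n
        = (KWB.wheelIso D).hom.f n ≫ (KWB.ceProj O).f n :=
      congrArg (fun f => f.f n) (KWB.schurKoszulMap_comp_plainIso D)
    have h3 : Epi ((KWB.wheelIso D).hom.f n ≫ (KWB.ceProj O).f n) := h2 ▸ epi_comp _ _
    exact epi_of_epi ((KWB.wheelIso D).hom.f n) _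
  · have h1 := KWB.isAlgebraic_schurKoszul D.M n
    have h2 := KWB.isAlgebraic_schurKoszul D.N n
    exact ⟨h1, h2, h1.of_epi ((KWB.wheelIso D).hom.f n), h2.of_epi ((KWB.plainIso D).hom.f n)⟩
  · have h1 := KWB.isAlgebraic_schurKoszul D.M n
    have h2 := KWB.isAlgebraic_schurKoszul D.N n
    refine ⟨?_, inferInstance, inferInstance, h1.homology, h2.homology,
      (h1.of_epi ((KWB.wheelIso D).hom.f n)).homology,
      (h2.of_epi ((KWB.plainIso D).hom.f n)).homology⟩
    rw [← HomologicalComplex.homologyMap_comp, ← HomologicalComplex.homologyMap_comp,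
      KWB.schurKoszulMap_comp_plainIso]
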